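/- Computation model: a randomized real RAM with random access to a memory of real numbers and to a memory of natural-number words (addresses). Unit-cost operations are: reading and writing a cell, reading an entry of the input, $+,-,\times,\div$ on reals, real powers $|x|^y$, comparison of reals, $+$, truncated $-$, $\times$, integer division and remainder on words, comparison of words, conversion of a word to a real (there is no rounding of reals to words), drawing a fair random bit, and procedure calls. Running in space $S$ means that all addresses accessed and all words computed are less than $S$ and the call stack has depth at most $S$. For $c\ge 1$ and $r>0$, a randomized data structure for the $(c,r)$-approximate near neighbor problem ($(c,r)$-ANN) in $\ell_p^d$ preprocesses an $n$-point set $V\subset\ell_p^d$, and then, for every fixed query $q\in\ell_p^d$ with $\min_{x\in V}\|q-x\|_p\le r$, reports with probability at least $2/3$ (over the random bits of preprocessing and query) a point $x\in V$ with $\|q-x\|_p\le cr$. If $\min_{x\in V}\|q-x\|_p> r$, it may report anything. Theorem. There are absolute constants $K\ge 1$ and $C\in\mathbb N$ and a single randomized algorithm (a preprocessing program and a query program, receiving $p,\varepsilon,r,d,n$ as parameters) such that for all real $p>2$, $0<\varepsilon<1$, $r>0$ and all integers $d\ge1$, $n\ge 1$, on every $n$-point dataset $V\subset \ell_p^d$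 it is a randomized data structure for $(c,r)$-ANN with $$c=K\,p^{\,1+\ln 4+\varepsilon},$$ its preprocessing time and its space (of preprocessing and of queries) are at most $$C\,\bigl(d\, n^{\varepsilon^{-1}\log_2 p}\bigr)^{C},$$ and its query time, for every query $q\in\ell_p^d$, is at most $$C\,\bigl(\varepsilon^{-1}\, d\,\log_2 (n+1)\bigr)^{C}.$$ The time and space bounds hold for all outcomes of the random bits. -/

import Mathlib

open scoped ENNReal

noncomputable section

/-- The space `ℓ_p^d`: real `d`-tuples with the `ℓ_p` distance. -/
abbrev LpSpace (p : ℝ) (d : ℕ) : Type := PiLp (ENNReal.ofReal p) (fun _ : Fin d => ℝ)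

/-- The index `i` is a valid report for the query `q` in the `(c, r)`-approximate near neighbor
problem on the dataset `V`: if some data point is within distance `r` of `q`, then `i` is the index
of a data point within distance `c * r` of `q`. -/
def IsNearNeighborAnswer {M : Type*} [Dist M] {n : ℕ} (V : Fin n → M) (c r : ℝ) (q : M)
    (i : ℕ) : Prop :=
  (∃ j, dist q (V j) ≤ r) → ∃ h : i < n, dist q (V ⟨i, h⟩) ≤ c * r

/-! ### A randomized real RAM

The machine has a memory of natural-number words, a memory of real numbers, a read-only array of
real inputs and a source of fair coins. Programs are finite pieces of text without real constants.
There is no rounding operation from reals to words. -/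

namespace RealRAM

/-- Word expressions; `load e` is the word stored at address `e`. Subtraction is truncated at `0`,
division and remainder are those of natural numbers. -/
inductive NExpr : Type
  | const (k : ℕ)
  | load (e : NExpr)
  | add (a b : NExpr)
  | sub (a b : NExpr)
  | mul (a b : NExpr)
  | div (a b : NExpr)
  | mod (a b : NExpr)

/-- Real expressions; `load e` is the real stored at address `e`, `input e` is the input entry
number `e`, `cast e` is a word viewed as a real, and `pow a b` is `|a| ^ b`. -/
inductive RExpr : Type
  | cast (e : NExpr)
  | load (e : NExpr)
  | input (e : NExpr)
  | add (a b : RExpr)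
  | sub (a b : RExpr)
  | mul (a b : RExpr)
  | div (a b : RExpr)
  | pow (a b : RExpr)

/-- Tests. -/
inductive BExpr : Type
  | ltN (a b : NExpr)
  | ltR (a b : RExpr)
  | not (b : BExpr)
  | and (b c : BExpr)

/-- Statements. `setN a e` and `setR a e` store the value of `e` at address `a` of the word memory
and of the real memory, `flip a` stores the next coin (as `0` or `1`) at address `a` of the word
memory, and `call i` executes the procedure number `i`. -/
inductive Stmt : Type
  | skip
  | setN (a e : NExpr)
  | setR (a : NExpr) (e : RExpr)
  | flip (a : NExpr)
  | seq (s t : Stmt)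
  | ite (b : BExpr) (s t : Stmt)
  | loop (b : BExpr) (s : Stmt)
  | call (i : ℕ)

/-- Configurations: the two memories, the number of coins used, the current depth of the call
stack, the number of elementary operations executed so far, and the space used so far. The space is
the least `m` such that every address accessed (in either memory or in the input), every word
computed and every depth of the call stack was so far bounded by `m`, with addresses and words
strictly below `m`: a memory of `m` cells whose words have `log₂ m` bits suffices. -/
structure State : Type where
  nat : ℕ → ℕ
  real : ℕ → ℝ
  coins : ℕ
  depth : ℕ
  time : ℕ
  space : ℕ

/-- Value of a word expression. -/
def NExpr.eval (m : ℕ → ℕ) : NExpr → ℕ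
  | const k => k
  | load e => m (e.eval m)
  | add a b => a.eval m + b.eval m
  | sub a b => a.eval m - b.eval m
  | mul a b => a.eval m * b.eval m
  | div a b => a.eval m / b.eval m
  | mod a b => a.eval m % b.eval m

/-- Number of elementary operations in the evaluation of a word expression. -/
def NExpr.cost : NExpr → ℕ
  | const _ => 1
  | load e => e.cost + 1
  | add a b | sub a b | mul a b | div a b | mod a b => a.cost + b.cost + 1

/-- One more than the largest word (in particular, address) that the evaluation produces. -/
def NExpr.peak (m : ℕ → ℕ) : NExpr → ℕ
  | const k => k + 1
  | load e => max (e.peak m) (m (e.eval m) + 1)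
  | add a b => max (max (a.peak m) (b.peak m)) (a.eval m + b.eval m + 1)
  | sub a b | mod a b | div a b => max (a.peak m) (b.peak m)
  | mul a b => max (max (a.peak m) (b.peak m)) (a.eval m * b.eval m + 1)

/-- Value of a real expression, for the input `inp`. -/
def RExpr.eval (inp : ℕ → ℝ) (s : State) : RExpr → ℝ
  | cast e => (e.eval s.nat : ℝ)
  | load e => s.real (e.eval s.nat)
  | input e => inp (e.eval s.nat)
  | add a b => a.eval inp s + b.eval inp s
  | sub a b => a.eval inp s - b.eval inp s
  | mul a b => a.eval inp s * b.eval inp s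
  | div a b => a.eval inp s / b.eval inp s
  | pow a b => |a.eval inp s| ^ b.eval inp s

/-- Number of elementary operations in the evaluation of a real expression. -/
def RExpr.cost : RExpr → ℕ
  | cast e | load e | input e => e.cost + 1
  | add a b | sub a b | mul a b | div a b | pow a b => a.cost + b.cost + 1

/-- One more than the largest word (in particular, address) that the evaluation produces. -/
def RExpr.peak (s : State) : RExpr → ℕ
  | cast e | load e | input e => e.peak s.nat
  | add a b | sub a b | mul a b | div a b | pow a b => max (a.peak s) (b.peak s)

/-- Truth of a test, for the input `inp`. -/
def BExpr.holds (inp : ℕ → ℝ) (s : State) : BExpr → Prop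
  | ltN a b => a.eval s.nat < b.eval s.nat
  | ltR a b => a.eval inp s < b.eval inp s
  | not b => ¬ b.holds inp s
  | and b c => b.holds inp s ∧ c.holds inp s

/-- Number of elementary operations in a test. -/
def BExpr.cost : BExpr → ℕ
  | ltN a b => a.cost + b.cost + 1
  | ltR a b => a.cost + b.cost + 1
  | not b => b.cost + 1
  | and b c => b.cost + c.cost + 1

/-- One more than the largest word (in particular, address) that the test produces. -/
def BExpr.peak (s : State) : BExpr → ℕ
  | ltN a b => max (a.peak s.nat) (b.peak s.nat)
  | ltR a b => max (a.peak s) (b.peak s)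
  | not b => b.peak s
  | and b c => max (b.peak s) (c.peak s)

/-- Account for `t` elementary operations and for the use of `m` cells. -/
def State.charge (s : State) (t m : ℕ) : State :=
  { s with time := s.time + t, space := max s.space m }

/-- `Exec procs ω inp c s s'`: with the procedures `procs`, the coins `ω` and the input `inp`, the
execution of `c` from the configuration `s` halts in the configuration `s'`. -/
inductive Exec (procs : List Stmt) (ω : ℕ → Bool) (inp : ℕ → ℝ) : Stmt → State → State → Prop
  | skip (s : State) : Exec procs ω inp .skip s (s.charge 1 0)
  | setN (s : State) (a e : NExpr) :
      Exec procs ω inp (.setN a e) s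
        { s.charge (a.cost + e.cost + 1) (max (a.peak s.nat) (e.peak s.nat)) with
          nat := Function.update s.nat (a.eval s.nat) (e.eval s.nat) }
  | setR (s : State) (a : NExpr) (e : RExpr) :
      Exec procs ω inp (.setR a e) s
        { s.charge (a.cost + e.cost + 1) (max (a.peak s.nat) (e.peak s)) with
          real := Function.update s.real (a.eval s.nat) (e.eval inp s) }
  | flip (s : State) (a : NExpr) :
      Exec procs ω inp (.flip a) s
        { s.charge (a.cost + 1) (max (a.peak s.nat) 2) with
          nat := Function.update s.nat (a.eval s.nat) (ω s.coins).toNat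
          coins := s.coins + 1 }
  | seq (c₁ c₂ : Stmt) (s s₁ s₂ : State) :
      Exec procs ω inp c₁ s s₁ → Exec procs ω inp c₂ s₁ s₂ → Exec procs ω inp (.seq c₁ c₂) s s₂
  | iteTrue (b : BExpr) (c₁ c₂ : Stmt) (s s' : State) : b.holds inp s →
      Exec procs ω inp c₁ (s.charge (b.cost + 1) (b.peak s)) s' →
      Exec procs ω inp (.ite b c₁ c₂) s s'
  | iteFalse (b : BExpr) (c₁ c₂ : Stmt) (s s' : State) : ¬ b.holds inp s →
      Exec procs ω inp c₂ (s.charge (b.cost + 1) (b.peak s)) s' →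
      Exec procs ω inp (.ite b c₁ c₂) s s'
  | loopTrue (b : BExpr) (c : Stmt) (s s₁ s₂ : State) : b.holds inp s →
      Exec procs ω inp c (s.charge (b.cost + 1) (b.peak s)) s₁ →
      Exec procs ω inp (.loop b c) s₁ s₂ →
      Exec procs ω inp (.loop b c) s s₂
  | loopFalse (b : BExpr) (c : Stmt) (s : State) : ¬ b.holds inp s →
      Exec procs ω inp (.loop b c) s (s.charge (b.cost + 1) (b.peak s))
  | call (i : ℕ) (c : Stmt) (s s' : State) : procs[i]? = some c →
      Exec procs ω inp c { s.charge 1 (s.depth + 1) with depth := s.depth + 1 } s' →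
      Exec procs ω inp (.call i) s { s' with depth := s.depth }

/-- Independent fair coins. -/
def coinMeasure : MeasureTheory.Measure (ℕ → Bool) :=
  MeasureTheory.Measure.infinitePi fun _ => (PMF.uniformOfFintype Bool).toMeasure

end RealRAM

open RealRAM

/-- A randomized algorithm for near neighbor search: a preprocessing program and a query program,
with the procedures that they may call. -/
structure ANNAlgorithm : Type where
  procs : List Stmt
  preprocess : Stmt
  query : Stmt

namespace ANNAlgorithm

/-- The dataset as an input array: coordinate `k` of point `i` is the entry number `i * d + k`. -/
def dataInput {p : ℝ} {d n : ℕ} (V : Fin n → LpSpace p d) (m : ℕ) : ℝ :=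
  if h : m / d < n ∧ m % d < d then V ⟨m / d, h.1⟩ ⟨m % d, h.2⟩ else 0

/-- The query point as an input array. -/
def queryInput {p : ℝ} {d : ℕ} (q : LpSpace p d) (m : ℕ) : ℝ :=
  if h : m < d then q ⟨m, h⟩ else 0

/-- The configuration in which preprocessing starts: the first two words are the number `n` of
points and the dimension `d`, and the first three reals are `p`, `ε` and `r`. -/
def initState (p ε r : ℝ) (d n : ℕ) : State where
  nat := fun m => if m = 0 then n else if m = 1 then d else 0
  real := fun m => if m = 0 then p else if m = 1 then ε else if m = 2 then r else 0
  coins := 0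
  depth := 0
  time := 0
  space := n + d + 3

/-- With the coins `ω`, the preprocessing of `V` halts in the configuration `s`. -/
def Preprocesses (A : ANNAlgorithm) (ε r : ℝ) {p : ℝ} {d n : ℕ} (V : Fin n → LpSpace p d)
    (ω : ℕ → Bool) (s : State) : Prop :=
  Exec A.procs ω (dataInput V) A.preprocess (initState p ε r d n) s

/-- With the coins `ω`, the query `q`, asked in the configuration `s` that preprocessing has left,
halts in the configuration `s'`. The clock is reset; the dataset can no longer be read except from
the memory. -/
def Answers (A : ANNAlgorithm) {p : ℝ} {d : ℕ} (ω : ℕ → Bool) (s : State) (q : LpSpace p d)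
    (s' : State) : Prop :=
  Exec A.procs ω (queryInput q) A.query { s with time := 0 } s'

/-- On the dataset `V` and for all outcomes of the coins, preprocessing halts in time `Tpre` and
space `S`, and then every query halts in time `Tquery`, still within space `S`. -/
def RunsWithin (A : ANNAlgorithm) (ε r : ℝ) {p : ℝ} {d n : ℕ} (V : Fin n → LpSpace p d)
    (Tpre S Tquery : ℝ) : Prop :=
  ∀ ω : ℕ → Bool, ∃ s, A.Preprocesses ε r V ω s ∧ (s.time : ℝ) ≤ Tpre ∧ (s.space : ℝ) ≤ S ∧
    ∀ q : LpSpace p d, ∃ s', A.Answers ω s q s' ∧ (s'.time : ℝ) ≤ Tquery ∧ (s'.space : ℝ) ≤ S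

/-- On the dataset `V`, every query is answered correctly for `(c, r)`-approximate near neighbor
with probability at least `2 / 3`; the reported index is the first word at the end of the query. -/
def IsCorrect (A : ANNAlgorithm) (ε c r : ℝ) {p : ℝ} {d n : ℕ} (V : Fin n → LpSpace p d) : Prop :=
  ∀ q : LpSpace p d, (2 / 3 : ℝ≥0∞) ≤ coinMeasure {ω | ∃ s s', A.Preprocesses ε r V ω s ∧
    A.Answers ω s q s' ∧ IsNearNeighborAnswer V c r q (s'.nat 0)}

end ANNAlgorithm

end

/-! The coordinatewise Mazur map `maz a`, z ↦ z|z|^(a-1) with 1 < a ≤ 2, carries ℓ_{aQ} to ℓ_Q. It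
is Lipschitz on balls, with a constant that grows like the radius to the power a-1, and its inverse
is 1/a-Hölder. Hence, once a data point at distance ρr from the query is known, search in ℓ_{aQ}
reduces to search in ℓ_Q: recenter at this point, apply the map, search, and pull the answer back.
The answer is closer than the center as long as ρ is large compared with the approximation factor in
ℓ_Q. One such round replaces ρ by 9/10 of ρ plus one tenth of a limit, and this limit is 5 times the
limit for the space below. With a = pc^(1/L), L such reductions lead from ℓ_pc to ℓ_1, at the price
of a factor 2^33 · 5^L; `search_spec` is this recursion. Since 2^(L-1) < p and log_2 5 < 7/3 < 1 +
ln 4, the factor is of order p^(1 + ln 4). The exponent is truncated at lam, the logarithm of the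
padded dimension D, because beyond it all norms agree up to a factor 2; so L is at most about log
log d.

The nested rounds are numbered by one integer j in base k: the digit e of j is the current round at
height e, and the center at height e is the answer at the time obtained from j by clearing the
digits below e.

At the bottom, one step of the search in ℓ_1 is a table look-up. Images are taken relative to the
current point, divided by the search radius and sketched, each bit being the parity of 4D random
threshold tests. Vectors at ℓ_1 distance at most 2^-33 seldom differ in a bit, while vectors at
distance at least 9/10, one of them in the unit ball, differ with probability at least 3/8. For
every step, every tuple of centers and every possible sketch the table holds a data point whose
sketch is similar, if there is one. `card_near_le` and `card_far_le` are the tail bounds. The union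
bound runs over all steps, tuples and points, so it does not matter that the centers depend on the
coins. The n^(L+1) tuples make a sketch of length about (L+3) log n necessary, which gives a table
of size polynomial in d n^(log p).

The search needs a starting point within a bounded ratio, although distances are arbitrary and reals
cannot be rounded. The points are sorted by a random linear functional with integer coefficients,
and binary search finds the first point whose value is not far below that of the query. By
anticoncentration (`measure_abs_le`) this point is within a ratio 2 · 2^S · D in ℓ_1. Phase 0, a
plain search in ℓ_1 with O(log n + log d) steps, makes the ratio polynomial in D. Phase 1 is the
search through the Mazur maps. Its number of steps, (log d)^O(log log d), is polynomial in d and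
independent of n, which it would not be without phase 0.

Programs are written in a small language with named arrays and counted loops. `wp` certifies at once
what they compute, that no loop makes more than Z rounds, and that stored words stay below B;
`exists_outcome` converts this into a run whose time is polynomial in Z and whose space is
polynomial in B. The query tosses no coins, so every random event concerns the words drawn in the
preprocessing. -/

noncomputable section

namespace LpANN

open RealRAM

/-! ### A structured language with named arrays, compiled to the machine -/

/-- Arrays of words; a scalar is the entry `0` of its array. -/
inductive NVar
  | n | d | lam | D | nu | L | S | PS | T | tp | t | TT | mm | lev | kk | JJ | nC
  | G | W | ord | tab | i | l | j | e | b | x | x' | ph | pw | cc | bb | q | h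
  | v | par | ans | mis | y | lo | hi | mid | cnt | dig | cen | bit | tgt | hist | u
  deriving DecidableEq

/-- Arrays of reals; a scalar is the entry `0` of its array. -/
inductive RVar
  | p | eps | r | pc | a | rr | cz | X | fv | tmp | z | rad | scale | w | sum
  deriving DecidableEq

/-- The address of the entry `i` of an array of words. -/
def NVar.addr (τ : NVar) (i : ℕ) : ℕ := 64 * i + τ.ctorIdx

/-- The address of the entry `i` of an array of reals. -/
def RVar.addr (τ : RVar) (i : ℕ) : ℕ := 64 * i + τ.ctorIdx

lemma NVar.ctorIdx_lt (τ : NVar) : τ.ctorIdx < 64 := by cases τ <;> decide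

lemma RVar.ctorIdx_lt (τ : RVar) : τ.ctorIdx < 64 := by cases τ <;> decide

/-- The residue of an address modulo 64 is the array and the quotient is the entry, so all arrays
can be unbounded without overlapping. -/
lemma NVar.addr_inj {τ σ : NVar} {i j : ℕ} : τ.addr i = σ.addr j ↔ τ = σ ∧ i = j := by
  constructor
  · intro h
    have h1 := τ.ctorIdx_lt
    have h2 := σ.ctorIdx_lt
    simp only [NVar.addr] at h
    have h3 : τ.ctorIdx = σ.ctorIdx := by omega
    refine ⟨?_, by omega⟩
    rw [← NVar.ofNat_ctorIdx τ, h3, NVar.ofNat_ctorIdx]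
  · rintro ⟨rfl, rfl⟩
    rfl

lemma RVar.addr_inj {τ σ : RVar} {i j : ℕ} : τ.addr i = σ.addr j ↔ τ = σ ∧ i = j := by
  constructor
  · intro h
    have h1 := τ.ctorIdx_lt
    have h2 := σ.ctorIdx_lt
    simp only [RVar.addr] at h
    have h3 : τ.ctorIdx = σ.ctorIdx := by omega
    refine ⟨?_, by omega⟩
    rw [← RVar.ofNat_ctorIdx τ, h3, RVar.ofNat_ctorIdx]
  · rintro ⟨rfl, rfl⟩
    rfl

/-- A memory of named arrays, and the number of coins used. -/
@[ext] structure Mem where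
  nat : NVar → ℕ → ℕ
  real : RVar → ℕ → ℝ
  coins : ℕ

/-- Store a word. -/
def Mem.setW (m : Mem) (τ : NVar) (i v : ℕ) : Mem :=
  { m with nat := Function.update m.nat τ (Function.update (m.nat τ) i v) }

/-- Store a real. -/
def Mem.setF (m : Mem) (τ : RVar) (i : ℕ) (v : ℝ) : Mem :=
  { m with real := Function.update m.real τ (Function.update (m.real τ) i v) }

/-- Store a coin. -/
def Mem.toss (m : Mem) (ω : ℕ → Bool) (τ : NVar) (i : ℕ) : Mem :=
  { m.setW τ i (ω m.coins).toNat with coins := m.coins + 1 }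

section MemLemmas
variable (m : Mem) (τ σ : NVar) (ρ π : RVar) (i j v : ℕ) (z : ℝ) (ω : ℕ → Bool)

@[simp] lemma Mem.setW_same : (m.setW τ i v).nat τ = Function.update (m.nat τ) i v := by
  simp [Mem.setW]
@[simp] lemma Mem.setF_same : (m.setF ρ i z).real ρ = Function.update (m.real ρ) i z := by
  simp [Mem.setF]
@[simp] lemma Mem.toss_same :
    (m.toss ω τ i).nat τ = Function.update (m.nat τ) i (ω m.coins).toNat := by
  simp [Mem.toss]
variable {τ σ ρ π} in
@[simp] lemma Mem.setW_ne (h : σ ≠ τ) : (m.setW τ i v).nat σ = m.nat σ := by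
  simp [Mem.setW, h]
variable {τ σ ρ π} in
@[simp] lemma Mem.setF_ne (h : π ≠ ρ) : (m.setF ρ i z).real π = m.real π := by
  simp [Mem.setF, h]
variable {τ σ ρ π} in
@[simp] lemma Mem.toss_ne (h : σ ≠ τ) : (m.toss ω τ i).nat σ = m.nat σ := by
  simp [Mem.toss, h]
@[simp] lemma Mem.setW_real : (m.setW τ i v).real = m.real := rfl
@[simp] lemma Mem.setF_nat : (m.setF ρ i z).nat = m.nat := rfl
@[simp] lemma Mem.toss_real : (m.toss ω τ i).real = m.real := rfl
@[simp] lemma Mem.setW_coins : (m.setW τ i v).coins = m.coins := rfl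
@[simp] lemma Mem.setF_coins : (m.setF ρ i z).coins = m.coins := rfl
@[simp] lemma Mem.toss_coins : (m.toss ω τ i).coins = m.coins + 1 := rfl
end MemLemmas

/-- Word expressions over named arrays. -/
inductive WExp
  | const (k : ℕ)
  | get (τ : NVar) (e : WExp)
  | add (a b : WExp)
  | sub (a b : WExp)
  | mul (a b : WExp)
  | div (a b : WExp)
  | mod (a b : WExp)

/-- Real expressions over named arrays. -/
inductive FExp
  | cast (e : WExp)
  | get (τ : RVar) (e : WExp)
  | input (e : WExp)
  | add (a b : FExp)
  | sub (a b : FExp)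
  | mul (a b : FExp)
  | div (a b : FExp)
  | pow (a b : FExp)

/-- Tests over named arrays. -/
inductive Test
  | ltW (a b : WExp)
  | ltF (a b : FExp)

/-- Programs over named arrays; all loops are counted. -/
inductive Prog
  | setW (τ : NVar) (e v : WExp)
  | setF (τ : RVar) (e : WExp) (v : FExp)
  | flip (τ : NVar) (e : WExp)
  | seq (s t : Prog)
  | ite (c : Test) (s t : Prog)
  | skip
  | forTo (τ : NVar) (b : WExp) (s : Prog)

instance (k : ℕ) : OfNat WExp k := ⟨.const k⟩
instance : Add WExp := ⟨.add⟩
instance : Sub WExp := ⟨.sub⟩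
instance : Mul WExp := ⟨.mul⟩
instance : Div WExp := ⟨.div⟩
instance : Mod WExp := ⟨.mod⟩
instance : Coe NVar WExp := ⟨fun τ => .get τ (.const 0)⟩
instance : Add FExp := ⟨.add⟩
instance : Sub FExp := ⟨.sub⟩
instance : Mul FExp := ⟨.mul⟩
instance : Div FExp := ⟨.div⟩
instance : Coe WExp FExp := ⟨.cast⟩
instance : Coe RVar FExp := ⟨fun τ => .get τ (.const 0)⟩

/-- The value of a word expression. -/
def WExp.val (m : Mem) : WExp → ℕ
  | const k => k
  | get τ e => m.nat τ (e.val m)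
  | add a b => a.val m + b.val m
  | sub a b => a.val m - b.val m
  | mul a b => a.val m * b.val m
  | div a b => a.val m / b.val m
  | mod a b => a.val m % b.val m

/-- The value of a real expression. -/
def FExp.val (inp : ℕ → ℝ) (m : Mem) : FExp → ℝ
  | cast e => (e.val m : ℝ)
  | get τ e => m.real τ (e.val m)
  | input e => inp (e.val m)
  | add a b => a.val inp m + b.val inp m
  | sub a b => a.val inp m - b.val inp m
  | mul a b => a.val inp m * b.val inp m
  | div a b => a.val inp m / b.val inp m
  | pow a b => |a.val inp m| ^ b.val inp m

/-- The truth of a test. -/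
def Test.val (inp : ℕ → ℝ) (m : Mem) : Test → Prop
  | ltW a b => a.val m < b.val m
  | ltF a b => a.val inp m < b.val inp m

section ValLemmas
variable (m : Mem) (inp : ℕ → ℝ) (τ : NVar) (ρ : RVar) (k : ℕ) (a b : WExp) (f g : FExp)
@[simp] lemma WExp.val_ofNat : (no_index (OfNat.ofNat k) : WExp).val m = k := rfl
@[simp] lemma WExp.val_const : (WExp.const k).val m = k := rfl
@[simp] lemma WExp.val_get : (WExp.get τ a).val m = m.nat τ (a.val m) := rfl
@[simp] lemma WExp.val_add : (a + b).val m = a.val m + b.val m := rfl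
@[simp] lemma WExp.val_sub : (a - b).val m = a.val m - b.val m := rfl
@[simp] lemma WExp.val_mul : (a * b).val m = a.val m * b.val m := rfl
@[simp] lemma WExp.val_div : (a / b).val m = a.val m / b.val m := rfl
@[simp] lemma WExp.val_mod : (a % b).val m = a.val m % b.val m := rfl
@[simp] lemma FExp.val_cast : (FExp.cast a).val inp m = (a.val m : ℝ) := rfl
@[simp] lemma FExp.val_get : (FExp.get ρ a).val inp m = m.real ρ (a.val m) := rfl
@[simp] lemma FExp.val_input : (FExp.input a).val inp m = inp (a.val m) := rfl
@[simp] lemma FExp.val_add : (f + g).val inp m = f.val inp m + g.val inp m := rfl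
@[simp] lemma FExp.val_sub : (f - g).val inp m = f.val inp m - g.val inp m := rfl
@[simp] lemma FExp.val_mul : (f * g).val inp m = f.val inp m * g.val inp m := rfl
@[simp] lemma FExp.val_div : (f / g).val inp m = f.val inp m / g.val inp m := rfl
@[simp] lemma FExp.val_pow : (FExp.pow f g).val inp m = |f.val inp m| ^ g.val inp m := rfl
@[simp] lemma Test.val_ltW : (Test.ltW a b).val inp m = (a.val m < b.val m) := rfl
@[simp] lemma Test.val_ltF : (Test.ltF f g).val inp m = (f.val inp m < g.val inp m) := rfl
end ValLemmas

/-- The machine expression for the address of an array entry. -/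
def addrExpr (i : NExpr) (k : ℕ) : NExpr := .add (.mul (.const 64) i) (.const k)

/-- Compilation of word expressions. -/
def WExp.code : WExp → NExpr
  | const k => .const k
  | get τ e => .load (addrExpr e.code τ.ctorIdx)
  | add a b => .add a.code b.code
  | sub a b => .sub a.code b.code
  | mul a b => .mul a.code b.code
  | div a b => .div a.code b.code
  | mod a b => .mod a.code b.code

/-- Compilation of real expressions. -/
def FExp.code : FExp → RExpr
  | cast e => .cast e.code
  | get τ e => .load (addrExpr e.code τ.ctorIdx)
  | input e => .input e.code
  | add a b => .add a.code b.code
  | sub a b => .sub a.code b.code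
  | mul a b => .mul a.code b.code
  | div a b => .div a.code b.code
  | pow a b => .pow a.code b.code

/-- Compilation of tests. -/
def Test.code : Test → BExpr
  | ltW a b => .ltN a.code b.code
  | ltF a b => .ltR a.code b.code

/-- Compilation of programs. -/
def Prog.code : Prog → Stmt
  | setW τ e v => .setN (addrExpr e.code τ.ctorIdx) v.code
  | setF τ e v => .setR (addrExpr e.code τ.ctorIdx) v.code
  | flip τ e => .flip (addrExpr e.code τ.ctorIdx)
  | seq s t => .seq s.code t.code
  | ite c s t => .ite c.code s.code t.code
  | skip => .skip
  | forTo τ b s =>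
    .seq (.setN (addrExpr (.const 0) τ.ctorIdx) (.const 0))
      (.loop (.ltN (WExp.get τ 0).code b.code)
        (.seq s.code (.setN (addrExpr (.const 0) τ.ctorIdx) (WExp.get τ 0 + 1).code)))

/-- The machine configuration `s` represents the memory `m`. -/
structure Mem.Rep (m : Mem) (s : State) : Prop where
  nat : ∀ τ i, s.nat (NVar.addr τ i) = m.nat τ i
  real : ∀ τ i, s.real (RVar.addr τ i) = m.real τ i
  coins : s.coins = m.coins

lemma eval_addrExpr (f : ℕ → ℕ) (e : NExpr) (k : ℕ) :
    (addrExpr e k).eval f = 64 * e.eval f + k := rfl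

lemma Mem.Rep.charge {m : Mem} {s : State} (h : m.Rep s) (a b : ℕ) : m.Rep (s.charge a b) :=
  ⟨h.1, h.2, h.3⟩

lemma WExp.eval_code {m : Mem} {s : State} (h : m.Rep s) (e : WExp) :
    e.code.eval s.nat = e.val m := by
  induction e with
  | const k => rfl
  | get τ e ih =>
    simp only [WExp.code, NExpr.eval, eval_addrExpr, ih]
    exact h.nat τ _
  | add a b iha ihb | sub a b iha ihb | mul a b iha ihb | div a b iha ihb | mod a b iha ihb =>
    simp only [WExp.code, NExpr.eval, iha, ihb, WExp.val]

lemma FExp.eval_code {m : Mem} {s : State} (h : m.Rep s) (inp : ℕ → ℝ) (e : FExp) :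
    e.code.eval inp s = e.val inp m := by
  induction e with
  | cast e | input e => simp only [FExp.code, RExpr.eval, WExp.eval_code h, FExp.val]
  | get τ e =>
    simp only [FExp.code, RExpr.eval, eval_addrExpr, WExp.eval_code h]
    exact h.real τ _
  | add a b iha ihb | sub a b iha ihb | mul a b iha ihb | div a b iha ihb | pow a b iha ihb =>
    simp only [FExp.code, RExpr.eval, iha, ihb, FExp.val]

lemma Test.holds_code {m : Mem} {s : State} (h : m.Rep s) (inp : ℕ → ℝ) (c : Test) :
    c.code.holds inp s ↔ c.val inp m := by
  cases c <;> simp only [Test.code, BExpr.holds, WExp.eval_code h, FExp.eval_code h, Test.val]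

/-! ### Exponents that bound the space, and costs that bound the time -/

/-- The peak of `e` is at most `B ^ e.deg` if all stored words are below `B`. -/
def nDeg : NExpr → ℕ
  | .const k => k + 1
  | .load e => nDeg e + 1
  | .add a b | .sub a b | .mul a b | .div a b | .mod a b => nDeg a + nDeg b

/-- As `nDeg`, for real expressions. -/
def rDeg : RExpr → ℕ
  | .cast e | .load e | .input e => nDeg e
  | .add a b | .sub a b | .mul a b | .div a b | .pow a b => rDeg a + rDeg b

/-- As `nDeg`, for tests. -/
def bDeg : BExpr → ℕ
  | .ltN a b => nDeg a + nDeg b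
  | .ltR a b => rDeg a + rDeg b
  | .not b => bDeg b
  | .and b c => bDeg b + bDeg c

/-- As `nDeg`, for statements. -/
def sDeg : Stmt → ℕ
  | .skip | .call _ => 0
  | .setN a e => nDeg a + nDeg e
  | .setR a e => nDeg a + rDeg e
  | .flip a => nDeg a + 1
  | .seq s t => sDeg s + sDeg t
  | .ite b s t => bDeg b + sDeg s + sDeg t
  | .loop b s => bDeg b + sDeg s

/-- Time of a statement whose loops are run at most `Z` times each. -/
def sCost (Z : ℕ) : Stmt → ℕ
  | .skip | .call _ => 1
  | .setN a e => a.cost + e.cost + 1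
  | .setR a e => a.cost + e.cost + 1
  | .flip a => a.cost + 1
  | .seq s t => sCost Z s + sCost Z t
  | .ite b s t => b.cost + 1 + (sCost Z s + sCost Z t)
  | .loop b s => (Z + 1) * (b.cost + 1 + sCost Z s)

/-- For a fixed program text the cost is a polynomial in Z with nonnegative coefficients, whose
degree is the nesting depth of the loops. One constant serves as factor and as exponent, the form in
which the theorem states its bounds. -/
lemma exists_sCost_le (c : Stmt) : ∃ C : ℕ, ∀ Z : ℕ, 1 ≤ Z → sCost Z c ≤ C * Z ^ C := by
  have key : ∀ k Z : ℕ, 1 ≤ Z → k ≤ k * Z ^ k := fun k Z hZ =>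
    Nat.le_mul_of_pos_right _ (Nat.pow_pos hZ)
  have mono : ∀ A C Z : ℕ, 1 ≤ Z → A ≤ C → A * Z ^ A ≤ C * Z ^ C := fun A C Z hZ h =>
    Nat.mul_le_mul h (Nat.pow_le_pow_right hZ h)
  have two : ∀ A C Z : ℕ, 1 ≤ Z → A * Z ^ A + C * Z ^ C ≤ (A + C) * Z ^ (A + C) := by
    intro A C Z hZ
    rw [add_mul]
    exact Nat.add_le_add (Nat.mul_le_mul_left _ (Nat.pow_le_pow_right hZ (by omega)))
      (Nat.mul_le_mul_left _ (Nat.pow_le_pow_right hZ (by omega)))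
  induction c with
  | skip => exact ⟨1, fun Z hZ => key _ _ hZ⟩
  | call i => exact ⟨1, fun Z hZ => key _ _ hZ⟩
  | setN a e => exact ⟨_, fun Z hZ => key _ _ hZ⟩
  | setR a e => exact ⟨_, fun Z hZ => key _ _ hZ⟩
  | flip a => exact ⟨_, fun Z hZ => key _ _ hZ⟩
  | seq s t hs ht =>
    obtain ⟨A, hA⟩ := hs
    obtain ⟨C, hC⟩ := ht
    exact ⟨A + C, fun Z hZ => (Nat.add_le_add (hA Z hZ) (hC Z hZ)).trans (two _ _ _ hZ)⟩
  | ite b s t hs ht =>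
    obtain ⟨A, hA⟩ := hs
    obtain ⟨C, hC⟩ := ht
    refine ⟨b.cost + 1 + (A + C), fun Z hZ => ?_⟩
    refine le_trans ?_ (two _ _ _ hZ)
    exact Nat.add_le_add (key _ _ hZ)
      ((Nat.add_le_add (hA Z hZ) (hC Z hZ)).trans (two _ _ _ hZ))
  | loop b s hs =>
    obtain ⟨A, hA⟩ := hs
    refine ⟨2 * (b.cost + 1 + A), fun Z hZ => ?_⟩
    have h1 : b.cost + 1 + sCost Z s ≤ (b.cost + 1 + A) * Z ^ (b.cost + 1 + A) :=
      (Nat.add_le_add (key _ _ hZ) (hA Z hZ)).trans (two _ _ _ hZ)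
    calc (Z + 1) * (b.cost + 1 + sCost Z s)
        ≤ (2 * Z) * ((b.cost + 1 + A) * Z ^ (b.cost + 1 + A)) :=
          Nat.mul_le_mul (by omega) h1
      _ = 2 * (b.cost + 1 + A) * Z ^ (b.cost + 1 + A + 1) := by ring
      _ ≤ _ := Nat.mul_le_mul_left _ (Nat.pow_le_pow_right hZ (by omega))

/-- The value has to be bounded together with the peak, because sums, products and addresses are
formed from values. Everything follows from x + y + 1 ≤ (x + 1)(y + 1) and xy + 1 ≤ (x + 1)(y + 1);
a load returns a word below B whatever its address. -/
lemma nDeg_spec {B : ℕ} (hB : 2 ≤ B) {f : ℕ → ℕ} (hf : ∀ a, f a < B) (e : NExpr) :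
    e.eval f + 1 ≤ B ^ nDeg e ∧ e.peak f ≤ B ^ nDeg e := by
  have hB1 : 1 ≤ B := by omega
  have up : ∀ x a b : ℕ, x ≤ B ^ a → x ≤ B ^ (a + b) := fun x a b h =>
    h.trans (Nat.pow_le_pow_right hB1 (by omega))
  have up' : ∀ x a b : ℕ, x ≤ B ^ b → x ≤ B ^ (a + b) := fun x a b h =>
    h.trans (Nat.pow_le_pow_right hB1 (by omega))
  have prod : ∀ x y a b : ℕ, x + 1 ≤ B ^ a → y + 1 ≤ B ^ b →
      (x + 1) * (y + 1) ≤ B ^ (a + b) := fun x y a b h h' => by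
    rw [pow_add]; exact Nat.mul_le_mul h h'
  induction e with
  | const k =>
    have : k + 1 ≤ B ^ (k + 1) :=
      (Nat.lt_two_pow_self (n := k + 1)).le.trans (Nat.pow_le_pow_left hB _)
    exact ⟨this, this⟩
  | load e ih =>
    have h1 : f (e.eval f) + 1 ≤ B ^ (nDeg e + 1) :=
      (Nat.succ_le_of_lt (hf _)).trans (by rw [pow_succ]; exact Nat.le_mul_of_pos_left _ (Nat.pow_pos hB1))
    exact ⟨h1, max_le (up _ _ _ ih.2) h1⟩
  | add a b iha ihb =>
    have h1 : a.eval f + b.eval f + 1 ≤ B ^ (nDeg a + nDeg b) :=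
      le_trans (by nlinarith) (prod _ _ _ _ iha.1 ihb.1)
    exact ⟨h1, max_le (max_le (up _ _ _ iha.2) (up' _ _ _ ihb.2)) h1⟩
  | mul a b iha ihb =>
    have h1 : a.eval f * b.eval f + 1 ≤ B ^ (nDeg a + nDeg b) :=
      le_trans (by nlinarith) (prod _ _ _ _ iha.1 ihb.1)
    exact ⟨h1, max_le (max_le (up _ _ _ iha.2) (up' _ _ _ ihb.2)) h1⟩
  | sub a b iha ihb =>
    refine ⟨up _ _ _ (le_trans ?_ iha.1), max_le (up _ _ _ iha.2) (up' _ _ _ ihb.2)⟩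
    have : a.eval f - b.eval f ≤ a.eval f := Nat.sub_le _ _
    exact Nat.succ_le_succ this
  | div a b iha ihb =>
    refine ⟨up _ _ _ (le_trans ?_ iha.1), max_le (up _ _ _ iha.2) (up' _ _ _ ihb.2)⟩
    exact Nat.succ_le_succ (Nat.div_le_self _ _)
  | mod a b iha ihb =>
    refine ⟨up _ _ _ (le_trans ?_ iha.1), max_le (up _ _ _ iha.2) (up' _ _ _ ihb.2)⟩
    exact Nat.succ_le_succ (Nat.mod_le _ _)

lemma rDeg_spec {B : ℕ} (hB : 2 ≤ B) {s : State} (hf : ∀ a, s.nat a < B) (e : RExpr) :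
    e.peak s ≤ B ^ rDeg e := by
  have hB1 : 1 ≤ B := by omega
  induction e with
  | cast e | load e | input e => exact (nDeg_spec hB hf e).2
  | add a b iha ihb | sub a b iha ihb | mul a b iha ihb | div a b iha ihb | pow a b iha ihb =>
    exact max_le (iha.trans (Nat.pow_le_pow_right hB1 (Nat.le_add_right _ _)))
      (ihb.trans (Nat.pow_le_pow_right hB1 (Nat.le_add_left _ _)))

lemma bDeg_spec {B : ℕ} (hB : 2 ≤ B) {s : State} (hf : ∀ a, s.nat a < B) (e : BExpr) :
    e.peak s ≤ B ^ bDeg e := by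
  have hB1 : 1 ≤ B := by omega
  induction e with
  | ltN a b =>
    exact max_le ((nDeg_spec hB hf a).2.trans (Nat.pow_le_pow_right hB1 (Nat.le_add_right _ _)))
      ((nDeg_spec hB hf b).2.trans (Nat.pow_le_pow_right hB1 (Nat.le_add_left _ _)))
  | ltR a b =>
    exact max_le ((rDeg_spec hB hf a).trans (Nat.pow_le_pow_right hB1 (Nat.le_add_right _ _)))
      ((rDeg_spec hB hf b).trans (Nat.pow_le_pow_right hB1 (Nat.le_add_left _ _)))
  | not b ih => exact ih
  | and a b iha ihb =>
    exact max_le (iha.trans (Nat.pow_le_pow_right hB1 (Nat.le_add_right _ _)))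
      (ihb.trans (Nat.pow_le_pow_right hB1 (Nat.le_add_left _ _)))

/-! ### Weakest preconditions -/

/-- `wp Z B ω inp P Q m`: started in `m`, the program `P` makes at most `Z` rounds in each of its
loops, stores only words below `B`, and ends in a memory that satisfies `Q`. -/
def wp (Z B : ℕ) (ω : ℕ → Bool) (inp : ℕ → ℝ) : Prog → (Mem → Prop) → Mem → Prop
  | .setW τ e v, Q, m => v.val m < B ∧ Q (m.setW τ (e.val m) (v.val m))
  | .setF τ e v, Q, m => Q (m.setF τ (e.val m) (v.val inp m))
  | .flip τ e, Q, m => Q (m.toss ω τ (e.val m))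
  | .seq s t, Q, m => wp Z B ω inp s (wp Z B ω inp t Q) m
  | .ite c s t, Q, m =>
    (c.val inp m → wp Z B ω inp s Q m) ∧ (¬ c.val inp m → wp Z B ω inp t Q m)
  | .skip, Q, m => Q m
  | .forTo τ b s, Q, m => ∃ (k : ℕ) (I : ℕ → Mem → Prop), k ≤ Z ∧ k < B ∧ I 0 (m.setW τ 0 0) ∧
      (∀ j ≤ k, ∀ m', I j m' → m'.nat τ 0 = j ∧ b.val m' = k) ∧
      (∀ j < k, ∀ m', I j m' → wp Z B ω inp s
        (fun m'' => m''.nat τ 0 = j ∧ I (j + 1) (m''.setW τ 0 (j + 1))) m') ∧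
      ∀ m', I k m' → Q m'

section WP
variable {Z B : ℕ} {ω : ℕ → Bool} {inp : ℕ → ℝ}

lemma wp_mono {P : Prog} {Q Q' : Mem → Prop} {m : Mem} (h : wp Z B ω inp P Q m)
    (hQ : ∀ m', Q m' → Q' m') : wp Z B ω inp P Q' m := by
  induction P generalizing Q Q' m with
  | setW τ e v => exact ⟨h.1, hQ _ h.2⟩
  | setF τ e v => exact hQ _ h
  | flip τ e => exact hQ _ h
  | seq s t ihs iht => exact ihs h fun m' hm' => iht hm' hQ
  | ite c s t ihs iht => exact ⟨fun hc => ihs (h.1 hc) hQ, fun hc => iht (h.2 hc) hQ⟩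
  | skip => exact hQ _ h
  | forTo τ b s ih =>
    obtain ⟨k, I, h1, h2, h3, h4, h5, h6⟩ := h
    exact ⟨k, I, h1, h2, h3, h4, h5, fun m' hm' => hQ _ (h6 m' hm')⟩

lemma Mem.Rep.setW {m : Mem} {s s' : State} (h : m.Rep s) (τ : NVar) (i v : ℕ)
    (h1 : s'.nat = Function.update s.nat (τ.addr i) v) (h2 : s'.real = s.real)
    (h3 : s'.coins = s.coins) : (m.setW τ i v).Rep s' := by
  refine ⟨fun σ j => ?_, fun σ j => by rw [h2]; exact h.real σ j, h3.trans h.coins⟩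
  rw [h1]
  by_cases hσ : σ = τ
  · subst hσ
    by_cases hj : j = i
    · subst hj; simp
    · rw [Function.update_of_ne (by simp [NVar.addr_inj, hj])]
      simp [hj, h.nat]
  · rw [Function.update_of_ne (by simp [NVar.addr_inj, hσ])]
    simp [hσ, h.nat]

lemma Mem.Rep.setF {m : Mem} {s s' : State} (h : m.Rep s) (τ : RVar) (i : ℕ) (v : ℝ)
    (h1 : s'.real = Function.update s.real (τ.addr i) v) (h2 : s'.nat = s.nat)
    (h3 : s'.coins = s.coins) : (m.setF τ i v).Rep s' := by
  refine ⟨fun σ j => by rw [h2]; exact h.nat σ j, fun σ j => ?_, h3.trans h.coins⟩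
  rw [h1]
  by_cases hσ : σ = τ
  · subst hσ
    by_cases hj : j = i
    · subst hj; simp
    · rw [Function.update_of_ne (by simp [RVar.addr_inj, hj])]
      simp [hj, h.real]
  · rw [Function.update_of_ne (by simp [RVar.addr_inj, hσ])]
    simp [hσ, h.real]

/-- The outcome of a run that is certified by `wp`. -/
structure Outcome (procs : List Stmt) (Z B : ℕ) (ω : ℕ → Bool) (inp : ℕ → ℝ) (c : Stmt)
    (Q : Mem → Prop) (cost deg : ℕ) (s s' : State) : Prop where
  exec : Exec procs ω inp c s s'
  post : ∃ m', m'.Rep s' ∧ Q m'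
  words : ∀ a, s'.nat a < B
  time : s'.time ≤ s.time + cost
  space : s'.space ≤ max s.space (B ^ deg)

lemma update_lt {f : ℕ → ℕ} (hf : ∀ a, f a < B) {i v : ℕ} (hv : v < B) (a : ℕ) :
    Function.update f i v a < B := by
  by_cases h : a = i
  · subst h; simpa
  · simpa [Function.update_of_ne h] using hf a

lemma outcome_setN (procs : List Stmt) (hB : 2 ≤ B) {m : Mem} {s : State} (hr : m.Rep s)
    (hb : ∀ a, s.nat a < B) (τ : NVar) (e v : WExp) (hv : v.val m < B) {Q : Mem → Prop}
    (hQ : Q (m.setW τ (e.val m) (v.val m))) :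
    ∃ s', Outcome procs Z B ω inp (.setN (addrExpr e.code τ.ctorIdx) v.code) Q
      (sCost Z (.setN (addrExpr e.code τ.ctorIdx) v.code))
      (sDeg (.setN (addrExpr e.code τ.ctorIdx) v.code)) s s' := by
  have hB1 : 1 ≤ B := by omega
  refine ⟨_, Exec.setN _ _ _, ⟨_, hr.setW τ (e.val m) (v.val m) ?_ rfl rfl, hQ⟩, ?_, le_rfl, ?_⟩
  · simp only [eval_addrExpr, WExp.eval_code hr]; rfl
  · exact update_lt hb (by rwa [WExp.eval_code hr])
  · refine max_le_max le_rfl (max_le ?_ ?_)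
    · exact (nDeg_spec hB hb _).2.trans (Nat.pow_le_pow_right hB1 (Nat.le_add_right _ _))
    · exact (nDeg_spec hB hb _).2.trans (Nat.pow_le_pow_right hB1 (Nat.le_add_left _ _))

lemma Outcome.mono {procs : List Stmt} {c : Stmt} {Q Q' : Mem → Prop} {C C' E E' : ℕ}
    {s s' : State} (h : Outcome procs Z B ω inp c Q C E s s') (hB : 1 ≤ B)
    (hQ : ∀ m', Q m' → Q' m') (hC : C ≤ C') (hE : E ≤ E') :
    Outcome procs Z B ω inp c Q' C' E' s s' :=
  ⟨h.exec, h.post.imp fun _ hm => ⟨hm.1, hQ _ hm.2⟩, h.words, h.time.trans (by omega),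
    h.space.trans (max_le_max le_rfl (Nat.pow_le_pow_right hB hE))⟩

lemma Outcome.seq {procs : List Stmt} {c₁ c₂ : Stmt} {Q Q' : Mem → Prop} {C C' E : ℕ}
    {s s₁ s₂ : State} (h : Outcome procs Z B ω inp c₁ Q C E s s₁)
    (h' : Outcome procs Z B ω inp c₂ Q' C' E s₁ s₂) :
    Outcome procs Z B ω inp (.seq c₁ c₂) Q' (C + C') E s s₂ :=
  ⟨.seq _ _ _ _ _ h.exec h'.exec, h'.post, h'.words,
    h'.time.trans (by have := h.time; omega),
    h'.space.trans (max_le (h.space) (le_max_right _ _))⟩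

/-- Soundness of the weakest preconditions. -/
theorem exists_outcome (procs : List Stmt) (hB : 2 ≤ B) {P : Prog} {Q : Mem → Prop} {m : Mem}
    {s : State} (h : wp Z B ω inp P Q m) (hr : m.Rep s) (hb : ∀ a, s.nat a < B) :
    ∃ s', Outcome procs Z B ω inp P.code Q (sCost Z P.code) (sDeg P.code) s s' := by
  have hB1 : 1 ≤ B := by omega
  induction P generalizing Q m s with
  | setW τ e v => exact outcome_setN procs hB hr hb τ e v h.1 h.2
  | setF τ e v =>
    refine ⟨_, Exec.setR _ _ _, ⟨_, hr.setF τ (e.val m) (v.val inp m) ?_ rfl rfl, h⟩, hb,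
      le_rfl, ?_⟩
    · simp only [eval_addrExpr, WExp.eval_code hr, FExp.eval_code hr]; rfl
    · refine max_le_max le_rfl (max_le ?_ ?_)
      · exact (nDeg_spec hB hb _).2.trans (Nat.pow_le_pow_right hB1 (Nat.le_add_right _ _))
      · exact (rDeg_spec hB hb _).trans (Nat.pow_le_pow_right hB1 (Nat.le_add_left _ _))
  | flip τ e =>
    set f := Function.update s.nat (τ.addr (e.val m)) (ω m.coins).toNat with hf
    -- A toss is a store of the coin followed by an increment of the coin counter, so the
    -- representation of the memory is that of a store.
    have hr' := hr.setW (s' := { s with nat := f }) τ (e.val m) (ω m.coins).toNat rfl rfl rfl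
    refine ⟨_, Exec.flip _ _, ⟨m.toss ω τ (e.val m), ⟨?_, hr'.real, congrArg (· + 1) hr.coins⟩, h⟩, ?_, le_rfl, ?_⟩
    · intro σ i
      simp only [eval_addrExpr, WExp.eval_code hr, hr.coins]
      exact hr'.nat σ i
    · refine update_lt hb ?_
      cases ω s.coins <;> simp <;> omega
    · refine max_le_max le_rfl (max_le ?_ ?_)
      · exact (nDeg_spec hB hb _).2.trans (Nat.pow_le_pow_right hB1 (Nat.le_add_right _ _))
      · calc 2 ≤ B ^ 1 := by simpa
          _ ≤ _ := Nat.pow_le_pow_right hB1 (Nat.le_add_left _ _)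
  | seq P P' ih ih' =>
    obtain ⟨s₁, h₁⟩ := ih h hr hb
    obtain ⟨m₁, hm₁, hQ₁⟩ := h₁.post
    obtain ⟨s₂, h₂⟩ := ih' hQ₁ hm₁ h₁.words
    exact ⟨s₂, (h₁.mono hB1 (fun _ h => h) le_rfl (Nat.le_add_right _ _)).seq
      (h₂.mono hB1 (fun _ h => h) le_rfl (Nat.le_add_left _ _))⟩
  | ite c P P' ih ih' =>
    have hpk := bDeg_spec hB hb c.code
    have e1 : bDeg c.code ≤ sDeg (Prog.ite c P P').code := by
      simp only [Prog.code, sDeg]; omega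
    by_cases hc : c.val inp m
    · obtain ⟨s', h'⟩ := ih (h.1 hc) (hr.charge _ _) (s := s.charge (c.code.cost + 1)
        (c.code.peak s)) hb
      refine ⟨s', .iteTrue _ _ _ _ _ ((Test.holds_code hr inp c).2 hc) h'.exec, h'.post, h'.words,
        ?_, ?_⟩
      · have := h'.time
        simp only [State.charge, Prog.code, sCost] at this ⊢; omega
      · refine h'.space.trans (max_le (max_le_max le_rfl (hpk.trans
          (Nat.pow_le_pow_right hB1 e1))) ((Nat.pow_le_pow_right hB1 ?_).trans (le_max_right _ _)))
        simp only [Prog.code, sDeg]; omega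
    · obtain ⟨s', h'⟩ := ih' (h.2 hc) (hr.charge _ _) (s := s.charge (c.code.cost + 1)
        (c.code.peak s)) hb
      refine ⟨s', .iteFalse _ _ _ _ _ (fun h => hc ((Test.holds_code hr inp c).1 h)) h'.exec,
        h'.post, h'.words, ?_, ?_⟩
      · have := h'.time
        simp only [State.charge, Prog.code, sCost] at this ⊢; omega
      · refine h'.space.trans (max_le (max_le_max le_rfl (hpk.trans
          (Nat.pow_le_pow_right hB1 e1))) ((Nat.pow_le_pow_right hB1 ?_).trans (le_max_right _ _)))
        simp only [Prog.code, sDeg]; omega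
  | skip =>
    exact ⟨_, Exec.skip _, ⟨m, hr.charge _ _, h⟩, hb, le_rfl, max_le (le_max_left _ _)
      (Nat.zero_le _)⟩
  | forTo τ b P ih =>
    obtain ⟨k, I, hkZ, hkB, h0, hI, hstep, hpost⟩ := h
    obtain ⟨s₀, hs₀⟩ := outcome_setN (Z := Z) (ω := ω) (inp := inp) (Q := I 0) procs hB hr hb τ 0 0
      (by simp only [WExp.val_ofNat]; omega) h0
    obtain ⟨m₀, hm₀, hI₀⟩ := hs₀.post
    set body : Stmt := .seq P.code
      (.setN (addrExpr (.const 0) τ.ctorIdx) (WExp.get τ 0 + 1).code) with hbody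
    set c : BExpr := .ltN (WExp.get τ 0).code b.code with hc
    -- Induction on the number `i` of rounds still to come; the invariant is therefore used at the
    -- index `k - i`.
    have loop : ∀ (i : ℕ), i ≤ k → ∀ (m₁ : Mem) (s₁ : State), I (k - i) m₁ → m₁.Rep s₁ →
        (∀ a, s₁.nat a < B) → ∃ s', Outcome procs Z B ω inp (.loop c body) Q
          ((i + 1) * (c.cost + 1 + sCost Z body)) (sDeg (.loop c body)) s₁ s' := by
      intro i
      induction i with
      | zero =>
        intro _ m₁ s₁ hI₁ hr₁ hb₁
        have hcnt := hI _ (Nat.sub_le _ _) _ hI₁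
        refine ⟨_, Exec.loopFalse _ _ _ ?_, ⟨m₁, hr₁.charge _ _, hpost _ (by simpa using hI₁)⟩, hb₁,
          ?_, ?_⟩
        · rw [hc]
          simp only [BExpr.holds, WExp.eval_code hr₁, hcnt.2]
          simp only [WExp.val_get, WExp.val_ofNat, hcnt.1]
          omega
        · simp only [State.charge]; omega
        · exact max_le_max le_rfl ((bDeg_spec hB hb₁ c).trans
            (Nat.pow_le_pow_right hB1 (Nat.le_add_right _ _)))
      | succ i ihi =>
        intro hi m₁ s₁ hI₁ hr₁ hb₁
        have hcnt := hI _ (Nat.sub_le _ _) _ hI₁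
        have hw := hstep _ (by omega) _ hI₁
        obtain ⟨s₂, h₂⟩ := ih hw (hr₁.charge _ _) (s := s₁.charge (c.cost + 1) (c.peak s₁)) hb₁
        obtain ⟨m₂, hm₂, hcnt₂, hI₂⟩ := h₂.post
        have hval : (WExp.get τ 0 + 1).val m₂ = k - (i + 1) + 1 := by
          simp [hcnt₂]
        obtain ⟨s₃, h₃⟩ := outcome_setN (Z := Z) (ω := ω) (inp := inp) (Q := I (k - i)) procs hB
          hm₂ h₂.words τ 0 (WExp.get τ 0 + 1) (by rw [hval]; omega) (by
            rw [hval]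
            have e : k - (i + 1) + 1 = k - i := by omega
            rw [e] at hI₂ ⊢
            exact hI₂)
        obtain ⟨m₃, hm₃, hI₃⟩ := h₃.post
        obtain ⟨s₄, h₄⟩ := ihi (by omega) m₃ s₃ hI₃ hm₃ h₃.words
        have h₂₃ := (h₂.mono hB1 (fun _ h => h) le_rfl (Nat.le_add_right _ _)).seq
          (h₃.mono hB1 (fun _ h => h) le_rfl (Nat.le_add_left _ _))
        refine ⟨s₄, .loopTrue _ _ _ _ _ ?_ h₂₃.exec h₄.exec, h₄.post, h₄.words, ?_, ?_⟩
        · rw [hc]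
          simp only [BExpr.holds, WExp.eval_code hr₁, hcnt.2]
          simp only [WExp.val_get, WExp.val_ofNat, hcnt.1]
          omega
        · have e1 := h₂₃.time
          have e2 := h₄.time
          have e3 : sCost Z body = sCost Z P.code + sCost Z (.setN (addrExpr (.const 0) τ.ctorIdx)
            (WExp.get τ 0 + 1).code) := rfl
          have e4 : (i + 1 + 1) * (c.cost + 1 + sCost Z body)
            = (i + 1) * (c.cost + 1 + sCost Z body) + (c.cost + 1 + sCost Z body) := by ring
          rw [e4]
          simp only [State.charge] at e1
          have e5 : (0 : WExp).code = .const 0 := rfl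
          rw [e5] at e1
          omega
        · refine h₄.space.trans (max_le (h₂₃.space.trans (max_le (max_le_max le_rfl
            ((bDeg_spec hB hb₁ c).trans (Nat.pow_le_pow_right hB1 (Nat.le_add_right _ _)))) ?_))
            (le_max_right _ _))
          exact (Nat.pow_le_pow_right hB1 (Nat.le_add_left _ _)).trans (le_max_right _ _)
    obtain ⟨s', h'⟩ := loop k le_rfl m₀ s₀ (by simpa using hI₀) hm₀ hs₀.words
    refine ⟨s', ((hs₀.mono hB1 (fun _ h => h) le_rfl (Nat.le_add_right _ _)).seq
      (h'.mono hB1 (fun _ h => h) ?_ (Nat.le_add_left _ _)))⟩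
    exact Nat.mul_le_mul_right _ (by omega)

end WP

/-! ### The programs -/

/-- The word stored in a scalar. -/
def NVar.word (τ : NVar) : WExp := .get τ 0
/-- The real stored in a scalar. -/
def RVar.num (τ : RVar) : FExp := .get τ 0
/-- Assignment to a scalar. -/
def NVar.put (τ : NVar) (v : WExp) : Prog := .setW τ 0 v
/-- Assignment to a scalar. -/
def RVar.put (τ : RVar) (v : FExp) : Prog := .setF τ 0 v
/-- A natural number as a real expression. -/
def lit (k : ℕ) : FExp := .cast (.const k)

@[simp] lemma NVar.val_word (m : Mem) (τ : NVar) : τ.word.val m = m.nat τ 0 := rfl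
@[simp] lemma RVar.val_num (inp : ℕ → ℝ) (m : Mem) (τ : RVar) :
    τ.num.val inp m = m.real τ 0 := rfl
@[simp] lemma val_lit (inp : ℕ → ℝ) (m : Mem) (k : ℕ) : (lit k).val inp m = (k : ℝ) := rfl

infixr:60 " ;; " => Prog.seq

section Programs
open NVar RVar

/-- `dst := base ^ ex` -/
def powP (dst : NVar) (base ex : WExp) : Prog :=
  dst.put 1 ;; .forTo .u ex (dst.put (dst.word * base))

/-- The expression `z |z| ^ (a - 1)`. -/
def mazE (f : FExp) : FExp := f * .pow f (a.num - lit 1)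

/-- The scalar parameters. -/
def paramsP : Prog :=
  lam.put 2 ;; D.put 4 ;;
  .forTo i d.word (.ite (.ltW D.word d.word) (D.put (D.word * 2) ;; lam.put (lam.word + 1)) .skip) ;;
  nu.put 0 ;; cnt.put 1 ;;
  .forTo i n.word (.ite (.ltW cnt.word n.word) (cnt.put (cnt.word * 2) ;; nu.put (nu.word + 1))
    .skip) ;;
  .ite (.ltF (.cast lam.word) p.num) (pc.put (.cast lam.word)) (pc.put p.num) ;;
  L.put 0 ;; cnt.put 1 ;;
  .forTo i lam.word (.ite (.ltF (.cast cnt.word) pc.num)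
    (cnt.put (cnt.word * 2) ;; L.put (L.word + 1)) .skip) ;;
  a.put (.pow pc.num (lit 1 / .cast L.word)) ;;
  S.put (2 * lam.word + nu.word + 40) ;;
  tp.put (nu.word * (L.word + 3) + 100 * lam.word + 100) ;;
  t.put (16 * tp.word) ;; mm.put (4 * D.word) ;;
  powP PS 2 S.word ;; T.put (PS.word / D.word) ;; powP TT 2 t.word

/-- The parameters of the two phases. -/
def phasesP : Prog :=
  .setW lev 0 0 ;; .setW lev 1 L.word ;;
  .setW kk 0 (7 * (S.word + lam.word + 1)) ;; .setW kk 1 (7 * (33 + 4 * lam.word)) ;;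
  .forTo ph 2 (powP pw (.get kk ph.word) (.get lev ph.word + 1) ;; .setW JJ ph.word pw.word ;;
    powP pw n.word (.get lev ph.word + 1) ;; .setW nC ph.word pw.word) ;;
  .setF rr 0 (.cast D.word * r.num) ;; .setF rr 1 (lit 2 * r.num) ;;
  .setF cz 0 (lit 2 * .cast PS.word * .cast D.word) ;;
  .setF cz 1 (lit 8589934592 * .cast (D.word * D.word * D.word * D.word))

/-- Copy `d` entries of the input, starting at `src`, to the row `row`, and pad with zeros. -/
def copyRowP (row src : WExp) : Prog :=
  .forTo i D.word (.ite (.ltW i.word d.word)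
    (.setF X (row * D.word + i.word) (.input (src + i.word)))
    (.setF X (row * D.word + i.word) (lit 0)))

/-- Fill an array with random words. -/
def drawP (arr : NVar) (count : WExp) : Prog :=
  .forTo x count (v.put 0 ;; .forTo b S.word (.flip par 0 ;; v.put (2 * v.word + par.word)) ;;
    .setW arr x.word v.word)

/-- The random linear functional on a row. -/
def dotP (row : WExp) : Prog :=
  sum.put (lit 0) ;;
  .forTo i D.word (sum.put (sum.num + .cast (.get G i.word) * .get X (row * D.word + i.word)))

/-- Sort the points by the random linear functional. -/
def orderP : Prog :=
  .forTo x n.word (dotP x.word ;; .setF fv x.word sum.num) ;;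
  .forTo x n.word (cnt.put 0 ;;
    .forTo x' n.word (.ite (.ltF (.get fv x'.word) (.get fv x.word)) (cnt.put (cnt.word + 1))
      (.ite (.ltF (.get fv x.word) (.get fv x'.word)) .skip
        (.ite (.ltW x'.word x.word) (cnt.put (cnt.word + 1)) .skip))) ;;
    .setW ord cnt.word x.word)

/-- The digits of `src`. -/
def digitsP (arr : NVar) (src base count : WExp) : Prog :=
  q.put src ;; .forTo e count (.setW arr e.word (q.word % base) ;; q.put (q.word / base))

/-- The word with given digits. -/
def encodeP (dst arr : NVar) (base count : WExp) : Prog :=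
  dst.put 0 ;; pw.put 1 ;;
  .forTo e count (dst.put (dst.word + .get arr e.word * pw.word) ;; pw.put (pw.word * base))

/-- The ratio of the search radius and the near radius. -/
def ratioE (h : WExp) : FExp :=
  lit 8589934592 * .pow (lit 5) (.cast h) +
    .get cz ph.word * .pow (lit 9 / lit 10) (.cast (.get dig h))

/-- The scale of a step. -/
def scaleP : Prog :=
  rad.put (.get rr ph.word) ;;
  .forTo l (.get lev ph.word) (h.put (.get lev ph.word - l.word) ;;
    rad.put (lit 2 * rad.num * .pow (ratioE h.word * rad.num + rad.num) (a.num - lit 1))) ;;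
  scale.put (ratioE 0 * rad.num)

/-- The image of a row under the recentered Mazur maps. -/
def imageP (row : WExp) : Prog :=
  .forTo i D.word (
    .forTo e (.get lev ph.word + 1) (.setF tmp e.word (.get X (.get cen e.word * D.word + i.word))) ;;
    z.put (.get X (row * D.word + i.word)) ;;
    .forTo l (.get lev ph.word) (h.put (.get lev ph.word - l.word) ;;
      z.put (mazE (z.num - .get tmp h.word)) ;;
      .forTo e h.word (.setF tmp e.word (mazE (.get tmp e.word - .get tmp h.word)))) ;;
    .setF w i.word ((z.num - .get tmp 0) / scale.num))

/-- The sketch of the current image. -/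
def sketchP : Prog :=
  .forTo b t.word (par.put 0 ;;
    .forTo e mm.word (v.put (.get W (b.word * mm.word + e.word)) ;;
      .ite (.ltF (.get w (v.word % D.word))
        ((lit 4 * .cast (v.word / D.word) + lit 2) / .cast T.word - lit 2))
        (par.put (1 - par.word)) .skip) ;;
    .setW bit b.word par.word)

/-- The address in the table. -/
def tabE : WExp := 2 * ((j.word * .get nC ph.word + cc.word) * TT.word + bb.word) + ph.word

/-- One entry of the table. -/
def entryP : Prog :=
  digitsP tgt bb.word 2 t.word ;; ans.put 0 ;;
  .forTo x n.word (imageP x.word ;; sketchP ;; mis.put 0 ;;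
    .forTo b t.word (.ite (.ltW (.get bit b.word) (.get tgt b.word)) (mis.put (mis.word + 1))
      (.ite (.ltW (.get tgt b.word) (.get bit b.word)) (mis.put (mis.word + 1)) .skip)) ;;
    .ite (.ltW tp.word mis.word) .skip (ans.put x.word)) ;;
  .setW tab tabE ans.word

/-- The table of answers. -/
def tableP : Prog :=
  .forTo ph 2 (.forTo j (.get JJ ph.word) (
    digitsP dig j.word (.get kk ph.word) (.get lev ph.word + 1) ;; scaleP ;;
    .forTo cc (.get nC ph.word) (digitsP cen cc.word n.word (.get lev ph.word + 1) ;;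
      .forTo bb TT.word entryP)))

/-- The preprocessing. -/
def preP : Prog :=
  paramsP ;; phasesP ;; .forTo x n.word (copyRowP x.word (x.word * d.word)) ;;
  drawP G D.word ;; drawP W (t.word * mm.word) ;; orderP ;; tableP

/-- Search for the first point whose functional is not far below that of the query. -/
def searchP : Prog :=
  lo.put 0 ;; hi.put n.word ;;
  .forTo b (nu.word + 1) (.ite (.ltW lo.word hi.word)
    (mid.put ((lo.word + hi.word) / 2) ;;
      .ite (.ltF (.get fv (.get ord mid.word)) (sum.num - .cast (PS.word * D.word) * r.num))
        (lo.put (mid.word + 1)) (hi.put mid.word)) .skip) ;;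
  .ite (.ltW lo.word n.word) (y.put (.get ord lo.word)) (y.put 0)

/-- One step of the search: the centers are former answers. -/
def stepP : Prog :=
  .setW hist j.word y.word ;;
  digitsP dig j.word (.get kk ph.word) (.get lev ph.word + 1) ;; scaleP ;;
  q.put j.word ;; pw.put 1 ;;
  .forTo e (.get lev ph.word + 1) (.setW cen e.word (.get hist (q.word * pw.word)) ;;
    q.put (q.word / .get kk ph.word) ;; pw.put (pw.word * .get kk ph.word)) ;;
  imageP n.word ;; sketchP ;; encodeP cc cen n.word (.get lev ph.word + 1) ;;
  encodeP bb bit 2 t.word ;; y.put (.get tab tabE)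

/-- The query. -/
def queryP : Prog :=
  copyRowP n.word 0 ;; dotP n.word ;; searchP ;;
  .forTo ph 2 (.forTo j (.get JJ ph.word) stepP) ;; n.put y.word

end Programs

/-! ### What the programs compute -/

/-- The Mazur map on a coordinate. -/
def maz (a z : ℝ) : ℝ := z * |z| ^ (a - 1)

/-- The composition of `h` Mazur maps, each recentered at the image of a center: the center of
the first map is `c h`, that of the last one is `c 1`. -/
def push (a : ℝ) : ℕ → (ℕ → ℝ) → ℝ → ℝ
  | 0, _, z => z
  | h + 1, c, z => push a h (fun e => maz a (c e - c (h + 1))) (maz a (z - c (h + 1)))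

/-- The ratio of the search radius and the near radius at height `h` in the round `k`. -/
def ratio (cz : ℝ) (h k : ℕ) : ℝ := 8589934592 * 5 ^ h + cz * (9 / 10) ^ k

/-- The near radius after `h` maps. -/
def nearRad (a cz : ℝ) (dig : ℕ → ℕ) : ℕ → ℝ → ℝ
  | 0, rr => rr
  | h + 1, rr => nearRad a cz dig h
      (2 * rr * |ratio cz (h + 1) (dig (h + 1)) * rr + rr| ^ (a - 1))

/-- The search radius after `h` maps. -/
def searchRad (a cz : ℝ) (dig : ℕ → ℕ) (h : ℕ) (rr : ℝ) : ℝ :=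
  ratio cz 0 (dig 0) * nearRad a cz dig h rr

/-- The coordinate `i` of the image of the row `x`, relative to the image of the last center. -/
def image (a : ℝ) (X : ℕ → ℝ) (D M : ℕ) (cen : ℕ → ℕ) (scale : ℝ) (x i : ℕ) : ℝ :=
  (push a M (fun e => X (cen e * D + i)) (X (x * D + i)) -
    push a M (fun e => X (cen e * D + i)) (X (cen 0 * D + i))) / scale

open Classical in
/-- The parity of the number of `e < m` with `P e`. -/
def parity (P : ℕ → Prop) : ℕ → ℕ
  | 0 => 0
  | m + 1 => if P m then 1 - parity P m else parity P m

/-- The threshold test given by the random word `v`. -/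
def Below (D T : ℕ) (w : ℕ → ℝ) (v : ℕ) : Prop :=
  w (v % D) < (4 * ((v / D : ℕ) : ℝ) + 2) / T - 2

/-- The bit `b` of the sketch. -/
def sketch (W : ℕ → ℕ) (D T mm : ℕ) (w : ℕ → ℝ) (b : ℕ) : ℕ :=
  parity (fun e => Below D T w (W (b * mm + e))) mm

/-- The number of mismatches. -/
def mismatch (f g : ℕ → ℕ) (t : ℕ) : ℕ := ((Finset.range t).filter fun b => f b ≠ g b).card

/-- The digit `e` of `v`. -/
def digit (k v e : ℕ) : ℕ := v / k ^ e % k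

/-- The word with given digits. -/
def encode (k : ℕ) (f : ℕ → ℕ) (m : ℕ) : ℕ := ∑ e ∈ Finset.range m, f e * k ^ e

/-- The word given by `S` coins. -/
def coinWord (ω : ℕ → Bool) (o : ℕ) : ℕ → ℕ
  | 0 => 0
  | S + 1 => 2 * coinWord ω o S + (ω (o + S)).toNat

/-- The random linear functional. -/
def dot (G : ℕ → ℕ) (X : ℕ → ℝ) (D x : ℕ) : ℝ := ∑ i ∈ Finset.range D, (G i : ℝ) * X (x * D + i)

/-! ### Proof rules -/

/-- The memories `m` and `m'` agree outside the given arrays. -/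
structure Frame (ns : List NVar) (rs : List RVar) (m m' : Mem) : Prop where
  nat : ∀ τ, τ ∉ ns → m'.nat τ = m.nat τ
  real : ∀ τ, τ ∉ rs → m'.real τ = m.real τ
  coins : m'.coins = m.coins

section Rules
variable {ns ns' : List NVar} {rs rs' : List RVar} {m m' m'' : Mem}

@[simp] lemma Frame.refl : Frame ns rs m m := ⟨fun _ _ => rfl, fun _ _ => rfl, rfl⟩

lemma Frame.trans (h : Frame ns rs m m') (h' : Frame ns rs m' m'') : Frame ns rs m m'' :=
  ⟨fun τ hτ => (h'.nat τ hτ).trans (h.nat τ hτ), fun τ hτ => (h'.real τ hτ).trans (h.real τ hτ),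
    h'.coins.trans h.coins⟩

lemma Frame.mono (h : Frame ns rs m m') (h1 : ns ⊆ ns') (h2 : rs ⊆ rs') : Frame ns' rs' m m' :=
  ⟨fun τ hτ => h.nat τ fun h => hτ (h1 h), fun τ hτ => h.real τ fun h => hτ (h2 h), h.coins⟩

-- An equivalence, so that `simp` strips the stores into listed arrays off a chain of updates.
@[simp] lemma frame_setW {τ : NVar} {i v : ℕ} (hτ : τ ∈ ns) :
    Frame ns rs m (m'.setW τ i v) ↔ Frame ns rs m m' := by
  have key : ∀ σ, σ ∉ ns → (m'.setW τ i v).nat σ = m'.nat σ := fun σ hσ =>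
    Mem.setW_ne m' i v (by rintro rfl; exact hσ hτ)
  constructor
  · intro h
    exact ⟨fun σ hσ => (key σ hσ).symm.trans (h.nat σ hσ), h.real, h.coins⟩
  · intro h
    exact ⟨fun σ hσ => (key σ hσ).trans (h.nat σ hσ), h.real, h.coins⟩

@[simp] lemma frame_setF {τ : RVar} {i : ℕ} {v : ℝ} (hτ : τ ∈ rs) :
    Frame ns rs m (m'.setF τ i v) ↔ Frame ns rs m m' := by
  have key : ∀ σ, σ ∉ rs → (m'.setF τ i v).real σ = m'.real σ := fun σ hσ =>
    Mem.setF_ne m' i v (by rintro rfl; exact hσ hτ)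
  constructor
  · intro h
    exact ⟨h.nat, fun σ hσ => (key σ hσ).symm.trans (h.real σ hσ), h.coins⟩
  · intro h
    exact ⟨h.nat, fun σ hσ => (key σ hσ).trans (h.real σ hσ), h.coins⟩

variable {Z B : ℕ} {ω : ℕ → Bool} {inp : ℕ → ℝ}

@[simp] lemma wp_put {τ : NVar} {v : WExp} {Q : Mem → Prop} :
    wp Z B ω inp (τ.put v) Q m ↔ v.val m < B ∧ Q (m.setW τ 0 (v.val m)) := Iff.rfl
@[simp] lemma wp_fput {τ : RVar} {v : FExp} {Q : Mem → Prop} :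
    wp Z B ω inp (τ.put v) Q m ↔ Q (m.setF τ 0 (v.val inp m)) := Iff.rfl
@[simp] lemma wp_setW {τ : NVar} {e v : WExp} {Q : Mem → Prop} :
    wp Z B ω inp (.setW τ e v) Q m ↔ v.val m < B ∧ Q (m.setW τ (e.val m) (v.val m)) := Iff.rfl
@[simp] lemma wp_setF {τ : RVar} {e : WExp} {v : FExp} {Q : Mem → Prop} :
    wp Z B ω inp (.setF τ e v) Q m ↔ Q (m.setF τ (e.val m) (v.val inp m)) := Iff.rfl
@[simp] lemma wp_flip {τ : NVar} {e : WExp} {Q : Mem → Prop} :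
    wp Z B ω inp (.flip τ e) Q m ↔ Q (m.toss ω τ (e.val m)) := Iff.rfl
@[simp] lemma wp_seq {s t : Prog} {Q : Mem → Prop} :
    wp Z B ω inp (s ;; t) Q m ↔ wp Z B ω inp s (wp Z B ω inp t Q) m := Iff.rfl
@[simp] lemma wp_ite {c : Test} {s t : Prog} {Q : Mem → Prop} :
    wp Z B ω inp (.ite c s t) Q m ↔
      (c.val inp m → wp Z B ω inp s Q m) ∧ (¬ c.val inp m → wp Z B ω inp t Q m) := Iff.rfl
@[simp] lemma wp_skip {Q : Mem → Prop} : wp Z B ω inp .skip Q m ↔ Q m := Iff.rfl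

/-- The rule for counted loops. -/
lemma wp_for (ns : List NVar) (rs : List RVar) (k : ℕ) (P : ℕ → Mem → Prop) {τ : NVar} {b : WExp}
    {body : Prog} {Q : Mem → Prop} (hZB : Z < B) (hτ : τ ∈ ns) (hk : k ≤ Z)
    (hb : ∀ m', Frame ns rs m m' → b.val m' = k)
    (hP : ∀ j m' v, P j m' → P j (m'.setW τ 0 v)) (h0 : P 0 m)
    (step : ∀ j < k, ∀ m', Frame ns rs m m' → P j m' → m'.nat τ 0 = j →
      wp Z B ω inp body (fun m'' => Frame ns rs m' m'' ∧ m''.nat τ 0 = j ∧ P (j + 1) m'') m')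
    (post : ∀ m', Frame ns rs m m' → P k m' → Q m') :
    wp Z B ω inp (.forTo τ b body) Q m := by
  refine ⟨k, fun j m' => Frame ns rs m m' ∧ m'.nat τ 0 = j ∧ P j m', hk, by omega,
    ⟨by simp [hτ], by simp, hP _ _ _ h0⟩, fun j _ m' h => ⟨h.2.1, hb _ h.1⟩, ?_,
    fun m' h => post m' h.1 h.2.2⟩
  intro j hj m' h
  refine wp_mono (step j hj m' h.1 h.2.2 h.2.1) ?_
  rintro m'' ⟨h1, h2, h3⟩
  exact ⟨h2, (frame_setW hτ).2 (h.1.trans h1), by simp, hP _ _ _ h3⟩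

/-- As `wp_for`, for bodies that may toss coins. -/
lemma wp_for' (k : ℕ) (P : ℕ → Mem → Prop) {τ : NVar} {b : WExp}
    {body : Prog} {Q : Mem → Prop} (hZB : Z < B) (hk : k ≤ Z)
    (hb : ∀ j m', P j m' → b.val m' = k)
    (hP : ∀ j m' v, P j m' → P j (m'.setW τ 0 v)) (h0 : P 0 m)
    (step : ∀ j < k, ∀ m', P j m' → m'.nat τ 0 = j →
      wp Z B ω inp body (fun m'' => m''.nat τ 0 = j ∧ P (j + 1) m'') m')
    (post : ∀ m', P k m' → Q m') :
    wp Z B ω inp (.forTo τ b body) Q m := by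
  refine ⟨k, fun j m' => m'.nat τ 0 = j ∧ P j m', hk, by omega,
    ⟨by simp, hP _ _ _ h0⟩, fun j _ m' h => ⟨h.1, hb _ _ h.2⟩, ?_,
    fun m' h => post m' h.2⟩
  intro j hj m' h
  refine wp_mono (step j hj m' h.2 h.1) ?_
  rintro m'' ⟨h2, h3⟩
  exact ⟨h2, by simp, hP _ _ _ h3⟩

/-! ### Specifications of the common procedures -/

variable {Q : Mem → Prop}

lemma wp_powP (hZB : Z < B) {dst : NVar} {base ex : WExp} (β κ : ℕ) (hd : dst ≠ .u)
    (hβ : ∀ m', Frame [dst, .u] [] m m' → base.val m' = β)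
    (hκ : ∀ m', Frame [dst, .u] [] m m' → ex.val m' = κ) (h1 : 1 ≤ β) (hκZ : κ ≤ Z)
    (hlt : β ^ κ < B)
    (hQ : ∀ m', Frame [dst, .u] [] m m' → m'.nat dst 0 = β ^ κ → Q m') :
    wp Z B ω inp (powP dst base ex) Q m := by
  have hle : ∀ j ≤ κ, β ^ j < B := fun j hj => (Nat.pow_le_pow_right h1 hj).trans_lt hlt
  have fr : ∀ m', Frame [dst, .u] [] (m.setW dst 0 1) m' → Frame [dst, .u] [] m m' := fun m' h =>
    Frame.trans (by simp) h
  simp only [powP, wp_seq, wp_put, WExp.val_ofNat]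
  refine ⟨by simpa using hle 0 (Nat.zero_le _), ?_⟩
  refine wp_for [dst, .u] [] κ (fun j m' => m'.nat dst 0 = β ^ j) hZB (by simp) hκZ
    (fun m' h => hκ m' (fr m' h)) (fun j m' v h => by simpa [hd] using h) (by simp) ?_
    (fun m' h h' => hQ m' (fr m' h) h')
  intro j hj m' hf hP hj'
  have hb := hβ m' (fr m' hf)
  simp only [wp_put, WExp.val_mul, NVar.val_word, hP, hb]
  have e : β ^ j * β = β ^ (j + 1) := (pow_succ _ _).symm
  rw [e]
  exact ⟨hle _ hj, by simp, by simp [hd.symm, hj'], by simp⟩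

lemma wp_digitsP (hZB : Z < B) {arr : NVar} {src base count : WExp} (s k c : ℕ)
    (hq : arr ≠ .q) (he : arr ≠ .e) (hs : src.val m = s) (hsB : s < B)
    (hk : ∀ m', Frame [arr, .q, .e] [] m m' → base.val m' = k)
    (hc : ∀ m', Frame [arr, .q, .e] [] m m' → count.val m' = c) (hcZ : c ≤ Z)
    (hQ : ∀ m', Frame [arr, .q, .e] [] m m' → (∀ e < c, m'.nat arr e = digit k s e) → Q m') :
    wp Z B ω inp (digitsP arr src base count) Q m := by
  have fr : ∀ m', Frame [arr, .q, .e] [] (m.setW .q 0 s) m' → Frame [arr, .q, .e] [] m m' :=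
    fun m' h => Frame.trans (by simp) h
  simp only [digitsP, wp_seq, wp_put, hs]
  refine ⟨hsB, ?_⟩
  refine wp_for [arr, .q, .e] [] c (fun j m' => m'.nat .q 0 = s / k ^ j ∧
    ∀ e < j, m'.nat arr e = digit k s e) hZB (by simp) hcZ
    (fun m' h => hc m' (fr m' h)) (fun j m' v h => by simpa [he] using h) (by simp) ?_
    (fun m' h h' => hQ m' (fr m' h) h'.2)
  rintro j hj m' hf ⟨hP, hP'⟩ hj'
  have hb := hk m' (fr m' hf)
  have hb' : ∀ i v, base.val (m'.setW arr i v) = k := fun i v =>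
    hk _ (by simpa using fr m' hf)
  simp only [wp_seq, wp_setW, wp_put, WExp.val_mod, WExp.val_div, NVar.val_word, hP, hb, hb', hj']
  have e1 : s / k ^ j ≤ s := Nat.div_le_self _ _
  refine ⟨((Nat.mod_le _ _).trans e1).trans_lt hsB, ?_, by simp, by simp [he.symm, hj'], ?_, ?_⟩
  · simp only [Mem.setW_ne _ _ _ hq.symm, hP]
    exact ((Nat.div_le_self _ _).trans e1).trans_lt hsB
  · simp [hq.symm, hP, Nat.div_div_eq_div_mul, pow_succ]
  · intro e he'
    by_cases h : e = j
    · subst h; simp [hq, digit]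
    · simp only [Mem.setW_ne _ _ _ hq, Mem.setW_same, Function.update_of_ne h]
      exact hP' e (by omega)

lemma encode_succ (k : ℕ) (f : ℕ → ℕ) (m : ℕ) : encode k f (m + 1) = encode k f m + f m * k ^ m := by
  simp [encode, Finset.sum_range_succ]

lemma encode_lt {k : ℕ} {f : ℕ → ℕ} {m : ℕ} (hf : ∀ e < m, f e < k) : encode k f m < k ^ m := by
  induction m with
  | zero => simp [encode]
  | succ m ih =>
    have h1 := ih fun e he => hf e (by omega)
    have h2 : (f m + 1) * k ^ m ≤ k * k ^ m := Nat.mul_le_mul_right _ (hf m (by omega))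
    rw [encode_succ, pow_succ]
    nlinarith

lemma encode_mono {k : ℕ} {f : ℕ → ℕ} {m m' : ℕ} (h : m ≤ m') : encode k f m ≤ encode k f m' :=
  Finset.sum_le_sum_of_subset (Finset.range_mono h)

lemma wp_encodeP (hZB : Z < B) {dst arr : NVar} {base count : WExp} (k c : ℕ) (hd : dst ≠ .pw)
    (hde : dst ≠ .e) (hda : arr ≠ dst) (hap : arr ≠ .pw) (hae : arr ≠ .e)
    (hk : ∀ m', Frame [dst, .pw, .e] [] m m' → base.val m' = k) (hk1 : 1 ≤ k)
    (hc : ∀ m', Frame [dst, .pw, .e] [] m m' → count.val m' = c) (hcZ : c ≤ Z)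
    (hf : ∀ e < c, m.nat arr e < k) (hB : k ^ c < B)
    (hQ : ∀ m', Frame [dst, .pw, .e] [] m m' → m'.nat dst 0 = encode k (m.nat arr) c → Q m') :
    wp Z B ω inp (encodeP dst arr base count) Q m := by
  have fr : ∀ m', Frame [dst, .pw, .e] [] ((m.setW dst 0 0).setW .pw 0 1) m' →
    Frame [dst, .pw, .e] [] m m' := fun m' h => Frame.trans (by simp) h
  have hlt := encode_lt hf
  simp only [encodeP, wp_seq, wp_put, WExp.val_ofNat]
  refine ⟨by omega, by have := Nat.one_le_pow c k hk1; omega, ?_⟩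
  refine wp_for [dst, .pw, .e] [] c (fun j m' => m'.nat dst 0 = encode k (m.nat arr) j ∧
    m'.nat .pw 0 = k ^ j) hZB (by simp) hcZ
    (fun m' h => hc m' (fr m' h)) (fun j m' v h => by simpa [hde] using h)
    (by simp [hd, encode]) ?_ (fun m' h h' => hQ m' (fr m' h) h'.1)
  rintro j hj m' hf' ⟨hP, hP'⟩ hj'
  have hb : ∀ i v, base.val (m'.setW dst i v) = k := fun i v =>
    hk _ (by simpa using fr m' hf')
  have ha : m'.nat arr = m.nat arr := (fr m' hf').nat arr (by simp [hda, hap, hae])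
  have e1 : encode k (m.nat arr) (j + 1) < B :=
    ((encode_mono hj).trans_lt hlt).trans hB
  simp only [wp_seq, wp_put, WExp.val_add, WExp.val_mul, WExp.val_get, NVar.val_word, hP, hb, hj',
    ha, hP', Mem.setW_ne _ _ _ hd.symm, ← encode_succ, ← pow_succ]
  refine ⟨e1, (Nat.pow_le_pow_right hk1 hj).trans_lt hB, by simp,
    by simp [hde.symm, hj'], by simp [hd], by simp⟩

/-- Only the centers 1, …, h enter. The entry 0 is therefore free to hold the point relative to
which the image is finally taken. -/
lemma push_congr (a : ℝ) (h : ℕ) {c c' : ℕ → ℝ} (hc : ∀ e, 1 ≤ e → e ≤ h → c e = c' e) (z : ℝ) :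
    push a h c z = push a h c' z := by
  induction h generalizing c c' z with
  | zero => rfl
  | succ h ih =>
    simp only [push]
    rw [hc (h + 1) (by omega) le_rfl]
    exact ih (fun e he he' => by rw [hc e he (by omega)]) _

lemma nearRad_congr (a cz : ℝ) (h : ℕ) {dig dig' : ℕ → ℕ} (hc : ∀ e ≤ h, dig e = dig' e) (rr : ℝ) :
    nearRad a cz dig h rr = nearRad a cz dig' h rr := by
  induction h generalizing rr with
  | zero => rfl
  | succ h ih =>
    simp only [nearRad]
    rw [hc (h + 1) le_rfl]
    exact ih (fun e he => hc e (by omega)) _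

lemma val_ratioE (e : WExp) : (ratioE e).val inp m =
    ratio (m.real .cz (m.nat .ph 0)) (e.val m) (m.nat .dig (e.val m)) := by
  simp only [ratioE, ratio, FExp.val_add, FExp.val_mul, val_lit, FExp.val_pow, FExp.val_cast,
    FExp.val_get, NVar.val_word, FExp.val_div, WExp.val_get, Real.rpow_natCast]
  norm_num [abs_of_nonneg]

lemma wp_scaleP (hZB : Z < B) {M : ℕ} {dig : ℕ → ℕ} (hM : m.nat .lev (m.nat .ph 0) = M) (hMZ : M ≤ Z)
    (hdig : ∀ e ≤ M, m.nat .dig e = dig e)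
    (hQ : ∀ m', Frame [.l, .h] [.rad, .scale] m m' → m'.real .scale 0 =
      searchRad (m.real .a 0) (m.real .cz (m.nat .ph 0)) dig M (m.real .rr (m.nat .ph 0)) → Q m') :
    wp Z B ω inp scaleP Q m := by
  have fr : ∀ m' z, Frame [.l, .h] [.rad, .scale] (m.setF .rad 0 z) m' →
    Frame [.l, .h] [.rad, .scale] m m' := fun m' z h => Frame.trans (by simp) h
  have key : ∀ m', Frame [.l, .h] [.rad, .scale] m m' → m'.nat .lev = m.nat .lev ∧
      m'.nat .ph = m.nat .ph ∧ m'.nat .dig = m.nat .dig ∧ m'.real .a = m.real .a ∧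
      m'.real .cz = m.real .cz := fun m' h =>
    ⟨h.nat _ (by simp), h.nat _ (by simp), h.nat _ (by simp), h.real _ (by simp), h.real _ (by simp)⟩
  simp only [scaleP, wp_seq, wp_fput, FExp.val_get, NVar.val_word]
  -- Invariant: the part of the recursion that remains, applied to the current radius, has a
  -- constant value. It begins at height M and is the identity at height 0.
  refine wp_for [.l, .h] [.rad, .scale] M (fun j m' =>
    nearRad (m.real .a 0) (m.real .cz (m.nat .ph 0)) dig (M - j) (m'.real .rad 0) =
    nearRad (m.real .a 0) (m.real .cz (m.nat .ph 0)) dig M (m.real .rr (m.nat .ph 0)))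
    hZB (by simp) hMZ ?_ (fun j m' v h => by simpa using h) (by simp) ?_ ?_
  · intro m' h
    obtain ⟨h1, h2, -⟩ := key m' (fr _ _ h)
    simp [h1, h2, hM]
  · intro j hj m' hf hP hj'
    obtain ⟨h1, h2, h3, h4, h5⟩ := key m' (fr _ _ hf)
    have e1 : M - j = M - (j + 1) + 1 := by omega
    simp only [wp_seq, wp_put, WExp.val_sub, WExp.val_get, NVar.val_word, wp_fput, FExp.val_mul,
      val_lit, RVar.val_num, FExp.val_pow, FExp.val_add, val_ratioE, FExp.val_sub, h1, h2, hj', hM, h5,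
      Mem.setW_real, h4]
    refine ⟨by omega, by simp, by simp [hj'], ?_⟩
    rw [← hP, e1]
    simp [nearRad, h2, h3, hdig _ (show M - (j + 1) + 1 ≤ M by omega)]
  · intro m' hf hP
    obtain ⟨h1, h2, h3, h4, h5⟩ := key m' (fr _ _ hf)
    refine hQ _ (by simpa using fr _ _ hf) ?_
    simp only [Nat.sub_self, nearRad] at hP
    simp [val_ratioE, h2, h3, h5, hP, searchRad, hdig 0 (Nat.zero_le _)]

lemma val_mazE (f : FExp) : (mazE f).val inp m = maz (m.real .a 0) (f.val inp m) := by
  simp [mazE, maz]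

lemma wp_imageP (hZB : Z < B) {M D : ℕ} {cen : ℕ → ℕ} {row : WExp} (r : ℕ)
    (hM : m.nat .lev (m.nat .ph 0) = M) (hMZ : M + 1 ≤ Z) (hD : m.nat .D 0 = D) (hDZ : D ≤ Z)
    (hcen : ∀ e ≤ M, m.nat .cen e = cen e)
    (hr : ∀ m', Frame [.i, .e, .l, .h] [.tmp, .z, .w] m m' → row.val m' = r)
    (hQ : ∀ m', Frame [.i, .e, .l, .h] [.tmp, .z, .w] m m' →
      (∀ i < D, m'.real .w i =
        image (m.real .a 0) (m.real .X) D M cen (m.real .scale 0) r i) → Q m') :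
    wp Z B ω inp (imageP row) Q m := by
  set ns : List NVar := [.i, .e, .l, .h] with hns
  set rs : List RVar := [.tmp, .z, .w] with hrs
  have key : ∀ m', Frame ns rs m m' → m'.nat .lev = m.nat .lev ∧
      m'.nat .ph = m.nat .ph ∧ m'.nat .cen = m.nat .cen ∧ m'.nat .D = m.nat .D ∧
      m'.real .a = m.real .a ∧ m'.real .X = m.real .X ∧ m'.real .scale = m.real .scale := fun m' h =>
    ⟨h.nat _ (by simp [hns]), h.nat _ (by simp [hns]), h.nat _ (by simp [hns]),
      h.nat _ (by simp [hns]), h.real _ (by simp [hrs]), h.real _ (by simp [hrs]),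
      h.real _ (by simp [hrs])⟩
  rw [imageP]
  refine wp_for ns rs D (fun j m' => ∀ i < j, m'.real .w i =
    image (m.real .a 0) (m.real .X) D M cen (m.real .scale 0) r i) hZB (by simp [hns]) hDZ ?_
    (fun j m' v h => by simpa using h) (by simp) ?_ hQ
  · intro m' h
    simp [(key m' h).2.2.2.1, hD]
  · intro i hi m₀ hf₀ hP₀ hi₀
    rw [wp_seq]
    refine wp_for [.e] [.tmp] (M + 1) (fun j m' => ∀ e < j, m'.real .tmp e =
      m.real .X (cen e * D + i)) hZB (by simp) hMZ ?_
      (fun j m' v h => by simpa using h) (by simp) ?_ ?_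
    · intro m' h
      obtain ⟨h1, h2, -⟩ := key m' (hf₀.trans (h.mono (by simp [hns]) (by simp [hrs])))
      simp [h1, h2, hM]
    · intro j hj m₁ hf₁ hP₁ hj₁
      obtain ⟨h1, h2, h3, h4, h5, h6, h7⟩ :=
        key m₁ (hf₀.trans (hf₁.mono (by simp [hns]) (by simp [hrs])))
      have hi₁ : m₁.nat .i 0 = i := by rw [hf₁.nat _ (by simp), hi₀]
      refine ⟨by simp, by simpa using hj₁, ?_⟩
      intro e he
      by_cases h : e = j
      · subst h
        simp [hj₁, h3, h4, h6, hD, hi₁, hcen e (by omega)]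
      · simp [hj₁, h, hP₁ e (by omega)]
    · intro m₁ hf₁ hP₁
      have hi₁ : m₁.nat .i 0 = i := by rw [hf₁.nat _ (by simp), hi₀]
      have hw₁ : m₁.real .w = m₀.real .w := hf₁.real _ (by simp)
      have hff := hf₀.trans (hf₁.mono (ns' := ns) (rs' := rs) (by simp [hns]) (by simp [hrs]))
      obtain ⟨h1, h2, h3, h4, h5, h6, h7⟩ := key m₁ hff
      have hrow := hr m₁ hff
      simp only [wp_seq, wp_fput, FExp.val_get, WExp.val_add, WExp.val_mul, hrow, NVar.val_word, h4,
        hD, hi₁, h6]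
      set c : ℕ → ℝ := fun e => m.real .X (cen e * D + i) with hc
      set zz := m.real .X (r * D + i) with hzz
      set a := m.real .a 0 with ha
      -- The maps that remain, applied to the current value, give a constant. The second clause
      -- follows the center of index 0, which is transformed along with the other centers.
      refine wp_for [.e, .l, .h] [.tmp, .z] M (fun j m' =>
        push a (M - j) (m'.real .tmp) (m'.real .z 0) = push a M c zz ∧
        push a (M - j) (m'.real .tmp) (m'.real .tmp 0) = push a M c (c 0)) hZB (by simp)
        (by omega) ?_ (fun j m' v h => by simpa using h) ?_ ?_ ?_
      · intro m' h
        have h' := h.mono (ns' := ns) (rs' := rs) (by simp [hns]) (by simp [hrs])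
        obtain ⟨g1, g2, -⟩ := key m' (hff.trans (Frame.trans (by simp [hrs]) h'))
        simp [g1, g2, hM]
      · have e0 : m₁.real .tmp 0 = c 0 := hP₁ 0 (by omega)
        simp only [Nat.sub_zero, Mem.setF_same, Function.update_self, ne_eq, reduceCtorEq,
          not_false_eq_true, Mem.setF_ne, e0]
        exact ⟨push_congr _ _ (fun e _ he => hP₁ e (by omega)) _,
          push_congr _ _ (fun e _ he => hP₁ e (by omega)) _⟩
      · rintro j hj m₂ hf₂ ⟨hP₂, hP₂'⟩ hj₂
        have h' := hf₂.mono (ns' := ns) (rs' := rs) (by simp [hns]) (by simp [hrs])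
        obtain ⟨g1, g2, g3, g4, g5, g6, g7⟩ := key m₂ (hff.trans (Frame.trans (by simp [hrs]) h'))
        obtain ⟨s, hs⟩ : ∃ s, M - j = s + 1 := ⟨M - j - 1, by omega⟩
        have hs' : M - (j + 1) = s := by omega
        rw [hs] at hP₂ hP₂'
        simp only [wp_seq, wp_put, wp_fput, WExp.val_sub, WExp.val_get, NVar.val_word, g1, g2, hM,
          hj₂, hs, val_mazE, FExp.val_sub, RVar.val_num, FExp.val_get, Mem.setW_real, g5,
          Mem.setW_same, Function.update_self, ← ha]
        refine ⟨by omega, ?_⟩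
        set t₂ := m₂.real .tmp with ht₂
        -- The centers are updated in place. The entry `s + 1`, at which all others are recentered,
        -- is never overwritten, since the loop stops just before it.
        refine wp_for [.e] [.tmp] (s + 1) (fun k m' =>
          (∀ e < k, m'.real .tmp e = maz a (t₂ e - t₂ (s + 1))) ∧
          (∀ e, k ≤ e → m'.real .tmp e = t₂ e)) hZB (by simp) (by omega) ?_
          (fun j m' v h => by simpa using h) (by simp [← ht₂]) ?_ ?_
        · intro m' h
          simp [h.nat .h (by simp)]
        · rintro k hk m₃ hf₃ ⟨hP₃, hP₃'⟩ hk₃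
          have hh : m₃.nat .h 0 = s + 1 := by rw [hf₃.nat .h (by simp)]; simp
          have ha₃ : m₃.real .a 0 = a := by rw [hf₃.real .a (by simp)]; simp [g5, ha]
          refine ⟨by simp, by simpa using hk₃, ?_, ?_⟩
          · intro e he
            by_cases h : e = k
            · subst h
              simp [hk₃, val_mazE, ha₃, hh, hP₃' e le_rfl, hP₃' (s + 1) hk.le]
            · simp [hk₃, h, hP₃ e (by omega)]
          · intro e he
            have : e ≠ k := by omega
            simp [hk₃, this, hP₃' e (by omega)]
        · rintro m₃ hf₃ ⟨hP₃, hP₃'⟩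
          have hz₃ : m₃.real .z 0 = maz a (m₂.real .z 0 - t₂ (s + 1)) := by
            rw [hf₃.real .z (by simp)]; simp
          refine ⟨?_, ?_, ?_, ?_⟩
          · refine Frame.trans (m' := (m₂.setW .h 0 (s + 1)).setF .z 0
              (maz a (m₂.real .z 0 - t₂ (s + 1)))) (by simp) (hf₃.mono (by simp) (by simp))
          · rw [hf₃.nat .l (by simp)]; simpa using hj₂
          · rw [← hP₂, hs', hz₃]
            simp only [push]
            exact push_congr _ _ (fun e _ he => hP₃ e (by omega)) _
          · rw [← hP₂', hs', hP₃ 0 (by omega)]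
            simp only [push]
            exact push_congr _ _ (fun e _ he => hP₃ e (by omega)) _
      · rintro m₂ hf₂ ⟨hP₂, hP₂'⟩
        have h' := hf₂.mono (ns' := ns) (rs' := rs) (by simp [hns]) (by simp [hrs])
        have hff₂ : Frame ns rs m₀ m₂ := (hf₁.mono (by simp [hns]) (by simp [hrs])).trans
          (Frame.trans (by simp [hrs]) h')
        obtain ⟨g1, g2, g3, g4, g5, g6, g7⟩ := key m₂ (hf₀.trans hff₂)
        have hi₂ : m₂.nat .i 0 = i := by rw [hf₂.nat .i (by simp)]; simpa using hi₁
        have hw₂ : m₂.real .w = m₀.real .w := by rw [hf₂.real .w (by simp)]; simpa using hw₁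
        simp only [Nat.sub_self, push] at hP₂ hP₂'
        refine ⟨by simpa [hrs] using hff₂, by simpa using hi₂, ?_⟩
        intro k hk
        by_cases h : k = i
        · subst h
          simp [hi₂, hP₂, hP₂', g7, image, hc, hzz, ha]
        · simp [hi₂, h, hw₂, hP₀ k (by omega)]

lemma parity_le_one (P : ℕ → Prop) (m : ℕ) : parity P m ≤ 1 := by
  induction m with
  | zero => simp [parity]
  | succ m ih => rw [parity]; split_ifs <;> omega

lemma wp_sketchP (hZB : Z < B) {t mm D T : ℕ} {W : ℕ → ℕ} {u : ℕ → ℝ} (ht : m.nat .t 0 = t)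
    (htZ : t ≤ Z) (hmm : m.nat .mm 0 = mm) (hmmZ : mm ≤ Z) (hD : m.nat .D 0 = D)
    (hT : m.nat .T 0 = T) (hWB : ∀ i < t * mm, W i < B) (hW : ∀ i < t * mm, m.nat .W i = W i)
    (hD0 : 0 < D) (hu : ∀ i < D, m.real .w i = u i)
    (hQ : ∀ m', Frame [.b, .e, .par, .v, .bit] [] m m' →
      (∀ b < t, m'.nat .bit b = sketch W D T mm u b) → Q m') :
    wp Z B ω inp sketchP Q m := by
  set ns : List NVar := [.b, .e, .par, .v, .bit] with hns
  have key : ∀ m', Frame ns [] m m' → m'.nat .t = m.nat .t ∧ m'.nat .mm = m.nat .mm ∧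
      m'.nat .D = m.nat .D ∧ m'.nat .T = m.nat .T ∧ m'.nat .W = m.nat .W ∧
      m'.real .w = m.real .w := fun m' h =>
    ⟨h.nat _ (by simp [hns]), h.nat _ (by simp [hns]), h.nat _ (by simp [hns]),
      h.nat _ (by simp [hns]), h.nat _ (by simp [hns]), h.real _ (by simp)⟩
  rw [sketchP]
  refine wp_for ns [] t (fun j m' => ∀ b < j, m'.nat .bit b = sketch W D T mm u b) hZB
    (by simp [hns]) htZ ?_ (fun j m' v h => by simpa using h) (by simp) ?_ hQ
  · intro m' h
    simp [(key m' h).1, ht]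
  · intro b hb m₀ hf₀ hP₀ hb₀
    obtain ⟨g1, g2, g3, g4, g5, g6⟩ := key m₀ hf₀
    simp only [wp_seq, wp_put, WExp.val_ofNat]
    refine ⟨by omega, ?_⟩
    set P : ℕ → Prop := fun e => Below D T u (W (b * mm + e)) with hP
    refine wp_for [.e, .par, .v] [] mm (fun j m' => m'.nat .par 0 = parity P j) hZB (by simp) hmmZ
      ?_ (fun j m' v h => by simpa using h) (by simp [parity]) ?_ ?_
    · intro m' h
      simp [h.nat .mm (by simp), g2, hmm]
    · intro e he m₁ hf₁ hP₁ he₁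
      have hf₁' := Frame.trans (m := m₀) (by simp) hf₁
      obtain ⟨h1, h2, h3, h4, h5, h6⟩ := key m₁ (hf₀.trans (hf₁'.mono (by simp [hns]) (by simp)))
      have hb₁ : m₁.nat .b 0 = b := by rw [hf₁'.nat .b (by simp), hb₀]
      have hidx : b * mm + e < t * mm := by nlinarith
      have hle := parity_le_one P e
      simp only [wp_seq, wp_put, WExp.val_get, WExp.val_add, WExp.val_mul, NVar.val_word, hb₁, h2,
        hmm, he₁, h5, hW _ hidx, hWB _ hidx, true_and, wp_ite, wp_skip, Test.val_ltF, FExp.val_get,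
        Mem.setW_real, h6, WExp.val_mod, WExp.val_div, Mem.setW_same, Function.update_self,
        FExp.val_sub, FExp.val_div, FExp.val_add, FExp.val_mul, val_lit, FExp.val_cast, ne_eq,
        reduceCtorEq, not_false_eq_true, Mem.setW_ne, h3, h4, hD, hT, hu _ (Nat.mod_lt _ hD0),
        WExp.val_sub, WExp.val_ofNat, hP₁]
      have hPe : P e ↔ u (W (b * mm + e) % D) <
          (((4 : ℕ) : ℝ) * ((W (b * mm + e) / D : ℕ) : ℝ) + (2 : ℕ)) / T - (2 : ℕ) := by
        simp [hP, Below]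
      constructor
      · intro h
        refine ⟨by omega, ?_⟩
        simp [parity, hPe.2 h]
      · intro h
        simp [parity, show ¬ P e from fun h' => h (hPe.1 h')]
    · intro m₁ hf₁ hP₁
      have hf₁' := Frame.trans (m := m₀) (by simp) hf₁
      have hb₁ : m₁.nat .b 0 = b := by rw [hf₁'.nat .b (by simp), hb₀]
      have hbit : m₁.nat .bit = m₀.nat .bit := hf₁'.nat .bit (by simp)
      have hle := parity_le_one P mm
      simp only [wp_setW, NVar.val_word, hb₁, hP₁]
      refine ⟨by omega, by simpa [hns] using hf₁'.mono (by simp) (by simp),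
        by simpa using hb₁, ?_⟩
      intro b' hb'
      by_cases h : b' = b
      · subst h; simp [sketch, hP]
      · simp [h, hbit, hP₀ b' (by omega)]

end Rules

/-! ### Specifications of copying, inner products and the drawing of random words. -/

section Copy
variable {Z B : ℕ} {ω : ℕ → Bool} {inp : ℕ → ℝ} {m : Mem} {Q : Mem → Prop}

lemma wp_copyRowP (hZB : Z < B) {row src : WExp} (r s d D : ℕ)
    (hr : ∀ m', Frame [.i] [.X] m m' → row.val m' = r)
    (hs : ∀ m', Frame [.i] [.X] m m' → src.val m' = s)
    (hd : m.nat .d 0 = d) (hD : m.nat .D 0 = D) (hDZ : D ≤ Z)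
    (hQ : ∀ m', Frame [.i] [.X] m m' →
      (∀ i < D, m'.real .X (r * D + i) = if i < d then inp (s + i) else 0) →
      (∀ r' i, r' ≠ r → i < D → m'.real .X (r' * D + i) = m.real .X (r' * D + i)) → Q m') :
    wp Z B ω inp (copyRowP row src) Q m := by
  rw [copyRowP]
  refine wp_for [.i] [.X] D (fun j m' =>
    (∀ i < j, m'.real .X (r * D + i) = if i < d then inp (s + i) else 0) ∧
    (∀ r' i, r' ≠ r → i < D → m'.real .X (r' * D + i) = m.real .X (r' * D + i))) hZB (by simp) hDZ
    ?_ (fun j m' v h => by simpa using h) (by simp) ?_ (fun m' h h' => hQ m' h h'.1 h'.2)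
  · intro m' h
    simp [h.nat .D (by simp), hD]
  · rintro j hj m' hf ⟨h1, h2⟩ hj'
    have key : ∀ z, (z = if j < d then inp (s + j) else 0) →
        Frame [.i] [.X] m' (m'.setF .X (r * D + j) z) ∧ (m'.setF .X (r * D + j) z).nat .i 0 = j ∧
        (∀ i < j + 1, (m'.setF .X (r * D + j) z).real .X (r * D + i) =
          if i < d then inp (s + i) else 0) ∧
        (∀ r' i, r' ≠ r → i < D →
          (m'.setF .X (r * D + j) z).real .X (r' * D + i) = m.real .X (r' * D + i)) := by
      intro z hz
      refine ⟨by simp, by simpa using hj', ?_, ?_⟩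
      · intro i hi
        by_cases h : i = j
        · subst h; simp [hz]
        · have : r * D + i ≠ r * D + j := by omega
          rw [Mem.setF_same, Function.update_of_ne this, h1 i (by omega)]
      · intro r' i hr' hi
        have : r' * D + i ≠ r * D + j := by
          intro h
          apply hr'
          have e1 := congrArg (· / D) h
          simpa [Nat.div_eq_of_lt, hi, hj, Nat.mul_comm _ D,
            Nat.mul_add_div (show 0 < D by omega)] using e1
        rw [Mem.setF_same, Function.update_of_ne this, h2 r' i hr' hi]
    have hr' := hr m' hf
    have hs' := hs m' hf
    have hd' : m'.nat .d 0 = d := by rw [hf.nat .d (by simp), hd]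
    have hD' : m'.nat .D 0 = D := by rw [hf.nat .D (by simp), hD]
    simp only [wp_ite, wp_setF, Test.val_ltW, NVar.val_word, WExp.val_add, WExp.val_mul, hr', hs',
      hd', hD', hj', FExp.val_input, val_lit]
    exact ⟨fun h => key _ (by simp [h]), fun h => key _ (by simp [h])⟩

lemma dot_succ (G : ℕ → ℕ) (X : ℕ → ℝ) (D x i : ℕ) :
    ∑ j ∈ Finset.range (i + 1), (G j : ℝ) * X (x * D + j) =
      ∑ j ∈ Finset.range i, (G j : ℝ) * X (x * D + j) + G i * X (x * D + i) :=
  Finset.sum_range_succ _ _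

lemma wp_dotP (hZB : Z < B) {row : WExp} (r D : ℕ)
    (hr : ∀ m', Frame [.i] [.sum] m m' → row.val m' = r)
    (hD : m.nat .D 0 = D) (hDZ : D ≤ Z)
    (hQ : ∀ m', Frame [.i] [.sum] m m' →
      m'.real .sum 0 = dot (m.nat .G) (m.real .X) D r → Q m') :
    wp Z B ω inp (dotP row) Q m := by
  have fr : ∀ m' z, Frame [.i] [.sum] (m.setF .sum 0 z) m' →
    Frame [.i] [.sum] m m' := fun m' z h => Frame.trans (by simp) h
  simp only [dotP, wp_seq, wp_fput]
  refine wp_for [.i] [.sum] D (fun j m' => m'.real .sum 0 =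
    ∑ i ∈ Finset.range j, (m.nat .G i : ℝ) * m.real .X (r * D + i)) hZB (by simp) hDZ
    ?_ (fun j m' v h => by simpa using h) (by simp) ?_ (fun m' h h' => hQ m' (fr _ _ h) h')
  · intro m' h
    simp [h.nat .D (by simp), hD]
  · intro j hj m' hf h1 hj'
    have hr' := hr m' (fr _ _ hf)
    have hD' : m'.nat .D 0 = D := by rw [hf.nat .D (by simp)]; simpa using hD
    have hG : m'.nat .G = m.nat .G := by rw [hf.nat .G (by simp)]; simp
    have hX : m'.real .X = m.real .X := by rw [hf.real .X (by simp)]; simp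
    simp [hr', hD', hG, hX, hj', h1, dot_succ]

lemma coinWord_lt (o S : ℕ) : coinWord ω o S < 2 ^ S := by
  induction S with
  | zero => simp [coinWord]
  | succ S ih =>
    have : (ω (o + S)).toNat ≤ 1 := Bool.toNat_le _
    rw [coinWord, pow_succ]
    omega

lemma wp_drawP (hZB : Z < B) {arr : NVar} {count : WExp} (c S : ℕ)
    (hS : m.nat .S 0 = S) (hSZ : S ≤ Z) (hSB : 2 ^ S ≤ B) (hcZ : c ≤ Z)
    (ha : arr ∉ [NVar.x, .v, .b, .par, .S])
    (hc : ∀ m' : Mem, (∀ τ, τ ∉ [NVar.x, .v, .b, .par, arr] → m'.nat τ = m.nat τ) → count.val m' = c)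
    (hQ : ∀ m' : Mem, (∀ τ, τ ∉ [NVar.x, .v, .b, .par, arr] → m'.nat τ = m.nat τ) →
      m'.real = m.real → m'.coins = m.coins + c * S →
      (∀ x < c, m'.nat arr x = coinWord ω (m.coins + x * S) S) → Q m') :
    wp Z B ω inp (drawP arr count) Q m := by
  simp only [List.mem_cons, List.not_mem_nil, or_false, not_or] at ha
  obtain ⟨a1, a2, a3, a4, a5⟩ := ha
  rw [drawP]
  -- `Frame` requires an unchanged number of coins, so here the invariant itself lists the arrays
  -- that keep their contents.
  refine wp_for' c (fun j m' => (∀ τ, τ ∉ [NVar.x, .v, .b, .par, arr] → m'.nat τ = m.nat τ) ∧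
    m'.real = m.real ∧ m'.coins = m.coins + j * S ∧
    ∀ x < j, m'.nat arr x = coinWord ω (m.coins + x * S) S) hZB hcZ
    (fun j m' h => hc m' h.1) ?_ (by simp) ?_ (fun m' h => hQ m' h.1 h.2.1 h.2.2.1 h.2.2.2)
  · rintro j m' v ⟨h1, h2, h3, h4⟩
    refine ⟨?_, h2, h3, by simpa [a1] using h4⟩
    intro τ hτ
    have : τ ≠ .x := by rintro rfl; simp at hτ
    rw [Mem.setW_ne _ _ _ this, h1 τ hτ]
  · rintro j hj m₀ ⟨h1, h2, h3, h4⟩ hj₀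
    simp only [wp_seq, wp_put, WExp.val_ofNat]
    refine ⟨by omega, ?_⟩
    refine wp_for' S (fun k m' => (∀ τ, τ ∉ [NVar.v, .b, .par] → m'.nat τ = m₀.nat τ) ∧
      m'.real = m.real ∧ m'.coins = m₀.coins + k ∧ m'.nat .v 0 = coinWord ω m₀.coins k) hZB hSZ
      ?_ ?_ ⟨?_, h2, by simp, by simp [coinWord]⟩ ?_ ?_
    · rintro k m' ⟨g1, -⟩
      simp [g1 .S (by simp), h1 .S (by simp [Ne.symm a5]), hS]
    · rintro k m' v ⟨g1, g2, g3, g4⟩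
      refine ⟨?_, g2, g3, by simpa using g4⟩
      intro τ hτ
      have : τ ≠ .b := by rintro rfl; simp at hτ
      rw [Mem.setW_ne _ _ _ this, g1 τ hτ]
    · intro τ hτ
      have : τ ≠ .v := by rintro rfl; simp at hτ
      rw [Mem.setW_ne _ _ _ this]
    · rintro k hk m₁ ⟨g1, g2, g3, g4⟩ hk₁
      have hlt := coinWord_lt (ω := ω) m₀.coins (k + 1)
      have hpow : 2 ^ (k + 1) ≤ 2 ^ S := Nat.pow_le_pow_right (by omega) hk
      simp only [wp_seq, wp_flip, wp_put, WExp.val_add, WExp.val_mul, WExp.val_ofNat,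
        NVar.val_word, Mem.toss_same, Function.update_self, g3, ne_eq, reduceCtorEq,
        not_false_eq_true, Mem.toss_ne, g4]
      change coinWord ω m₀.coins (k + 1) < B ∧ _
      refine ⟨by omega, by simpa using hk₁, ?_, g2, by simp [g3]; ring, by simp [coinWord]⟩
      intro τ hτ
      have e1 : τ ≠ .v := by rintro rfl; simp at hτ
      have e2 : τ ≠ .par := by rintro rfl; simp at hτ
      rw [Mem.setW_ne _ _ _ e1, Mem.toss_ne _ _ _ e2, g1 τ hτ]
    · rintro m₁ ⟨g1, g2, g3, g4⟩
      have hx : m₁.nat .x 0 = j := by rw [g1 .x (by simp), hj₀]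
      have hlt := coinWord_lt (ω := ω) m₀.coins S
      simp only [wp_setW, NVar.val_word, g4, hx]
      refine ⟨by omega, by simpa [Ne.symm a1] using hx, ?_, g2, by simp [g3, h3]; ring, ?_⟩
      · intro τ hτ
        have e1 : τ ≠ arr := by rintro rfl; simp at hτ
        rw [Mem.setW_ne _ _ _ e1, g1 τ (by simp at hτ ⊢; tauto), h1 τ hτ]
      · intro x hx
        by_cases h : x = j
        · subst h; simp [h3]
        · have e1 : m₁.nat arr = m₀.nat arr := g1 arr (by simp [a2, a3, a4])
          simp [h, e1, h4 x (by omega)]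

end Copy

/-! ### Sorting -/

/-- The order of the points by value, with ties broken by index. -/
def Precedes (f : ℕ → ℝ) (x y : ℕ) : Prop := f x < f y ∨ (f x = f y ∧ x < y)

open Classical in
/-- The number of `x < k` that precede `y`. -/
def rankBelow (f : ℕ → ℝ) (k y : ℕ) : ℕ := ((Finset.range k).filter fun x => Precedes f x y).card

lemma Precedes.trans {f : ℕ → ℝ} {x y z : ℕ} (h : Precedes f x y) (h' : Precedes f y z) :
    Precedes f x z := by
  rcases h with h | h <;> rcases h' with h' | h'
  · exact .inl (h.trans h')
  · exact .inl (h'.1 ▸ h)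
  · exact .inl (h.1 ▸ h')
  · exact .inr ⟨h.1.trans h'.1, h.2.trans h'.2⟩

lemma Precedes.irrefl (f : ℕ → ℝ) (x : ℕ) : ¬ Precedes f x x := by
  rintro (h | h)
  · exact lt_irrefl _ h
  · exact lt_irrefl _ h.2

lemma precedes_total (f : ℕ → ℝ) {x y : ℕ} (h : x ≠ y) : Precedes f x y ∨ Precedes f y x := by
  rcases lt_trichotomy (f x) (f y) with h1 | h1 | h1
  · exact .inl (.inl h1)
  · rcases lt_or_gt_of_ne h with h2 | h2
    · exact .inl (.inr ⟨h1, h2⟩)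
    · exact .inr (.inr ⟨h1.symm, h2⟩)
  · exact .inr (.inl h1)

/-- By transitivity whatever precedes `x` precedes `y`, and `x` itself is counted for `y` but not
for `x`. -/
lemma rankBelow_lt_of_precedes {f : ℕ → ℝ} {n x y : ℕ} (hx : x < n) (h : Precedes f x y) :
    rankBelow f n x < rankBelow f n y := by
  classical
  refine Finset.card_lt_card ⟨?_, ?_⟩
  · intro z hz
    simp only [Finset.mem_filter] at hz ⊢
    exact ⟨hz.1, hz.2.trans h⟩
  · intro hsub
    have := hsub (Finset.mem_filter.2 ⟨Finset.mem_range.2 hx, h⟩)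
    exact Precedes.irrefl f x (Finset.mem_filter.1 this).2

lemma rankBelow_lt {f : ℕ → ℝ} {n x : ℕ} (hx : x < n) : rankBelow f n x < n := by
  classical
  have : rankBelow f n x < (Finset.range n).card := by
    refine Finset.card_lt_card ⟨Finset.filter_subset _ _, ?_⟩
    intro hsub
    have := hsub (Finset.mem_range.2 hx)
    exact Precedes.irrefl f x (Finset.mem_filter.1 this).2
  simpa using this

/-- `o` lists the points `0, …, n - 1` in the order of their values. -/
structure IsSorting (f : ℕ → ℝ) (n : ℕ) (o : ℕ → ℕ) : Prop where
  lt : ∀ i < n, o i < n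
  surj : ∀ x < n, ∃ i < n, o i = x
  mono : ∀ i j, i ≤ j → j < n → f (o i) ≤ f (o j)

/-- An array that inverts the rank makes the rank injective on the n points, hence a bijection onto
the n positions. An inversion of values would contradict the strict monotonicity of the rank. -/
lemma isSorting_of_rank {f : ℕ → ℝ} {n : ℕ} {o : ℕ → ℕ}
    (h : ∀ x < n, o (rankBelow f n x) = x) : IsSorting f n o := by
  have inj : ∀ x < n, ∀ y < n, rankBelow f n x = rankBelow f n y → x = y := by
    intro x hx y hy hxy
    rw [← h x hx, hxy, h y hy]
  have surj : ∀ i < n, ∃ x < n, rankBelow f n x = i := by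
    intro i hi
    have := Finset.surj_on_of_inj_on_of_card_le (s := Finset.range n) (t := Finset.range n)
      (fun x _ => rankBelow f n x) (fun x hx => Finset.mem_range.2 (rankBelow_lt
        (Finset.mem_range.1 hx))) (fun x y hx hy hxy => inj x (Finset.mem_range.1 hx) y
        (Finset.mem_range.1 hy) hxy) le_rfl i (Finset.mem_range.2 hi)
    obtain ⟨x, hx, hxi⟩ := this
    exact ⟨x, Finset.mem_range.1 hx, hxi.symm⟩
  refine ⟨?_, fun x hx => ⟨_, rankBelow_lt hx, h x hx⟩, ?_⟩
  · intro i hi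
    obtain ⟨x, hx, rfl⟩ := surj i hi
    rwa [h x hx]
  · intro i j hij hj
    obtain ⟨x, hx, rfl⟩ := surj i (by omega)
    obtain ⟨y, hy, rfl⟩ := surj j hj
    rw [h x hx, h y hy]
    by_contra hlt
    push Not at hlt
    have := rankBelow_lt_of_precedes hy (.inl hlt : Precedes f y x)
    omega

section Order
variable {Z B : ℕ} {ω : ℕ → Bool} {inp : ℕ → ℝ} {m : Mem} {Q : Mem → Prop}

open Classical in
lemma rankBelow_succ (f : ℕ → ℝ) (k y : ℕ) :
    rankBelow f (k + 1) y = rankBelow f k y + if Precedes f k y then 1 else 0 := by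
  rw [rankBelow, Finset.range_add_one, Finset.filter_insert]
  split_ifs with h
  · rw [Finset.card_insert_of_notMem (by simp)]; rfl
  · rfl

/-- Each point is put at the position given by its rank, found by comparison with all points.
Different points have different ranks because ties are broken by index, so no entry is overwritten.
Quadratic time is harmless in the preprocessing. -/
lemma wp_orderP (hZB : Z < B) (n D : ℕ) (hn : m.nat .n 0 = n) (hnZ : n ≤ Z)
    (hD : m.nat .D 0 = D) (hDZ : D ≤ Z)
    (hQ : ∀ m', Frame [.x, .i, .cnt, .x', .ord] [.sum, .fv] m m' →
      (∀ x < n, m'.real .fv x = dot (m.nat .G) (m.real .X) D x) →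
      IsSorting (m'.real .fv) n (m'.nat .ord) → Q m') :
    wp Z B ω inp orderP Q m := by
  rw [orderP, wp_seq]
  refine wp_for [.x, .i] [.sum, .fv] n (fun j m' => ∀ x < j, m'.real .fv x =
    dot (m.nat .G) (m.real .X) D x) hZB (by simp) hnZ
    (fun m' h => by simp [h.nat .n (by simp), hn]) (fun j m' v h => by simpa using h) (by simp) ?_ ?_
  · intro j hj m₀ hf₀ h₀ hj₀
    rw [wp_seq]
    refine wp_dotP hZB j D (fun m' h => by simp [h.nat .x (by simp), hj₀])
      (by rw [hf₀.nat .D (by simp), hD]) hDZ ?_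
    intro m₁ hf₁ h₁
    have hx : m₁.nat .x 0 = j := by rw [hf₁.nat .x (by simp), hj₀]
    rw [hf₀.nat .G (by simp), hf₀.real .X (by simp)] at h₁
    simp only [wp_setF, NVar.val_word, RVar.val_num, hx, h₁]
    refine ⟨by simpa using hf₁.mono (by simp) (by simp), by simpa using hx, ?_⟩
    intro x hx
    by_cases h : x = j
    · subst h; simp
    · simp [h, hf₁.real .fv (by simp), h₀ x (by omega)]
  · intro m₁ hf₁ h₁
    refine wp_for [.x, .cnt, .x', .ord] [] n (fun j m' => ∀ x < j,
      m'.nat .ord (rankBelow (m₁.real .fv) n x) = x) hZB (by simp) hnZ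
      (fun m' h => by simp [h.nat .n (by simp), hf₁.nat .n (by simp), hn])
      (fun j m' v h => by simpa using h) (by simp) ?_ ?_
    · intro j hj m₂ hf₂ h₂ hj₂
      simp only [wp_seq, wp_put, WExp.val_ofNat]
      refine ⟨by omega, ?_⟩
      have hle : ∀ k ≤ n, rankBelow (m₁.real .fv) k j ≤ n := fun k hk => by
        classical
        calc rankBelow (m₁.real .fv) k j ≤ (Finset.range k).card := Finset.card_filter_le _ _
          _ ≤ n := by simpa using hk
      refine wp_for [.cnt, .x'] [] n (fun k m' => m'.nat .cnt 0 = rankBelow (m₁.real .fv) k j)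
        hZB (by simp) hnZ (fun m' h => by
          simp [h.nat .n (by simp), hf₂.nat .n (by simp), hf₁.nat .n (by simp), hn])
        (fun j m' v h => by simpa using h) (by simp [rankBelow]) ?_ ?_
      · intro k hk m₃ hf₃ h₃ hk₃
        have hx : m₃.nat .x 0 = j := by rw [hf₃.nat .x (by simp)]; simpa using hj₂
        have hfv : m₃.real .fv = m₁.real .fv := by
          rw [hf₃.real .fv (by simp), Mem.setW_real, hf₂.real .fv (by simp)]
        have hle' := hle (k + 1) hk
        rw [rankBelow_succ] at hle'
        simp only [wp_ite, Test.val_ltF, FExp.val_get, NVar.val_word, hfv, hx, hk₃, wp_put,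
          WExp.val_add, h₃, WExp.val_ofNat, wp_skip, Test.val_ltW, rankBelow_succ]
        refine ⟨fun h => ?_, fun h => ⟨fun h' => ?_, fun h' => ⟨fun h'' => ?_, fun h'' => ?_⟩⟩⟩
        · have hp : Precedes (m₁.real .fv) k j := .inl h
          simp only [hp, if_true] at hle' ⊢
          exact ⟨by omega, by simp, by simpa using hk₃, by simp⟩
        · have hp : ¬ Precedes (m₁.real .fv) k j := by
            rintro (h1 | h1)
            · exact h h1
            · exact h'.ne h1.1.symm
          simp [hp]
        · have hp : Precedes (m₁.real .fv) k j := .inr ⟨le_antisymm (not_lt.1 h') (not_lt.1 h), h''⟩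
          simp only [hp, if_true] at hle' ⊢
          exact ⟨by omega, by simp, by simpa using hk₃, by simp⟩
        · have hp : ¬ Precedes (m₁.real .fv) k j := by
            rintro (h1 | h1)
            · exact h h1
            · exact h'' h1.2
          simp [hp]
      · intro m₃ hf₃ h₃
        have hf₃' := Frame.trans (m := m₂) (by simp) hf₃
        have hx : m₃.nat .x 0 = j := by rw [hf₃'.nat .x (by simp)]; simpa using hj₂
        simp only [wp_setW, NVar.val_word, hx, h₃]
        refine ⟨by omega, by simpa using hf₃'.mono (by simp) (by simp), by simpa using hx, ?_⟩
        intro x hx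
        by_cases h : x = j
        · subst h; simp
        · have hne : rankBelow (m₁.real .fv) n x ≠ rankBelow (m₁.real .fv) n j := by
            rcases precedes_total (m₁.real .fv) h with h' | h'
            · exact (rankBelow_lt_of_precedes (by omega) h').ne
            · exact (rankBelow_lt_of_precedes (by omega) h').ne'
          simp [hne, hf₃'.nat .ord (by simp), h₂ x (by omega)]
    · intro m₂ hf₂ h₂
      have hfv : m₂.real .fv = m₁.real .fv := hf₂.real .fv (by simp)
      refine hQ m₂ ((hf₁.mono (by simp) (by simp)).trans (hf₂.mono (by simp) (by simp))) ?_ ?_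
      · intro x hx; rw [hfv, h₁ x hx]
      · rw [hfv]; exact isSorting_of_rank h₂

end Order

/-! ### Parameters -/

/-- The numbers on which the parameters of the algorithm depend. -/
structure Param where
  p : ℝ
  r : ℝ
  d : ℕ
  n : ℕ
  lam : ℕ
  nu : ℕ
  L : ℕ

namespace Param
variable (P : Param)
/-- The padded dimension. -/
def D : ℕ := 2 ^ P.lam
/-- The number of coins per word. -/
def S : ℕ := 2 * P.lam + P.nu + 40
/-- The number of admissible mismatches. -/
def tp : ℕ := P.nu * (P.L + 3) + 100 * P.lam + 100
/-- The length of a sketch. -/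
def t : ℕ := 16 * P.tp
/-- The number of thresholds per bit of a sketch. -/
def mm : ℕ := 4 * P.D
/-- The number of thresholds per coordinate. -/
def T : ℕ := 2 ^ P.S / P.D
/-- The truncated exponent. -/
def pc : ℝ := if (P.lam : ℝ) < P.p then P.lam else P.p
/-- The exponent of the Mazur maps. -/
def a : ℝ := |P.pc| ^ (1 / (P.L : ℝ))
/-- The number of Mazur maps in a phase. -/
def lev (ph : ℕ) : ℕ := if ph = 0 then 0 else P.L
/-- The number of rounds per level in a phase. -/
def kk (ph : ℕ) : ℕ := if ph = 0 then 7 * (P.S + P.lam + 1) else 7 * (33 + 4 * P.lam)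
/-- The number of steps of a phase. -/
def JJ (ph : ℕ) : ℕ := P.kk ph ^ (P.lev ph + 1)
/-- The number of tuples of centers. -/
def nC (ph : ℕ) : ℕ := P.n ^ (P.lev ph + 1)
/-- The near radius of a phase. -/
def rr (ph : ℕ) : ℝ := if ph = 0 then P.D * P.r else 2 * P.r
/-- The initial ratio of a phase. -/
def cz (ph : ℕ) : ℝ := if ph = 0 then 2 * 2 ^ P.S * P.D else 8589934592 * (P.D * P.D * P.D * P.D)

/-- The image of a row in the step `j` of the phase `ph`, for given centers. -/
def vec (X : ℕ → ℝ) (ph j : ℕ) (cen : ℕ → ℕ) (x i : ℕ) : ℝ :=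
  image P.a X P.D (P.lev ph) cen
    (searchRad P.a (P.cz ph) (digit (P.kk ph) j) (P.lev ph) (P.rr ph)) x i

/-- The sketch of a row. -/
def bits (W : ℕ → ℕ) (X : ℕ → ℝ) (ph j : ℕ) (cen : ℕ → ℕ) (x b : ℕ) : ℕ :=
  sketch W P.D P.T P.mm (P.vec X ph j cen x) b

/-- A correct entry of the table. -/
def IsEntry (W : ℕ → ℕ) (X : ℕ → ℝ) (ph j cc bb y : ℕ) : Prop :=
  y < P.n ∧ ∀ x < P.n,
    mismatch (P.bits W X ph j (digit P.n cc) x) (digit 2 bb) P.t ≤ P.tp →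
    mismatch (P.bits W X ph j (digit P.n cc) y) (digit 2 bb) P.t ≤ P.tp

/-- A correct entry of the table, indexed linearly. -/
def IsEntryAt (W : ℕ → ℕ) (X : ℕ → ℝ) (ph s y : ℕ) : Prop :=
  P.IsEntry W X ph (s / 2 ^ P.t / P.nC ph) (s / 2 ^ P.t % P.nC ph) (s % 2 ^ P.t) y

/-- The table is filled up to the entry `s` of the phase `ph`. -/
def Filled (W : ℕ → ℕ) (X : ℕ → ℝ) (tab : ℕ → ℕ) (ph s : ℕ) : Prop :=
  (∀ ph' < ph, ∀ s < P.JJ ph' * P.nC ph' * 2 ^ P.t, P.IsEntryAt W X ph' s (tab (2 * s + ph'))) ∧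
  ∀ s' < s, P.IsEntryAt W X ph s' (tab (2 * s' + ph))

/-- The parameters satisfy the inequalities on which the analysis is based. -/
structure Ok : Prop where
  two_lt_p : 2 < P.p
  r_pos : 0 < P.r
  one_le_d : 1 ≤ P.d
  one_le_n : 1 ≤ P.n
  two_le_lam : 2 ≤ P.lam
  d_le : P.d ≤ 2 ^ P.lam
  lam_min : 2 < P.lam → 2 ^ (P.lam - 1) < P.d
  n_le : P.n ≤ 2 ^ P.nu
  nu_min : 0 < P.nu → 2 ^ (P.nu - 1) < P.n
  one_le_L : 1 ≤ P.L
  L_le : P.L ≤ P.lam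
  pc_le : P.pc ≤ 2 ^ P.L
  lt_pc : (2 : ℝ) ^ (P.L - 1) < P.pc

/-- The bounds `Z` on the number of rounds and `B` on words are large enough for the query. -/
structure Fits (Z B : ℕ) : Prop where
  lt : Z < B
  sketch_lt : 2 ^ P.t < B
  S_le : 2 ^ P.S ≤ 2 ^ P.t
  D_le : P.D ≤ Z
  t_le : P.t ≤ Z
  mm_le : P.mm ≤ Z
  lev_le : ∀ ph < 2, P.lev ph + 1 ≤ Z
  JJ_le : ∀ ph < 2, P.JJ ph ≤ Z
  nu_le : P.nu + 1 ≤ Z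
  two_le : 2 ≤ Z
  nC_lt : ∀ ph < 2, P.nC ph < B
  n_lt : P.n < B

/-- As `Fits`, for the preprocessing. -/
structure FitsPre (Z B : ℕ) : Prop extends P.Fits Z B where
  n_le : P.n ≤ Z
  d_le : P.d ≤ Z
  lam_le : P.lam ≤ Z
  nC_le : ∀ ph < 2, P.nC ph ≤ Z
  sketch_le : 2 ^ P.t ≤ Z
  draw_le : P.t * P.mm ≤ Z
  S_le_Z : P.S ≤ Z
  kk_le : ∀ ph < 2, P.kk ph ≤ Z
  tp_le : P.tp ≤ Z

/-- The word arrays that hold the parameters. -/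
def staticN : List NVar := [.n, .d, .lam, .D, .nu, .L, .S, .PS, .T, .tp, .t, .TT, .mm, .lev, .kk,
  .JJ, .nC]
/-- The real arrays that hold the parameters. -/
def staticR : List RVar := [.p, .r, .pc, .a, .rr, .cz]

/-- The scalar parameters are stored in the memory. -/
structure Base (m : Mem) : Prop where
  n : m.nat .n 0 = P.n
  d : m.nat .d 0 = P.d
  lam : m.nat .lam 0 = P.lam
  D : m.nat .D 0 = P.D
  nu : m.nat .nu 0 = P.nu
  L : m.nat .L 0 = P.L
  S : m.nat .S 0 = P.S
  PS : m.nat .PS 0 = 2 ^ P.S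
  T : m.nat .T 0 = P.T
  tp : m.nat .tp 0 = P.tp
  t : m.nat .t 0 = P.t
  TT : m.nat .TT 0 = 2 ^ P.t
  mm : m.nat .mm 0 = P.mm
  r : m.real .r 0 = P.r
  a : m.real .a 0 = P.a

/-- The parameters are stored in the memory. -/
structure Loaded (m : Mem) : Prop extends P.Base m where
  lev : ∀ ph < 2, m.nat .lev ph = P.lev ph
  kk : ∀ ph < 2, m.nat .kk ph = P.kk ph
  JJ : ∀ ph < 2, m.nat .JJ ph = P.JJ ph
  nC : ∀ ph < 2, m.nat .nC ph = P.nC ph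
  rr : ∀ ph < 2, m.real .rr ph = P.rr ph
  cz : ∀ ph < 2, m.real .cz ph = P.cz ph

variable {P}

lemma Base.congr {m m' : Mem} (h : P.Base m) (hn : ∀ τ ∈ staticN, τ ∉ [NVar.lev, .kk, .JJ, .nC] →
    m'.nat τ = m.nat τ) (hr : ∀ τ ∈ staticR, τ ∉ [RVar.rr, .cz] → m'.real τ = m.real τ) :
    P.Base m' := by
  constructor
  case r => rw [hr _ (by simp [staticR]) (by simp)]; exact h.r
  case a => rw [hr _ (by simp [staticR]) (by simp)]; exact h.a
  all_goals rw [hn _ (by simp [staticN]) (by simp)]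
  exacts [h.n, h.d, h.lam, h.D, h.nu, h.L, h.S, h.PS, h.T, h.tp, h.t, h.TT, h.mm]

lemma Loaded.congr {m m' : Mem} (h : P.Loaded m) (hn : ∀ τ ∈ staticN, m'.nat τ = m.nat τ)
    (hr : ∀ τ ∈ staticR, m'.real τ = m.real τ) : P.Loaded m' := by
  refine ⟨h.toBase.congr (fun τ hτ _ => hn τ hτ) (fun τ hτ _ => hr τ hτ), ?_, ?_, ?_, ?_, ?_, ?_⟩
  · rw [hn _ (by simp [staticN])]; exact h.lev
  · rw [hn _ (by simp [staticN])]; exact h.kk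
  · rw [hn _ (by simp [staticN])]; exact h.JJ
  · rw [hn _ (by simp [staticN])]; exact h.nC
  · rw [hr _ (by simp [staticR])]; exact h.rr
  · rw [hr _ (by simp [staticR])]; exact h.cz

lemma Loaded.frame {m m' : Mem} {ns : List NVar} {rs : List RVar} (h : P.Loaded m)
    (hf : Frame ns rs m m') (hn : ∀ τ ∈ staticN, τ ∉ ns) (hr : ∀ τ ∈ staticR, τ ∉ rs) :
    P.Loaded m' :=
  h.congr (fun τ hτ => hf.nat τ (hn τ hτ)) (fun τ hτ => hf.real τ (hr τ hτ))

end Param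

/-! ### The table -/

lemma mismatch_succ (f g : ℕ → ℕ) (t : ℕ) :
    mismatch f g (t + 1) = mismatch f g t + if f t ≠ g t then 1 else 0 := by
  rw [mismatch, Finset.range_add_one, Finset.filter_insert]
  split_ifs with h
  · rw [Finset.card_insert_of_notMem (by simp)]; rfl
  · rfl

lemma mismatch_le (f g : ℕ → ℕ) (t : ℕ) : mismatch f g t ≤ t := by
  calc mismatch f g t ≤ (Finset.range t).card := Finset.card_filter_le _ _
    _ = t := by simp

lemma mismatch_congr {f f' g g' : ℕ → ℕ} {t : ℕ} (h : ∀ b < t, f b = f' b)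
    (h' : ∀ b < t, g b = g' b) : mismatch f g t = mismatch f' g' t := by
  unfold mismatch
  congr 1
  refine Finset.filter_congr fun b hb => ?_
  rw [h b (Finset.mem_range.1 hb), h' b (Finset.mem_range.1 hb)]

lemma image_congr (a : ℝ) (X : ℕ → ℝ) (D M : ℕ) {cen cen' : ℕ → ℕ} (h : ∀ e ≤ M, cen e = cen' e)
    (scale : ℝ) (x i : ℕ) : image a X D M cen scale x i = image a X D M cen' scale x i := by
  unfold image
  have key : ∀ z, push a M (fun e => X (cen e * D + i)) z = push a M (fun e => X (cen' e * D + i)) z :=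
    fun z => push_congr a M (fun e _ he => by rw [h e he]) z
  rw [key, key, h 0 (Nat.zero_le _)]

section Table
variable {Z B : ℕ} {ω : ℕ → Bool} {inp : ℕ → ℝ} {m : Mem} {Q : Mem → Prop} {P : Param}

/-- The word arrays that `entryP` may change. -/
def entryN : List NVar := [.q, .e, .tgt, .ans, .x, .i, .l, .h, .b, .par, .v, .bit, .mis, .tab]

/-- The real arrays that `entryP` may change. -/
def entryR : List RVar := [.tmp, .z, .w]

/-- Used both for the table and for the query: for equal words, steps and centers both compute the
same function `Param.bits` of a row, which is what gives a look-up its meaning. -/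
lemma wp_sketch_row (hF : P.Fits Z B) (hL : P.Loaded m) {W : ℕ → ℕ} {ph j : ℕ} {cen : ℕ → ℕ}
    {row : WExp} (x : ℕ) (hph : m.nat .ph 0 = ph) (hph2 : ph < 2)
    (hcen : ∀ e ≤ P.lev ph, m.nat .cen e = cen e)
    (hsc : m.real .scale 0 =
      searchRad P.a (P.cz ph) (digit (P.kk ph) j) (P.lev ph) (P.rr ph))
    (hW : ∀ i < P.t * P.mm, m.nat .W i = W i) (hWB : ∀ i < P.t * P.mm, W i < B)
    (hr : ∀ m', Frame [.i, .e, .l, .h] [.tmp, .z, .w] m m' → row.val m' = x) {c : Prog}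
    (hQ : ∀ m', Frame [.i, .e, .l, .h, .b, .par, .v, .bit] [.tmp, .z, .w] m m' →
      (∀ b < P.t, m'.nat .bit b = P.bits W (m.real .X) ph j cen x b) → wp Z B ω inp c Q m') :
    wp Z B ω inp (imageP row ;; sketchP ;; c) Q m := by
  rw [wp_seq]
  refine wp_imageP hF.lt x (by rw [hph, hL.lev _ hph2]) (hF.lev_le _ hph2) hL.D hF.D_le hcen hr ?_
  intro m₁ hf₁ h₁
  have hL₁ := hL.frame hf₁ (by simp [Param.staticN]) (by simp [Param.staticR])
  rw [hL.a, hsc] at h₁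
  rw [wp_seq]
  refine wp_sketchP hF.lt (W := W) hL₁.t hF.t_le hL₁.mm hF.mm_le hL₁.D hL₁.T hWB
    (fun i hi => by rw [hf₁.nat _ (by simp)]; exact hW i hi) (Nat.pow_pos (by norm_num)) h₁ ?_
  intro m₂ hf₂ h₂
  exact hQ m₂ ((hf₁.mono (by simp) (by simp)).trans (hf₂.mono (by simp) (by simp))) h₂

lemma wp_entryP (hF : P.FitsPre Z B) (hL : P.Loaded m) (hn : 1 ≤ P.n) {W : ℕ → ℕ} {ph j cc bb : ℕ}
    (hph : m.nat .ph 0 = ph) (hph2 : ph < 2) (hj : m.nat .j 0 = j) (hcc : m.nat .cc 0 = cc)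
    (hbb : m.nat .bb 0 = bb) (hbbB : bb < B)
    (hcen : ∀ e ≤ P.lev ph, m.nat .cen e = digit P.n cc e)
    (hsc : m.real .scale 0 =
      searchRad P.a (P.cz ph) (digit (P.kk ph) j) (P.lev ph) (P.rr ph))
    (hW : ∀ i < P.t * P.mm, m.nat .W i = W i) (hWB : ∀ i < P.t * P.mm, W i < B)
    (hQ : ∀ m' y, Frame entryN entryR m m' → P.IsEntry W (m.real .X) ph j cc bb y →
      m'.nat .tab = Function.update (m.nat .tab)
        (2 * ((j * P.nC ph + cc) * 2 ^ P.t + bb) + ph) y → Q m') :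
    wp Z B ω inp entryP Q m := by
  have hZB := hF.lt
  rw [entryP, wp_seq]
  refine wp_digitsP hZB bb 2 P.t (by simp) (by simp) (by simp [hbb]) hbbB (fun _ _ => rfl)
    (fun m' h => by simp [h.nat .t (by simp), hL.t]) hF.t_le ?_
  intro m₁ hf₁ h₁
  have hL₁ := hL.frame hf₁ (by simp [Param.staticN]) (by simp [Param.staticR])
  simp only [wp_seq, wp_put, WExp.val_ofNat]
  refine ⟨by omega, ?_⟩
  set μ : ℕ → ℕ := fun x => mismatch (P.bits W (m.real .X) ph j (digit P.n cc) x) (digit 2 bb) P.t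
    with hμ
  -- The point 0 is the default answer, legitimate since n ≥ 1. A point scanned later replaces the
  -- answer exactly if its sketch is similar, so the answer is similar as soon as one scanned point
  -- is.
  refine wp_for [.ans, .x, .i, .l, .h, .e, .b, .par, .v, .bit, .mis] entryR P.n
    (fun k m' => m'.nat .ans 0 < P.n ∧ ∀ x < k, μ x ≤ P.tp → μ (m'.nat .ans 0) ≤ P.tp) hZB
    (by decide) hF.n_le ?_ (fun j m' v h => by simpa using h) (by simp; omega) ?_ ?_
  · intro m' hf
    simpa [hf.nat .n (by decide)] using hL₁.n
  · rintro x hx m₂ hf₂ ⟨h₂, h₂'⟩ hx₂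
    have hf₂' := Frame.trans (m := m₁) (by simp) hf₂
    have hf02 : Frame entryN entryR m m₂ := (hf₁.mono (by simp [entryN]) (by simp)).trans
      (hf₂'.mono (by simp [entryN]) (by simp))
    have hL₂ := hL.frame hf02 (by decide) (by decide)
    have htgt : ∀ e < P.t, m₂.nat .tgt e = digit 2 bb e := by
      rw [hf₂'.nat .tgt (by simp)]; exact h₁
    refine wp_sketch_row hF.toFits hL₂ (W := W) (j := j) (cen := digit P.n cc) x
      (by rw [hf02.nat _ (by decide), hph]) hph2
      (by
        rw [hf₂'.nat .cen (by simp), hf₁.nat .cen (by simp)]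
        exact hcen) (by rw [hf02.real _ (by decide), hsc])
      (by rw [hf02.nat _ (by decide)]; exact hW) hWB
      (fun m' hf => by simp [hf.nat .x (by simp), hx₂]) ?_
    intro m₃ hf₃ h₃
    rw [hf02.real .X (by decide)] at h₃
    have hL₃ := hL₂.frame hf₃ (by decide) (by decide)
    simp only [wp_seq, wp_put, WExp.val_ofNat]
    refine ⟨by omega, ?_⟩
    refine wp_for [.b, .mis] [] P.t (fun k m' => m'.nat .mis 0 =
      mismatch (P.bits W (m.real .X) ph j (digit P.n cc) x) (digit 2 bb) k) hZB (by simp) hF.t_le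
      (fun m' hf => by simp [hf.nat .t (by simp), hL₃.t])
      (fun j m' v h => by simpa using h) (by simp [mismatch]) ?_ ?_
    · intro b hb m₄ hf₄ h₄ hb₄
      have e1 : m₄.nat .bit b = P.bits W (m.real .X) ph j (digit P.n cc) x b := by
        rw [hf₄.nat .bit (by simp)]; simpa using h₃ b hb
      have e2 : m₄.nat .tgt b = digit 2 bb b := by
        rw [hf₄.nat .tgt (by simp)]
        simpa [hf₃.nat .tgt (by simp)] using htgt b hb
      have hle := mismatch_le (P.bits W (m.real .X) ph j (digit P.n cc) x) (digit 2 bb) b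
      have hlt : b + 1 < B := by have := hF.t_le; omega
      simp only [wp_ite, Test.val_ltW, WExp.val_get, NVar.val_word, hb₄, e1, e2, wp_put,
        WExp.val_add, WExp.val_ofNat, h₄, wp_skip, mismatch_succ]
      refine ⟨fun h => ?_, fun h => ⟨fun h' => ?_, fun h' => ?_⟩⟩
      · rw [if_pos h.ne]
        exact ⟨by omega, by simp, by simpa using hb₄, by simp⟩
      · rw [if_pos h'.ne']
        exact ⟨by omega, by simp, by simpa using hb₄, by simp⟩
      · rw [if_neg (by omega)]
        simp
    · intro m₄ hf₄ h₄
      have hf₄' := Frame.trans (m := m₃) (by simp) hf₄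
      have hx₄ : m₄.nat .x 0 = x := by
        rw [hf₄'.nat .x (by simp), hf₃.nat .x (by simp), hx₂]
      have hans : m₄.nat .ans 0 = m₂.nat .ans 0 := by
        rw [hf₄'.nat .ans (by simp), hf₃.nat .ans (by simp)]
      have htp : m₄.nat .tp 0 = P.tp := by rw [hf₄'.nat .tp (by simp), hL₃.tp]
      have hff : Frame [.ans, .x, .i, .l, .h, .e, .b, .par, .v, .bit, .mis] entryR m₂ m₄ :=
        (hf₃.mono (by simp) (by simp [entryR])).trans (hf₄'.mono (by simp) (by simp))
      have hnZ := hF.n_le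
      simp only [wp_ite, Test.val_ltW, NVar.val_word, htp, wp_skip, wp_put, h₄, hx₄]
      refine ⟨fun h => ⟨hff, trivial, by rw [hans]; exact h₂, ?_⟩,
        fun h => ⟨by omega, by simpa using hff, by simpa using hx₄, by simpa using hx, ?_⟩⟩
      · intro x' hx' hle
        rw [hans]
        by_cases h' : x' = x
        · subst h'; exact absurd hle (not_le.2 h)
        · exact h₂' x' (by omega) hle
      · intro x' hx' hle
        simpa [hμ] using h
  · rintro m₂ hf₂ ⟨h₂, h₂'⟩
    have hf₂' := Frame.trans (m := m₁) (by simp) hf₂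
    have hf02 : Frame (entryN.erase .tab) entryR m m₂ :=
      (hf₁.mono (by decide) (by simp)).trans (hf₂'.mono (by decide) (by simp))
    have hL₂ := hL.frame hf02 (by decide) (by decide)
    have hnZ := hF.n_le
    have hv : tabE.val m₂ = 2 * ((j * P.nC ph + cc) * 2 ^ P.t + bb) + ph := by
      simp [tabE, hf02.nat .j (by decide), hj, hf02.nat .ph (by decide), hph, hL₂.nC _ hph2,
        hf02.nat .cc (by decide), hcc, hL₂.TT, hf02.nat .bb (by decide), hbb]
    simp only [wp_setW, NVar.val_word, hv]
    refine ⟨by omega, hQ _ (m₂.nat .ans 0) ?_ ⟨h₂, h₂'⟩ ?_⟩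
    · rw [frame_setW (by decide)]
      exact hf02.mono (by decide) (by simp)
    · simp [hf02.nat .tab (by decide)]

/-- The word arrays that `tableP` may change. -/
def tableN : List NVar := [.ph, .j, .cc, .bb, .dig, .cen] ++ entryN

/-- The real arrays that `tableP` may change. -/
def tableR : List RVar := [.rad, .scale] ++ entryR

/-- The phases 0 and 1 occupy the even and the odd entries, so a store for one phase does not affect
the other. -/
lemma Param.Filled.succ {W : ℕ → ℕ} {X : ℕ → ℝ} {tab : ℕ → ℕ} {ph s y : ℕ}
    (h : P.Filled W X tab ph s) (hph : ph < 2) (hy : P.IsEntryAt W X ph s y) :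
    P.Filled W X (Function.update tab (2 * s + ph) y) ph (s + 1) := by
  refine ⟨fun ph' hph' s' hs' => ?_, fun s' hs' => ?_⟩
  · rw [Function.update_of_ne (by omega)]
    exact h.1 ph' hph' s' hs'
  · by_cases e : s' = s
    · subst e; simpa using hy
    · rw [Function.update_of_ne (by omega)]
      exact h.2 s' (by omega)

lemma wp_tableP (hF : P.FitsPre Z B) (hL : P.Loaded m) (hn : 1 ≤ P.n) {W : ℕ → ℕ}
    (hW : ∀ i < P.t * P.mm, m.nat .W i = W i) (hWB : ∀ i < P.t * P.mm, W i < B)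
    (hQ : ∀ m', Frame tableN tableR m m' →
      P.Filled W (m.real .X) (m'.nat .tab) 2 0 → Q m') :
    wp Z B ω inp tableP Q m := by
  have hZB := hF.lt
  set X := m.real .X with hX
  rw [tableP]
  refine wp_for tableN tableR 2 (fun ph m' => P.Filled W X (m'.nat .tab) ph 0) hZB (by decide)
    hF.two_le (fun m' hf => rfl) (fun j m' v h => by simpa using h) (by simp [Param.Filled]) ?_
    (fun m' hf h => hQ m' hf h)
  intro ph hph m₀ hf₀ h₀ hph₀
  have hL₀ := hL.frame hf₀ (by decide) (by decide)
  -- The three nested loops share one invariant. They enumerate steps, tuples of centers and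
  -- sketches in the order of the mixed-radix index (j nC + cc) 2^t + bb, so each inner loop extends
  -- the filled initial segment.
  refine wp_for (tableN.erase .ph) tableR (P.JJ ph)
    (fun j m' => P.Filled W X (m'.nat .tab) ph (j * P.nC ph * 2 ^ P.t)) hZB (by decide)
    (hF.JJ_le _ hph) (fun m' hf => ?_) (fun j m' v h => by simpa using h) (by simpa using h₀) ?_ ?_
  · simp [hf.nat .JJ (by decide), hf.nat .ph (by decide), hph₀, hL₀.JJ _ hph]
  · intro j hj m₁ hf₁ h₁ hj₁
    have hL₁ := hL₀.frame hf₁ (by decide) (by decide)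
    have hph₁ : m₁.nat .ph 0 = ph := by rw [hf₁.nat .ph (by decide), hph₀]
    rw [wp_seq]
    have hjB : j < B := by have := hF.JJ_le ph hph; omega
    refine wp_digitsP hZB j (P.kk ph) (P.lev ph + 1) (by simp) (by simp) (by simp [hj₁]) hjB
      (fun m' hf => by simp [hf.nat .kk (by decide), hf.nat .ph (by decide), hph₁, hL₁.kk _ hph])
      (fun m' hf => by simp [hf.nat .lev (by decide), hf.nat .ph (by decide), hph₁, hL₁.lev _ hph])
      (hF.lev_le _ hph) ?_
    intro m₂ hf₂ h₂
    have hL₂ := hL₁.frame hf₂ (by decide) (by decide)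
    have hph₂ : m₂.nat .ph 0 = ph := by rw [hf₂.nat .ph (by decide), hph₁]
    rw [wp_seq]
    refine wp_scaleP hZB (M := P.lev ph) (dig := digit (P.kk ph) j) (by rw [hph₂, hL₂.lev _ hph])
      (by have := hF.lev_le ph hph; omega) (fun e he => h₂ e (by omega)) ?_
    intro m₃ hf₃ h₃
    rw [hph₂, hL₂.a, hL₂.cz _ hph, hL₂.rr _ hph] at h₃
    have hL₃ := hL₂.frame hf₃ (by decide) (by decide)
    have hf13 : Frame (((tableN.erase .ph).erase .j).erase .tab) tableR m₁ m₃ :=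
      (hf₂.mono (by decide) (by decide)).trans (hf₃.mono (by decide) (by decide))
    have hph₃ : m₃.nat .ph 0 = ph := by rw [hf₃.nat .ph (by decide), hph₂]
    have hj₃ : m₃.nat .j 0 = j := by rw [hf13.nat .j (by decide), hj₁]
    have hf03 : Frame tableN tableR m m₃ := hf₀.trans ((hf₁.mono (by decide) (by decide)).trans
      (hf13.mono (by decide) (by decide)))
    refine wp_for (((tableN.erase .ph).erase .j).erase .dig) entryR (P.nC ph)
      (fun cc m' => P.Filled W X (m'.nat .tab) ph ((j * P.nC ph + cc) * 2 ^ P.t)) hZB (by decide)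
      (hF.nC_le _ hph) (fun m' hf => ?_) (fun j m' v h => by simpa using h)
      (by simpa [hf13.nat .tab (by decide)] using h₁) ?_ ?_
    · simp [hf.nat .nC (by decide), hf.nat .ph (by decide), hph₃, hL₃.nC _ hph]
    · intro cc hcc m₄ hf₄ h₄ hcc₄
      have hL₄ := hL₃.frame hf₄ (by decide) (by decide)
      have hccB : cc < B := by have := hF.nC_le ph hph; omega
      rw [wp_seq]
      refine wp_digitsP hZB cc P.n (P.lev ph + 1) (by simp) (by simp) (by simp [hcc₄]) hccB
        (fun m' hf => by simp [hf.nat .n (by decide), hL₄.n])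
        (fun m' hf => by
          simp [hf.nat .lev (by decide), hf.nat .ph (by decide), hf₄.nat .ph (by decide), hph₃,
            hL₄.lev _ hph])
        (hF.lev_le _ hph) ?_
      intro m₅ hf₅ h₅
      have hL₅ := hL₄.frame hf₅ (by decide) (by decide)
      have hf35 : Frame (((tableN.erase .ph).erase .j).erase .dig) entryR m₃ m₅ :=
        hf₄.trans (hf₅.mono (by decide) (by decide))
      refine wp_for (.bb :: entryN) entryR (2 ^ P.t) (fun bb m' => P.Filled W X (m'.nat .tab) ph
        ((j * P.nC ph + cc) * 2 ^ P.t + bb)) hZB (by decide) hF.sketch_le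
        (fun m' hf => by simp [hf.nat .TT (by decide), hL₅.TT]) (fun j m' v h => by simpa using h)
        (by simpa [hf₅.nat .tab (by decide)] using h₄) ?_ ?_
      · intro bb hbb m₆ hf₆ h₆ hbb₆
        have hL₆ := hL₅.frame hf₆ (by decide) (by decide)
        have hf36 := hf35.trans (hf₆.mono (by decide) (by decide))
        have hf06 := hf03.trans (hf36.mono (ns' := tableN) (rs' := tableR) (by decide) (by decide))
        have hX₆ : m₆.real .X = X := hf06.real .X (by decide)
        refine wp_entryP hF hL₆ hn (W := W) (ph := ph) (j := j) (cc := cc) (bb := bb)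
          (by rw [hf36.nat .ph (by decide), hph₃]) hph
          (by rw [hf36.nat .j (by decide), hj₃])
          (by rw [hf₆.nat .cc (by decide), hf₅.nat .cc (by decide), hcc₄])
          hbb₆ (by have := hF.sketch_lt; omega)
          (by
            intro e he
            rw [hf₆.nat .cen (by decide)]
            exact h₅ e (by omega))
          (by rw [hf36.real .scale (by decide), h₃])
          (by rw [hf06.nat .W (by decide)]; exact hW) hWB ?_
        intro m₇ y hf₇ hy h₇
        rw [hX₆] at hy
        refine ⟨hf₇.mono (by decide) (by decide), by rw [hf₇.nat .bb (by decide), hbb₆], ?_⟩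
        rw [h₇, ← Nat.add_assoc]
        refine h₆.succ hph ?_
        have e1 : ((j * P.nC ph + cc) * 2 ^ P.t + bb) / 2 ^ P.t = j * P.nC ph + cc := by
          rw [Nat.mul_comm _ (2 ^ P.t), Nat.mul_add_div (by positivity), Nat.div_eq_of_lt hbb,
            add_zero]
        have e2 : ((j * P.nC ph + cc) * 2 ^ P.t + bb) % 2 ^ P.t = bb := by
          rw [Nat.mul_comm _ (2 ^ P.t), Nat.mul_add_mod, Nat.mod_eq_of_lt hbb]
        have e3 : (j * P.nC ph + cc) / P.nC ph = j := by
          rw [Nat.mul_comm _ (P.nC ph), Nat.mul_add_div (by omega), Nat.div_eq_of_lt hcc, add_zero]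
        have e4 : (j * P.nC ph + cc) % P.nC ph = cc := by
          rw [Nat.mul_comm _ (P.nC ph), Nat.mul_add_mod, Nat.mod_eq_of_lt hcc]
        rw [Param.IsEntryAt, e1, e2, e3, e4]
        exact hy
      · intro m₆ hf₆ h₆
        refine ⟨(hf₅.mono (by decide) (by decide)).trans (hf₆.mono (by decide) (by decide)), ?_, ?_⟩
        · rw [hf₆.nat .cc (by decide), hf₅.nat .cc (by decide), hcc₄]
        · have e : (j * P.nC ph + (cc + 1)) * 2 ^ P.t = (j * P.nC ph + cc) * 2 ^ P.t + 2 ^ P.t := by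
            ring
          rw [e]; exact h₆
    · intro m₄ hf₄ h₄
      refine ⟨(hf13.mono (by decide) (by decide)).trans (hf₄.mono (by decide) (by decide)), ?_, ?_⟩
      · rw [hf₄.nat .j (by decide), hj₃]
      · rw [Nat.succ_mul]; exact h₄
  · intro m₁ hf₁ h₁
    refine ⟨hf₁.mono (by decide) (by decide), by rw [hf₁.nat .ph (by decide), hph₀], ?_, by simp⟩
    intro ph' hph' s hs
    by_cases e : ph' = ph
    · subst e; exact h₁.2 s hs
    · exact h₁.1 ph' (by omega) s hs

end Table

/-! ### Correctness of the preprocessing. -/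

section Pre
variable {Z B : ℕ} {ω : ℕ → Bool} {inp : ℕ → ℝ} {m : Mem} {Q : Mem → Prop} {P : Param}

/-- Logarithms are computed by doubling. As all loops are counted, the loop makes a crude number N
of rounds and stands still once the target is reached, hence the minimum in the invariant. -/
lemma wp_doubling (hZB : Z < B) {pow ctr : NVar} {c : Test} {b : WExp} (c₀ N target : ℕ)
    (hp : pow ≠ ctr) (hpi : pow ≠ .i) (hci : ctr ≠ .i) (h0 : m.nat ctr 0 = c₀)
    (h0' : m.nat pow 0 = 2 ^ c₀) (h1 : c₀ ≤ target) (h2 : target ≤ c₀ + N) (hN : N ≤ Z)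
    (ht : target ≤ Z) (ht' : 2 ^ target < B)
    (hb : ∀ m', Frame [pow, ctr, .i] [] m m' → b.val m' = N)
    (hc : ∀ m' j, Frame [pow, ctr, .i] [] m m' → c₀ ≤ j → j ≤ target → m'.nat pow 0 = 2 ^ j →
      (c.val inp m' ↔ j < target))
    (hQ : ∀ m', Frame [pow, ctr, .i] [] m m' → m'.nat ctr 0 = target → m'.nat pow 0 = 2 ^ target →
      Q m') :
    wp Z B ω inp (.forTo .i b (.ite c (pow.put (pow.word * 2) ;; ctr.put (ctr.word + 1)) .skip))
      Q m := by
  refine wp_for [pow, ctr, .i] [] N (fun j m' => m'.nat ctr 0 = min (c₀ + j) target ∧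
    m'.nat pow 0 = 2 ^ (min (c₀ + j) target)) hZB (by simp) hN hb
    (fun j m' v h => by simpa [hpi, hci] using h) (by simp [h0, h0', h1]) ?_ ?_
  · rintro j hj m' hf ⟨h3, h4⟩ hj'
    have key := hc m' _ hf (by omega) (min_le_right _ _) h4
    simp only [wp_ite, wp_seq, wp_put, wp_skip, NVar.val_word, WExp.val_mul, WExp.val_ofNat,
      WExp.val_add, h4, Mem.setW_ne _ _ _ hp.symm, h3, ← pow_succ]
    refine ⟨fun h => ?_, fun h => ?_⟩
    · have h5 := key.1 h
      have e : min (c₀ + (j + 1)) target = min (c₀ + j) target + 1 := by omega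
      rw [e]
      have : 2 ^ (min (c₀ + j) target + 1) ≤ 2 ^ target :=
        Nat.pow_le_pow_right (by norm_num) (by omega)
      refine ⟨by omega, by omega, by simp, by simp [hpi.symm, hci.symm, hj'], by simp,
        by simp [hp]⟩
    · have h5 : ¬ _ := fun h' => h (key.2 h')
      have e : min (c₀ + (j + 1)) target = min (c₀ + j) target := by omega
      rw [e]
      exact ⟨Frame.refl, hj', rfl, rfl⟩
  · rintro m' hf ⟨h3, h4⟩
    rw [min_eq_right h2] at h3 h4
    exact hQ m' hf h3 h4

lemma lt_target_iff {d target j : ℕ} (h1 : d ≤ 2 ^ target)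
    (h2 : j < target → 2 ^ (target - 1) < d) (hj : j ≤ target) : 2 ^ j < d ↔ j < target := by
  constructor
  · intro h
    by_contra h'
    have : target = j := by omega
    subst this
    omega
  · intro h
    exact (Nat.pow_le_pow_right (by norm_num) (by omega)).trans_lt (h2 h)

/-- The word arrays that `paramsP` may change. -/
def paramsN : List NVar := [.lam, .D, .i, .nu, .cnt, .L, .S, .tp, .t, .mm, .PS, .T, .TT, .u]

lemma wp_paramsP (hF : P.FitsPre Z B) (hP : P.Ok) (hn : m.nat .n 0 = P.n) (hd : m.nat .d 0 = P.d)
    (hp : m.real .p 0 = P.p) (hr : m.real .r 0 = P.r)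
    (hQ : ∀ m', Frame paramsN [.pc, .a] m m' → P.Base m' → Q m') :
    wp Z B ω inp paramsP Q m := by
  have hZB := hF.lt
  have hDZ := hF.D_le
  have hlam := hF.lam_le
  have hnu := hF.nu_le
  have h2 := hF.two_le
  have hSt := hF.S_le
  have htB := hF.sketch_lt
  have h2lam := hP.two_le_lam
  have hLlam := hP.L_le
  -- A loop with d rounds suffices for the logarithm of d, by minimality of `lam` and m < 2^m; the
  -- same argument serves for n.
  have hlamd : P.lam ≤ 2 + P.d := by
    by_contra h
    have h1 := hP.lam_min (by omega)
    have h3 := Nat.lt_two_pow_self (n := P.lam - 1)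
    omega
  have hnun : P.nu ≤ 0 + P.n := by
    by_contra h
    have h1 := hP.nu_min (by omega)
    have h3 := Nat.lt_two_pow_self (n := P.nu - 1)
    omega
  have hDZ' : 2 ^ P.lam ≤ Z := hDZ
  have h4 : 2 ^ 2 ≤ 2 ^ P.lam := Nat.pow_le_pow_right (by norm_num) h2lam
  simp only [paramsP, wp_seq, wp_put, WExp.val_ofNat]
  refine ⟨by omega, by omega, ?_⟩
  refine wp_doubling hZB 2 P.d P.lam (by simp) (by simp) (by simp) (by simp) (by simp) h2lam hlamd
    hF.d_le hlam (by omega) (fun m' hf => by simp [hf.nat .d (by simp), hd]) ?_ ?_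
  · intro m' j hf hj0 hj h
    simp only [Test.val_ltW, NVar.val_word, h, hf.nat .d (by simp)]
    simp only [ne_eq, reduceCtorEq, not_false_eq_true, Mem.setW_ne, hd]
    -- The exponent starts at 2, and it is known to be minimal only if it is larger than 2.
    by_cases hlam2 : P.lam = 2
    · have h5 := hP.d_le
      have : j = 2 := by omega
      subst this
      rw [hlam2] at h5 ⊢
      omega
    · exact lt_target_iff hP.d_le (fun _ => hP.lam_min (by omega)) hj
  intro m₁ hf₁ hlam₁ hD₁
  have hf₁' : Frame paramsN [.pc, .a] m m₁ := Frame.trans (by simp [paramsN])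
    (hf₁.mono (by decide) (by simp))
  have hn₁ : m₁.nat .n 0 = P.n := by rw [hf₁'.nat .n (by decide), hn]
  simp only [wp_seq, wp_put, WExp.val_ofNat]
  refine ⟨by omega, by omega, ?_⟩
  have hnuS : 2 ^ P.nu ≤ 2 ^ P.S := Nat.pow_le_pow_right (by norm_num) (by unfold Param.S; omega)
  refine wp_doubling hZB 0 P.n P.nu (by simp) (by simp) (by simp) (by simp) (by simp) (by simp) hnun
    hF.n_le (by omega) (by omega) (fun m' hf => by simp [hf.nat .n (by simp), hn₁]) ?_ ?_
  · intro m' j hf hj0 hj h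
    simp only [Test.val_ltW, NVar.val_word, h, hf.nat .n (by simp)]
    simp only [ne_eq, reduceCtorEq, not_false_eq_true, Mem.setW_ne, hn₁]
    exact lt_target_iff hP.n_le (fun _ => hP.nu_min (by omega)) hj
  intro m₂ hf₂ hnu₂ _
  have hf₂' : Frame [.cnt, .nu, .i] [.pc] m₁ m₂ := Frame.trans (by simp)
    (hf₂.mono (by simp) (by simp))
  have hlam₂ : m₂.nat .lam 0 = P.lam := by rw [hf₂'.nat .lam (by simp), hlam₁]
  have hp₂ : m₂.real .p 0 = P.p := by
    rw [hf₂'.real .p (by simp), hf₁'.real .p (by simp), hp]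
  simp only [wp_seq, wp_ite, Test.val_ltF, FExp.val_cast, NVar.val_word, RVar.val_num, hlam₂, hp₂,
    wp_fput]
  -- Both branches of the truncation of the exponent continue in the same way, so the rest of the
  -- program is verified once.
  suffices key : ∀ m₃, Frame [.cnt, .nu, .i] [.pc] m₁ m₃ → m₃.nat .nu 0 = P.nu →
      m₃.real .pc 0 = P.pc → wp Z B ω inp (NVar.L.put 0) (wp Z B ω inp (NVar.cnt.put 1)
        (wp Z B ω inp (.forTo .i NVar.lam.word (.ite (.ltF (.cast NVar.cnt.word) RVar.pc.num)
        (NVar.cnt.put (NVar.cnt.word * 2) ;; NVar.L.put (NVar.L.word + 1)) .skip)) (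
        wp Z B ω inp (RVar.a.put (.pow RVar.pc.num (lit 1 / .cast NVar.L.word)) ;;
        NVar.S.put (2 * NVar.lam.word + NVar.nu.word + 40) ;;
        NVar.tp.put (NVar.nu.word * (NVar.L.word + 3) + 100 * NVar.lam.word + 100) ;;
        NVar.t.put (16 * NVar.tp.word) ;; NVar.mm.put (4 * NVar.D.word) ;;
        powP .PS 2 NVar.S.word ;; NVar.T.put (NVar.PS.word / NVar.D.word) ;;
        powP .TT 2 NVar.t.word) Q))) m₃ by
    refine ⟨fun h => ?_, fun h => ?_⟩
    · refine key _ (by simpa using hf₂') (by simpa using hnu₂) ?_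
      simp [Param.pc, h]
    · refine key _ (by simpa using hf₂') (by simpa using hnu₂) ?_
      simp [Param.pc, h]
  intro m₃ hf₃ hnu₃ hpc₃
  have hlam₃ : m₃.nat .lam 0 = P.lam := by rw [hf₃.nat .lam (by simp), hlam₁]
  simp only [wp_put, WExp.val_ofNat]
  refine ⟨by omega, by omega, ?_⟩
  have hLpow : 2 ^ P.L ≤ 2 ^ P.lam := Nat.pow_le_pow_right (by norm_num) hLlam
  refine wp_doubling hZB 0 P.lam P.L (by simp) (by simp) (by simp) (by simp) (by simp) (by simp)
    (by omega) hlam (by omega) (by omega)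
    (fun m' hf => by simp [hf.nat .lam (by simp), hlam₃]) ?_ ?_
  · intro m' j hf hj0 hj h
    simp only [Test.val_ltF, FExp.val_cast, NVar.val_word, h, RVar.val_num, hf.real .pc (by simp)]
    simp only [Mem.setW_real, hpc₃, Nat.cast_pow, Nat.cast_ofNat]
    have h5 := hP.pc_le
    have h6 := hP.lt_pc
    constructor
    · intro h7
      by_contra h8
      have : j = P.L := by omega
      subst this
      linarith
    · intro h7
      refine lt_of_le_of_lt (pow_le_pow_right₀ (by norm_num) (by omega)) h6
  intro m₄ hf₄ hL₄ _
  have hf₄' : Frame [.cnt, .L, .i] [.pc] m₃ m₄ := Frame.trans (by simp)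
    (hf₄.mono (by simp) (by simp))
  have hfD : Frame [.cnt, .L, .nu, .i] [.pc] m₁ m₄ :=
    (hf₃.mono (by simp) (by simp)).trans (hf₄'.mono (by simp) (by simp))
  have hfm : Frame paramsN [.pc, .a] m m₄ := hf₁'.trans (hfD.mono (by decide) (by simp))
  have hlam₄ : m₄.nat .lam 0 = P.lam := by rw [hf₄'.nat .lam (by simp), hlam₃]
  have hnu₄ : m₄.nat .nu 0 = P.nu := by rw [hf₄'.nat .nu (by simp), hnu₃]
  have hD₄ : m₄.nat .D 0 = P.D := by rw [hfD.nat .D (by simp), hD₁]; rfl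
  have hpc₄ : m₄.real .pc 0 = P.pc := by
    rw [hf₄.real .pc (by simp)]; simpa using hpc₃
  have hSe : 2 * P.lam + P.nu + 40 = P.S := rfl
  have htpe : P.nu * (P.L + 3) + 100 * P.lam + 100 = P.tp := rfl
  have hte : 16 * P.tp = P.t := rfl
  have hme : 4 * P.D = P.mm := rfl
  have b1 := hF.S_le_Z
  have b2 := hF.tp_le
  have b3 := hF.t_le
  have b4 := hF.mm_le
  simp only [wp_seq, wp_fput, wp_put, FExp.val_pow, RVar.val_num, hpc₄, FExp.val_div, val_lit,
    FExp.val_cast, NVar.val_word, hL₄, WExp.val_add, WExp.val_mul, WExp.val_ofNat, Mem.setF_nat,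
    hlam₄, hnu₄, hSe, ne_eq, reduceCtorEq, not_false_eq_true, Mem.setW_ne, Mem.setW_same,
    Function.update_self, htpe, hte, hD₄, hme]
  refine ⟨by omega, by omega, by omega, by omega, ?_⟩
  have ha : (|P.pc| ^ (((1 : ℕ) : ℝ) / (P.L : ℝ))) = P.a := by simp [Param.a]
  rw [ha]
  refine wp_powP hZB 2 P.S (by simp) (fun _ _ => rfl)
    (fun m' hf => by simp [hf.nat .S (by simp)]) (by norm_num) b1 (by omega) ?_
  intro m₅ hf₅ hPS₅
  have hD₅ : m₅.nat .D 0 = P.D := by rw [hf₅.nat .D (by simp)]; simpa using hD₄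
  simp only [wp_seq, wp_put, WExp.val_div, NVar.val_word, hPS₅, hD₅]
  refine ⟨(Nat.div_le_self _ _).trans_lt (by omega), ?_⟩
  refine wp_powP hZB 2 P.t (by simp) (fun _ _ => rfl)
    (fun m' hf => by simp [hf.nat .t (by simp), hf₅.nat .t (by simp)]) (by norm_num) b3 htB ?_
  intro m₆ hf₆ hTT₆
  refine hQ _ ?_ ?_
  · refine Frame.trans ?_ (hf₆.mono (by decide) (by simp))
    rw [frame_setW (by decide)]
    refine Frame.trans ?_ (hf₅.mono (by decide) (by simp))
    rw [frame_setW (by decide), frame_setW (by decide), frame_setW (by decide),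
      frame_setW (by decide), frame_setF (by decide)]
    exact hfm
  · constructor
    case TT => exact hTT₆
    case r => simp [hf₆.real .r (by simp), hf₅.real .r (by simp), hfm.real .r (by simp), hr]
    case a => simp [hf₆.real .a (by simp), hf₅.real .a (by simp)]
    all_goals rw [hf₆.nat _ (by decide)]
    case PS => simpa using hPS₅
    case T => simp; rfl
    all_goals simp only [ne_eq, reduceCtorEq, not_false_eq_true, Mem.setW_ne]; rw [hf₅.nat _ (by decide)]
    case n => simpa [hfm.nat .n (by decide)] using hn
    case d => simpa [hfm.nat .d (by decide)] using hd
    all_goals simp [*]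

/-- The word arrays that `phasesP` may change. -/
def phasesN : List NVar := [.lev, .kk, .ph, .pw, .u, .JJ, .nC]

lemma Param.Base.loaded_setF (hB : P.Base m) (h1 : ∀ ph < 2, m.nat .lev ph = P.lev ph)
    (h2 : ∀ ph < 2, m.nat .kk ph = P.kk ph) (h3 : ∀ ph < 2, m.nat .JJ ph = P.JJ ph)
    (h4 : ∀ ph < 2, m.nat .nC ph = P.nC ph) {v0 v1 v2 v3 : ℝ} (e0 : v0 = P.rr 0) (e1 : v1 = P.rr 1)
    (e2 : v2 = P.cz 0) (e3 : v3 = P.cz 1) :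
    P.Loaded ((((m.setF .rr 0 v0).setF .rr 1 v1).setF .cz 0 v2).setF .cz 1 v3) := by
  refine ⟨hB.congr (fun τ _ _ => rfl) ?_, h1, h2, h3, h4, ?_, ?_⟩
  · intro τ h h'
    simp only [List.mem_cons, List.not_mem_nil, or_false, not_or] at h'
    simp [h'.1, h'.2]
  · intro ph hph
    interval_cases ph <;> simp [e0, e1]
  · intro ph hph
    interval_cases ph <;> simp [e2, e3]

lemma wp_phasesP (hF : P.FitsPre Z B) (hP : P.Ok) (hL : P.Base m)
    (hQ : ∀ m', Frame phasesN [.rr, .cz] m m' → P.Loaded m' → Q m') :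
    wp Z B ω inp phasesP Q m := by
  have hZB := hF.lt
  have hlam := hF.lam_le
  have h1 := hP.L_le
  have h2 := hF.two_le
  have hn1 := hP.one_le_n
  have k0 := hF.kk_le 0 (by norm_num)
  have k1 := hF.kk_le 1 (by norm_num)
  have e0 : 7 * (P.S + P.lam + 1) = P.kk 0 := rfl
  have e1 : 7 * (33 + 4 * P.lam) = P.kk 1 := rfl
  simp only [phasesP, wp_seq, wp_setW, WExp.val_ofNat, NVar.val_word, hL.L, WExp.val_mul,
    WExp.val_add, ne_eq, reduceCtorEq, not_false_eq_true, Mem.setW_ne, hL.S, hL.lam, e0, e1]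
  refine ⟨by omega, by omega, by omega, by omega, ?_⟩
  set m₀ := (((m.setW .lev 0 0).setW .lev 1 P.L).setW .kk 0 (P.kk 0)).setW .kk 1 (P.kk 1) with hm₀
  have hf₀ : Frame phasesN [.rr, .cz] m m₀ := by simp [hm₀, phasesN]
  have hlev₀ : ∀ ph < 2, m₀.nat .lev ph = P.lev ph := by
    intro ph hph
    interval_cases ph <;> simp [hm₀, Param.lev]
  have hkk₀ : ∀ ph < 2, m₀.nat .kk ph = P.kk ph := by
    intro ph hph
    interval_cases ph <;> simp [hm₀]
  refine wp_for [.ph, .pw, .u, .JJ, .nC] [] 2 (fun k m' => (∀ ph < k, m'.nat .JJ ph = P.JJ ph) ∧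
    ∀ ph < k, m'.nat .nC ph = P.nC ph) hZB (by simp) h2 (fun _ _ => rfl)
    (fun j m' v h => by simpa using h) (by simp) ?_ ?_
  · rintro ph hph m₁ hf₁ ⟨h₁, h₁'⟩ hph₁
    have hkpos : 1 ≤ P.kk ph := by unfold Param.kk; split_ifs <;> omega
    have hJ := hF.JJ_le ph hph
    have hC := hF.nC_le ph hph
    have hlev := hF.lev_le ph hph
    refine wp_powP hZB (P.kk ph) (P.lev ph + 1) (by simp)
      (fun m' hf => by simp [hf.nat .kk (by simp), hf₁.nat .kk (by simp), hf.nat .ph (by simp), hph₁,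
        hkk₀ _ hph])
      (fun m' hf => by simp [hf.nat .lev (by simp), hf₁.nat .lev (by simp), hf.nat .ph (by simp),
        hph₁, hlev₀ _ hph]) hkpos hlev (show P.JJ ph < B by omega) ?_
    intro m₂ hf₂ h₂
    have hph₂ : m₂.nat .ph 0 = ph := by rw [hf₂.nat .ph (by simp), hph₁]
    simp only [wp_seq, wp_setW, NVar.val_word, h₂, hph₂]
    refine ⟨show P.JJ ph < B by omega, ?_⟩
    refine wp_powP hZB P.n (P.lev ph + 1) (by simp)
      (fun m' hf => by
        simp [hf.nat .n (by simp), hf₂.nat .n (by simp), hf₁.nat .n (by simp),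
          hf₀.nat .n (by decide), hL.n])
      (fun m' hf => by simp [hf.nat .lev (by simp), hf₂.nat .lev (by simp), hf₁.nat .lev (by simp),
        hf.nat .ph (by simp), hph₂, hlev₀ _ hph]) hn1 hlev (show P.nC ph < B by omega) ?_
    intro m₃ hf₃ h₃
    have hph₃ : m₃.nat .ph 0 = ph := by rw [hf₃.nat .ph (by simp)]; simpa using hph₂
    simp only [wp_setW, NVar.val_word, h₃, hph₃]
    refine ⟨show P.nC ph < B by omega, ?_, by simpa using hph₃, ?_, ?_⟩
    · rw [frame_setW (by simp)]
      refine Frame.trans ?_ (hf₃.mono (by simp) (by simp))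
      rw [frame_setW (by simp)]
      exact hf₂.mono (by simp) (by simp)
    · intro ph' hph'
      by_cases h : ph' = ph
      · subst h; simp [hf₃.nat .JJ (by simp), Param.JJ]
      · simp [hf₃.nat .JJ (by simp), h, hf₂.nat .JJ (by simp), h₁ ph' (by omega)]
    · intro ph' hph'
      by_cases h : ph' = ph
      · subst h; simp [Param.nC]
      · simp [hf₃.nat .nC (by simp), h, hf₂.nat .nC (by simp), h₁' ph' (by omega)]
  · rintro m₁ hf₁ ⟨h₁, h₁'⟩
    have hf01 : Frame phasesN [.rr, .cz] m m₁ := hf₀.trans (hf₁.mono (by decide) (by simp))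
    have hB₁ : P.Base m₁ := hL.congr (fun τ h h' => hf01.nat τ (by revert τ; decide))
      (fun τ h h' => hf01.real τ h')
    simp only [wp_seq, wp_setF]
    have v0 : P.rr 0 = (FExp.cast NVar.D.word * RVar.r.num).val inp m₁ := by
      simp only [FExp.val_mul, FExp.val_cast, NVar.val_word, RVar.val_num, hB₁.D, hB₁.r, Param.rr,
        if_true]
    have v1 : P.rr 1 = (lit 2 * RVar.r.num).val inp m₁ := by
      simp only [FExp.val_mul, val_lit, RVar.val_num, hB₁.r, Param.rr, one_ne_zero, if_false,
        Nat.cast_ofNat]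
    have v2 : P.cz 0 = (lit 2 * FExp.cast NVar.PS.word * FExp.cast NVar.D.word).val inp m₁ := by
      simp only [FExp.val_mul, FExp.val_cast, NVar.val_word, hB₁.D, hB₁.PS, Param.cz,
        if_true, val_lit, Nat.cast_pow, Nat.cast_ofNat]
    have v3 : P.cz 1 = (lit 8589934592 *
        FExp.cast (NVar.D.word * NVar.D.word * NVar.D.word * NVar.D.word)).val inp m₁ := by
      simp only [FExp.val_mul, FExp.val_cast, NVar.val_word, hB₁.D, Param.cz, WExp.val_mul,
        one_ne_zero, if_false, val_lit, Nat.cast_mul, Nat.cast_ofNat]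
    refine hQ _ ?_ (hB₁.loaded_setF (fun ph hph => ?_) (fun ph hph => ?_) h₁ h₁' v0.symm ?_ ?_ ?_)
    · rw [frame_setF (by simp), frame_setF (by simp), frame_setF (by simp), frame_setF (by simp)]
      exact hf01
    · rw [hf₁.nat .lev (by simp), hlev₀ _ hph]
    · rw [hf₁.nat .kk (by simp), hkk₀ _ hph]
    · rw [v1]; rfl
    · rw [v2]; rfl
    · rw [v3]; rfl

/-- The rows of the data matrix. -/
def rowMatrix (D d n : ℕ) (V : ℕ → ℝ) (X : ℕ → ℝ) : Prop :=
  ∀ x < n, ∀ i < D, X (x * D + i) = if i < d then V (x * d + i) else 0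

/-- What the preprocessing leaves in the memory. -/
structure Ready (P : Param) (V : ℕ → ℝ) (ω : ℕ → Bool) (m : Mem) : Prop extends P.Loaded m where
  rows : rowMatrix P.D P.d P.n V (m.real .X)
  G : ∀ i < P.D, m.nat .G i = coinWord ω (i * P.S) P.S
  W : ∀ i < P.t * P.mm, m.nat .W i = coinWord ω (P.D * P.S + i * P.S) P.S
  values : ∀ x < P.n, m.real .fv x = dot (m.nat .G) (m.real .X) P.D x
  order : IsSorting (m.real .fv) P.n (m.nat .ord)
  table : P.Filled (m.nat .W) (m.real .X) (m.nat .tab) 2 0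

lemma wp_preP (hF : P.FitsPre Z B) (hP : P.Ok) (hn : m.nat .n 0 = P.n) (hd : m.nat .d 0 = P.d)
    (hp : m.real .p 0 = P.p) (hr : m.real .r 0 = P.r) (hco : m.coins = 0)
    (hQ : ∀ m', Ready P inp ω m' → Q m') :
    wp Z B ω inp preP Q m := by
  have hZB := hF.lt
  rw [preP, wp_seq]
  refine wp_paramsP hF hP hn hd hp hr ?_
  intro m₁ hf₁ h₁
  rw [wp_seq]
  refine wp_phasesP hF hP h₁ ?_
  intro m₂ hf₂ h₂
  have hco₂ : m₂.coins = 0 := by rw [hf₂.coins, hf₁.coins, hco]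
  rw [wp_seq]
  refine wp_for [.x, .i] [.X] P.n (fun k m' => rowMatrix P.D P.d k inp (m'.real .X)) hZB (by simp)
    hF.n_le (fun m' hf => by simp [hf.nat .n (by simp), h₂.n])
    (fun j m' v h => by simpa using h) (by simp [rowMatrix]) ?_ ?_
  · intro x hx m' hf h hx'
    have hL' := h₂.frame hf (by decide) (by decide)
    refine wp_copyRowP hZB x (x * P.d) P.d P.D
      (fun m'' hf' => by simp [hf'.nat .x (by simp), hx'])
      (fun m'' hf' => by simp [hf'.nat .x (by simp), hx', hf'.nat .d (by simp), hL'.d])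
      hL'.d hL'.D hF.D_le ?_
    intro m'' hf' h1 h2
    refine ⟨hf'.mono (by simp) (by simp), by rw [hf'.nat .x (by simp), hx'], ?_⟩
    intro x' hx' i hi
    by_cases e : x' = x
    · subst e; exact h1 i hi
    · rw [h2 x' i e hi, h x' (by omega) i hi]
  intro m₃ hf₃ h₃
  have hL₃ := h₂.frame hf₃ (by decide) (by decide)
  have hSB : 2 ^ P.S ≤ B := by have := hF.S_le; have := hF.sketch_lt; omega
  rw [wp_seq]
  refine wp_drawP hZB P.D P.S hL₃.S hF.S_le_Z hSB hF.D_le (by simp)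
    (fun m' h => by simp [h .D (by simp), hL₃.D]) ?_
  intro m₄ hn₄ hr₄ hc₄ hG₄
  have hL₄ := hL₃.congr (fun τ h => hn₄ τ (by revert τ; decide)) (fun τ _ => by rw [hr₄])
  rw [hf₃.coins, hco₂] at hG₄ hc₄
  rw [wp_seq]
  refine wp_drawP hZB (P.t * P.mm) P.S hL₄.S hF.S_le_Z hSB hF.draw_le (by simp)
    (fun m' h => by simp [h .t (by simp), h .mm (by simp), hL₄.t, hL₄.mm]) ?_
  intro m₅ hn₅ hr₅ hc₅ hW₅
  have hL₅ := hL₄.congr (fun τ h => hn₅ τ (by revert τ; decide)) (fun τ _ => by rw [hr₅])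
  rw [hc₄] at hW₅
  rw [wp_seq]
  refine wp_orderP hZB P.n P.D hL₅.n hF.n_le hL₅.D hF.D_le ?_
  intro m₆ hf₆ h₆ h₆'
  have hL₆ := hL₅.frame hf₆ (by decide) (by decide)
  have hW₆ : ∀ i < P.t * P.mm, m₆.nat .W i = m₅.nat .W i := fun i _ => by
    rw [hf₆.nat .W (by simp)]
  refine wp_tableP hF hL₆ hP.one_le_n hW₆ (fun i hi => ?_) ?_
  · rw [hW₅ i hi]
    exact (coinWord_lt _ _).trans_le hSB
  intro m₇ hf₇ h₇
  have hX₆ : m₆.real .X = m₅.real .X := hf₆.real .X (by simp)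
  have hX₇ : m₇.real .X = m₃.real .X := by rw [hf₇.real .X (by decide), hX₆, hr₅, hr₄]
  have hG₅ : m₅.nat .G = m₄.nat .G := hn₅ .G (by simp)
  have hG₇ : m₇.nat .G = m₄.nat .G := by
    rw [hf₇.nat .G (by decide), hf₆.nat .G (by decide), hG₅]
  have hW₇ : m₇.nat .W = m₅.nat .W := by rw [hf₇.nat .W (by decide), hf₆.nat .W (by decide)]
  have hfv₇ : m₇.real .fv = m₆.real .fv := hf₇.real .fv (by decide)
  refine hQ m₇ ⟨hL₆.frame hf₇ (by decide) (by decide), ?_, ?_, ?_, ?_, ?_, ?_⟩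
  · rw [hX₇]; exact h₃
  · intro i hi
    rw [hG₇, hG₄ i hi, zero_add]
  · intro i hi
    rw [hW₇, hW₅ i hi, zero_add]
  · intro x hx
    rw [hfv₇, h₆ x hx, hG₇, hG₅, hX₇, hr₅, hr₄]
  · rw [hfv₇, hf₇.nat .ord (by decide)]; exact h₆'
  · rw [hW₇, hX₇]
    rwa [hX₆, hr₅, hr₄] at h₇

end Pre

/-! ### The query -/

lemma encode_succ' (k : ℕ) (f : ℕ → ℕ) (m : ℕ) :
    encode k f (m + 1) = f 0 + k * encode k (fun e => f (e + 1)) m := by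
  simp only [encode, Finset.sum_range_succ', Finset.mul_sum, pow_zero, mul_one, add_comm (f 0)]
  congr 1
  exact Finset.sum_congr rfl fun e _ => by ring

lemma digit_encode {k m e : ℕ} {f : ℕ → ℕ} (hf : ∀ e < m, f e < k) (he : e < m) :
    digit k (encode k f m) e = f e := by
  induction m generalizing f e with
  | zero => omega
  | succ m ih =>
    have h0 := hf 0 (by omega)
    rw [encode_succ']
    cases e with
    | zero => simp [digit, Nat.mod_eq_of_lt h0]
    | succ e =>
      have h1 := ih (f := fun e => f (e + 1)) (e := e) (fun e he => hf _ (by omega)) (by omega)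
      rw [← h1, digit, digit, pow_succ', ← Nat.div_div_eq_div_mul, add_comm,
        Nat.mul_add_div (by omega), Nat.div_eq_of_lt h0, add_zero]

lemma sketch_congr (W : ℕ → ℕ) {D : ℕ} (T mm : ℕ) (hD : 0 < D) {w w' : ℕ → ℝ}
    (h : ∀ i < D, w i = w' i) (b : ℕ) : sketch W D T mm w b = sketch W D T mm w' b := by
  unfold sketch
  congr 1
  funext e
  rw [Below, Below, h _ (Nat.mod_lt _ hD)]

lemma image_congr_rows (a : ℝ) {X X' : ℕ → ℝ} {D n M : ℕ} {cen : ℕ → ℕ} (hcen : ∀ e ≤ M, cen e < n)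
    (h : ∀ x < n, ∀ i < D, X (x * D + i) = X' (x * D + i)) (scale : ℝ) {x i : ℕ} (hx : x < n)
    (hi : i < D) : image a X D M cen scale x i = image a X' D M cen scale x i := by
  unfold image
  have key : ∀ z, push a M (fun e => X (cen e * D + i)) z = push a M (fun e => X' (cen e * D + i)) z :=
    fun z => push_congr a M (fun e _ he => h _ (hcen e he) i hi) z
  rw [key, key, h x hx i hi, h _ (hcen 0 (Nat.zero_le _)) i hi]

/-- The centers of the step `j`: the last answers before the rounds in progress. -/
def centers (k : ℕ) (y : ℕ → ℕ) (j e : ℕ) : ℕ := y (j / k ^ e * k ^ e)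

namespace Param
variable (P : Param)

/-- The sequence `y` of answers is correct in the step `j`, for the query in the row `n`. -/
def Step (W : ℕ → ℕ) (X : ℕ → ℝ) (ph : ℕ) (y : ℕ → ℕ) (j : ℕ) : Prop :=
  ∀ x < P.n,
    mismatch (P.bits W X ph j (centers (P.kk ph) y j) x)
      (P.bits W X ph j (centers (P.kk ph) y j) P.n) P.t ≤ P.tp →
    mismatch (P.bits W X ph j (centers (P.kk ph) y j) (y (j + 1)))
      (P.bits W X ph j (centers (P.kk ph) y j) P.n) P.t ≤ P.tp

/-- The first `J` answers are correct. -/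
structure Run (W : ℕ → ℕ) (X : ℕ → ℝ) (ph J : ℕ) (y : ℕ → ℕ) : Prop where
  lt : ∀ j ≤ J, y j < P.n
  step : ∀ j < J, P.Step W X ph y j

/-- `y` is the first point whose value `f y` is at least `s`, if there is one. -/
def IsFirst (n : ℕ) (f : ℕ → ℝ) (s : ℝ) (y : ℕ) : Prop :=
  y < n ∧ ∀ x < n, s ≤ f x → s ≤ f y ∧ f y ≤ f x

/-- The result of a query. -/
structure Result (inp : ℕ → ℝ) (m : Mem) (X : ℕ → ℝ) (ans : ℕ) : Prop where
  old : ∀ x < P.n, ∀ i < P.D, X (x * P.D + i) = m.real .X (x * P.D + i)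
  new : ∀ i < P.D, X (P.n * P.D + i) = if i < P.d then inp i else 0
  run : ∃ y₀ y₁ : ℕ → ℕ,
    IsFirst P.n (dot (m.nat .G) X P.D) (dot (m.nat .G) X P.D P.n - 2 ^ P.S * P.D * P.r) (y₀ 0) ∧
    P.Run (m.nat .W) X 0 (P.JJ 0) y₀ ∧ y₁ 0 = y₀ (P.JJ 0) ∧ P.Run (m.nat .W) X 1 (P.JJ 1) y₁ ∧
    ans = y₁ (P.JJ 1)

variable {P}

/-- The centers of step j are answers given at times at most j, so later answers can be appended
without spoiling earlier steps. -/
lemma Step.congr {W : ℕ → ℕ} {X : ℕ → ℝ} {ph j : ℕ} {y y' : ℕ → ℕ} (h : P.Step W X ph y j)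
    (hy : ∀ i ≤ j + 1, y i = y' i) : P.Step W X ph y' j := by
  have e : centers (P.kk ph) y j = centers (P.kk ph) y' j := by
    funext e
    exact hy _ ((Nat.div_mul_le_self _ _).trans (Nat.le_succ _))
  rw [Step, ← e, ← hy _ le_rfl]
  exact h

lemma bits_congr_cen (W : ℕ → ℕ) (X : ℕ → ℝ) (ph j : ℕ) {cen cen' : ℕ → ℕ}
    (h : ∀ e ≤ P.lev ph, cen e = cen' e) (x b : ℕ) :
    P.bits W X ph j cen x b = P.bits W X ph j cen' x b := by
  unfold bits
  congr 1
  funext i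
  exact image_congr _ _ _ _ h _ _ _

lemma D_pos : 0 < P.D := Nat.pow_pos (by norm_num)

/-- The query writes its point into the row n, after the table has been filled. The entries stay
valid because data points and centers are rows below n. -/
lemma bits_congr_rows (W : ℕ → ℕ) {X X' : ℕ → ℝ} (ph j : ℕ) {cen : ℕ → ℕ}
    (hcen : ∀ e ≤ P.lev ph, cen e < P.n)
    (h : ∀ x < P.n, ∀ i < P.D, X (x * P.D + i) = X' (x * P.D + i)) {x : ℕ} (hx : x < P.n) (b : ℕ) :
    P.bits W X ph j cen x b = P.bits W X' ph j cen x b :=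
  sketch_congr _ _ _ D_pos (fun _ hi => image_congr_rows _ hcen h _ hx hi) _

end Param

section Query
variable {Z B : ℕ} {ω : ℕ → Bool} {inp V : ℕ → ℝ} {m : Mem} {Q : Mem → Prop} {P : Param}

lemma wp_searchP (hF : P.Fits Z B) (hP : P.Ok) (hL : P.Loaded m) {f : ℕ → ℝ} {s : ℝ}
    (hs : m.real .sum 0 = s) (hf : ∀ x < P.n, m.real .fv x = f x)
    (ho : IsSorting (m.real .fv) P.n (m.nat .ord))
    (hQ : ∀ m', Frame [.lo, .hi, .b, .mid, .y] [] m m' →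
      Param.IsFirst P.n f (s - 2 ^ P.S * P.D * P.r) (m'.nat .y 0) → Q m') :
    wp Z B ω inp searchP Q m := by
  have hZB := hF.lt
  have hnB := hF.n_lt
  have hnu := hF.nu_le
  have hn := hP.n_le
  have hn1 := hP.one_le_n
  set o := m.nat .ord with ho'
  set fv := m.real .fv with hfv
  set thr := s - 2 ^ P.S * P.D * P.r with hthr
  have fr : ∀ m' u v, Frame [.lo, .hi, .b, .mid, .y] [] ((m.setW .lo 0 u).setW .hi 0 v) m' →
    Frame [.lo, .hi, .b, .mid, .y] [] m m' := fun m' _ _ h => Frame.trans (by simp) h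
  simp only [searchP, wp_seq, wp_put, WExp.val_ofNat, NVar.val_word, ne_eq, reduceCtorEq,
    not_false_eq_true, Mem.setW_ne, hL.n]
  refine ⟨by omega, by omega, ?_⟩
  -- Positions below `lo` carry values below the threshold, positions from `hi` on do not. The gap
  -- is less than a power of 2 that is halved in every round; n ≤ 2^nu makes nu + 1 rounds enough.
  refine wp_for [.lo, .hi, .b, .mid, .y] [] (P.nu + 1) (fun j m' =>
    m'.nat .lo 0 ≤ m'.nat .hi 0 ∧ m'.nat .hi 0 ≤ P.n ∧
    m'.nat .hi 0 - m'.nat .lo 0 < 2 ^ (P.nu + 1 - j) ∧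
    (∀ i < m'.nat .lo 0, fv (o i) < thr) ∧ (∀ i < P.n, m'.nat .hi 0 ≤ i → thr ≤ fv (o i))) hZB
    (by simp) hnu (fun m' h => by simp [h.nat .nu (by simp), hL.nu])
    (fun j m' v h => by simpa using h) ?_ ?_ ?_
  · simp only [ne_eq, reduceCtorEq, not_false_eq_true, Mem.setW_ne, Mem.setW_same,
      Function.update_self, Nat.sub_zero, Nat.zero_le, le_refl, true_and, pow_succ]
    exact ⟨by omega, by simp, fun i h h' => by omega⟩
  · rintro j hj m' hf' ⟨h1, h2, h3, h4, h5⟩ hj'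
    have hfm := fr _ _ _ hf'
    have hL' := hL.frame hfm (by decide) (by decide)
    have hs' : m'.real .sum 0 = s := by rw [hfm.real .sum (by simp), hs]
    have hfv' : m'.real .fv = fv := hfm.real .fv (by simp)
    have ho'' : m'.nat .ord = o := hfm.nat .ord (by simp)
    have e1 : 2 ^ (P.nu + 1 - j) = 2 * 2 ^ (P.nu + 1 - (j + 1)) := by
      rw [← pow_succ']; congr 1; omega
    rw [e1] at h3
    set lo := m'.nat .lo 0 with hlo
    set hi := m'.nat .hi 0 with hhi
    set mid := (lo + hi) / 2 with hmid
    simp only [wp_ite, wp_seq, wp_put, wp_skip, Test.val_ltW, Test.val_ltF, NVar.val_word,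
      WExp.val_div, WExp.val_add, WExp.val_ofNat, FExp.val_get, FExp.val_sub, FExp.val_mul,
      FExp.val_cast, WExp.val_mul, RVar.val_num, WExp.val_get, ne_eq, reduceCtorEq, not_false_eq_true,
      Mem.setW_ne, Mem.setW_same, Function.update_self, Mem.setW_real, hs', hfv', ho'', hL'.PS, hL'.D,
      hL'.r, ← hlo, ← hhi, ← hmid]
    have e2 : s - ((2 ^ P.S * P.D : ℕ) : ℝ) * P.r = thr := by rw [hthr]; push_cast; ring
    rw [e2]
    refine ⟨fun h => ⟨by omega, fun h' => ⟨by omega, by simp, by simpa using hj', ?_⟩,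
      fun h' => ⟨by omega, by simp, by simpa using hj', ?_⟩⟩, fun h => ⟨Frame.refl, hj', ?_⟩⟩
    · refine ⟨by omega, h2, by omega, fun i hi' => ?_, h5⟩
      exact (ho.mono i mid (by omega) (by omega)).trans_lt h'
    · refine ⟨by omega, by omega, by omega, h4, fun i hi' hm => ?_⟩
      exact (not_lt.1 h').trans (ho.mono mid i hm hi')
    · exact ⟨h1, h2, by have : 0 < 2 ^ (P.nu + 1 - (j + 1)) := by positivity
                        omega, h4, h5⟩
  · rintro m' hf' ⟨h1, h2, h3, h4, h5⟩
    have hfm := fr _ _ _ hf'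
    have hL' := hL.frame hfm (by decide) (by decide)
    have ho'' : m'.nat .ord = o := hfm.nat .ord (by simp)
    rw [Nat.sub_self, pow_zero] at h3
    set lo := m'.nat .lo 0 with hlo
    simp only [wp_ite, wp_put, Test.val_ltW, NVar.val_word, hL'.n, WExp.val_get, WExp.val_ofNat,
      ho'', ← hlo]
    refine ⟨fun h => ⟨(ho.lt _ h).trans hnB, hQ _ (by simpa using hfm) ?_⟩,
      fun h => ⟨by omega, hQ _ (by simpa using hfm) ?_⟩⟩
    · simp only [Mem.setW_same, Function.update_self]
      refine ⟨ho.lt _ h, fun x hx hfx => ?_⟩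
      rw [← hf x hx] at hfx ⊢
      rw [← hf _ (ho.lt _ h)]
      obtain ⟨i, hi, rfl⟩ := ho.surj x hx
      refine ⟨h5 _ h (by omega), ho.mono _ _ ?_ hi⟩
      by_contra h'
      exact absurd (h4 i (by omega)) (not_lt.2 hfx)
    -- All values are below the threshold. The answer 0 is a mere default, and what is claimed about
    -- it is void.
    · simp only [Mem.setW_same, Function.update_self]
      refine ⟨by omega, fun x hx hfx => ?_⟩
      rw [← hf x hx] at hfx
      obtain ⟨i, hi, rfl⟩ := ho.surj x hx
      exact absurd (h4 i (by omega)) (not_lt.2 hfx)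

lemma mixed_radix_lt {j J c C b T : ℕ} (hj : j < J) (hc : c < C) (hb : b < T) :
    (j * C + c) * T + b < J * C * T := by
  have e1 : j * C + c + 1 ≤ J * C := by nlinarith
  have e2 := Nat.mul_le_mul_right T e1
  nlinarith

/-- The word arrays that `stepP` may change. -/
def stepN : List NVar := [.hist, .dig, .cen, .q, .pw, .e, .i, .l, .h, .b, .par, .v, .bit, .cc, .bb, .y]

/-- The real arrays that `stepP` may change. -/
def stepR : List RVar := [.rad, .scale, .tmp, .z, .w]

lemma wp_stepP (hF : P.Fits Z B) (hP : P.Ok) (hL : P.Loaded m) {W : ℕ → ℕ} {X : ℕ → ℝ} {ph j : ℕ}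
    {y : ℕ → ℕ} (hph : m.nat .ph 0 = ph) (hph2 : ph < 2) (hj : m.nat .j 0 = j) (hjJ : j < P.JJ ph)
    (hW : ∀ i < P.t * P.mm, m.nat .W i = W i) (hWB : ∀ i < P.t * P.mm, W i < B)
    (hX : ∀ x < P.n, ∀ i < P.D, X (x * P.D + i) = m.real .X (x * P.D + i))
    (ht : P.Filled W X (m.nat .tab) 2 0) (hy : ∀ i ≤ j, y i < P.n)
    (hh : ∀ i < j, m.nat .hist i = y i) (hyj : m.nat .y 0 = y j)
    (hQ : ∀ m' y', Frame stepN stepR m m' → (∀ i ≤ j, y' i = y i) → y' (j + 1) < P.n →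
      (∀ i ≤ j, m'.nat .hist i = y' i) → m'.nat .y 0 = y' (j + 1) →
      P.Step W (m.real .X) ph y' j → Q m') :
    wp Z B ω inp stepP Q m := by
  have hZB := hF.lt
  have hnB := hF.n_lt
  have hlev := hF.lev_le ph hph2
  have hJZ := hF.JJ_le ph hph2
  have hkpos : 1 ≤ P.kk ph := by
    by_contra h
    have h0 : P.kk ph = 0 := by omega
    rw [Param.JJ, h0, zero_pow (by omega)] at hjJ
    omega
  have hyB : y j < B := (hy j le_rfl).trans hnB
  rw [stepP, wp_seq, wp_setW]
  simp only [NVar.val_word, hyj, hj]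
  refine ⟨hyB, ?_⟩
  have hf₀ : Frame stepN stepR m (m.setW .hist j (y j)) := by simp [stepN]
  have hh₀ : ∀ i ≤ j, (m.setW .hist j (y j)).nat .hist i = y i := by
    intro i hi
    by_cases h : i = j
    · subst h; simp
    · simp [h, hh i (by omega)]
  generalize m.setW .hist j (y j) = m₀ at hf₀ hh₀
  have hL₀ := hL.frame hf₀ (by decide) (by decide)
  have hph₀ : m₀.nat .ph 0 = ph := by rw [hf₀.nat .ph (by decide), hph]
  have hj₀ : m₀.nat .j 0 = j := by rw [hf₀.nat .j (by decide), hj]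
  rw [wp_seq]
  refine wp_digitsP hZB j (P.kk ph) (P.lev ph + 1) (by simp) (by simp) (by simp [hj₀]) (by omega)
    (fun m' hf => by simp [hf.nat .kk (by decide), hf.nat .ph (by decide), hph₀, hL₀.kk _ hph2])
    (fun m' hf => by simp [hf.nat .lev (by decide), hf.nat .ph (by decide), hph₀, hL₀.lev _ hph2])
    hlev ?_
  intro m₁ hf₁ h₁
  have hL₁ := hL₀.frame hf₁ (by decide) (by decide)
  have hph₁ : m₁.nat .ph 0 = ph := by rw [hf₁.nat .ph (by decide), hph₀]
  rw [wp_seq]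
  refine wp_scaleP hZB (M := P.lev ph) (dig := digit (P.kk ph) j) (by rw [hph₁, hL₁.lev _ hph2])
    (by omega) (fun e he => h₁ e (by omega)) ?_
  intro m₂ hf₂ h₂
  rw [hph₁, hL₁.a, hL₁.cz _ hph2, hL₁.rr _ hph2] at h₂
  have hf02 : Frame [.dig, .q, .e, .l, .h] [.rad, .scale] m₀ m₂ :=
    (hf₁.mono (by simp) (by simp)).trans (hf₂.mono (by simp) (by simp))
  have hL₂ := hL₀.frame hf02 (by decide) (by decide)
  have hph₂ : m₂.nat .ph 0 = ph := by rw [hf02.nat .ph (by decide), hph₀]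
  have hj₂ : m₂.nat .j 0 = j := by rw [hf02.nat .j (by decide), hj₀]
  have hh₂ : ∀ i ≤ j, m₂.nat .hist i = y i := by rw [hf02.nat .hist (by decide)]; exact hh₀
  simp only [wp_seq, wp_put, NVar.val_word, WExp.val_ofNat, hj₂]
  refine ⟨by omega, by omega, ?_⟩
  refine wp_for [.e, .cen, .q, .pw] [] (P.lev ph + 1) (fun k m' =>
    (∀ e < k, m'.nat .cen e = centers (P.kk ph) y j e) ∧ m'.nat .q 0 = j / P.kk ph ^ k ∧
    m'.nat .pw 0 = P.kk ph ^ k) hZB (by simp) hlev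
    (fun m' hf => by simp [hf.nat .lev (by simp), hf.nat .ph (by simp), hph₂, hL₂.lev _ hph2])
    (fun j m' v h => by simpa using h) (by simp) ?_ ?_
  · rintro e he m' hf ⟨g1, g2, g3⟩ he'
    have hhist : m'.nat .hist = m₂.nat .hist := by rw [hf.nat .hist (by simp)]; simp
    have hk' : m'.nat .kk ph = P.kk ph := by rw [hf.nat .kk (by simp)]; simpa using hL₂.kk _ hph2
    have hph' : m'.nat .ph 0 = ph := by rw [hf.nat .ph (by simp)]; simpa using hph₂
    have hle := Nat.div_mul_le_self j (P.kk ph ^ e)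
    have e1 : j / P.kk ph ^ e / P.kk ph = j / P.kk ph ^ (e + 1) := by
      rw [Nat.div_div_eq_div_mul, pow_succ]
    have e2 : P.kk ph ^ (e + 1) ≤ P.JJ ph := Nat.pow_le_pow_right hkpos he
    have e3 := Nat.div_le_self j (P.kk ph ^ (e + 1))
    simp only [wp_setW, wp_seq, wp_put, WExp.val_get, WExp.val_mul, WExp.val_div, NVar.val_word, g2, g3,
      he', hhist, hh₂ _ hle, ne_eq, reduceCtorEq, not_false_eq_true, Mem.setW_ne, hk', hph', e1,
      ← pow_succ]
    refine ⟨(hy _ hle).trans hnB, by omega, by omega, by simp, by simp, ?_, by simp, by simp⟩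
    intro e' h
    by_cases h' : e' = e
    · subst h'; simp [centers]
    · simp [h', g1 e' (by omega)]
  rintro m₃ hf₃ ⟨hcen₃, -, -⟩
  have hf₃' := Frame.trans (m := m₂) (by simp) hf₃
  have hf03 : Frame [.dig, .q, .e, .l, .h, .cen, .pw] [.rad, .scale] m₀ m₃ :=
    (hf02.mono (by simp) (by simp)).trans (hf₃'.mono (by simp) (by simp))
  have hL₃ := hL₀.frame hf03 (by decide) (by decide)
  have hph₃ : m₃.nat .ph 0 = ph := by rw [hf03.nat .ph (by decide), hph₀]
  have hj₃ : m₃.nat .j 0 = j := by rw [hf03.nat .j (by decide), hj₀]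
  have hX₃ : m₃.real .X = m.real .X := by rw [hf03.real .X (by decide), hf₀.real .X (by decide)]
  refine wp_sketch_row hF hL₃ (W := W) (j := j) (cen := centers (P.kk ph) y j) P.n hph₃ hph2
    (fun e he => hcen₃ e (by omega)) (by rw [hf₃'.real .scale (by simp), h₂])
    (by rw [hf03.nat .W (by decide), hf₀.nat .W (by decide)]; exact hW) hWB
    (fun m' hf => by simp [hf.nat .n (by decide), hL₃.n]) ?_
  intro m₄ hf₄ h₄
  rw [hX₃] at h₄
  have hL₄ := hL₃.frame hf₄ (by decide) (by decide)
  have hcen₄ : ∀ e < P.lev ph + 1, m₄.nat .cen e = centers (P.kk ph) y j e := by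
    rw [hf₄.nat .cen (by decide)]; exact hcen₃
  have hcn : ∀ e, centers (P.kk ph) y j e < P.n := fun e => hy _ (Nat.div_mul_le_self _ _)
  have hph₄ : m₄.nat .ph 0 = ph := by rw [hf₄.nat .ph (by decide), hph₃]
  rw [wp_seq]
  refine wp_encodeP hZB P.n (P.lev ph + 1) (by simp) (by simp) (by simp) (by simp) (by simp)
    (fun m' hf => by simp [hf.nat .n (by decide), hL₄.n]) hP.one_le_n
    (fun m' hf => by simp [hf.nat .lev (by decide), hf.nat .ph (by decide), hph₄, hL₄.lev _ hph2])
    hlev (fun e he => by rw [hcen₄ e he]; exact hcn e) (hF.nC_lt _ hph2) ?_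
  intro m₅ hf₅ h₅
  have hL₅ := hL₄.frame hf₅ (by decide) (by decide)
  have hbit₅ : m₅.nat .bit = m₄.nat .bit := hf₅.nat .bit (by decide)
  have hbitlt : ∀ b < P.t, m₄.nat .bit b < 2 := by
    intro b hb
    rw [h₄ b hb, Param.bits, sketch]
    have := parity_le_one (fun e => Below P.D P.T (P.vec (m.real .X) ph j
      (centers (P.kk ph) y j) P.n) (W (b * P.mm + e))) P.mm
    omega
  rw [wp_seq]
  refine wp_encodeP hZB 2 P.t (by simp) (by simp) (by simp) (by simp) (by simp)
    (fun m' hf => rfl) (by norm_num)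
    (fun m' hf => by simp [hf.nat .t (by decide), hL₅.t])
    hF.t_le (fun b hb => by rw [hbit₅]; exact hbitlt b hb) hF.sketch_lt ?_
  intro m₆ hf₆ h₆
  rw [hbit₅] at h₆
  have hL₆ := hL₅.frame hf₆ (by decide) (by decide)
  have hf46 : Frame [.cc, .bb, .pw, .e] [] m₄ m₆ :=
    (hf₅.mono (by simp) (by simp)).trans (hf₆.mono (by simp) (by simp))
  have hf36 : Frame [.i, .e, .l, .h, .b, .par, .v, .bit, .cc, .bb, .pw] [.tmp, .z, .w] m₃ m₆ :=
    (hf₄.mono (by simp) (by simp)).trans (hf46.mono (by simp) (by simp))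
  have hf06 : Frame (stepN.erase .hist) stepR m₀ m₆ :=
    (hf03.mono (by decide) (by decide)).trans (hf36.mono (by decide) (by decide))
  have hf6 : Frame stepN stepR m m₆ := hf₀.trans (hf06.mono (by decide) (by decide))
  set cc := encode P.n (m₄.nat .cen) (P.lev ph + 1) with hcc
  set bb := encode 2 (m₄.nat .bit) P.t with hbb
  have hccn : cc < P.nC ph := encode_lt fun e he => by rw [hcen₄ e he]; exact hcn e
  have hbbn : bb < 2 ^ P.t := encode_lt hbitlt
  have hv : tabE.val m₆ = 2 * ((j * P.nC ph + cc) * 2 ^ P.t + bb) + ph := by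
    have e1 : m₆.nat .cc 0 = cc := by rw [hf₆.nat .cc (by decide)]; exact h₅
    simp [tabE, hf06.nat .j (by decide), hj₀, hf06.nat .ph (by decide), hph₀, hL₆.nC _ hph2,
      e1, hL₆.TT, h₆]
  have htab₆ : m₆.nat .tab = m.nat .tab := hf6.nat .tab (by decide)
  have hs : (j * P.nC ph + cc) * 2 ^ P.t + bb < P.JJ ph * P.nC ph * 2 ^ P.t :=
    mixed_radix_lt hjJ hccn hbbn
  have hent := ht.1 ph hph2 _ hs
  rw [Param.IsEntryAt] at hent
  have e1 : ((j * P.nC ph + cc) * 2 ^ P.t + bb) / 2 ^ P.t = j * P.nC ph + cc := by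
    rw [Nat.mul_comm _ (2 ^ P.t), Nat.mul_add_div (by positivity), Nat.div_eq_of_lt hbbn, add_zero]
  have e2 : ((j * P.nC ph + cc) * 2 ^ P.t + bb) % 2 ^ P.t = bb := by
    rw [Nat.mul_comm _ (2 ^ P.t), Nat.mul_add_mod, Nat.mod_eq_of_lt hbbn]
  have e3 : (j * P.nC ph + cc) / P.nC ph = j := by
    rw [Nat.mul_comm _ (P.nC ph), Nat.mul_add_div (by omega), Nat.div_eq_of_lt hccn, add_zero]
  have e4 : (j * P.nC ph + cc) % P.nC ph = cc := by
    rw [Nat.mul_comm _ (P.nC ph), Nat.mul_add_mod, Nat.mod_eq_of_lt hccn]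
  rw [e1, e2, e3, e4] at hent
  set y' := m.nat .tab (2 * ((j * P.nC ph + cc) * 2 ^ P.t + bb) + ph) with hy'
  rw [wp_put]
  simp only [WExp.val_get, hv, htab₆, ← hy']
  -- The history is extended by the new answer at the index j + 1. All centers of step j have
  -- indices at most j and are not affected.
  refine ⟨hent.1.trans hnB, hQ _ (Function.update y (j + 1) y') ?_ ?_ ?_ ?_ ?_ ?_⟩
  · rw [frame_setW (by decide)]; exact hf6
  · intro i hi
    rw [Function.update_of_ne (by omega)]
  · simpa using hent.1
  · intro i hi
    rw [Function.update_of_ne (by omega), Mem.setW_ne _ _ _ (by decide), hf06.nat .hist (by decide)]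
    exact hh₀ i hi
  · simp
  · intro x hx hmis
    have ec : centers (P.kk ph) (Function.update y (j + 1) y') j = centers (P.kk ph) y j := by
      funext e
      have := Nat.div_mul_le_self j (P.kk ph ^ e)
      rw [centers, Function.update_of_ne (by omega), centers]
    rw [ec] at hmis ⊢
    rw [Function.update_self]
    -- The entry that is looked up was computed for exactly this situation: the digits of `cc` are
    -- the present centers and those of `bb` are the sketch of the query.
    have key : ∀ x < P.n, mismatch (P.bits W X ph j (digit P.n cc) x) (digit 2 bb) P.t =
        mismatch (P.bits W (m.real .X) ph j (centers (P.kk ph) y j) x)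
          (P.bits W (m.real .X) ph j (centers (P.kk ph) y j) P.n) P.t := by
      intro x hx
      refine mismatch_congr (fun b _ => ?_) (fun b hb => ?_)
      · have hd : ∀ e ≤ P.lev ph, digit P.n cc e = centers (P.kk ph) y j e := by
          intro e he
          rw [← hcen₄ e (by omega), hcc]
          exact digit_encode (fun e he => by rw [hcen₄ e he]; exact hcn e) (by omega)
        rw [Param.bits_congr_cen W X ph j hd x b]
        exact Param.bits_congr_rows W ph j (fun e _ => hcn e) hX hx b
      · rw [← h₄ b hb, hbb]
        exact digit_encode hbitlt hb
    rw [← key x hx] at hmis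
    rw [← key y' hent.1]
    exact hent.2 x hx hmis

lemma wp_queryP (hF : P.Fits Z B) (hP : P.Ok) (hR : Ready P V ω m)
    (hQ : ∀ m' X, P.Result inp m X (m'.nat .n 0) → Q m') : wp Z B ω inp queryP Q m := by
  have hZB := hF.lt
  have hnB := hF.n_lt
  have hSB : 2 ^ P.S < B := hF.S_le.trans_lt hF.sketch_lt
  have hL : P.Loaded m := hR.toLoaded
  rw [queryP, wp_seq]
  refine wp_copyRowP hZB P.n 0 P.d P.D (fun m' hf => by simp [hf.nat .n (by simp), hL.n])
    (fun m' hf => rfl) hL.d hL.D hF.D_le ?_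
  intro m₁ hf₁ hnew hold
  have hL₁ := hL.frame hf₁ (by decide) (by decide)
  set X := m₁.real .X with hX
  have hold' : ∀ x < P.n, ∀ i < P.D, X (x * P.D + i) = m.real .X (x * P.D + i) :=
    fun x hx i hi => hold x i hx.ne hi
  rw [wp_seq]
  refine wp_dotP hZB P.n P.D (fun m' hf => by simp [hf.nat .n (by simp), hL₁.n]) hL₁.D hF.D_le ?_
  intro m₂ hf₂ h₂
  rw [hf₁.nat .G (by simp)] at h₂
  have hf02 : Frame [.i] [.X, .sum] m m₂ :=
    (hf₁.mono (by simp) (by simp)).trans (hf₂.mono (by simp) (by simp))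
  have hL₂ := hL.frame hf02 (by decide) (by decide)
  rw [wp_seq]
  refine wp_searchP hF hP hL₂ (f := dot (m.nat .G) X P.D) h₂ (fun x hx => ?_) ?_ ?_
  · rw [hf02.real .fv (by simp), hR.values x hx]
    exact Finset.sum_congr rfl fun i hi => by rw [hold' x hx i (Finset.mem_range.1 hi)]
  · rw [hf02.real .fv (by simp), hf02.nat .ord (by simp)]
    exact hR.order
  intro m₃ hf₃ h₃
  set y₀ := m₃.nat .y 0 with hy₀
  have hf03 : Frame [.i, .lo, .hi, .b, .mid, .y] [.X, .sum] m m₃ :=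
    (hf02.mono (by simp) (by simp)).trans (hf₃.mono (by simp) (by simp))
  have hX₃ : m₃.real .X = X := by
    rw [hf₃.real .X (by simp), hf₂.real .X (by simp)]
  have hWB : ∀ i < P.t * P.mm, m.nat .W i < B := fun i hi => by
    rw [hR.W i hi]
    exact (coinWord_lt _ _).trans hSB
  set good : ℕ → ℕ → ℕ → Prop := fun ph y y' => ∃ u : ℕ → ℕ, u 0 = y ∧
    P.Run (m.nat .W) X ph (P.JJ ph) u ∧ y' = u (P.JJ ph) with hgood
  rw [wp_seq]
  -- `v ph` is the answer with which the phase `ph` starts; each phase appends the last answer of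
  -- its own run.
  refine wp_for (.ph :: .j :: stepN) stepR 2 (fun ph m' => ∃ v : ℕ → ℕ, v 0 = y₀ ∧
    (∀ i < ph, good i (v i) (v (i + 1))) ∧ m'.nat .y 0 = v ph ∧ v ph < P.n) hZB (by simp) hF.two_le
    (fun _ _ => rfl) (fun j m' v h => by simpa using h)
    ⟨fun _ => y₀, rfl, by simp, hy₀.symm, h₃.1⟩ ?_ ?_
  · rintro ph hph m₄ hf₄ ⟨v, hv0, hv, hv1, hvn⟩ hph₄
    have hf04 : Frame ([.i, .lo, .hi, .b, .mid, .y, .ph, .j] ++ stepN) ([.X, .sum] ++ stepR) m m₄ :=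
      (hf03.mono (by decide) (by decide)).trans (hf₄.mono (by decide) (by decide))
    have hL₄ := hL.frame hf04 (by decide) (by decide)
    have hX₄ : m₄.real .X = X := by rw [hf₄.real .X (by decide), hX₃]
    refine wp_for (.j :: stepN) stepR (P.JJ ph) (fun j m' => ∃ u : ℕ → ℕ, u 0 = v ph ∧
      (∀ i < j, m'.nat .hist i = u i) ∧ m'.nat .y 0 = u j ∧ P.Run (m.nat .W) X ph j u) hZB (by simp)
      (hF.JJ_le _ hph)
      (fun m' hf => by simp [hf.nat .JJ (by decide), hf.nat .ph (by decide), hph₄, hL₄.JJ _ hph])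
      (fun j m' v h => by simpa using h) ?_ ?_ ?_
    · refine ⟨fun _ => v ph, rfl, by simp, hv1, ?_, by simp⟩
      intro j hj
      exact hvn
    · rintro j hj m₅ hf₅ ⟨u, hu0, hu, hu1, hrun⟩ hj₅
      have hL₅ := hL₄.frame hf₅ (by decide) (by decide)
      have hf05 : Frame ([.i, .lo, .hi, .b, .mid, .y, .ph, .j] ++ stepN) ([.X, .sum] ++ stepR) m m₅ :=
        hf04.trans (hf₅.mono (by decide) (by decide))
      have hX₅ : m₅.real .X = X := by rw [hf₅.real .X (by decide), hX₄]
      have htab : m₅.nat .tab = m.nat .tab := hf05.nat .tab (by decide)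
      refine wp_stepP hF hP hL₅ (W := m.nat .W) (X := m.real .X) (ph := ph) (j := j) (y := u)
        (by rw [hf₅.nat .ph (by decide), hph₄]) hph hj₅ hj
        (fun i _ => by rw [hf05.nat .W (by decide)]) hWB
        (by rw [hX₅]; exact fun x hx i hi => (hold' x hx i hi).symm) (by rw [htab]; exact hR.table)
        hrun.lt hu hu1 ?_
      intro m' u' hf' hu' hn' hh' hy' hs'
      rw [hX₅] at hs'
      refine ⟨hf'.mono (by decide) (by decide), by rw [hf'.nat .j (by decide), hj₅], u',
        by rw [hu' 0 (Nat.zero_le _), hu0], fun i hi => hh' i (by omega), hy', ?_, ?_⟩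
      · intro i hi
        by_cases h : i = j + 1
        · subst h; exact hn'
        · rw [hu' i (by omega)]
          exact hrun.lt i (by omega)
      · intro i hi
        by_cases h : i = j
        · subst h; exact hs'
        · exact (hrun.step i (by omega)).congr fun k hk => (hu' k (by omega)).symm
    · rintro m₅ hf₅ ⟨u, hu0, hu, hu1, hrun⟩
      refine ⟨hf₅.mono (by decide) (by decide), by rw [hf₅.nat .ph (by decide), hph₄],
        Function.update v (ph + 1) (u (P.JJ ph)), ?_, ?_, by simpa using hu1,
        by simpa using hrun.lt _ le_rfl⟩
      · rw [Function.update_of_ne (by omega), hv0]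
      · intro i hi
        rw [Function.update_of_ne (by omega)]
        by_cases h : i = ph
        · subst h
          rw [Function.update_self]
          exact ⟨u, hu0, hrun, rfl⟩
        · rw [Function.update_of_ne (by omega)]
          exact hv i (by omega)
  · rintro m₄ hf₄ ⟨v, hv0, hv, hv1, hvn⟩
    rw [wp_put]
    simp only [NVar.val_word, hv1]
    refine ⟨hvn.trans hnB, hQ _ X ⟨hold', fun i hi => by rw [hnew i hi, zero_add], ?_⟩⟩
    obtain ⟨u₀, h0, hr0, e0⟩ := hv 0 (by norm_num)
    obtain ⟨u₁, h1, hr1, e1⟩ := hv 1 (by norm_num)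
    refine ⟨u₀, u₁, ?_, hr0, ?_, hr1, ?_⟩
    · rw [h0, hv0]; exact h₃
    · rw [h1, ← e0]
    · simpa using e1

end Query

/-! ### Mazur maps -/

/-- The `ℓ_P` norm of the first `D` coordinates. -/
def nrm (D : ℕ) (P : ℝ) (v : ℕ → ℝ) : ℝ := (∑ i ∈ Finset.range D, |v i| ^ P) ^ (1 / P)

section Norm
variable {D : ℕ} {P : ℝ} {u v : ℕ → ℝ}

lemma nrm_sum_nonneg : 0 ≤ ∑ i ∈ Finset.range D, |v i| ^ P :=
  Finset.sum_nonneg fun _ _ => Real.rpow_nonneg (abs_nonneg _) _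

lemma nrm_nonneg : 0 ≤ nrm D P v := Real.rpow_nonneg nrm_sum_nonneg _

lemma nrm_mono (hP : 0 ≤ P) (h : ∀ i < D, |u i| ≤ |v i|) : nrm D P u ≤ nrm D P v := by
  refine Real.rpow_le_rpow nrm_sum_nonneg (Finset.sum_le_sum fun i hi => ?_) (by positivity)
  exact Real.rpow_le_rpow (abs_nonneg _) (h i (Finset.mem_range.1 hi)) hP

lemma nrm_congr (h : ∀ i < D, u i = v i) : nrm D P u = nrm D P v := by
  unfold nrm
  congr 1
  exact Finset.sum_congr rfl fun i hi => by rw [h i (Finset.mem_range.1 hi)]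

lemma nrm_add_le (hP : 1 ≤ P) : nrm D P (fun i => u i + v i) ≤ nrm D P u + nrm D P v :=
  Real.Lp_add_le _ _ _ hP

lemma nrm_one : nrm D 1 v = ∑ i ∈ Finset.range D, |v i| := by simp [nrm]

lemma nrm_const_mul (hP : 0 < P) {c : ℝ} (hc : 0 ≤ c) :
    nrm D P (fun i => c * v i) = c * nrm D P v := by
  simp only [nrm, abs_mul, abs_of_nonneg hc, Real.mul_rpow hc (abs_nonneg _), ← Finset.mul_sum]
  rw [Real.mul_rpow (Real.rpow_nonneg hc _) nrm_sum_nonneg, ← Real.rpow_mul hc,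
    mul_one_div_cancel hP.ne', Real.rpow_one]

end Norm

section Mazur
variable {a s t : ℝ}

lemma maz_zero : maz a 0 = 0 := by simp [maz]

lemma maz_neg (s : ℝ) : maz a (-s) = -maz a s := by simp [maz]

lemma maz_of_nonneg (ha : 1 < a) (hs : 0 ≤ s) : maz a s = s ^ a := by
  rw [maz, abs_of_nonneg hs]
  rcases hs.eq_or_lt with rfl | hs
  · rw [zero_mul, Real.zero_rpow (by linarith)]
  · rw [Real.rpow_sub_one hs.ne', mul_div_cancel₀ _ hs.ne']

lemma abs_maz (ha : 1 < a) (s : ℝ) : |maz a s| = |s| ^ a := by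
  rcases le_total 0 s with h | h
  · rw [maz_of_nonneg ha h, abs_of_nonneg h, abs_of_nonneg (Real.rpow_nonneg h _)]
  · have h' : 0 ≤ -s := by linarith
    rw [← neg_neg s, maz_neg, abs_neg, abs_neg, maz_of_nonneg ha h', abs_of_nonneg h',
      abs_of_nonneg (Real.rpow_nonneg h' _)]

/-- A symmetric relation of two reals that is invariant under reflection holds if it holds for
nonnegative reals and for reals of different signs. -/
lemma real_sign_cases {R : ℝ → ℝ → Prop} (symm : ∀ s t, R s t → R t s)
    (neg : ∀ s t, R s t → R (-s) (-t)) (h1 : ∀ s t, 0 ≤ t → t ≤ s → R s t)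
    (h2 : ∀ s t, 0 ≤ s → 0 ≤ t → R s (-t)) (s t : ℝ) : R s t := by
  have pos : ∀ s t, 0 ≤ s → 0 ≤ t → R s t := fun s t hs ht =>
    (le_total t s).elim (h1 s t ht) fun h => symm _ _ (h1 t s hs h)
  rcases le_total 0 s with hs | hs <;> rcases le_total 0 t with ht | ht
  · exact pos s t hs ht
  · simpa using h2 s (-t) hs (by linarith)
  · exact symm _ _ (by simpa using h2 t (-s) ht (by linarith))
  · simpa using neg _ _ (pos (-s) (-t) (by linarith) (by linarith))

/-- The inverse of the Mazur map is 1/a-Hölder. For equal signs this is the superadditivity of x^a,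
with constant 1; for opposite signs it is the convexity inequality (s + t)^a ≤ 2^(a-1) (s^a + t^a),
which determines the constant. -/
lemma abs_sub_rpow_le_maz (ha : 1 < a) (s t : ℝ) :
    |s - t| ^ a ≤ 2 ^ (a - 1) * |maz a s - maz a t| := by
  refine real_sign_cases (R := fun s t => |s - t| ^ a ≤ 2 ^ (a - 1) * |maz a s - maz a t|) ?_ ?_ ?_
    ?_ s t
  · intro s t h
    rwa [abs_sub_comm t, abs_sub_comm (maz a t)]
  · intro s t h
    have e1 : -s - -t = -(s - t) := by ring
    have e2 : -maz a s - -maz a t = -(maz a s - maz a t) := by ring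
    rwa [maz_neg, maz_neg, e1, e2, abs_neg, abs_neg]
  · intro s t ht hts
    have h := Real.add_rpow_le_rpow_add (sub_nonneg.2 hts) ht ha.le
    rw [sub_add_cancel] at h
    have h0 := Real.rpow_nonneg (sub_nonneg.2 hts) a
    have h1 : (1 : ℝ) ≤ 2 ^ (a - 1) := Real.one_le_rpow (by norm_num) (by linarith)
    rw [maz_of_nonneg ha ht, maz_of_nonneg ha (ht.trans hts), abs_of_nonneg (sub_nonneg.2 hts),
      abs_of_nonneg (by linarith)]
    nlinarith
  · intro s t hs ht
    rw [maz_neg, maz_of_nonneg ha hs, maz_of_nonneg ha ht, sub_neg_eq_add, sub_neg_eq_add,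
      abs_of_nonneg (by positivity), abs_of_nonneg (by positivity)]
    lift s to NNReal using hs
    lift t to NNReal using ht
    exact_mod_cast NNReal.rpow_add_le_mul_rpow_add_rpow s t ha.le

lemma maz_sub_le (ha : 1 < a) (ha2 : a ≤ 2) (s t : ℝ) :
    |maz a s - maz a t| ≤ 2 * (|s - t| * max |s| |t| ^ (a - 1)) := by
  refine real_sign_cases
    (R := fun s t => |maz a s - maz a t| ≤ 2 * (|s - t| * max |s| |t| ^ (a - 1))) ?_ ?_ ?_ ?_ s t
  · intro s t h
    rwa [abs_sub_comm t, abs_sub_comm (maz a t), max_comm]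
  · intro s t h
    have e1 : -s - -t = -(s - t) := by ring
    have e2 : -maz a s - -maz a t = -(maz a s - maz a t) := by ring
    rwa [maz_neg, maz_neg, e1, e2, abs_neg, abs_neg, abs_neg, abs_neg]
  · intro s t ht hts
    have hs := ht.trans hts
    rcases hs.eq_or_lt with rfl | hs'
    · obtain rfl : t = 0 := le_antisymm hts ht
      simp
    · have key : t * s ^ (a - 1) ≤ t ^ (a - 1) * s := by
        have e1 : t ^ (a - 1) * t ^ (2 - a) = t := by
          rw [← Real.rpow_add_of_nonneg ht (by linarith) (by linarith)]
          norm_num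
        have e2 : s ^ (2 - a) * s ^ (a - 1) = s := by
          rw [← Real.rpow_add_of_nonneg hs (by linarith) (by linarith)]
          norm_num
        have h1 : t ^ (2 - a) ≤ s ^ (2 - a) := Real.rpow_le_rpow ht hts (by linarith)
        calc t * s ^ (a - 1) = t ^ (a - 1) * t ^ (2 - a) * s ^ (a - 1) := by rw [e1]
          _ ≤ t ^ (a - 1) * s ^ (2 - a) * s ^ (a - 1) := by gcongr
          _ = t ^ (a - 1) * s := by rw [mul_assoc, e2]
      have hmono : maz a t ≤ maz a s := by
        rw [maz_of_nonneg ha ht, maz_of_nonneg ha hs]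
        exact Real.rpow_le_rpow ht hts (by linarith)
      rw [abs_of_nonneg (sub_nonneg.2 hmono), abs_of_nonneg hs, abs_of_nonneg ht,
        abs_of_nonneg (sub_nonneg.2 hts), max_eq_left hts, maz, maz, abs_of_nonneg hs,
        abs_of_nonneg ht]
      have hS : 0 ≤ s ^ (a - 1) := Real.rpow_nonneg hs _
      refine le_of_mul_le_mul_left ?_ hs'
      nlinarith [mul_nonneg (mul_nonneg (sub_nonneg.2 hts) (sub_nonneg.2 hts)) hS,
        mul_le_mul_of_nonneg_left key ht]
  · intro s t hs ht
    have h1 : s ^ (a - 1) ≤ max s t ^ (a - 1) :=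
      Real.rpow_le_rpow hs (le_max_left _ _) (by linarith)
    have h2 : t ^ (a - 1) ≤ max s t ^ (a - 1) :=
      Real.rpow_le_rpow ht (le_max_right _ _) (by linarith)
    have h3 : 0 ≤ max s t ^ (a - 1) := Real.rpow_nonneg (le_max_of_le_left hs) _
    rw [maz_neg, sub_neg_eq_add, sub_neg_eq_add, abs_neg, abs_of_nonneg hs, abs_of_nonneg ht,
      abs_of_nonneg (by positivity : 0 ≤ s + t), maz, maz, abs_of_nonneg hs, abs_of_nonneg ht,
      abs_of_nonneg (by positivity)]
    nlinarith [mul_le_mul_of_nonneg_left h1 hs, mul_le_mul_of_nonneg_left h2 ht, mul_nonneg hs h3,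
      mul_nonneg ht h3]

end Mazur

/-! ### Mazur maps between ℓ norms. -/

section MazurNorm
variable {D : ℕ} {a Q : ℝ}

lemma nrm_maz (ha : 1 < a) (hQ : 1 ≤ Q) (s : ℕ → ℝ) :
    nrm D Q (fun i => maz a (s i)) = nrm D (a * Q) s ^ a := by
  rw [nrm, nrm, ← Real.rpow_mul nrm_sum_nonneg]
  congr 1
  · refine Finset.sum_congr rfl fun i _ => ?_
    rw [abs_maz ha, ← Real.rpow_mul (abs_nonneg _)]
  · field_simp

lemma nrm_rpow_le_maz (ha : 1 < a) (hQ : 1 ≤ Q) (s t : ℕ → ℝ) :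
    nrm D (a * Q) (fun i => s i - t i) ^ a ≤
      2 ^ (a - 1) * nrm D Q (fun i => maz a (s i) - maz a (t i)) := by
  rw [← nrm_const_mul (by linarith) (by positivity), ← nrm_maz ha hQ]
  refine nrm_mono (by linarith) fun i _ => ?_
  rw [abs_maz ha, abs_mul, abs_of_nonneg (by positivity : (0 : ℝ) ≤ 2 ^ (a - 1))]
  exact abs_sub_rpow_le_maz ha _ _

/-- Hölder's inequality with the exponents a and a / (a - 1), applied to |u|^Q and w^((a-1)Q). -/
lemma nrm_mul_rpow_le (ha : 1 < a) (hQ : 1 ≤ Q) {u w : ℕ → ℝ} (hw : ∀ i, 0 ≤ w i) :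
    nrm D Q (fun i => u i * w i ^ (a - 1)) ≤
      nrm D (a * Q) u * nrm D (a * Q) w ^ (a - 1) := by
  have hconj : a.HolderConjugate (a / (a - 1)) := Real.HolderConjugate.conjExponent ha
  have ha0 : a - 1 ≠ 0 := by linarith
  have h := Real.inner_le_Lp_mul_Lq (Finset.range D) (fun i => |u i| ^ Q)
    (fun i => (w i ^ (a - 1)) ^ Q) hconj
  have e1 : ∀ i, |u i| ^ Q * (w i ^ (a - 1)) ^ Q = |u i * w i ^ (a - 1)| ^ Q := fun i => by
    have := Real.rpow_nonneg (hw i) (a - 1)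
    rw [abs_mul, abs_of_nonneg this, Real.mul_rpow (abs_nonneg _) this]
  have e2 : ∀ i, |(|u i| ^ Q)| ^ a = |u i| ^ (a * Q) := fun i => by
    rw [abs_of_nonneg (Real.rpow_nonneg (abs_nonneg _) _), ← Real.rpow_mul (abs_nonneg _), mul_comm]
  have e3 : ∀ i, |(w i ^ (a - 1)) ^ Q| ^ (a / (a - 1)) = |w i| ^ (a * Q) := fun i => by
    rw [abs_of_nonneg (Real.rpow_nonneg (Real.rpow_nonneg (hw i) _) _), abs_of_nonneg (hw i),
      ← Real.rpow_mul (hw i), ← Real.rpow_mul (hw i)]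
    congr 1
    field_simp
  simp only [e1, e2, e3] at h
  have hQ0 : Q ≠ 0 := by linarith
  calc nrm D Q (fun i => u i * w i ^ (a - 1))
      ≤ ((∑ i ∈ Finset.range D, |u i| ^ (a * Q)) ^ (1 / a) *
        (∑ i ∈ Finset.range D, |w i| ^ (a * Q)) ^ (1 / (a / (a - 1)))) ^ (1 / Q) :=
        Real.rpow_le_rpow nrm_sum_nonneg h (by positivity)
    _ = _ := by
      rw [Real.mul_rpow (Real.rpow_nonneg nrm_sum_nonneg _) (Real.rpow_nonneg nrm_sum_nonneg _),
        ← Real.rpow_mul nrm_sum_nonneg, ← Real.rpow_mul nrm_sum_nonneg, nrm, nrm,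
        ← Real.rpow_mul nrm_sum_nonneg]
      congr 2 <;> field_simp

/-- The local Lipschitz constant of the map is a power of max(|s|, |t|) ≤ |s| + |s - t|, whose norm
is at most R + r; Hölder's inequality then separates the two factors. The bound is small only for
small R, which is why each map is recentered at a point close to the query. -/
lemma nrm_maz_sub_le (ha : 1 < a) (ha2 : a ≤ 2) (hQ : 1 ≤ Q) {s t : ℕ → ℝ} {R r : ℝ}
    (hs : nrm D (a * Q) s ≤ R) (hr : nrm D (a * Q) (fun i => s i - t i) ≤ r) :
    nrm D Q (fun i => maz a (s i) - maz a (t i)) ≤ 2 * r * (R + r) ^ (a - 1) := by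
  have hP : 1 ≤ a * Q := by nlinarith
  set w : ℕ → ℝ := fun i => max |s i| |t i| with hw
  have hw0 : ∀ i, 0 ≤ w i := fun i => le_max_of_le_left (abs_nonneg _)
  have h1 : nrm D (a * Q) w ≤ R + r := by
    calc nrm D (a * Q) w ≤ nrm D (a * Q) (fun i => |s i| + |s i - t i|) := by
          refine nrm_mono (by linarith) fun i _ => ?_
          rw [abs_of_nonneg (hw0 i), abs_of_nonneg (by positivity)]
          refine max_le (by linarith [abs_nonneg (s i - t i)]) ?_
          have := abs_add_le (s i) (t i - s i)
          rw [add_sub_cancel, abs_sub_comm (t i)] at this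
          exact this
      _ ≤ nrm D (a * Q) (fun i => |s i|) + nrm D (a * Q) (fun i => |s i - t i|) := nrm_add_le hP
      _ = nrm D (a * Q) s + nrm D (a * Q) (fun i => s i - t i) := by simp only [nrm, abs_abs]
      _ ≤ R + r := add_le_add hs hr
  calc nrm D Q (fun i => maz a (s i) - maz a (t i))
      ≤ nrm D Q (fun i => 2 * ((s i - t i) * w i ^ (a - 1))) := by
        refine nrm_mono (by linarith) fun i _ => ?_
        rw [abs_mul, abs_mul, abs_of_nonneg (Real.rpow_nonneg (hw0 i) _)]
        simpa using maz_sub_le ha ha2 (s i) (t i)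
    _ = 2 * nrm D Q (fun i => (s i - t i) * w i ^ (a - 1)) :=
        nrm_const_mul (by linarith) (by norm_num)
    _ ≤ 2 * (nrm D (a * Q) (fun i => s i - t i) * nrm D (a * Q) w ^ (a - 1)) :=
        mul_le_mul_of_nonneg_left (nrm_mul_rpow_le ha hQ hw0) (by norm_num)
    _ ≤ 2 * (r * (R + r) ^ (a - 1)) := by
        have := nrm_nonneg (D := D) (P := a * Q) (v := fun i => s i - t i)
        have h2 : nrm D (a * Q) w ^ (a - 1) ≤ (R + r) ^ (a - 1) :=
          Real.rpow_le_rpow nrm_nonneg h1 (by linarith)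
        have h3 := Real.rpow_nonneg (nrm_nonneg (D := D) (P := a * Q) (v := w)) (a - 1)
        exact mul_le_mul_of_nonneg_left (mul_le_mul hr h2 h3 (this.trans hr)) (by norm_num)
    _ = _ := by ring

end MazurNorm

/-! ### The iterated search -/

/-- One step of the search is successful: if the current point is within the search radius of `q`
and `x` within the near radius, then the next point is within `9 / 10` of the search radius. -/
def StepOk (D : ℕ) (a cz : ℝ) (k M : ℕ) (rr : ℝ) (q x : ℕ → ℝ) (y : ℕ → ℕ → ℝ) (j : ℕ) : Prop :=
  let B : (ℕ → ℝ) → ℕ → ℝ := fun v i => push a M (fun e => y (j / k ^ e * k ^ e) i) (v i)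
  nrm D 1 (fun i => B q i - B (y j) i) ≤ searchRad a cz (digit k j) M rr →
  nrm D 1 (fun i => B q i - B x i) ≤ nearRad a cz (digit k j) M rr →
  nrm D 1 (fun i => B q i - B (y (j + 1)) i) ≤ 9 / 10 * searchRad a cz (digit k j) M rr

/-- The hypotheses are the cases a = 1 and a = 2, and the general case is their geometric mean: c
u^(a-1) = c^(2-a) (cu)^(a-1). -/
lemma mul_rpow_sub_one_le {a c u v : ℝ} (ha : 1 < a) (ha2 : a ≤ 2) (hc : 0 ≤ c) (hu : 0 ≤ u)
    (h1 : c ≤ v) (h2 : c * u ≤ v * v) : c * u ^ (a - 1) ≤ v ^ a := by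
  have hv : 0 ≤ v := hc.trans h1
  have e1 : c ^ (2 - a) * c ^ (a - 1) = c := by
    rw [← Real.rpow_add_of_nonneg hc (by linarith) (by linarith)]; norm_num
  have e2 : v ^ (2 - a) * (v * v) ^ (a - 1) = v ^ a := by
    rw [Real.mul_rpow hv hv, ← Real.rpow_add_of_nonneg hv (by linarith) (by linarith),
      ← Real.rpow_add_of_nonneg hv (by linarith) (by linarith)]
    congr 1; ring
  calc c * u ^ (a - 1) = c ^ (2 - a) * (c * u) ^ (a - 1) := by
        rw [Real.mul_rpow hc hu, ← mul_assoc, e1]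
    _ ≤ v ^ (2 - a) * (v * v) ^ (a - 1) := by
        gcongr
    _ = v ^ a := e2

section Search
variable {D : ℕ} {a cz : ℝ} {k : ℕ}

lemma searchRad_succ (a cz : ℝ) (δ : ℕ → ℕ) (M : ℕ) (rr : ℝ) :
    searchRad a cz δ (M + 1) rr =
      searchRad a cz δ M (2 * rr * |ratio cz (M + 1) (δ (M + 1)) * rr + rr| ^ (a - 1)) := rfl

lemma searchRad_congr (a cz : ℝ) (M : ℕ) {δ δ' : ℕ → ℕ} (h : ∀ e ≤ M, δ e = δ' e) (rr : ℝ) :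
    searchRad a cz δ M rr = searchRad a cz δ' M rr := by
  rw [searchRad, searchRad, h 0 (Nat.zero_le _), nearRad_congr a cz M h]

lemma digit_top {M i j : ℕ} (hi : i < k) (hj : j < k ^ M) : digit k (i * k ^ M + j) M = i := by
  have h0 : 0 < k ^ M := Nat.pow_pos (by omega)
  rw [digit, mul_comm, Nat.mul_add_div h0, Nat.div_eq_of_lt hj, add_zero, Nat.mod_eq_of_lt hi]

lemma block_div {M e : ℕ} (hk : 0 < k) (he : e ≤ M) (i j : ℕ) :
    (i * k ^ M + j) / k ^ e = i * k ^ (M - e) + j / k ^ e := by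
  have h1 : k ^ M = k ^ e * k ^ (M - e) := by rw [← pow_add]; congr 1; omega
  rw [h1, show i * (k ^ e * k ^ (M - e)) + j = k ^ e * (i * k ^ (M - e)) + j by ring,
    Nat.mul_add_div (Nat.pow_pos hk)]

lemma digit_block {M e : ℕ} (hk : 0 < k) (he : e < M) (i j : ℕ) :
    digit k (i * k ^ M + j) e = digit k j e := by
  rw [digit, block_div hk he.le, digit]
  have h1 : M - e = M - e - 1 + 1 := by omega
  rw [h1, pow_succ, ← mul_assoc, Nat.add_comm, Nat.add_mul_mod_self_right]

/-- A block of k^M consecutive steps is one round at height M. Inside it the lower digits and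
centers are those of a search that starts at the beginning of the block, which is what the induction
on the height needs. -/
lemma center_block {M e : ℕ} (hk : 0 < k) (he : e ≤ M) (i j : ℕ) :
    (i * k ^ M + j) / k ^ e * k ^ e = i * k ^ M + j / k ^ e * k ^ e := by
  rw [block_div hk he, add_mul, mul_assoc, ← pow_add, Nat.sub_add_cancel he]

/-- The iterated search reduces the distance to the query to the near radius, up to a constant. -/
theorem search_spec (ha : 1 < a) (ha2 : a ≤ 2) (hcz0 : 0 ≤ cz) (hcz : cz * (9 / 10) ^ k ≤ 1)
    (M : ℕ) (hM : ∀ h < M, 3 * (8589934592 * 5 ^ h) ≤ cz) {rr : ℝ} (hrr : 0 < rr) {q x : ℕ → ℝ}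
    {y : ℕ → ℕ → ℝ} (hx : nrm D (a ^ M) (fun i => q i - x i) ≤ rr)
    (hy : nrm D (a ^ M) (fun i => q i - y 0 i) ≤ (8589934592 * 5 ^ M + cz) * rr)
    (hstep : ∀ j < k ^ (M + 1), StepOk D a cz k M rr q x y j) :
    nrm D (a ^ M) (fun i => q i - y (k ^ (M + 1)) i) ≤ (8589934592 * 5 ^ M + cz * (9 / 10) ^ k) * rr := by
  induction M generalizing rr q x y with
  | zero =>
    simp only [pow_zero, zero_add, pow_one, mul_one] at hx hy hstep ⊢
    -- At height 0 each step multiplies the search ratio by at most 9/10, and this is at most the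
    -- next ratio because the constant term of `ratio` does not decrease.
    have key : ∀ j ≤ k, nrm D 1 (fun i => q i - y j i) ≤ (8589934592 + cz * (9 / 10) ^ j) * rr := by
      intro j hj
      induction j with
      | zero => simpa using hy
      | succ j ih =>
        have h1 := ih (by omega)
        have hs := hstep j (by omega)
        have hd : digit k j 0 = j := by simp [digit, Nat.mod_eq_of_lt (show j < k by omega)]
        simp only [StepOk, push, searchRad, nearRad, hd, ratio, pow_zero, mul_one] at hs
        refine (hs h1 hx).trans ?_
        rw [pow_succ]
        nlinarith
    exact key k le_rfl
  | succ M ih =>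
    have hM' := hM M (by omega)
    set K := k ^ (M + 1) with hK
    set ρ : ℕ → ℝ := fun i => 8589934592 * 5 ^ (M + 1) + cz * (9 / 10) ^ i with hρ
    have h5 : (1 : ℝ) ≤ 5 ^ M := one_le_pow₀ (by norm_num)
    have hQ : 1 ≤ a ^ M := one_le_pow₀ ha.le
    have ePQ : a ^ (M + 1) = a * a ^ M := pow_succ' _ _
    rw [ePQ] at hx hy ⊢
    -- Induction on the rounds at the top height: after i rounds the distance is at most ρ i times
    -- the near radius.
    have key : ∀ i ≤ k, nrm D (a * a ^ M) (fun l => q l - y (i * K) l) ≤ ρ i * rr := by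
      intro i hi
      induction i with
      | zero => simpa [hρ] using hy
      | succ i ihi =>
        have hnow := ihi (by omega)
        have hk : 0 < k := by omega
        have hpos : 0 ≤ cz * (9 / 10 : ℝ) ^ i := by positivity
        have hle1 : (9 / 10 : ℝ) ^ i ≤ 1 := pow_le_one₀ (by norm_num) (by norm_num)
        have hρlow : 8589934592 * 5 ^ (M + 1) ≤ ρ i := by simp only [hρ]; linarith
        have hρ0 : 0 < ρ i := lt_of_lt_of_le (by positivity) hρlow
        set c := y (i * K) with hc
        -- The near radius for the images, by `nrm_maz_sub_le` with R = ρ i · rr.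
        set rr' := 2 * rr * (ρ i * rr + rr) ^ (a - 1) with hrr'
        have hbase : 0 < ρ i * rr + rr := by positivity
        have hrr0 : 0 < rr' := by positivity
        have hlast := ih (fun h hh => hM h (by omega)) hrr0 (q := fun l => maz a (q l - c l))
          (x := fun l => maz a (x l - c l)) (y := fun j l => maz a (y (i * K + j) l - c l)) ?_ ?_ ?_
        · have e1 := nrm_rpow_le_maz (D := D) ha hQ (fun l => q l - c l)
            (fun l => y (i * K + K) l - c l)
          have e2 : (fun l => q l - c l - (y (i * K + K) l - c l)) =
              fun l => q l - y ((i + 1) * K) l := by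
            funext l; rw [Nat.succ_mul]; ring
          rw [e2] at e1
          have hC : 8589934592 * 5 ^ M + cz * (9 / 10) ^ k ≤ 8589934592 * 5 ^ M + 1 := by linarith
          set C : ℝ := 8589934592 * 5 ^ M + 1 with hCdef
          have hC0 : 0 < C := by positivity
          have hfour : (2 : ℝ) ^ (a - 1) ≤ 2 := by
            calc (2 : ℝ) ^ (a - 1) ≤ 2 ^ (1 : ℝ) :=
                  Real.rpow_le_rpow_of_exponent_le (by norm_num) (by linarith)
              _ = 2 := Real.rpow_one 2
          have hρ' : ρ (i + 1) = 9 / 10 * ρ i + 1 / 10 * (8589934592 * 5 ^ (M + 1)) := by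
            simp only [hρ, pow_succ]; ring
          have hρ'0 : 0 < ρ (i + 1) := by rw [hρ']; positivity
          have hB : (8589934592 : ℝ) * 5 ^ (M + 1) = 5 * (8589934592 * 5 ^ M) := by
            rw [pow_succ]; ring
          -- Put b = 2^33 · 5^M. Then C = b + 1, ρ i = 5b + s with s = cz (9/10)^i, and the next
          -- ratio is 5b + 9s/10. By interpolation it suffices that 4(b + 1) and the root of 4(b +
          -- 1)(5b + s + 1) are at most 5b + 9s/10, which holds because 5 exceeds 4 and b is large.
          -- The 4 consists of 2 from the Lipschitz bound and 2^(a-1) ≤ 2 from the Hölder bound.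
          have main : 4 * C * (ρ i + 1) ^ (a - 1) ≤ ρ (i + 1) ^ a := by
            obtain ⟨s, hs⟩ : ∃ s, ρ i = 8589934592 * 5 ^ (M + 1) + s := ⟨_, rfl⟩
            obtain ⟨b, hb⟩ : ∃ b : ℝ, b = 8589934592 * 5 ^ M := ⟨_, rfl⟩
            have hb0 : 1000000000 ≤ b := by rw [hb]; linarith
            rw [hs, hB] at hρlow
            rw [hs, hB] at hρ'
            rw [hs, hρ', hB, hCdef, ← hb]
            rw [← hb] at hρlow
            refine mul_rpow_sub_one_le ha ha2 (by linarith) (by linarith) (by linarith) ?_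
            have hs0 : 0 ≤ s := by linarith
            nlinarith [mul_nonneg hs0 hs0, mul_nonneg (sub_nonneg.2 hb0) hs0,
              mul_nonneg (sub_nonneg.2 hb0) (sub_nonneg.2 hb0)]
          have e3 : nrm D (a * a ^ M) (fun l => q l - y ((i + 1) * K) l) ^ a ≤
              (ρ (i + 1) * rr) ^ a := by
            calc _ ≤ 2 ^ (a - 1) * (C * rr') := by
                  refine e1.trans (mul_le_mul_of_nonneg_left (hlast.trans ?_) (by positivity))
                  exact mul_le_mul_of_nonneg_right hC hrr0.le
              _ ≤ 2 * (C * rr') := by gcongr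
              _ = 4 * C * (ρ i + 1) ^ (a - 1) * (rr * rr ^ (a - 1)) := by
                  have e4 : ρ i * rr + rr = (ρ i + 1) * rr := by ring
                  rw [hrr', e4, Real.mul_rpow (by positivity) hrr.le]
                  ring
              _ ≤ ρ (i + 1) ^ a * (rr * rr ^ (a - 1)) := by gcongr
              _ = (ρ (i + 1) * rr) ^ a := by
                  rw [Real.mul_rpow hρ'0.le hrr.le, Real.rpow_sub_one hrr.ne',
                    mul_div_cancel₀ _ hrr.ne']
          exact (Real.rpow_le_rpow_iff nrm_nonneg (by positivity) (by linarith)).1 e3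
        · refine nrm_maz_sub_le ha ha2 hQ hnow ?_
          have e1 : (fun l => q l - c l - (x l - c l)) = fun l => q l - x l := by
            funext l; ring
          rwa [e1]
        -- The block starts at its own center, whose image is 0, so the starting distance below is
        -- the norm of the image of the query.
        · simp only [add_zero, ← hc, sub_self, maz_zero, sub_zero]
          rw [nrm_maz ha hQ]
          calc nrm D (a * a ^ M) (fun l => q l - c l) ^ a ≤ (ρ i * rr) ^ a :=
                Real.rpow_le_rpow nrm_nonneg hnow (by linarith)
            _ = ρ i * rr * (ρ i * rr) ^ (a - 1) := by
                rw [Real.rpow_sub_one (by positivity), mul_div_cancel₀ _ (by positivity)]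
            _ ≤ ρ i * rr * (ρ i * rr + rr) ^ (a - 1) := by
                gcongr
                linarith
            -- This is the role of `hM`: ρ i ≤ 5b + cz with b = 2^33 · 5^M, and 5b + cz ≤ 2(b + cz)
            -- amounts to 3b ≤ cz.
            _ ≤ (2 * (8589934592 * 5 ^ M + cz)) * rr * (ρ i * rr + rr) ^ (a - 1) := by
                gcongr
                simp only [hρ, pow_succ]
                nlinarith
            _ = _ := by rw [hrr']; ring
        · intro j hj
          have hjK : i * K + j < k ^ (M + 1 + 1) := by
            rw [pow_succ, ← hK]; nlinarith
          have hs := hstep _ hjK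
          have hdM : digit k (i * K + j) (M + 1) = i := digit_top (by omega) hj
          have hde : ∀ e ≤ M, digit k (i * K + j) e = digit k j e := fun e he =>
            digit_block hk (by omega) i j
          have hce : ∀ e ≤ M, (i * K + j) / k ^ e * k ^ e = i * K + j / k ^ e * k ^ e := fun e he =>
            center_block hk (by omega) i j
          have hcM : (i * K + j) / k ^ (M + 1) * k ^ (M + 1) = i * K := by
            rw [hK, center_block hk le_rfl, Nat.div_eq_of_lt hj, zero_mul, add_zero]
          have hrad : |ratio cz (M + 1) i * rr + rr| = ρ i * rr + rr := abs_of_pos hbase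
          have hpush : ∀ l z, push a (M + 1) (fun e => y ((i * K + j) / k ^ e * k ^ e) l) z =
              push a M (fun e => maz a (y (i * K + j / k ^ e * k ^ e) l - c l)) (maz a (z - c l)) := by
            intro l z
            simp only [push, hcM]
            exact push_congr a M (fun e _ he => by rw [hce e he]) _
          simp only [StepOk, hpush, searchRad_succ, nearRad, hdM, hrad] at hs ⊢
          rw [← hrr', searchRad_congr a cz M hde, nearRad_congr a cz M hde] at hs
          exact hs
    have := key k le_rfl
    have e : k * K = k ^ (M + 1 + 1) := by rw [hK, pow_succ' k (M + 1)]
    rwa [e] at this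

end Search

/-! ### Random thresholds -/

section Thresholds
open Classical in
/-- The number of thresholds that separate `u` from `w`. -/
def separating (T : ℕ) (u w : ℝ) : ℕ :=
  ((Finset.range T).filter fun k : ℕ =>
    ¬ (u < (4 * (k : ℝ) + 2) / T - 2 ↔ w < (4 * (k : ℝ) + 2) / T - 2)).card

/-- An interval (α, β] contains ⌊β⌋ - ⌊α⌋ integers, so thresholds are counted with an error of at
most 1 per coordinate. -/
lemma card_filter_le_of_mem_Ioc {T : ℕ} {p : ℕ → Prop} [DecidablePred p] {α β : ℝ} (h : α ≤ β)
    (hp : ∀ k < T, p k → α < k ∧ (k : ℝ) ≤ β) :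
    (((Finset.range T).filter p).card : ℝ) ≤ β - α + 1 := by
  have h1 : ((Finset.range T).filter p).card ≤ (Finset.Ioc ⌊α⌋ ⌊β⌋).card := by
    refine Finset.card_le_card_of_injOn (fun k : ℕ => (k : ℤ)) ?_ (Nat.cast_injective.injOn)
    intro k hk
    simp only [Finset.coe_filter, Finset.mem_range, Set.mem_ofPred_eq] at hk
    obtain ⟨h1, h2⟩ := hp k hk.1 hk.2
    simp only [Finset.coe_Ioc, Set.mem_Ioc]
    exact ⟨Int.floor_lt.2 (by exact_mod_cast h1), Int.le_floor.2 (by exact_mod_cast h2)⟩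
  rw [Int.card_Ioc] at h1
  have h2 : ((⌊β⌋ - ⌊α⌋).toNat : ℤ) = ⌊β⌋ - ⌊α⌋ :=
    Int.toNat_of_nonneg (sub_nonneg.2 (Int.floor_le_floor h))
  have h3 : (((⌊β⌋ - ⌊α⌋).toNat : ℕ) : ℝ) = (⌊β⌋ : ℝ) - ⌊α⌋ := by exact_mod_cast h2
  have h4 : (((Finset.range T).filter p).card : ℝ) ≤ ((⌊β⌋ - ⌊α⌋).toNat : ℕ) := by exact_mod_cast h1
  have h5 := Int.floor_le β
  have h6 := Int.lt_floor_add_one α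
  linarith

lemma le_card_filter_of_mem_Ioc {T : ℕ} {p : ℕ → Prop} [DecidablePred p] {α β : ℝ} (hα : -1 ≤ α)
    (hβ : β < T) (hp : ∀ k < T, α < k → (k : ℝ) ≤ β → p k) :
    β - α - 1 ≤ (((Finset.range T).filter p).card : ℝ) := by
  have h1 : (Finset.Ioc ⌊α⌋ ⌊β⌋).card ≤ ((Finset.range T).filter p).card := by
    refine Finset.card_le_card_of_injOn (fun k : ℤ => k.toNat) ?_ ?_
    · intro k hk
      simp only [Finset.coe_Ioc, Set.mem_Ioc] at hk
      have h0 : -1 ≤ ⌊α⌋ := Int.le_floor.2 (by exact_mod_cast hα)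
      have hk0 : 0 ≤ k := by omega
      lift k to ℕ using hk0
      have h2 : α < k := by exact_mod_cast Int.floor_lt.1 hk.1
      have h3 : (k : ℝ) ≤ β := by exact_mod_cast Int.le_floor.1 hk.2
      have hkT : k < T := by exact_mod_cast h3.trans_lt hβ
      simpa [hkT] using hp k hkT h2 h3
    · intro k hk k' hk' h
      simp only [Finset.coe_Ioc, Set.mem_Ioc] at hk hk'
      have h0 : -1 ≤ ⌊α⌋ := Int.le_floor.2 (by exact_mod_cast hα)
      simp only at h
      omega
  rw [Int.card_Ioc] at h1
  have h2 : (⌊β⌋ : ℤ) - ⌊α⌋ ≤ ((⌊β⌋ - ⌊α⌋).toNat : ℤ) := Int.self_le_toNat _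
  have h3 : (⌊β⌋ : ℝ) - ⌊α⌋ ≤ (((⌊β⌋ - ⌊α⌋).toNat : ℕ) : ℝ) := by exact_mod_cast h2
  have h4 : (((⌊β⌋ - ⌊α⌋).toNat : ℕ) : ℝ) ≤ (((Finset.range T).filter p).card : ℝ) := by
    exact_mod_cast h1
  have h5 := Int.floor_le α
  have h6 := Int.lt_floor_add_one β
  linarith

/-- The thresholds are the midpoints of T equal cells of [-2, 2]. In this form the separating ones
are the integers in an interval of length T|u - w| / 4. -/
lemma lt_threshold_iff {T : ℕ} (hT : 0 < T) (u : ℝ) (k : ℕ) :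
    u < (4 * (k : ℝ) + 2) / T - 2 ↔ T * (u + 2) / 4 - 1 / 2 < k := by
  have : (0 : ℝ) < T := by exact_mod_cast hT
  rw [lt_sub_iff_add_lt, lt_div_iff₀ this]
  constructor <;> intro h <;> linarith

lemma separating_comm (T : ℕ) (u w : ℝ) : separating T u w = separating T w u := by
  unfold separating
  congr 1
  exact Finset.filter_congr fun k _ => not_congr iff_comm

lemma separating_le {T : ℕ} (hT : 0 < T) (u w : ℝ) :
    (separating T u w : ℝ) ≤ T / 4 * |u - w| + 1 := by
  have hT' : (0 : ℝ) < T := by exact_mod_cast hT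
  wlog h : u ≤ w generalizing u w
  · rw [separating_comm, abs_sub_comm]
    exact this w u (le_of_not_ge h)
  classical
  have h1 : (T : ℝ) * (u + 2) / 4 - 1 / 2 ≤ T * (w + 2) / 4 - 1 / 2 := by nlinarith
  have h2 : (separating T u w : ℝ) ≤ (T * (w + 2) / 4 - 1 / 2) - (T * (u + 2) / 4 - 1 / 2) + 1 := by
    refine card_filter_le_of_mem_Ioc h1 fun k _ hk => ?_
    rw [lt_threshold_iff hT, lt_threshold_iff hT] at hk
    by_cases hu : (T : ℝ) * (u + 2) / 4 - 1 / 2 < k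
    · exact ⟨hu, not_lt.1 fun hw => hk ⟨fun _ => hw, fun _ => hu⟩⟩
    · exact absurd ⟨fun h => absurd h hu, fun h => absurd (h1.trans_lt h) hu⟩ hk
  rw [abs_sub_comm, abs_of_nonneg (sub_nonneg.2 h)]
  linarith

/-- All thresholds lie in [-2, 2], so w can be moved to the nearest point of this interval, at
distance at most 3 from u. The bound keeps the probability of separation away from 1, where the
parity of many tests would be biased again. -/
lemma separating_le_of_abs_le_one {T : ℕ} (hT : 0 < T) {u : ℝ} (hu : |u| ≤ 1) (w : ℝ) :
    (separating T u w : ℝ) ≤ 3 / 4 * T + 1 := by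
  have hT' : (0 : ℝ) < T := by exact_mod_cast hT
  obtain ⟨hu1, hu2⟩ := abs_le.1 hu
  have key : ∀ w' : ℝ, |u - w'| ≤ 3 → (∀ k < T, w < (4 * (k : ℝ) + 2) / T - 2 ↔
      w' < (4 * (k : ℝ) + 2) / T - 2) → (separating T u w : ℝ) ≤ 3 / 4 * T + 1 := by
    intro w' h1 h2
    have e : separating T u w = separating T u w' := by
      unfold separating
      congr 1
      refine Finset.filter_congr fun k hk => ?_
      rw [h2 k (Finset.mem_range.1 hk)]
    rw [e]
    refine (separating_le hT u w').trans ?_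
    nlinarith
  rcases le_total w 2 with hw | hw
  · rcases le_total (-2) w with hw' | hw'
    · exact key w (abs_le.2 ⟨by linarith, by linarith⟩) fun _ _ => Iff.rfl
    · refine key (-2) (abs_le.2 ⟨by linarith, by linarith⟩) fun k _ => ?_
      have : (0 : ℝ) < (4 * (k : ℝ) + 2) / T := by positivity
      exact ⟨fun _ => by linarith, fun _ => by linarith⟩
  · refine key 2 (abs_le.2 ⟨by linarith, by linarith⟩) fun k hk => ?_
    have hk' : (k : ℝ) + 1 ≤ T := by exact_mod_cast hk
    have : (4 * (k : ℝ) + 2) / T ≤ 4 := by rw [div_le_iff₀ hT']; linarith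
    exact ⟨fun h => by linarith, fun h => by linarith⟩

/-- Thresholds extend only by 1 beyond the range [-1, 1] of u, hence the truncation of the distance
at 1. -/
lemma le_separating {T : ℕ} (hT : 0 < T) {u : ℝ} (hu : |u| ≤ 1) (w : ℝ) :
    T / 4 * min |u - w| 1 - 1 ≤ (separating T u w : ℝ) := by
  classical
  have hT' : (1 : ℝ) ≤ T := by exact_mod_cast hT
  obtain ⟨hu1, hu2⟩ := abs_le.1 hu
  rcases le_total u w with h | h
  · set w' := min w (u + 1) with hw'
    have h1 : min |u - w| 1 = w' - u := by
      rw [abs_sub_comm, abs_of_nonneg (sub_nonneg.2 h), hw', ← min_sub_sub_right, add_sub_cancel_left]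
    have h2 : w' ≤ u + 1 := min_le_right _ _
    have h3 : w' ≤ w := min_le_left _ _
    have := le_card_filter_of_mem_Ioc (T := T) (p := fun k : ℕ =>
      ¬ (u < (4 * (k : ℝ) + 2) / T - 2 ↔ w < (4 * (k : ℝ) + 2) / T - 2))
      (α := T * (u + 2) / 4 - 1 / 2) (β := T * (w' + 2) / 4 - 1 / 2) (by nlinarith) (by nlinarith)
      (fun k hk hα hβ => by
        rw [lt_threshold_iff hT, lt_threshold_iff hT]
        intro hiff
        have := hiff.1 hα
        nlinarith)
    rw [h1]
    refine le_trans (le_of_eq ?_) this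
    ring
  · set w' := max w (u - 1) with hw'
    have h1 : min |u - w| 1 = u - w' := by
      rw [abs_of_nonneg (sub_nonneg.2 h), hw', ← min_sub_sub_left, sub_sub_cancel]
    have h2 : u - 1 ≤ w' := le_max_right _ _
    have h3 : w ≤ w' := le_max_left _ _
    have := le_card_filter_of_mem_Ioc (T := T) (p := fun k : ℕ =>
      ¬ (u < (4 * (k : ℝ) + 2) / T - 2 ↔ w < (4 * (k : ℝ) + 2) / T - 2))
      (α := T * (w' + 2) / 4 - 1 / 2) (β := T * (u + 2) / 4 - 1 / 2) (by nlinarith) (by nlinarith)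
      (fun k hk hα hβ => by
        rw [lt_threshold_iff hT, lt_threshold_iff hT]
        intro hiff
        have := hiff.2 (by nlinarith)
        linarith)
    rw [h1]
    refine le_trans (le_of_eq ?_) this
    ring

lemma sum_range_mul_eq {M : Type*} [AddCommMonoid M] (f : ℕ → M) (T D : ℕ) :
    ∑ v ∈ Finset.range (T * D), f v = ∑ i ∈ Finset.range D, ∑ k ∈ Finset.range T, f (k * D + i) := by
  rw [Finset.sum_comm]
  induction T with
  | zero => simp
  | succ T ih => rw [Nat.succ_mul, Finset.sum_range_add, ih, Finset.sum_range_succ]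

open Classical in
/-- The number of words that separate `u` from `w`. -/
def sepWords (D T : ℕ) (u w : ℕ → ℝ) : ℕ :=
  ((Finset.range (T * D)).filter fun v => ¬ (Below D T u v ↔ Below D T w v)).card

/-- A word encodes a coordinate, its remainder modulo D, and a threshold, its quotient. A uniform
word below TD thus chooses both uniformly and independently. -/
lemma sepWords_eq {D T : ℕ} (hD : 0 < D) (u w : ℕ → ℝ) :
    sepWords D T u w = ∑ i ∈ Finset.range D, separating T (u i) (w i) := by
  classical
  rw [sepWords, Finset.card_filter, sum_range_mul_eq]
  refine Finset.sum_congr rfl fun i hi => ?_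
  rw [separating, Finset.card_filter]
  refine Finset.sum_congr rfl fun k _ => ?_
  have hi' := Finset.mem_range.1 hi
  have e1 : (k * D + i) % D = i := by
    rw [Nat.mul_comm, Nat.mul_add_mod, Nat.mod_eq_of_lt hi']
  have e2 : (k * D + i) / D = k := by
    rw [Nat.mul_comm, Nat.mul_add_div hD, Nat.div_eq_of_lt hi', add_zero]
  simp only [Below, e1, e2]

variable {D T : ℕ} {u w : ℕ → ℝ}

lemma sepWords_le (hD : 0 < D) (hT : 0 < T) :
    (sepWords D T u w : ℝ) ≤ T / 4 * ∑ i ∈ Finset.range D, |u i - w i| + D := by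
  rw [sepWords_eq hD, Finset.mul_sum]
  push_cast
  calc ∑ i ∈ Finset.range D, (separating T (u i) (w i) : ℝ)
      ≤ ∑ i ∈ Finset.range D, (T / 4 * |u i - w i| + 1) :=
        Finset.sum_le_sum fun i _ => separating_le hT _ _
    _ = _ := by rw [Finset.sum_add_distrib]; simp

lemma abs_le_of_sum_le {R : ℝ} (hu : ∑ i ∈ Finset.range D, |u i| ≤ R) {i : ℕ} (hi : i < D) :
    |u i| ≤ R :=
  (Finset.single_le_sum (f := fun i => |u i|) (fun _ _ => abs_nonneg _)
    (Finset.mem_range.2 hi)).trans hu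

lemma sepWords_le_of_sum_le_one (hD : 0 < D) (hT : 0 < T)
    (hu : ∑ i ∈ Finset.range D, |u i| ≤ 1) : (sepWords D T u w : ℝ) ≤ D * (3 / 4 * T + 1) := by
  rw [sepWords_eq hD]
  push_cast
  calc ∑ i ∈ Finset.range D, (separating T (u i) (w i) : ℝ)
      ≤ ∑ i ∈ Finset.range D, ((3 : ℝ) / 4 * T + 1) := Finset.sum_le_sum fun i hi =>
        separating_le_of_abs_le_one hT (abs_le_of_sum_le hu (Finset.mem_range.1 hi)) _
    _ = _ := by simp; ring

/-- The truncation does no harm for c ≤ 1: a coordinate that is truncated contributes 1 ≥ c by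
itself, and otherwise nothing is truncated. -/
lemma le_sepWords (hD : 0 < D) (hT : 0 < T) (hu : ∑ i ∈ Finset.range D, |u i| ≤ 1) {c : ℝ}
    (hc : c ≤ 1) (hw : c ≤ ∑ i ∈ Finset.range D, |u i - w i|) :
    T / 4 * c - D ≤ (sepWords D T u w : ℝ) := by
  have h1 : c ≤ ∑ i ∈ Finset.range D, min |u i - w i| 1 := by
    by_cases h : ∃ i ∈ Finset.range D, 1 ≤ |u i - w i|
    · obtain ⟨i, hi, h⟩ := h
      refine hc.trans ?_
      have := Finset.single_le_sum (f := fun i => min |u i - w i| 1)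
        (fun j _ => le_min (abs_nonneg _) zero_le_one) hi
      simpa [min_eq_right h] using this
    · push Not at h
      refine hw.trans (Finset.sum_le_sum fun i hi => ?_)
      rw [min_eq_left (h i hi).le]
  rw [sepWords_eq hD]
  push_cast
  calc T / 4 * c - D ≤ T / 4 * ∑ i ∈ Finset.range D, min |u i - w i| 1 - D := by gcongr
    _ = ∑ i ∈ Finset.range D, (T / 4 * min |u i - w i| 1 - 1) := by
        rw [Finset.sum_sub_distrib, Finset.mul_sum]; simp
    _ ≤ _ := Finset.sum_le_sum fun i hi =>
        le_separating hT (abs_le_of_sum_le hu (Finset.mem_range.1 hi)) _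

end Thresholds

/-! ### Random sketches -/

section Sketch

open Classical in
/-- The sign `-1` if `P` holds. -/
def sgn (P : Prop) : ℝ := if P then -1 else 1

lemma parity_congr {P P' : ℕ → Prop} {m : ℕ} (h : ∀ e < m, (P e ↔ P' e)) : parity P m = parity P' m := by
  induction m with
  | zero => rfl
  | succ m ih =>
    rw [parity, parity, ih fun e he => h e (by omega)]
    have hm := h m (by omega)
    by_cases h' : P m
    · rw [if_pos h', if_pos (hm.1 h')]
    · rw [if_neg h', if_neg fun h'' => h' (hm.2 h'')]

/-- Passing to signs turns the parity of a number of tests into a product, which makes independence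
usable. -/
lemma prod_sgn (P P' : ℕ → Prop) (m : ℕ) :
    ∏ e ∈ Finset.range m, sgn (¬ (P e ↔ P' e)) = sgn (parity P m ≠ parity P' m) := by
  induction m with
  | zero => simp [sgn, parity]
  | succ m ih =>
    have h1 := parity_le_one P m
    have h2 := parity_le_one P' m
    rw [Finset.prod_range_succ, ih, parity, parity]
    generalize parity P m = x at *
    generalize parity P' m = y at *
    by_cases hP : P m <;> by_cases hP' : P' m <;> interval_cases x <;> interval_cases y <;>
      simp [hP, hP', sgn]

/-- A family of words, as a sequence. -/
def flat {t mm N : ℕ} (W : Fin t → Fin mm → Fin N) (i : ℕ) : ℕ :=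
  if h : i / mm < t ∧ i % mm < mm then W ⟨i / mm, h.1⟩ ⟨i % mm, h.2⟩ else 0

lemma flat_apply {t mm N : ℕ} (W : Fin t → Fin mm → Fin N) (b : Fin t) (e : Fin mm) :
    flat W (b * mm + e) = W b e := by
  have h0 : 0 < mm := e.pos
  have e1 : (b * mm + e) / mm = (b : ℕ) := by
    rw [Nat.mul_comm, Nat.mul_add_div h0, Nat.div_eq_of_lt e.2, add_zero]
  have e2 : (b * mm + e) % mm = (e : ℕ) := by
    rw [Nat.mul_comm, Nat.mul_add_mod, Nat.mod_eq_of_lt e.2]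
  simp only [flat, e1, e2, b.2, e.2, and_self, dite_true, Fin.eta]

variable {D T mm t : ℕ} (u w : ℕ → ℝ)

lemma pow_mismatch (z : ℝ) (f g : ℕ → ℕ) (t : ℕ) :
    z ^ mismatch f g t = ∏ b : Fin t, ((1 + z) / 2 + (1 - z) / 2 * sgn (f b ≠ g b)) := by
  rw [Fin.prod_univ_eq_prod_range (fun b => (1 + z) / 2 + (1 - z) / 2 * sgn (f b ≠ g b)) t]
  induction t with
  | zero => simp [mismatch]
  | succ t ih =>
    rw [mismatch_succ, Finset.prod_range_succ, pow_add, ih]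
    congr 1
    by_cases h : f t = g t
    · simp [h, sgn]; ring
    · simp [h, sgn]; ring

lemma sgn_sketch (W : Fin t → Fin mm → Fin (T * D)) (b : Fin t) :
    sgn (sketch (flat W) D T mm u b ≠ sketch (flat W) D T mm w b) =
      ∏ e : Fin mm, sgn (¬ (Below D T u (W b e) ↔ Below D T w (W b e))) := by
  rw [sketch, sketch, ← prod_sgn, ← Fin.prod_univ_eq_prod_range
    (fun e => sgn (¬ (Below D T u (flat W (b * mm + e)) ↔ Below D T w (flat W (b * mm + e)))))]
  simp only [flat_apply]

lemma sum_sgn_word : ∑ v : Fin (T * D), sgn (¬ (Below D T u v ↔ Below D T w v)) =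
    (T * D : ℕ) - 2 * (sepWords D T u w : ℝ) := by
  classical
  rw [Fin.sum_univ_eq_sum_range (fun v => sgn (¬ (Below D T u v ↔ Below D T w v)))]
  have h : ∀ v, sgn (¬ (Below D T u v ↔ Below D T w v)) =
      1 - 2 * (if ¬ (Below D T u v ↔ Below D T w v) then 1 else 0) := by
    intro v; unfold sgn; split_ifs <;> norm_num
  simp only [h]
  rw [Finset.sum_sub_distrib, ← Finset.mul_sum, sepWords, Finset.card_filter]
  simp

/-- The generating function of the mismatch is computed exactly. The power of z is a product over
the bits of affine functions of a sign, each sign is a product over the words, and a sum over a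
product set of such a product factorizes. -/
lemma sum_pow_mismatch (z : ℝ) :
    ∑ W : Fin t → Fin mm → Fin (T * D), z ^ mismatch (sketch (flat W) D T mm u)
      (sketch (flat W) D T mm w) t =
    ((1 + z) / 2 * ((T * D : ℕ) : ℝ) ^ mm +
      (1 - z) / 2 * ((T * D : ℕ) - 2 * (sepWords D T u w : ℝ)) ^ mm) ^ t := by
  have h1 : ∀ W : Fin t → Fin mm → Fin (T * D), z ^ mismatch (sketch (flat W) D T mm u)
      (sketch (flat W) D T mm w) t = ∏ b : Fin t, ((1 + z) / 2 + (1 - z) / 2 *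
        ∏ e : Fin mm, sgn (¬ (Below D T u (W b e) ↔ Below D T w (W b e)))) := by
    intro W
    rw [pow_mismatch]
    simp only [sgn_sketch]
  simp only [h1]
  rw [← Fintype.sum_pow (fun w' : Fin mm → Fin (T * D) => (1 + z) / 2 + (1 - z) / 2 *
        ∏ e : Fin mm, sgn (¬ (Below D T u (w' e) ↔ Below D T w (w' e)))) t]
  congr 1
  rw [Finset.sum_add_distrib, ← Finset.mul_sum,
    ← Fintype.sum_pow (fun v : Fin (T * D) => sgn (¬ (Below D T u v ↔ Below D T w v))) mm,
    sum_sgn_word]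
  simp [mul_comm]

lemma card_mul_le_sum {α : Type*} [Fintype α] (A : Finset α) {f : α → ℝ} {c : ℝ}
    (hf : ∀ x, 0 ≤ f x) (hA : ∀ x ∈ A, c ≤ f x) : A.card * c ≤ ∑ x, f x := by
  calc A.card * c = ∑ x ∈ A, c := by simp
    _ ≤ ∑ x ∈ A, f x := Finset.sum_le_sum hA
    _ ≤ _ := Finset.sum_le_sum_of_subset_of_nonneg (Finset.subset_univ _) fun x _ _ => hf x

variable {u w}

/-- The average of `z` to the power of a mismatch, relative to all words. -/
lemma mean_eq (hT : 0 < T) (hD : 0 < D) (z : ℝ) (s : ℝ) :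
    (1 + z) / 2 * ((T * D : ℕ) : ℝ) ^ mm + (1 - z) / 2 * ((T * D : ℕ) - 2 * s) ^ mm =
    ((T * D : ℕ) : ℝ) ^ mm * ((1 + z) / 2 + (1 - z) / 2 * (1 - 2 * s / (T * D : ℕ)) ^ mm) := by
  have h : ((T * D : ℕ) : ℝ) ≠ 0 := by positivity
  have e : ((T * D : ℕ) : ℝ) - 2 * s = (T * D : ℕ) * (1 - 2 * s / (T * D : ℕ)) := by
    field_simp
  rw [e, mul_pow]
  ring

/-- Close vectors have similar sketches. -/
lemma card_near_le (hD : 4 ≤ D) (hT : 2 ^ 40 * D ≤ T) (tp : ℕ)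
    (h : ∑ i ∈ Finset.range D, |u i - w i| ≤ 1 / 8589934592)
    (A : Finset (Fin (16 * tp) → Fin (4 * D) → Fin (T * D)))
    (hA : ∀ W ∈ A, tp < mismatch (sketch (flat W) D T (4 * D) u) (sketch (flat W) D T (4 * D) w)
      (16 * tp)) :
    (A.card : ℝ) * 8 ^ tp ≤ (((T * D : ℕ) : ℝ) ^ (4 * D)) ^ (16 * tp) := by
  have hT0 : 0 < T := by omega
  have hT' : (0 : ℝ) < T := by exact_mod_cast hT0
  have hD' : (4 : ℝ) ≤ D := by exact_mod_cast hD
  have hTD : (2 : ℝ) ^ 40 * D ≤ T := by exact_mod_cast hT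
  have hs := sepWords_le (u := u) (w := w) (by omega : 0 < D) hT0
  set s : ℝ := (sepWords D T u w : ℝ) with hs'
  have hs0 : 0 ≤ s := Nat.cast_nonneg _
  -- Markov's inequality for z^mismatch. The mean per bit is at most 2, so the proportion of bad
  -- words is at most 2^(16 tp) / z^tp = 2^(-16 tp).
  set z : ℝ := 2 ^ 32 with hz
  have h1 := card_mul_le_sum A (f := fun W => z ^ mismatch (sketch (flat W) D T (4 * D) u)
    (sketch (flat W) D T (4 * D) w) (16 * tp)) (c := z ^ tp) (fun _ => by positivity)
    (fun W hW => pow_le_pow_right₀ (by rw [hz]; norm_num) (hA W hW).le)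
  rw [sum_pow_mismatch, mean_eq hT0 (by omega), mul_pow] at h1
  set N : ℝ := (((T * D : ℕ) : ℝ) ^ (4 * D)) ^ (16 * tp) with hN
  have hN0 : 0 ≤ N := by positivity
  have hcast : ((T * D : ℕ) : ℝ) = T * D := by push_cast; rfl
  have hsT : 8 * s ≤ (1 / 2 ^ 31) * T := by
    have : s ≤ T / 4 * (1 / 8589934592) + D := hs.trans (by gcongr)
    linarith
  have hx : -2 ≤ -(2 * s / (T * D : ℕ)) := by
    have : 2 * s / (T * D : ℕ) ≤ 2 := by
      rw [hcast, div_le_iff₀ (by positivity)]; nlinarith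
    linarith
  have hber := one_add_mul_le_pow hx (4 * D)
  have e1 : ((4 * D : ℕ) : ℝ) * -(2 * s / (T * D : ℕ)) = -(8 * s / T) := by
    rw [hcast]; push_cast; field_simp; ring
  rw [e1] at hber
  have h8 : 8 * s / T ≤ 1 / 2 ^ 31 := by rwa [div_le_iff₀ hT']
  have hmean : (1 + z) / 2 + (1 - z) / 2 * (1 - 2 * s / (T * D : ℕ)) ^ (4 * D) ≤ 2 := by
    rw [← sub_eq_add_neg] at hber
    rw [← sub_eq_add_neg] at hber
    have h9 : 1 - 1 / 2 ^ 31 ≤ (1 - 2 * s / (T * D : ℕ)) ^ (4 * D) := by linarith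
    have h10 : (1 - z) / 2 * (1 - 2 * s / (T * D : ℕ)) ^ (4 * D) ≤ (1 - z) / 2 * (1 - 1 / 2 ^ 31) :=
      mul_le_mul_of_nonpos_left h9 (by rw [hz]; norm_num)
    have h11 : (1 + z) / 2 + (1 - z) / 2 * (1 - 1 / 2 ^ 31) ≤ 2 := by rw [hz]; norm_num
    linarith
  have hmean0 : 0 ≤ (1 + z) / 2 + (1 - z) / 2 * (1 - 2 * s / (T * D : ℕ)) ^ (4 * D) := by
    have h9 : (1 - 2 * s / (T * D : ℕ)) ^ (4 * D) ≤ 1 := by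
      have hle : |1 - 2 * s / (T * D : ℕ)| ≤ 1 := by
        have : 0 ≤ 2 * s / ((T * D : ℕ) : ℝ) := by positivity
        exact abs_le.2 ⟨by linarith, by linarith⟩
      calc _ ≤ |(1 - 2 * s / (T * D : ℕ)) ^ (4 * D)| := le_abs_self _
        _ ≤ 1 := by rw [abs_pow]; exact pow_le_one₀ (abs_nonneg _) hle
    have h10 : (1 - z) / 2 * 1 ≤ (1 - z) / 2 * (1 - 2 * s / (T * D : ℕ)) ^ (4 * D) :=
      mul_le_mul_of_nonpos_left h9 (by rw [hz]; norm_num)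
    linarith
  have h12 : (A.card : ℝ) * z ^ tp ≤ N * 2 ^ (16 * tp) :=
    h1.trans (mul_le_mul_of_nonneg_left (pow_le_pow_left₀ hmean0 hmean _) hN0)
  have e2 : z ^ tp = (2 ^ 16) ^ tp * 2 ^ (16 * tp) := by
    rw [hz, pow_mul, ← mul_pow]; norm_num
  rw [e2, ← mul_assoc] at h12
  have h13 := le_of_mul_le_mul_right h12 (by positivity)
  refine le_trans (mul_le_mul_of_nonneg_left ?_ (Nat.cast_nonneg _)) h13
  exact pow_le_pow_left₀ (by norm_num) (by norm_num) _

/-- Distant vectors have different sketches. -/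
lemma card_far_le (hD : 4 ≤ D) (hT : 2 ^ 40 * D ≤ T) (tp : ℕ)
    (hu : ∑ i ∈ Finset.range D, |u i| ≤ 1)
    (h : 9 / 10 ≤ ∑ i ∈ Finset.range D, |u i - w i|)
    (A : Finset (Fin (16 * tp) → Fin (4 * D) → Fin (T * D)))
    (hA : ∀ W ∈ A, mismatch (sketch (flat W) D T (4 * D) u) (sketch (flat W) D T (4 * D) w)
      (16 * tp) ≤ tp) :
    (A.card : ℝ) * 8 ^ tp ≤ (((T * D : ℕ) : ℝ) ^ (4 * D)) ^ (16 * tp) := by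
  have hT0 : 0 < T := by omega
  have hT' : (0 : ℝ) < T := by exact_mod_cast hT0
  have hD' : (4 : ℝ) ≤ D := by exact_mod_cast hD
  have hTD : (2 : ℝ) ^ 40 * D ≤ T := by exact_mod_cast hT
  have hs := le_sepWords (u := u) (w := w) (by omega : 0 < D) hT0 hu (by norm_num) h
  have hs2 := sepWords_le_of_sum_le_one (u := u) (w := w) (by omega : 0 < D) hT0 hu
  set s : ℝ := (sepWords D T u w : ℝ) with hs'
  -- Markov's inequality for (1/2)^mismatch. The mean per bit is at most 3/4 + 1/4 · 1/4 = 13/16,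
  -- and (13/16)^16 ≤ 1/16 = 1/2 · 1/8.
  have h1 := card_mul_le_sum A (f := fun W => (1 / 2 : ℝ) ^ mismatch (sketch (flat W) D T (4 * D) u)
    (sketch (flat W) D T (4 * D) w) (16 * tp)) (c := (1 / 2) ^ tp) (fun _ => by positivity)
    (fun W hW => pow_le_pow_of_le_one (by norm_num) (by norm_num) (hA W hW))
  rw [sum_pow_mismatch, mean_eq hT0 (by omega), mul_pow] at h1
  set N : ℝ := (((T * D : ℕ) : ℝ) ^ (4 * D)) ^ (16 * tp) with hN
  have hN0 : 0 ≤ N := by positivity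
  have hcast : ((T * D : ℕ) : ℝ) = T * D := by push_cast; rfl
  have heven : (1 - 2 * s / (T * D : ℕ)) ^ (4 * D) = |1 - 2 * s / (T * D : ℕ)| ^ (4 * D) :=
    (Even.pow_abs ⟨2 * D, by ring⟩ _).symm
  -- The base lies between -3/5 and 1. If it is positive, it is at most exp(-2s/(TD)), and 8s/T ≥
  -- 3/2 with e^(3/2) ≥ 4; if it is negative, the exponent, even and at least 16, suffices.
  have hy : (1 - 2 * s / (T * D : ℕ)) ^ (4 * D) ≤ 1 / 4 := by
    rw [heven]
    rcases le_total 0 (1 - 2 * s / (T * D : ℕ)) with h2 | h2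
    · rw [abs_of_nonneg h2]
      have h3 : 1 - 2 * s / (T * D : ℕ) ≤ Real.exp (-(2 * s / (T * D : ℕ))) := by
        have := Real.add_one_le_exp (-(2 * s / (T * D : ℕ)))
        linarith
      have h4 : (1 - 2 * s / (T * D : ℕ)) ^ (4 * D) ≤ Real.exp (-(8 * s / T)) := by
        refine (pow_le_pow_left₀ h2 h3 _).trans (le_of_eq ?_)
        rw [← Real.exp_nat_mul]
        congr 1
        rw [hcast]; push_cast; field_simp; ring
      have h5 : 3 / 2 ≤ 8 * s / T := by rw [le_div_iff₀ hT']; linarith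
      have h6 : (4 : ℝ) ≤ Real.exp (3 / 2) := by
        have e1 : Real.exp (3 / 2) = Real.exp (1 / 2) ^ 3 := by
          rw [← Real.exp_nat_mul]; norm_num
        have e2 : (1.6 : ℝ) ≤ Real.exp (1 / 2) := by
          have := Real.quadratic_le_exp_of_nonneg (show (0 : ℝ) ≤ 1 / 2 by norm_num)
          linarith
        rw [e1]
        calc (4 : ℝ) ≤ 1.6 ^ 3 := by norm_num
          _ ≤ _ := pow_le_pow_left₀ (by norm_num) e2 3
      refine h4.trans ?_
      rw [Real.exp_neg, one_div]
      exact inv_anti₀ (by norm_num) (h6.trans (Real.exp_le_exp.2 h5))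
    · rw [abs_of_nonpos h2]
      have h3 : -(1 - 2 * s / (T * D : ℕ)) ≤ 3 / 5 := by
        have : 2 * s / (T * D : ℕ) ≤ 8 / 5 := by
          rw [hcast, div_le_iff₀ (by positivity)]
          nlinarith
        linarith
      calc (-(1 - 2 * s / (T * D : ℕ))) ^ (4 * D) ≤ (3 / 5) ^ (4 * D) :=
            pow_le_pow_left₀ (by linarith) h3 _
        _ ≤ (3 / 5) ^ 16 := pow_le_pow_of_le_one (by norm_num) (by norm_num) (by omega)
        _ ≤ 1 / 4 := by norm_num
  have hy0 : 0 ≤ (1 - 2 * s / (T * D : ℕ)) ^ (4 * D) := by rw [heven]; positivity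
  have h12 : (A.card : ℝ) * (1 / 2) ^ tp ≤ N * (13 / 16) ^ (16 * tp) :=
    h1.trans (mul_le_mul_of_nonneg_left (pow_le_pow_left₀ (by linarith) (by linarith) _) hN0)
  have e2 : (1 / 2 : ℝ) ^ tp = 8 ^ tp * (1 / 16) ^ tp := by
    rw [← mul_pow]; norm_num
  have e3 : (13 / 16 : ℝ) ^ (16 * tp) ≤ (1 / 16) ^ tp := by
    rw [pow_mul]
    exact pow_le_pow_left₀ (by norm_num) (by norm_num) _
  rw [e2, ← mul_assoc] at h12
  have h13 := h12.trans (mul_le_mul_of_nonneg_left e3 hN0)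
  exact le_of_mul_le_mul_right h13 (by positivity)

end Sketch

/-! ### The law of the coins -/

section Coins
open MeasureTheory

instance : IsProbabilityMeasure coinMeasure := by unfold coinMeasure; infer_instance

lemma coinMeasure_cylinder (F : Finset ℕ) (ω₀ : ℕ → Bool) :
    coinMeasure {ω | ∀ m ∈ F, ω m = ω₀ m} = 2⁻¹ ^ F.card := by
  have e : {ω : ℕ → Bool | ∀ m ∈ F, ω m = ω₀ m} = Set.pi F fun m => {ω₀ m} := by
    ext ω; simp
  rw [e, coinMeasure, Measure.infinitePi_pi _ fun m _ => measurableSet_singleton _]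
  simp

/-- Binary expansions are unique, so an event about words is an event about their coins. -/
lemma coinWord_eq_iff (ω ω' : ℕ → Bool) (o S : ℕ) :
    coinWord ω o S = coinWord ω' o S ↔ ∀ b < S, ω (o + b) = ω' (o + b) := by
  induction S with
  | zero => simp [coinWord]
  | succ S ih =>
    rw [coinWord, coinWord]
    have h1 := Bool.toNat_le (ω (o + S))
    have h2 := Bool.toNat_le (ω' (o + S))
    constructor
    · intro h b hb
      have h3 : coinWord ω o S = coinWord ω' o S := by omega
      have h4 : (ω (o + S)).toNat = (ω' (o + S)).toNat := by omega
      rcases Nat.lt_succ_iff_lt_or_eq.1 hb with hb | rfl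
      · exact ih.1 h3 b hb
      · revert h4; cases ω (o + b) <;> cases ω' (o + b) <;> simp
    · intro h
      rw [ih.2 fun b hb => h b (by omega), h S (by omega)]

/-- Words that are read from disjoint sets of coins are independent and uniform. -/
lemma measure_words_le {ι : Type*} [Fintype ι] (o : ι → ℕ) (S : ℕ)
    (ho : Function.Injective fun x : ι × Fin S => o x.1 + x.2) (A : Finset (ι → Fin (2 ^ S)))
    {c : ℕ} (hA : A.card * c ≤ (2 ^ S) ^ Fintype.card ι) :
    coinMeasure {ω | ∃ w ∈ A, ∀ i, coinWord ω (o i) S = w i} ≤ (c : ℝ≥0∞)⁻¹ := by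
  classical
  set F : Finset ℕ := Finset.univ.image fun x : ι × Fin S => o x.1 + x.2 with hF
  have hcard : F.card = S * Fintype.card ι := by
    rw [hF, Finset.card_image_of_injective _ ho]
    simp [mul_comm]
  have hone : ∀ w : ι → Fin (2 ^ S),
      coinMeasure {ω | ∀ i, coinWord ω (o i) S = w i} ≤ 2⁻¹ ^ (S * Fintype.card ι) := by
    intro w
    -- Either no sequence of coins yields these words, or the event lies in the cylinder of any one
    -- sequence that does.
    by_cases h : ∃ ω₀, ∀ i, coinWord ω₀ (o i) S = w i
    · obtain ⟨ω₀, h₀⟩ := h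
      rw [← hcard, ← coinMeasure_cylinder F ω₀]
      refine measure_mono fun ω hω m hm => ?_
      obtain ⟨⟨i, b⟩, -, rfl⟩ := Finset.mem_image.1 hm
      exact (coinWord_eq_iff ω ω₀ (o i) S).1 ((hω i).trans (h₀ i).symm) b b.2
    · have e : {ω | ∀ i, coinWord ω (o i) S = w i} = ∅ := by
        ext ω
        simpa using fun h' => h ⟨ω, h'⟩
      rw [e]; simp
  have e : {ω | ∃ w ∈ A, ∀ i, coinWord ω (o i) S = w i} =
      ⋃ w ∈ A, {ω | ∀ i, coinWord ω (o i) S = w i} := by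
    ext ω; simp
  calc coinMeasure {ω | ∃ w ∈ A, ∀ i, coinWord ω (o i) S = w i}
      ≤ ∑ w ∈ A, coinMeasure {ω | ∀ i, coinWord ω (o i) S = w i} := by
        rw [e]; exact measure_biUnion_finset_le _ _
    _ ≤ ∑ _w ∈ A, 2⁻¹ ^ (S * Fintype.card ι) := Finset.sum_le_sum fun w _ => hone w
    _ = A.card * 2⁻¹ ^ (S * Fintype.card ι) := by simp
    _ ≤ (c : ℝ≥0∞)⁻¹ := by
        rw [ENNReal.le_inv_iff_mul_le, ← ENNReal.inv_pow, mul_right_comm, ← div_eq_mul_inv]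
        refine ENNReal.div_le_of_le_mul ?_
        rw [one_mul]
        rw [← pow_mul] at hA
        exact_mod_cast hA

lemma measure_consecutive_words_le (S D : ℕ) (A : Finset (Fin D → Fin (2 ^ S))) {c : ℕ}
    (hA : A.card * c ≤ (2 ^ S) ^ D) :
    coinMeasure {ω | ∃ w ∈ A, ∀ i : Fin D, coinWord ω (i * S) S = w i} ≤ (c : ℝ≥0∞)⁻¹ := by
  refine measure_words_le (fun i : Fin D => (i : ℕ) * S) S ?_ A (by rwa [Fintype.card_fin])
  · rintro ⟨i, b⟩ ⟨i', b'⟩ h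
    have hS : 0 < S := b.pos
    have e1 := congrArg (· % S) h
    have e2 := congrArg (· / S) h
    simp only [Nat.mul_comm _ S, Nat.mul_add_mod, Nat.mod_eq_of_lt b.2, Nat.mod_eq_of_lt b'.2,
      Nat.mul_add_div hS, Nat.div_eq_of_lt b.2, Nat.div_eq_of_lt b'.2, add_zero] at e1 e2
    simp only [Prod.mk.injEq]
    exact ⟨Fin.ext e2, Fin.ext e1⟩

lemma measure_flat_words_le (o₀ S t mm : ℕ) (A : Finset (Fin t → Fin mm → Fin (2 ^ S)))
    {c : ℕ} (hA : A.card * c ≤ ((2 ^ S) ^ mm) ^ t) :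
    coinMeasure {ω | ∃ w ∈ A, ∀ i < t * mm, coinWord ω (o₀ + i * S) S = flat w i} ≤
      (c : ℝ≥0∞)⁻¹ := by
  classical
  have h := measure_words_le (ι := Fin t × Fin mm) (fun x => o₀ + (x.1 * mm + x.2) * S) S ?_
    (A.map (Equiv.curry (Fin t) (Fin mm) (Fin (2 ^ S))).symm.toEmbedding) (c := c) ?_
  · refine (measure_mono ?_).trans h
    rintro ω ⟨w, hw, hω⟩
    refine ⟨_, Finset.mem_map_of_mem _ hw, fun x => ?_⟩
    have hx : (x.1 : ℕ) * mm + x.2 < t * mm := by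
      have h1 : ((x.1 : ℕ) + 1) * mm ≤ t * mm := Nat.mul_le_mul_right _ x.1.2
      have h2 := x.2.2
      rw [add_mul, one_mul] at h1
      omega
    rw [hω _ hx, flat_apply]
    rfl
  · rintro ⟨⟨i, j⟩, b⟩ ⟨⟨i', j'⟩, b'⟩ h
    simp only [add_assoc, Nat.add_left_cancel_iff] at h
    have hS : 0 < S := b.pos
    have hm : 0 < mm := j.pos
    have e1 := congrArg (· % S) h
    have e2 := congrArg (· / S) h
    simp only [Nat.mul_comm _ S, Nat.mul_add_mod, Nat.mod_eq_of_lt b.2, Nat.mod_eq_of_lt b'.2,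
      Nat.mul_add_div hS, Nat.div_eq_of_lt b.2, Nat.div_eq_of_lt b'.2, add_zero] at e1 e2
    have e3 := congrArg (· % mm) e2
    have e4 := congrArg (· / mm) e2
    simp only [Nat.mul_comm _ mm, Nat.mul_add_mod, Nat.mod_eq_of_lt j.2, Nat.mod_eq_of_lt j'.2,
      Nat.mul_add_div hm, Nat.div_eq_of_lt j.2, Nat.div_eq_of_lt j'.2, add_zero] at e3 e4
    simp only [Prod.mk.injEq]
    exact ⟨⟨Fin.ext e4, Fin.ext e3⟩, Fin.ext e1⟩
  · rw [Finset.card_map]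
    simpa [← pow_mul, mul_comm t mm, mul_assoc] using hA

lemma measure_bUnion_le {ι : Type*} (s : Finset ι) (E : ι → Set (ℕ → Bool)) {c : ℝ≥0∞}
    (h : ∀ i ∈ s, coinMeasure (E i) ≤ c) : coinMeasure (⋃ i ∈ s, E i) ≤ s.card * c := by
  calc coinMeasure (⋃ i ∈ s, E i) ≤ ∑ i ∈ s, coinMeasure (E i) := measure_biUnion_finset_le _ _
    _ ≤ ∑ _i ∈ s, c := Finset.sum_le_sum h
    _ = s.card * c := by simp

end Coins

/-! ### Anticoncentration of random integer linear forms. -/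

lemma exists_finset_mem_iff {α : Type*} [Fintype α] (p : α → Prop) :
    ∃ A : Finset α, ∀ a, a ∈ A ↔ p a := by
  classical
  exact ⟨Finset.univ.filter p, fun a => by simp⟩

lemma mul_pow_le_of_cast {a N m t k : ℕ} (h : (a : ℝ) * 8 ^ k ≤ ((N : ℝ) ^ m) ^ t) :
    a * 8 ^ k ≤ (N ^ m) ^ t := by exact_mod_cast h

/-- A set of tuples that are determined by their entries away from `k` is small. -/
lemma card_mul_le_of_unique {N D : ℕ} (A : Finset (Fin D → Fin N)) (k : Fin D)
    (h : ∀ g ∈ A, ∀ g' ∈ A, (∀ i, i ≠ k → g i = g' i) → g = g') : A.card * N ≤ N ^ D := by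
  have h1 : (A ×ˢ (Finset.univ : Finset (Fin N))).card ≤
      (Finset.univ : Finset (Fin D → Fin N)).card := by
    -- The new tuple shows the value c at `k` and the entries of g elsewhere, and the latter
    -- determine g.
    refine Finset.card_le_card_of_injOn (fun x => Function.update x.1 k x.2)
      (fun _ _ => Finset.mem_coe.2 (Finset.mem_univ _)) ?_
    rintro ⟨g, c⟩ hg ⟨g', c'⟩ hg' e
    simp only [Finset.coe_product, Set.mem_prod, Finset.mem_coe] at hg hg' e
    have hc : c = c' := by simpa using congrFun e k
    have hgg : g = g' := h g hg.1 g' hg'.1 fun i hi => by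
      simpa [Function.update_of_ne hi] using congrFun e i
    rw [hc, hgg]
  simpa using h1

/-- A linear form with a large coefficient is seldom small. -/
lemma card_mul_le_of_abs_le {N D : ℕ} (Δ : ℕ → ℝ) {thr : ℝ} {i₀ : ℕ} (hi₀ : i₀ < D)
    (hbig : 2 * thr < |Δ i₀|) (A : Finset (Fin D → Fin N))
    (hA : ∀ g ∈ A, |∑ i : Fin D, ((g i : ℕ) : ℝ) * Δ i| ≤ thr) : A.card * N ≤ N ^ D := by
  set k₀ : Fin D := ⟨i₀, hi₀⟩ with hk₀
  -- Two tuples that differ only in the large coordinate, by integers, have values more than 2 thr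
  -- apart, so at most one of them is in `A`.
  have huniq : ∀ g ∈ A, ∀ g' ∈ A, (∀ i, i ≠ k₀ → g i = g' i) → g = g' := by
    intro g hg g' hg' h
    replace hg := hA g hg
    replace hg' := hA g' hg'
    have hdiff : (∑ i : Fin D, ((g i : ℕ) : ℝ) * Δ i) - ∑ i : Fin D, ((g' i : ℕ) : ℝ) * Δ i =
        (((g k₀ : ℕ) : ℝ) - ((g' k₀ : ℕ) : ℝ)) * Δ k₀ := by
      rw [← Finset.sum_sub_distrib, Finset.sum_eq_single k₀]
      · ring
      · intro i _ hi
        rw [h i hi, sub_self]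
      · simp
    have hk : g k₀ = g' k₀ := by
      by_contra hne
      have hne' : (g k₀ : ℕ) ≠ (g' k₀ : ℕ) := fun h => hne (Fin.ext h)
      have h1 : (1 : ℝ) ≤ |((g k₀ : ℕ) : ℝ) - ((g' k₀ : ℕ) : ℝ)| := by
        have : (1 : ℤ) ≤ |((g k₀ : ℕ) : ℤ) - ((g' k₀ : ℕ) : ℤ)| :=
          Int.one_le_abs (sub_ne_zero.2 (by exact_mod_cast hne'))
        exact_mod_cast this
      have h2 : |(((g k₀ : ℕ) : ℝ) - ((g' k₀ : ℕ) : ℝ)) * Δ k₀| ≤ 2 * thr := by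
        rw [← hdiff]
        have := abs_sub (∑ i : Fin D, ((g i : ℕ) : ℝ) * Δ i)
          (∑ i : Fin D, ((g' i : ℕ) : ℝ) * Δ i)
        linarith
      rw [abs_mul] at h2
      have h3 : |Δ k₀| ≤ |((g k₀ : ℕ) : ℝ) - ((g' k₀ : ℕ) : ℝ)| * |Δ k₀| :=
        le_mul_of_one_le_left (abs_nonneg _) h1
      have : 2 * thr < |Δ k₀| := hbig
      linarith
    funext i
    by_cases hi : i = k₀
    · rw [hi, hk]
    · exact h i hi
  exact card_mul_le_of_unique A k₀ huniq

lemma measure_abs_le (S : ℕ) {D : ℕ} (Δ : ℕ → ℝ) {thr : ℝ} {i₀ : ℕ} (hi₀ : i₀ < D)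
    (hbig : 2 * thr < |Δ i₀|) :
    coinMeasure {ω | |∑ i : Fin D, (coinWord ω (i * S) S : ℝ) * Δ i| ≤ thr} ≤
      ((2 ^ S : ℕ) : ℝ≥0∞)⁻¹ := by
  obtain ⟨A, hA⟩ := exists_finset_mem_iff
    fun g : Fin D → Fin (2 ^ S) => |∑ i : Fin D, ((g i : ℕ) : ℝ) * Δ i| ≤ thr
  refine le_trans (MeasureTheory.measure_mono ?_) (measure_consecutive_words_le S D A
    (card_mul_le_of_abs_le Δ hi₀ hbig A fun g hg => (hA g).1 hg))
  intro ω hω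
  exact ⟨fun i => ⟨coinWord ω (i * S) S, coinWord_lt _ _⟩, (hA _).2 hω, fun i => rfl⟩

/-! ### Good random words -/

/-- The words that determine the linear functional. -/
def gWords (P : Param) (ω : ℕ → Bool) (i : ℕ) : ℕ := coinWord ω (i * P.S) P.S

/-- The words that determine the sketches. -/
def wWords (P : Param) (ω : ℕ → Bool) (i : ℕ) : ℕ := coinWord ω (P.D * P.S + i * P.S) P.S

lemma mismatch_comm (f g : ℕ → ℕ) (t : ℕ) : mismatch f g t = mismatch g f t := by
  unfold mismatch
  congr 1
  exact Finset.filter_congr fun b _ => ne_comm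

lemma sketch_congr_words {W W' : ℕ → ℕ} {t mm : ℕ} (h : ∀ i < t * mm, W i = W' i) (D T : ℕ) (u : ℕ → ℝ)
    {b : ℕ} (hb : b < t) : sketch W D T mm u b = sketch W' D T mm u b := by
  refine parity_congr fun e he => ?_
  have : b * mm + e < t * mm := by
    have := Nat.mul_le_mul_right mm (show b + 1 ≤ t from hb)
    rw [add_mul, one_mul] at this
    omega
  rw [h _ this]

namespace Param
variable (P : Param)

/-- The sketches of the query, in the row `n`, and of the point `x` are similar or different, as
the images are close or distant. -/
def Faithful (W : ℕ → ℕ) (X : ℕ → ℝ) (ph j cc x : ℕ) : Prop :=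
  let u := P.vec X ph j (digit P.n cc)
  ∑ i ∈ Finset.range P.D, |u P.n i| ≤ 1 →
    (∑ i ∈ Finset.range P.D, |u P.n i - u x i| ≤ 1 / 8589934592 →
      mismatch (P.bits W X ph j (digit P.n cc) x) (P.bits W X ph j (digit P.n cc) P.n) P.t ≤ P.tp) ∧
    (9 / 10 ≤ ∑ i ∈ Finset.range P.D, |u P.n i - u x i| →
      P.tp < mismatch (P.bits W X ph j (digit P.n cc) x) (P.bits W X ph j (digit P.n cc) P.n) P.t)

/-- All sketches are faithful. -/
def GoodW (W : ℕ → ℕ) (X : ℕ → ℝ) : Prop :=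
  ∀ ph < 2, ∀ j < P.JJ ph, ∀ cc < P.nC ph, ∀ x < P.n, P.Faithful W X ph j cc x

/-- The linear functional separates the query from distant points. -/
def GoodG (G : ℕ → ℕ) (X : ℕ → ℝ) : Prop :=
  ∀ x < P.n, |dot G X P.D P.n - dot G X P.D x| ≤ 2 ^ P.S * P.D * P.r →
    ∀ i < P.D, |X (P.n * P.D + i) - X (x * P.D + i)| ≤ 2 * (2 ^ P.S * P.D * P.r)

variable {P}

lemma Faithful.congr {W W' : ℕ → ℕ} (h : ∀ i < P.t * P.mm, W i = W' i) {X : ℕ → ℝ} {ph j cc x : ℕ}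
    (hF : P.Faithful W X ph j cc x) : P.Faithful W' X ph j cc x := by
  have e : mismatch (P.bits W X ph j (digit P.n cc) x) (P.bits W X ph j (digit P.n cc) P.n) P.t =
      mismatch (P.bits W' X ph j (digit P.n cc) x) (P.bits W' X ph j (digit P.n cc) P.n) P.t :=
    mismatch_congr (fun b hb => sketch_congr_words h _ _ _ hb)
      (fun b hb => sketch_congr_words h _ _ _ hb)
  simp only [Faithful, e] at hF ⊢
  exact hF

/-- Since D is a power of 2 that divides 2^S, a word of S coins is exactly a uniform choice of
coordinate and threshold. -/
lemma T_mul_D : P.T * P.D = 2 ^ P.S :=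
  Nat.div_mul_cancel (pow_dvd_pow 2 (by unfold S; omega))

lemma four_le_D (hP : P.Ok) : 4 ≤ P.D :=
  Nat.pow_le_pow_right (n := 2) (by norm_num) hP.two_le_lam

lemma mul_D_le_T : 2 ^ 40 * P.D ≤ P.T := by
  rw [T, Nat.le_div_iff_mul_le D_pos, D, ← pow_add, ← pow_add]
  exact Nat.pow_le_pow_right (by norm_num) (by unfold S; omega)

/-- For a fixed matrix the distance of the two images is fixed, so at most one of the two
implications can fail, and each has its own tail bound. Between the two distances nothing is
claimed. -/
lemma card_not_faithful_le (hP : P.Ok) (X : ℕ → ℝ) (ph j cc x : ℕ) {N : ℕ} (hN : N = P.T * P.D)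
    (A : Finset (Fin P.t → Fin P.mm → Fin N))
    (hmem : ∀ w ∈ A, ¬ P.Faithful (flat w) X ph j cc x) :
    (A.card : ℝ) * 8 ^ P.tp ≤ ((N : ℝ) ^ P.mm) ^ P.t := by
  subst hN
  have h4 := four_le_D hP
  have hT := mul_D_le_T (P := P)
  have hpos : 0 ≤ (((P.T * P.D : ℕ) : ℝ) ^ P.mm) ^ P.t := pow_nonneg (pow_nonneg (Nat.cast_nonneg _) _) _
  have empty : A = ∅ → (A.card : ℝ) * 8 ^ P.tp ≤ (((P.T * P.D : ℕ) : ℝ) ^ P.mm) ^ P.t := by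
    rintro rfl
    rw [Finset.card_empty, Nat.cast_zero, zero_mul]
    exact hpos
  by_cases h1 : ∑ i ∈ Finset.range P.D, |P.vec X ph j (digit P.n cc) P.n i| ≤ 1
  · by_cases h2 : ∑ i ∈ Finset.range P.D, |P.vec X ph j (digit P.n cc) P.n i -
        P.vec X ph j (digit P.n cc) x i| ≤ 1 / 8589934592
    · refine card_near_le h4 hT P.tp h2 A fun w hw => ?_
      by_contra h3
      refine hmem w hw fun _ => ⟨fun _ => ?_, fun h => ?_⟩
      · rw [mismatch_comm]; exact not_lt.1 h3
      · exact absurd (h.trans h2) (by norm_num)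
    · by_cases h2' : 9 / 10 ≤ ∑ i ∈ Finset.range P.D, |P.vec X ph j (digit P.n cc) P.n i -
          P.vec X ph j (digit P.n cc) x i|
      · refine card_far_le h4 hT P.tp h1 h2' A fun w hw => ?_
        by_contra h3
        refine hmem w hw fun _ => ⟨fun h => absurd h h2, fun _ => ?_⟩
        rw [mismatch_comm]; exact not_le.1 h3
      · exact empty (Finset.eq_empty_of_forall_notMem fun w hw =>
          hmem w hw fun _ => ⟨fun h => absurd h h2, fun h => absurd h h2'⟩)
  · exact empty (Finset.eq_empty_of_forall_notMem fun w hw => hmem w hw fun h => absurd h h1)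

lemma measure_not_faithful (hP : P.Ok) (X : ℕ → ℝ) (ph j cc x : ℕ) :
    coinMeasure {ω | ¬ P.Faithful (wWords P ω) X ph j cc x} ≤ ((8 ^ P.tp : ℕ) : ℝ≥0∞)⁻¹ := by
  obtain ⟨A, hA⟩ : ∃ A : Finset (Fin P.t → Fin P.mm → Fin (2 ^ P.S)),
      ∀ w, w ∈ A ↔ ¬ P.Faithful (flat w) X ph j cc x :=
    exists_finset_mem_iff fun w => ¬ P.Faithful (flat w) X ph j cc x
  have hN : 2 ^ P.S = P.T * P.D := T_mul_D.symm
  have key := card_not_faithful_le (N := 2 ^ P.S) hP X ph j cc x hN A fun w hw => (hA w).1 hw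
  have key' : A.card * 8 ^ P.tp ≤ ((2 ^ P.S) ^ P.mm) ^ P.t := mul_pow_le_of_cast (N := 2 ^ P.S) key
  generalize hc : 8 ^ P.tp = c at key' ⊢
  refine le_trans (MeasureTheory.measure_mono ?_)
    (measure_flat_words_le (P.D * P.S) P.S P.t P.mm A key')
  intro ω hω
  set w : Fin P.t → Fin P.mm → Fin (2 ^ P.S) := fun b e =>
    ⟨wWords P ω (b * P.mm + e), coinWord_lt _ _⟩ with hw
  have hflat : ∀ i < P.t * P.mm, wWords P ω i = flat w i := by
    intro i hi
    have hm : 0 < P.mm := Nat.mul_pos (by norm_num) D_pos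
    have h1 : i / P.mm < P.t := Nat.div_lt_of_lt_mul (by rwa [mul_comm])
    have h2 : i % P.mm < P.mm := Nat.mod_lt _ hm
    rw [flat, dif_pos ⟨h1, h2⟩, hw]
    simp only [Nat.div_add_mod']
  refine ⟨w, (hA w).2 ?_, fun i hi => hflat i hi⟩
  exact fun h => hω (h.congr fun i hi => (hflat i hi).symm)

/-- The centers met by a query depend on the coins, so the union bound covers every tuple of centers
that might occur, for every step and every point. -/
lemma measure_not_goodW (hP : P.Ok) (X : ℕ → ℝ) :
    coinMeasure {ω | ¬ P.GoodW (wWords P ω) X} ≤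
      ((P.JJ 0 * P.nC 0 * P.n + P.JJ 1 * P.nC 1 * P.n : ℕ) : ℝ≥0∞) * ((8 ^ P.tp : ℕ) : ℝ≥0∞)⁻¹ := by
  have one : ∀ ph, coinMeasure (⋃ a ∈ (Finset.range (P.JJ ph) ×ˢ Finset.range (P.nC ph)) ×ˢ
      Finset.range P.n, {ω | ¬ P.Faithful (wWords P ω) X ph a.1.1 a.1.2 a.2}) ≤
      ((P.JJ ph * P.nC ph * P.n : ℕ) : ℝ≥0∞) * ((8 ^ P.tp : ℕ) : ℝ≥0∞)⁻¹ := by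
    intro ph
    refine (measure_bUnion_le _ _ fun a _ => measure_not_faithful hP X ph a.1.1 a.1.2 a.2).trans ?_
    rw [Finset.card_product, Finset.card_product, Finset.card_range, Finset.card_range,
      Finset.card_range]
  have hsub : {ω | ¬ P.GoodW (wWords P ω) X} ⊆
      (⋃ a ∈ (Finset.range (P.JJ 0) ×ˢ Finset.range (P.nC 0)) ×ˢ
      Finset.range P.n, {ω | ¬ P.Faithful (wWords P ω) X 0 a.1.1 a.1.2 a.2}) ∪
      (⋃ a ∈ (Finset.range (P.JJ 1) ×ˢ Finset.range (P.nC 1)) ×ˢ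
      Finset.range P.n, {ω | ¬ P.Faithful (wWords P ω) X 1 a.1.1 a.1.2 a.2}) := by
    intro ω hω
    simp only [Set.mem_ofPred_eq, GoodW] at hω
    push Not at hω
    obtain ⟨ph, hph, j, hj, cc, hcc, x, hx, h⟩ := hω
    interval_cases ph
    · refine Set.mem_union_left _ (Set.mem_iUnion₂.2 ⟨((j, cc), x), Finset.mem_product.2
        ⟨Finset.mem_product.2 ⟨Finset.mem_range.2 hj, Finset.mem_range.2 hcc⟩, Finset.mem_range.2 hx⟩, h⟩)
    · refine Set.mem_union_right _ (Set.mem_iUnion₂.2 ⟨((j, cc), x), Finset.mem_product.2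
        ⟨Finset.mem_product.2 ⟨Finset.mem_range.2 hj, Finset.mem_range.2 hcc⟩, Finset.mem_range.2 hx⟩, h⟩)
  refine (MeasureTheory.measure_mono hsub).trans ((MeasureTheory.measure_union_le _ _).trans ?_)
  rw [Nat.cast_add, add_mul]
  exact add_le_add (one 0) (one 1)

/-- For each point either no coordinate violates the bound, and the event is empty, or one fixed
coordinate does, and the functional is seldom small. -/
lemma measure_not_goodG (X : ℕ → ℝ) :
    coinMeasure {ω | ¬ P.GoodG (gWords P ω) X} ≤ (P.n : ℝ≥0∞) * ((2 ^ P.S : ℕ) : ℝ≥0∞)⁻¹ := by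
  set thr := 2 ^ P.S * P.D * P.r with hthr
  set E : ℕ → Set (ℕ → Bool) := fun x => {ω | |dot (gWords P ω) X P.D P.n -
    dot (gWords P ω) X P.D x| ≤ thr ∧ ∃ i < P.D, 2 * thr < |X (P.n * P.D + i) - X (x * P.D + i)|}
    with hE
  have hsub : {ω | ¬ P.GoodG (gWords P ω) X} ⊆ ⋃ x ∈ Finset.range P.n, E x := by
    intro ω hω
    simp only [Set.mem_ofPred_eq, GoodG] at hω
    push Not at hω
    obtain ⟨x, hx, h1, i, hi, h2⟩ := hω
    exact Set.mem_iUnion₂.2 ⟨x, Finset.mem_range.2 hx, h1, i, hi, h2⟩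
  refine (MeasureTheory.measure_mono hsub).trans ((measure_bUnion_le (c :=
    ((2 ^ P.S : ℕ) : ℝ≥0∞)⁻¹) _ _ fun x _ => ?_).trans (by rw [Finset.card_range]))
  by_cases hi : ∃ i < P.D, 2 * thr < |X (P.n * P.D + i) - X (x * P.D + i)|
  swap
  · have : E x = ∅ := by
      ext ω
      simp only [hE, Set.mem_ofPred_eq, Set.mem_empty_iff_false, iff_false]
      exact fun h => hi h.2
    rw [this, MeasureTheory.measure_empty]
    exact zero_le
  obtain ⟨i₀, hi₀, hbig⟩ := hi
  set Δ : ℕ → ℝ := fun i => X (P.n * P.D + i) - X (x * P.D + i) with hΔ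
  have hdot : ∀ G : ℕ → ℕ, dot G X P.D P.n - dot G X P.D x = ∑ i : Fin P.D, (G i : ℝ) * Δ i := by
    intro G
    rw [dot, dot, ← Finset.sum_sub_distrib, Finset.sum_range]
    exact Finset.sum_congr rfl fun i _ => by simp only [hΔ]; ring
  refine le_trans (MeasureTheory.measure_mono ?_) (measure_abs_le P.S Δ hi₀ hbig)
  rintro ω ⟨hω, -⟩
  rwa [hdot] at hω

end Param

/-! ### Correctness for good random words -/

lemma ratio_pos {cz : ℝ} (hcz : 0 ≤ cz) (h k : ℕ) : 0 < ratio cz h k := by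
  unfold ratio; positivity

lemma nearRad_pos {a cz : ℝ} (hcz : 0 ≤ cz) (dig : ℕ → ℕ) (h : ℕ) {rr : ℝ} (hrr : 0 < rr) :
    0 < nearRad a cz dig h rr := by
  induction h generalizing rr with
  | zero => exact hrr
  | succ h ih =>
    refine ih ?_
    have := ratio_pos hcz (h + 1) (dig (h + 1))
    have h1 : 0 < |ratio cz (h + 1) (dig (h + 1)) * rr + rr| := abs_pos.2 (by positivity)
    positivity

/-- At every height the near radius is at most 2^-33 of the search radius, the gap that the sketches
require. -/
lemma mul_nearRad_le_searchRad {a cz : ℝ} (hcz : 0 ≤ cz) (dig : ℕ → ℕ) (h : ℕ) {rr : ℝ}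
    (hrr : 0 < rr) : 8589934592 * nearRad a cz dig h rr ≤ searchRad a cz dig h rr := by
  refine mul_le_mul_of_nonneg_right ?_ (nearRad_pos hcz dig h hrr).le
  have : 0 ≤ cz * (9 / 10 : ℝ) ^ dig 0 := by positivity
  simp only [ratio, pow_zero, mul_one]
  linarith

lemma sum_abs_div {D : ℕ} (f : ℕ → ℝ) {s : ℝ} (hs : 0 < s) :
    ∑ i ∈ Finset.range D, |f i / s| = (∑ i ∈ Finset.range D, |f i|) / s := by
  rw [Finset.sum_div]
  exact Finset.sum_congr rfl fun i _ => by rw [abs_div, abs_of_pos hs]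

section Norm
variable {D : ℕ} {P : ℝ} {v : ℕ → ℝ}

lemma abs_le_nrm (hP : 0 < P) {i : ℕ} (hi : i < D) : |v i| ≤ nrm D P v := by
  rw [← Real.rpow_rpow_inv (abs_nonneg (v i)) hP.ne', nrm, one_div]
  refine Real.rpow_le_rpow (Real.rpow_nonneg (abs_nonneg _) _) ?_ (inv_nonneg.2 hP.le)
  exact Finset.single_le_sum (f := fun i => |v i| ^ P)
    (fun _ _ => Real.rpow_nonneg (abs_nonneg _) _) (Finset.mem_range.2 hi)

lemma nrm_le_of_abs_le (hP : 0 < P) {c : ℝ} (hc : 0 ≤ c) (h : ∀ i < D, |v i| ≤ c) :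
    nrm D P v ≤ (D : ℝ) ^ (1 / P) * c := by
  have h1 : ∑ i ∈ Finset.range D, |v i| ^ P ≤ D * c ^ P := by
    have := Finset.sum_le_card_nsmul (Finset.range D) (fun i => |v i| ^ P) (c ^ P) fun i hi =>
      Real.rpow_le_rpow (abs_nonneg _) (h i (Finset.mem_range.1 hi)) hP.le
    simpa using this
  refine (Real.rpow_le_rpow nrm_sum_nonneg h1 (by positivity)).trans ?_
  rw [Real.mul_rpow (Nat.cast_nonneg _) (by positivity), ← Real.rpow_mul hc, mul_one_div_cancel hP.ne',
    Real.rpow_one]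

end Norm

/-- From 2 (9/10)^7 < 1: seven rounds halve the ratio, which explains the factor 7 in `kk`. -/
lemma two_pow_mul_le_one (N : ℕ) : (2 : ℝ) ^ N * (9 / 10) ^ (7 * N) ≤ 1 := by
  rw [pow_mul, ← mul_pow]
  exact pow_le_one₀ (by norm_num) (by norm_num)

namespace Param
variable {P : Param}

lemma rr_pos (hP : P.Ok) (ph : ℕ) : 0 < P.rr ph := by
  have := hP.r_pos
  have hD : (0 : ℝ) < P.D := Nat.cast_pos.2 D_pos
  unfold rr
  split_ifs <;> positivity

lemma cz_nonneg (ph : ℕ) : 0 ≤ P.cz ph := by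
  unfold cz
  split_ifs <;> positivity

/-- Divided by the search radius, the image of the query relative to the current point lies in the
unit ball of ℓ_1, so `Faithful` applies. The sketch of the near point passes the mismatch test,
hence that of the stored answer does too; a point at 9/10 of the search radius would fail it. -/
lemma stepOk_of_goodW {W : ℕ → ℕ} {X : ℕ → ℝ} (hP : P.Ok) (hG : P.GoodW W X) {ph : ℕ} (hph : ph < 2)
    {y : ℕ → ℕ} (hR : P.Run W X ph (P.JJ ph) y) {x : ℕ} (hx : x < P.n) {j : ℕ} (hj : j < P.JJ ph) :
    StepOk P.D P.a (P.cz ph) (P.kk ph) (P.lev ph) (P.rr ph) (fun i => X (P.n * P.D + i))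
      (fun i => X (x * P.D + i)) (fun j i => X (y j * P.D + i)) j := by
  rw [StepOk]
  set B : (ℕ → ℝ) → ℕ → ℝ := fun v i => push P.a (P.lev ph)
    (fun e => X (y (j / P.kk ph ^ e * P.kk ph ^ e) * P.D + i)) (v i) with hB
  change nrm P.D 1 (fun i => B (fun i => X (P.n * P.D + i)) i -
    B (fun i => X (y j * P.D + i)) i) ≤ _ → nrm P.D 1 (fun i => B (fun i => X (P.n * P.D + i)) i -
    B (fun i => X (x * P.D + i)) i) ≤ _ → nrm P.D 1 (fun i => B (fun i => X (P.n * P.D + i)) i -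
    B (fun i => X (y (j + 1) * P.D + i)) i) ≤ _
  intro hq hn
  set cen := centers (P.kk ph) y j with hcen
  set sr := searchRad P.a (P.cz ph) (digit (P.kk ph) j) (P.lev ph) (P.rr ph) with hsr
  have hnpos := nearRad_pos (a := P.a) (cz_nonneg (P := P) ph) (digit (P.kk ph) j) (P.lev ph)
    (rr_pos hP ph)
  have hle := mul_nearRad_le_searchRad (a := P.a) (cz_nonneg (P := P) ph) (digit (P.kk ph) j)
    (P.lev ph) (rr_pos hP ph)
  rw [← hsr] at hle
  have hspos : 0 < sr := lt_of_lt_of_le (by positivity) hle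
  have hcn : ∀ e, cen e < P.n := fun e =>
    hR.lt _ ((Nat.div_mul_le_self _ _).trans hj.le)
  set cc := encode P.n cen (P.lev ph + 1) with hcc
  have hccn : cc < P.nC ph := encode_lt fun e _ => hcn e
  have hdig : ∀ e ≤ P.lev ph, digit P.n cc e = cen e := fun e he =>
    digit_encode (fun e _ => hcn e) (by omega)
  have hbits : ∀ z b, P.bits W X ph j (digit P.n cc) z b = P.bits W X ph j cen z b :=
    fun z b => bits_congr_cen W X ph j hdig z b
  have hbits' : ∀ z, P.bits W X ph j (digit P.n cc) z = P.bits W X ph j cen z :=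
    fun z => funext (hbits z)
  have hc0 : cen 0 = y j := by simp [hcen, centers]
  have hvec : ∀ z i, P.vec X ph j (digit P.n cc) z i =
      (B (fun i => X (z * P.D + i)) i - B (fun i => X (y j * P.D + i)) i) / sr := by
    intro z i
    rw [vec, image_congr _ _ _ _ hdig, image, hc0]
    rfl
  have hq' : ∑ i ∈ Finset.range P.D, |P.vec X ph j (digit P.n cc) P.n i| ≤ 1 := by
    simp only [hvec]
    rw [sum_abs_div _ hspos, div_le_one hspos, ← nrm_one]
    exact hq
  have hdiff : ∀ z, ∑ i ∈ Finset.range P.D, |P.vec X ph j (digit P.n cc) P.n i -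
      P.vec X ph j (digit P.n cc) z i| = nrm P.D 1 (fun i => B (fun i => X (P.n * P.D + i)) i -
        B (fun i => X (z * P.D + i)) i) / sr := by
    intro z
    simp only [hvec, ← sub_div, sub_sub_sub_cancel_right]
    rw [sum_abs_div _ hspos, nrm_one]
  have hy1 : y (j + 1) < P.n := hR.lt _ hj
  have hnear := (hG ph hph j hj cc hccn x hx hq').1
  have hfar := (hG ph hph j hj cc hccn _ hy1 hq').2
  rw [hdiff, hbits', hbits'] at hnear hfar
  by_contra hcon
  refine absurd (hR.step j hj x hx (hnear ?_)) (not_le.2 (hfar ?_))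
  · rw [div_le_div_iff₀ hspos (by norm_num)]
    linarith
  · rw [le_div_iff₀ hspos]
    exact (not_le.1 hcon).le

lemma two_le_pc (hP : P.Ok) : 2 ≤ P.pc := by
  have h1 : (2 : ℝ) ≤ P.lam := by exact_mod_cast hP.two_le_lam
  have h2 := hP.two_lt_p
  unfold pc
  split_ifs <;> linarith

lemma one_lt_a (hP : P.Ok) : 1 < P.a := by
  have h2 := two_le_pc hP
  have hL : (0 : ℝ) < P.L := Nat.cast_pos.2 hP.one_le_L
  rw [a, abs_of_pos (by linarith)]
  exact Real.one_lt_rpow (by linarith) (by positivity)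

lemma a_pow_L (hP : P.Ok) : P.a ^ P.L = P.pc := by
  have h2 := two_le_pc hP
  rw [a, abs_of_pos (by linarith), one_div]
  exact Real.rpow_inv_natCast_pow (by linarith) (by have := hP.one_le_L; omega)

lemma a_le_two (hP : P.Ok) : P.a ≤ 2 := by
  have h : P.a ^ P.L ≤ 2 ^ P.L := (a_pow_L hP).trans_le hP.pc_le
  exact (pow_le_pow_iff_left₀ (by linarith [one_lt_a hP]) (by norm_num)
    (by have := hP.one_le_L; omega)).1 h

lemma cz_zero : P.cz 0 = 2 ^ (P.S + P.lam + 1) := by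
  rw [cz, if_pos rfl, D, Nat.cast_pow, Nat.cast_ofNat, pow_succ, pow_add]
  ring

lemma cz_one : P.cz 1 = 2 ^ (33 + 4 * P.lam) := by
  rw [cz, if_neg one_ne_zero, D, Nat.cast_pow, Nat.cast_ofNat, pow_add, pow_mul', ]
  norm_num
  ring

lemma cz_mul_le_one {ph : ℕ} (hph : ph < 2) : P.cz ph * (9 / 10) ^ P.kk ph ≤ 1 := by
  interval_cases ph
  · rw [cz_zero, kk, if_pos rfl]
    exact two_pow_mul_le_one _
  · rw [cz_one, kk, if_neg one_ne_zero]
    exact two_pow_mul_le_one _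

lemma abs_dot_sub_le {G : ℕ → ℕ} {X : ℕ → ℝ} (hG : ∀ i < P.D, G i ≤ 2 ^ P.S) {x : ℕ}
    (h : ∀ i < P.D, |X (P.n * P.D + i) - X (x * P.D + i)| ≤ P.r) :
    |dot G X P.D P.n - dot G X P.D x| ≤ 2 ^ P.S * P.D * P.r := by
  rw [dot, dot, ← Finset.sum_sub_distrib]
  refine (Finset.abs_sum_le_sum_abs _ _).trans ?_
  have := Finset.sum_le_card_nsmul (Finset.range P.D) (fun i => |(G i : ℝ) * X (P.n * P.D + i) -
    (G i : ℝ) * X (x * P.D + i)|) (2 ^ P.S * P.r) fun i hi => ?_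
  · refine this.trans_eq ?_
    rw [Finset.card_range, nsmul_eq_mul]
    ring
  · have hi' := Finset.mem_range.1 hi
    have h1 : (G i : ℝ) ≤ 2 ^ P.S := (Nat.cast_le.2 (hG i hi')).trans_eq (by rw [Nat.cast_pow, Nat.cast_ofNat])
    rw [← mul_sub, abs_mul, abs_of_nonneg (Nat.cast_nonneg _)]
    exact mul_le_mul h1 (h i hi') (abs_nonneg _) (pow_nonneg (by norm_num) _)

/-- The value of the near point is in the window around the value of the query. The first point in
the window lies no higher, so its value is within the slack on both sides, and `GoodG` bounds its
coordinates. -/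
lemma nrm_one_first_le {G : ℕ → ℕ} {X : ℕ → ℝ} (hG : ∀ i < P.D, G i ≤ 2 ^ P.S) (hGG : P.GoodG G X)
    {x y : ℕ} (hx : x < P.n) (h : ∀ i < P.D, |X (P.n * P.D + i) - X (x * P.D + i)| ≤ P.r)
    (hy : IsFirst P.n (dot G X P.D) (dot G X P.D P.n - 2 ^ P.S * P.D * P.r) y) :
    nrm P.D 1 (fun i => X (P.n * P.D + i) - X (y * P.D + i)) ≤ P.cz 0 * P.rr 0 := by
  have h1 := abs_le.1 (abs_dot_sub_le hG h)
  obtain ⟨h2, h3⟩ := hy.2 x hx (by linarith)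
  have h4 := hGG y hy.1 (abs_le.2 ⟨by linarith, by linarith⟩)
  rw [nrm_one]
  have := Finset.sum_le_card_nsmul (Finset.range P.D) _ _ fun i hi => h4 i (Finset.mem_range.1 hi)
  refine this.trans_eq ?_
  rw [Finset.card_range, nsmul_eq_mul, cz, rr, if_pos rfl, if_pos rfl]
  ring

/-- The first phase finds a point whose `ℓ₁` distance is near. -/
lemma nrm_one_le {W : ℕ → ℕ} {X : ℕ → ℝ} (hP : P.Ok) (hG : P.GoodW W X) {x : ℕ} (hx : x < P.n)
    (h : ∀ i < P.D, |X (P.n * P.D + i) - X (x * P.D + i)| ≤ P.r) {y : ℕ → ℕ}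
    (hR : P.Run W X 0 (P.JJ 0) y)
    (hy : nrm P.D 1 (fun i => X (P.n * P.D + i) - X (y 0 * P.D + i)) ≤ P.cz 0 * P.rr 0) :
    nrm P.D 1 (fun i => X (P.n * P.D + i) - X (y (P.JJ 0) * P.D + i)) ≤
      (8589934592 + 1) * (P.D * P.r) := by
  have hrr := rr_pos hP 0
  have hlev : P.lev 0 = 0 := rfl
  have key := search_spec (D := P.D) (M := 0) (q := fun i => X (P.n * P.D + i)) (x := fun i => X (x * P.D + i))
    (y := fun j i => X (y j * P.D + i)) (one_lt_a hP) (a_le_two hP) (cz_nonneg (P := P) 0)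
    (cz_mul_le_one two_pos) (by simp) hrr ?_ ?_ fun j hj =>
      stepOk_of_goodW hP hG two_pos hR hx hj
  · rw [pow_zero] at key
    refine key.trans ?_
    rw [pow_zero, mul_one]
    exact mul_le_mul_of_nonneg_right (by linarith [cz_mul_le_one (P := P) two_pos]) hrr.le
  · rw [pow_zero, nrm_one]
    have := Finset.sum_le_card_nsmul (Finset.range P.D) _ _ fun i hi => h i (Finset.mem_range.1 hi)
    refine this.trans_eq ?_
    rw [Finset.card_range, nsmul_eq_mul]
    rfl
  · rw [pow_zero]
    refine hy.trans (mul_le_mul_of_nonneg_right ?_ hrr.le)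
    norm_num

/-- For exponents p ≥ lam the norm is within D^(1/p) = 2^(lam/p) ≤ 2 of the maximum norm. This
justifies the truncation of the exponent at `lam`. -/
lemma D_rpow_le_two {p : ℝ} (hP : P.Ok) (hp : P.lam ≤ p) : (P.D : ℝ) ^ (1 / p) ≤ 2 := by
  have h1 : (2 : ℝ) ≤ P.lam := by exact_mod_cast hP.two_le_lam
  have hp0 : 0 < p := by linarith
  rw [D, Nat.cast_pow, Nat.cast_ofNat, ← Real.rpow_natCast, ← Real.rpow_mul (by norm_num)]
  refine (Real.rpow_le_rpow_of_exponent_le (by norm_num) ?_).trans_eq (Real.rpow_one _)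
  rw [mul_one_div, div_le_one hp0]
  exact hp

lemma nrm_pc_le (hP : P.Ok) {v : ℕ → ℝ} {c : ℝ} (hc : 0 ≤ c) (h : nrm P.D P.p v ≤ c) :
    nrm P.D P.pc v ≤ 2 * c := by
  have hp := hP.two_lt_p
  have h2 := two_le_pc hP
  by_cases h1 : (P.lam : ℝ) < P.p
  · refine (nrm_le_of_abs_le (by linarith) hc fun i hi => (abs_le_nrm (by linarith) hi).trans h).trans ?_
    refine mul_le_mul_of_nonneg_right (D_rpow_le_two hP ?_) hc
    rw [pc, if_pos h1]
  · rw [pc, if_neg h1]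
    linarith

lemma nrm_p_le (hP : P.Ok) {v : ℕ → ℝ} {c : ℝ} (hc : 0 ≤ c) (h : nrm P.D P.pc v ≤ c) :
    nrm P.D P.p v ≤ 2 * c := by
  have hp := hP.two_lt_p
  have h2 := two_le_pc hP
  by_cases h1 : (P.lam : ℝ) < P.p
  · refine (nrm_le_of_abs_le (by linarith) hc fun i hi => (abs_le_nrm (by linarith) hi).trans h).trans ?_
    exact mul_le_mul_of_nonneg_right (D_rpow_le_two hP h1.le) hc
  · rw [pc, if_neg h1] at h
    linarith

/-- The second phase finds a near point. -/
lemma nrm_le {W : ℕ → ℕ} {X : ℕ → ℝ} (hP : P.Ok) (hG : P.GoodW W X) {x : ℕ} (hx : x < P.n)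
    (h : nrm P.D P.p (fun i => X (P.n * P.D + i) - X (x * P.D + i)) ≤ P.r) {y : ℕ → ℕ}
    (hR : P.Run W X 1 (P.JJ 1) y)
    (hy : nrm P.D 1 (fun i => X (P.n * P.D + i) - X (y 0 * P.D + i)) ≤
      (8589934592 + 1) * (P.D * P.r)) :
    nrm P.D P.p (fun i => X (P.n * P.D + i) - X (y (P.JJ 1) * P.D + i)) ≤
      4 * (8589934592 * 5 ^ P.L + 1) * P.r := by
  have hr := hP.r_pos
  have h2 := two_le_pc hP
  have hrr := rr_pos hP 1
  have hrr1 : P.rr 1 = 2 * P.r := rfl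
  have hcz1 : P.cz 1 = 8589934592 * (P.D * P.D * P.D * P.D) := rfl
  have hD : (4 : ℝ) ≤ P.D := by exact_mod_cast four_le_D hP
  have key := search_spec (D := P.D) (M := P.L) (q := fun i => X (P.n * P.D + i))
    (x := fun i => X (x * P.D + i))
    (y := fun j i => X (y j * P.D + i)) (one_lt_a hP) (a_le_two hP) (cz_nonneg (P := P) 1)
    (cz_mul_le_one one_lt_two) ?_ hrr ?_ ?_ fun j hj =>
      stepOk_of_goodW hP hG one_lt_two hR hx hj
  · rw [a_pow_L hP] at key
    have hpos : (0 : ℝ) ≤ (8589934592 * 5 ^ P.L + 1) * (2 * P.r) := by positivity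
    -- The factor 4 is 2 from the passage from ℓ_p to ℓ_pc, contained in `rr`, times 2 from the way
    -- back.
    have e := nrm_p_le hP hpos (key.trans (mul_le_mul_of_nonneg_right
      (by linarith [cz_mul_le_one (P := P) one_lt_two]) hrr.le))
    refine e.trans_eq ?_
    ring
  · intro h hh
    rw [hcz1, D, Nat.cast_pow, Nat.cast_ofNat]
    -- The power D^4 = 16^lam in `cz` dominates 3 · 5^h for all h < L ≤ lam.
    have e1 : (3 : ℝ) * 5 ^ h ≤ 16 ^ (h + 1) := by
      rw [pow_succ, mul_comm]
      exact mul_le_mul (pow_le_pow_left₀ (by norm_num) (by norm_num) _) (by norm_num) (by norm_num)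
        (by positivity)
    have e2 : (16 : ℝ) ^ (h + 1) ≤ 16 ^ P.lam :=
      pow_le_pow_right₀ (by norm_num) (by have := hP.L_le; omega)
    have e3 : (2 : ℝ) ^ P.lam * 2 ^ P.lam * 2 ^ P.lam * 2 ^ P.lam = 16 ^ P.lam := by
      rw [← mul_pow, ← mul_pow, ← mul_pow]; norm_num
    rw [e3]
    linarith
  · rw [a_pow_L hP]
    exact nrm_pc_le hP hr.le h
  · rw [a_pow_L hP]
    -- A crude comparison is enough: the ℓ_pc distance is at most D times the ℓ_1 bound of phase 0,
    -- which already contains one factor D.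
    have hD1 : (P.D : ℝ) ^ (1 / P.pc) ≤ P.D := by
      refine (Real.rpow_le_rpow_of_exponent_le (by linarith) ?_).trans_eq (Real.rpow_one _)
      rw [div_le_one (by linarith)]
      linarith
    have hpos : (0 : ℝ) ≤ (8589934592 + 1) * (P.D * P.r) := by positivity
    refine (nrm_le_of_abs_le (by linarith) hpos fun i hi => (abs_le_nrm one_pos hi).trans hy).trans ?_
    refine (mul_le_mul_of_nonneg_right hD1 hpos).trans ?_
    rw [hcz1, hrr1]
    have e1 : (0 : ℝ) ≤ 8589934592 * 5 ^ P.L * (2 * P.r) := by positivity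
    have e2 : (1 : ℝ) ≤ P.D * P.D := by nlinarith
    have e3 : (P.D : ℝ) * P.D * P.r ≤ P.D * P.D * (P.D * P.D) * P.r :=
      mul_le_mul_of_nonneg_right (le_mul_of_one_le_right (by positivity) e2) hr.le
    nlinarith

/-- If the random words are good, then the reported point is near. -/
theorem Result.nrm_le {inp V : ℕ → ℝ} {ω : ℕ → Bool} {m : Mem} {X : ℕ → ℝ} {ans : ℕ} (hP : P.Ok)
    (hm : Ready P V ω m) (hR : P.Result inp m X ans) (hW : P.GoodW (wWords P ω) X)
    (hG : P.GoodG (gWords P ω) X) {x : ℕ} (hx : x < P.n)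
    (h : nrm P.D P.p (fun i => X (P.n * P.D + i) - X (x * P.D + i)) ≤ P.r) :
    ans < P.n ∧ nrm P.D P.p (fun i => X (P.n * P.D + i) - X (ans * P.D + i)) ≤
      4 * (8589934592 * 5 ^ P.L + 1) * P.r := by
  obtain ⟨y₀, y₁, h1, h2, h3, h4, h5⟩ := hR.run
  have hp := hP.two_lt_p
  have hW' : P.GoodW (m.nat .W) X := fun ph hph j hj cc hcc x hx =>
    (hW ph hph j hj cc hcc x hx).congr fun i hi => (hm.W i hi).symm
  have hdot : ∀ x, dot (m.nat .G) X P.D x = dot (gWords P ω) X P.D x := fun x =>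
    Finset.sum_congr rfl fun i hi => by rw [hm.G i (Finset.mem_range.1 hi)]; rfl
  have hG' : P.GoodG (m.nat .G) X := by
    intro x hx
    rw [hdot, hdot]
    exact hG x hx
  have hi : ∀ i < P.D, |X (P.n * P.D + i) - X (x * P.D + i)| ≤ P.r := fun i hi =>
    (abs_le_nrm (v := fun i => X (P.n * P.D + i) - X (x * P.D + i)) (by linarith) hi).trans h
  have e1 := nrm_one_first_le (fun i hi => by rw [hm.G i hi]; exact (coinWord_lt _ _).le) hG' hx hi h1
  have e2 := nrm_one_le hP hW' hx hi h2 e1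
  rw [← h3] at e2
  rw [h5]
  exact ⟨h4.lt _ le_rfl, Param.nrm_le hP hW' hx h h4 e2⟩

end Param

/-! ### The size of the parameters -/

lemma two_pow_bound (h : ℕ) : (h + 9) * (h + 2) ≤ 18 * 2 ^ h := by
  induction h with
  | zero => norm_num
  | succ h ih =>
    rw [pow_succ]
    nlinarith

lemma le_two_pow (k : ℕ) : k ≤ 2 ^ k := Nat.lt_two_pow_self.le

lemma mul_two_pow_le {c a b k : ℕ} (hc : c ≤ 2 ^ k) (h : k + a ≤ b) : c * 2 ^ a ≤ 2 ^ b := by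
  calc c * 2 ^ a ≤ 2 ^ k * 2 ^ a := Nat.mul_le_mul_right _ hc
    _ = 2 ^ (k + a) := (pow_add _ _ _).symm
    _ ≤ 2 ^ b := Nat.pow_le_pow_right two_pos h

namespace Param
variable {P : Param}

lemma L_le_log_lam (hP : P.Ok) : P.L ≤ Nat.log 2 P.lam + 1 := by
  have hlam := hP.two_le_lam
  have h1 : (2 : ℝ) ^ (P.L - 1) < P.lam := by
    refine hP.lt_pc.trans_le ?_
    unfold pc
    split_ifs with h
    · exact le_rfl
    · exact not_lt.1 h
  have h2 : 2 ^ (P.L - 1) < P.lam := by exact_mod_cast h1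
  have h3 : P.L - 1 ≤ Nat.log 2 P.lam := Nat.le_log_of_pow_le (by norm_num) h2.le
  omega

/-- With h = ⌊log_2 lam⌋ the number of steps is at most 2^((h+9)(h+2)), and the exponent, quadratic
in log lam, is O(lam). So (log d)^O(log log d) is polynomial in d, without any dependence on n. -/
lemma JJ_one_le (hP : P.Ok) : P.JJ 1 ≤ 2 ^ (18 * P.lam) := by
  have hlam := hP.two_le_lam
  set h := Nat.log 2 P.lam with hh
  have h1 : P.lam < 2 ^ (h + 1) := Nat.lt_pow_succ_log_self (by norm_num) _
  have h2 : 2 ^ h ≤ P.lam := Nat.pow_log_le_self 2 (by omega)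
  have h3 : P.kk 1 ≤ 2 ^ (h + 9) := by
    rw [kk, if_neg one_ne_zero]
    have : 2 ^ (h + 9) = 256 * 2 ^ (h + 1) := by rw [pow_add, pow_add]; ring
    omega
  calc P.JJ 1 ≤ (2 ^ (h + 9)) ^ (P.L + 1) := Nat.pow_le_pow_left h3 _
    _ ≤ (2 ^ (h + 9)) ^ (h + 2) :=
        Nat.pow_le_pow_right (by positivity) (by have := L_le_log_lam hP; omega)
    _ = 2 ^ ((h + 9) * (h + 2)) := (pow_mul _ _ _).symm
    _ ≤ 2 ^ (18 * P.lam) := Nat.pow_le_pow_right two_pos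
        ((two_pow_bound h).trans (Nat.mul_le_mul_left _ h2))

lemma JJ_zero_eq : P.JJ 0 = 7 * (3 * P.lam + P.nu + 41) := by
  rw [JJ, lev, kk, if_pos rfl, if_pos rfl, S, zero_add, pow_one]
  ring

lemma JJ_zero_le : P.JJ 0 ≤ 2 ^ (18 * P.lam + P.nu + 44) := by
  rw [JJ_zero_eq]
  calc 7 * (3 * P.lam + P.nu + 41) ≤ 7 * 2 ^ (3 * P.lam + P.nu + 41) :=
        Nat.mul_le_mul_left _ (le_two_pow _)
    _ ≤ _ := mul_two_pow_le (k := 3) (by norm_num) (by omega)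

lemma JJ_le (hP : P.Ok) {ph : ℕ} (hph : ph < 2) : P.JJ ph ≤ 2 ^ (18 * P.lam + P.nu + 44) := by
  interval_cases ph
  · exact JJ_zero_le
  · exact (JJ_one_le hP).trans (Nat.pow_le_pow_right two_pos (by omega))

lemma lev_le (ph : ℕ) : P.lev ph ≤ P.L := by
  unfold lev
  split_ifs <;> omega

lemma nC_le (hP : P.Ok) (ph : ℕ) : P.nC ph ≤ 2 ^ (P.nu * (P.L + 1)) := by
  calc P.nC ph ≤ P.n ^ (P.L + 1) :=
        Nat.pow_le_pow_right hP.one_le_n (by have := lev_le (P := P) ph; omega)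
    _ ≤ (2 ^ P.nu) ^ (P.L + 1) := Nat.pow_le_pow_left hP.n_le _
    _ = _ := (pow_mul _ _ _).symm

lemma JJ_mul_nC_mul_n_le (hP : P.Ok) {ph : ℕ} (hph : ph < 2) :
    P.JJ ph * P.nC ph * P.n ≤ 2 ^ (18 * P.lam + P.nu * (P.L + 3) + 44) := by
  calc P.JJ ph * P.nC ph * P.n
      ≤ 2 ^ (18 * P.lam + P.nu + 44) * 2 ^ (P.nu * (P.L + 1)) * 2 ^ P.nu :=
        Nat.mul_le_mul (Nat.mul_le_mul (JJ_le hP hph) (nC_le hP ph)) hP.n_le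
    _ = _ := by rw [← pow_add, ← pow_add]; congr 1; ring

/-- This dictates the choice of `tp`: in nu (L + 3), L + 1 comes from the tuples of centers, 1 from
the points and 1 from the number of steps of phase 0. -/
lemma six_mul_le (hP : P.Ok) :
    6 * (P.JJ 0 * P.nC 0 * P.n + P.JJ 1 * P.nC 1 * P.n) ≤ 8 ^ P.tp := by
  have h0 := JJ_mul_nC_mul_n_le hP (ph := 0) (by norm_num)
  have h1 := JJ_mul_nC_mul_n_le hP (ph := 1) (by norm_num)
  calc 6 * (P.JJ 0 * P.nC 0 * P.n + P.JJ 1 * P.nC 1 * P.n)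
      ≤ 12 * 2 ^ (18 * P.lam + P.nu * (P.L + 3) + 44) := by omega
    _ ≤ 2 ^ (3 * P.tp) := mul_two_pow_le (k := 4) (by norm_num) (by unfold tp; omega)
    _ = 8 ^ P.tp := by rw [pow_mul, show 2 ^ 3 = 8 from rfl]

lemma six_mul_n_le (hP : P.Ok) : 6 * P.n ≤ 2 ^ P.S :=
  (Nat.mul_le_mul_left _ hP.n_le).trans
    (mul_two_pow_le (k := 3) (by norm_num) (by unfold S; omega))

lemma mul_inv_le_of_six_mul_le {a b : ℕ} (hb : 0 < b) (h : 6 * a ≤ b) :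
    (a : ℝ≥0∞) * (b : ℝ≥0∞)⁻¹ ≤ 6⁻¹ := by
  rw [← div_eq_mul_inv, ENNReal.div_le_iff (by exact_mod_cast hb.ne') (ENNReal.natCast_ne_top b),
    mul_comm, ← div_eq_mul_inv, ENNReal.le_div_iff_mul_le (by simp) (by simp), mul_comm]
  exact_mod_cast h

/-- The random words are good with probability at least `2 / 3`. -/
lemma measure_good (hP : P.Ok) (X : ℕ → ℝ) :
    2 / 3 ≤ coinMeasure {ω | P.GoodW (wWords P ω) X ∧ P.GoodG (gWords P ω) X} := by
  have h8 : 0 < 8 ^ P.tp := Nat.pow_pos (by norm_num)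
  have h2 : 0 < 2 ^ P.S := Nat.pow_pos (by norm_num)
  have hW := (measure_not_goodW hP X).trans (mul_inv_le_of_six_mul_le h8 (six_mul_le hP))
  have hG := (measure_not_goodG (P := P) X).trans (mul_inv_le_of_six_mul_le h2 (six_mul_n_le hP))
  set A := {ω | P.GoodW (wWords P ω) X ∧ P.GoodG (gWords P ω) X} with hA
  have hcov : Set.univ ⊆ A ∪ ({ω | ¬ P.GoodW (wWords P ω) X} ∪ {ω | ¬ P.GoodG (gWords P ω) X}) := by
    intro ω _
    by_cases h1 : P.GoodW (wWords P ω) X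
    · by_cases h2 : P.GoodG (gWords P ω) X
      · exact Or.inl ⟨h1, h2⟩
      · exact Or.inr (Or.inr h2)
    · exact Or.inr (Or.inl h1)
  have h1 : 1 ≤ coinMeasure A + (6⁻¹ + 6⁻¹) := by
    rw [← MeasureTheory.measure_univ (μ := coinMeasure)]
    refine (MeasureTheory.measure_mono hcov).trans ((MeasureTheory.measure_union_le _ _).trans ?_)
    refine add_le_add le_rfl ((MeasureTheory.measure_union_le _ _).trans (add_le_add hW hG))
  have h3 : (2 / 3 : ℝ≥0∞) + (6⁻¹ + 6⁻¹) = 1 := by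
    rw [← ENNReal.toReal_eq_one_iff, ENNReal.toReal_add (by finiteness) (by finiteness),
      ENNReal.toReal_add (by finiteness) (by finiteness), ENNReal.toReal_div, ENNReal.toReal_inv]
    norm_num
  rw [← h3] at h1
  exact (ENNReal.add_le_add_iff_right (by finiteness)).1 h1

/-! ### Bounds on loops and words; existence of the parameters. -/

/-- A bound on the number of rounds of the loops of a query. -/
def ZQ (P : Param) : ℕ := 2 ^ (18 * P.lam + 12) * (P.nu + 1)

lemma t_le_ZQ (hP : P.Ok) : P.t ≤ P.ZQ := by
  have h := hP.L_le
  have h1 : P.tp ≤ (101 * P.lam + 103) * (P.nu + 1) := by unfold tp; nlinarith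
  have h2 : 16 * (101 * P.lam + 103) ≤ 2 ^ (18 * P.lam + 12) := by
    have : 16 * (101 * P.lam + 103) ≤ 2 ^ 12 * 2 ^ P.lam := by
      have := le_two_pow P.lam
      have := Nat.one_le_two_pow (n := P.lam)
      omega
    refine this.trans ?_
    rw [← pow_add]
    exact Nat.pow_le_pow_right two_pos (by omega)
  calc P.t ≤ 16 * ((101 * P.lam + 103) * (P.nu + 1)) := Nat.mul_le_mul_left _ h1
    _ = 16 * (101 * P.lam + 103) * (P.nu + 1) := by ring
    _ ≤ _ := Nat.mul_le_mul_right _ h2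

lemma two_pow_le_ZQ {k : ℕ} (h : k ≤ 18 * P.lam + 12) : 2 ^ k ≤ P.ZQ :=
  (Nat.pow_le_pow_right two_pos h).trans (Nat.le_mul_of_pos_right _ (by omega))

lemma le_two_pow_t {k : ℕ} (h : k ≤ P.t) {c : ℕ} (hc : c ≤ 2 ^ k) : c ≤ 2 ^ P.t :=
  hc.trans (Nat.pow_le_pow_right two_pos h)

lemma t_ge : 16 * (P.nu * (P.L + 3)) + 1600 * P.lam + 1600 = P.t := by
  unfold t tp; ring

lemma nu_le_t : P.nu + 1600 * P.lam + 1600 ≤ P.t := by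
  rw [← t_ge]
  nlinarith [Nat.zero_le (P.nu * P.L)]

lemma ZQ_le : P.ZQ ≤ 2 ^ P.t := by
  have h : P.nu + 1 ≤ 2 ^ P.nu := Nat.lt_two_pow_self
  calc P.ZQ ≤ 2 ^ (18 * P.lam + 12) * 2 ^ P.nu := Nat.mul_le_mul_left _ h
    _ = 2 ^ (18 * P.lam + 12 + P.nu) := (pow_add _ _ _).symm
    _ ≤ 2 ^ P.t := Nat.pow_le_pow_right two_pos (by have := nu_le_t (P := P); omega)

lemma nC_le_two_pow_t (hP : P.Ok) (ph : ℕ) : P.nC ph ≤ 2 ^ P.t :=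
  le_two_pow_t (by rw [← t_ge]; nlinarith [Nat.zero_le (P.nu * P.L)]) (nC_le hP ph)

lemma n_le_two_pow_t (hP : P.Ok) : P.n ≤ 2 ^ P.t :=
  le_two_pow_t (by have := nu_le_t (P := P); omega) hP.n_le

/-- The loops of the query run over steps, bits and coordinates, never over points or the table, so
they stay polynomial in d and log n. Only stored words must be at most 2^t; the address of a table
entry is an intermediate value and is covered by the degree of the space bound. -/
lemma fits_ZQ (hP : P.Ok) : P.Fits P.ZQ (2 ^ P.t + 1) where
  lt := Nat.lt_succ_of_le ZQ_le
  sketch_lt := Nat.lt_succ_self _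
  S_le := Nat.pow_le_pow_right two_pos (by have := nu_le_t (P := P); unfold S; omega)
  D_le := two_pow_le_ZQ (by omega)
  t_le := t_le_ZQ hP
  mm_le := by
    have e : P.mm = 2 ^ (2 + P.lam) := by rw [mm, D, pow_add]; norm_num
    rw [e]
    exact two_pow_le_ZQ (by omega)
  lev_le := fun ph _ => by
    have h1 := Param.lev_le (P := P) ph
    have h2 := hP.L_le
    exact (le_two_pow _).trans (two_pow_le_ZQ (by omega))
  JJ_le := fun ph hph => by
    interval_cases ph
    · rw [JJ_zero_eq]
      have h1 : 7 * (3 * P.lam + P.nu + 41) ≤ 7 * (3 * P.lam + 41) * (P.nu + 1) := by nlinarith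
      refine h1.trans (Nat.mul_le_mul_right _ ?_)
      have h2 : 7 * (3 * P.lam + 41) ≤ 2 ^ 12 * 2 ^ P.lam := by
        have := le_two_pow P.lam
        have := Nat.one_le_two_pow (n := P.lam)
        omega
      refine h2.trans ?_
      rw [← pow_add]
      exact Nat.pow_le_pow_right two_pos (by omega)
    · exact (JJ_one_le hP).trans (two_pow_le_ZQ (by omega))
  nu_le := Nat.le_mul_of_pos_left _ (Nat.pow_pos two_pos)
  two_le := two_pow_le_ZQ (k := 1) (by omega)
  nC_lt := fun ph _ => Nat.lt_succ_of_le (nC_le_two_pow_t hP ph)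
  n_lt := Nat.lt_succ_of_le (n_le_two_pow_t hP)

lemma fitsPre (hP : P.Ok) : P.FitsPre (2 ^ P.t) (2 ^ P.t + 1) :=
  have hF := fits_ZQ hP
  have hZ := ZQ_le (P := P)
  have hnu := nu_le_t (P := P)
  have hS : P.S ≤ 2 ^ P.t := (le_two_pow _).trans hF.S_le
  have hlam : P.lam ≤ 2 ^ P.t := le_two_pow_t (by omega) (le_two_pow _)
  { lt := Nat.lt_succ_self _
    sketch_lt := hF.sketch_lt
    S_le := hF.S_le
    D_le := hF.D_le.trans hZ
    t_le := hF.t_le.trans hZ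
    mm_le := hF.mm_le.trans hZ
    lev_le := fun ph hph => (hF.lev_le ph hph).trans hZ
    JJ_le := fun ph hph => (hF.JJ_le ph hph).trans hZ
    nu_le := hF.nu_le.trans hZ
    two_le := hF.two_le.trans hZ
    nC_lt := hF.nC_lt
    n_lt := hF.n_lt
    n_le := n_le_two_pow_t hP
    d_le := hP.d_le.trans (hF.D_le.trans hZ)
    lam_le := hlam
    nC_le := fun ph _ => nC_le_two_pow_t hP ph
    sketch_le := le_rfl
    draw_le := by
      have e : P.t * P.mm = 64 * P.tp * 2 ^ P.lam := by rw [t, mm, D]; ring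
      have h1 : 64 * P.tp ≤ 2 ^ (6 + P.tp) := by
        rw [pow_add]
        exact Nat.mul_le_mul_left _ (le_two_pow _)
      rw [e]
      exact mul_two_pow_le h1 (by unfold t; have : P.lam + 6 ≤ P.tp := by { unfold tp; omega }
                                  omega)
    S_le_Z := hS
    kk_le := fun ph hph => (Nat.le_self_pow (by omega) _).trans ((hF.JJ_le ph hph).trans hZ)
    tp_le := le_trans (by unfold t; omega) (hF.t_le.trans hZ) }

/-- The parameters exist. -/
lemma exists_ok {p r : ℝ} {d n : ℕ} (hp : 2 < p) (hr : 0 < r) (hd : 1 ≤ d) (hn : 1 ≤ n) :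
    ∃ P : Param, P.Ok ∧ P.p = p ∧ P.r = r ∧ P.d = d ∧ P.n = n := by
  -- The lower bound 2 ensures that D ≥ 4 and that the truncated exponent is at least 2.
  set lam := max 2 (Nat.clog 2 d) with hlam
  have h2 : 2 ≤ lam := le_max_left _ _
  set c : ℝ := if (lam : ℝ) < p then lam else p with hc
  have hc2 : 2 ≤ c := by
    have : (2 : ℝ) ≤ lam := by exact_mod_cast h2
    rw [hc]
    split_ifs <;> linarith
  have hcl : c ≤ lam := by
    rw [hc]
    split_ifs with h
    · exact le_rfl
    · exact not_lt.1 h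
  have hceil : 2 ≤ ⌈c⌉₊ := by
    have : (1 : ℝ) < c := by linarith
    exact Nat.lt_ceil.2 (by exact_mod_cast this)
  set L := Nat.clog 2 ⌈c⌉₊ with hL
  have hL1 : 1 ≤ L := Nat.clog_pos (by norm_num) hceil
  refine ⟨⟨p, r, d, n, lam, Nat.clog 2 n, L⟩, ?_, rfl, rfl, rfl, rfl⟩
  refine ⟨hp, hr, hd, hn, h2, ?_, ?_, Nat.le_pow_clog (by norm_num) _, ?_, hL1, ?_, ?_, ?_⟩
  · exact (Nat.le_pow_clog (by norm_num) _).trans (Nat.pow_le_pow_right two_pos (le_max_right _ _))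
  · intro h
    have e : lam = Nat.clog 2 d := by
      rcases max_choice 2 (Nat.clog 2 d) with h' | h'
      · change 2 < lam at h; omega
      · exact h'
    change 2 ^ (lam - 1) < d
    rw [e]
    refine Nat.pow_pred_clog_lt_self (by norm_num) ?_
    by_contra h'
    have : d = 1 := by omega
    rw [this, Nat.clog_one_right] at e
    omega
  · intro h
    refine Nat.pow_pred_clog_lt_self (by norm_num) ?_
    by_contra h'
    have : n = 1 := by omega
    change 0 < Nat.clog 2 n at h
    rw [this, Nat.clog_one_right] at h
    omega
  · refine Nat.clog_le_of_le_pow ((Nat.ceil_le.2 ?_ : ⌈c⌉₊ ≤ lam).trans (le_two_pow _))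
    exact hcl
  · change c ≤ 2 ^ L
    refine (Nat.le_ceil c).trans ?_
    have : ⌈c⌉₊ ≤ 2 ^ L := Nat.le_pow_clog (by norm_num) _
    exact_mod_cast this
  · change (2 : ℝ) ^ (L - 1) < c
    have : 2 ^ (L - 1) < ⌈c⌉₊ := Nat.pow_pred_clog_lt_self (by norm_num) hceil
    have := Nat.lt_ceil.1 this
    exact_mod_cast this

end Param

/-! ### Bounds in terms of the data -/

lemma mul_pow_le_mul_pow {x : ℝ} (hx : 1 ≤ x) {A C k l : ℕ} (hA : A ≤ C) (hk : k ≤ l) :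
    (A : ℝ) * x ^ k ≤ C * x ^ l :=
  mul_le_mul (Nat.cast_le.2 hA) (pow_le_pow_right₀ hx hk) (by positivity) (Nat.cast_nonneg _)

lemma four_thirds_lt_log_four : 4 / 3 < Real.log 4 := by
  rw [show (4 : ℝ) = 2 ^ 2 by norm_num, Real.log_pow]
  have := Real.log_two_gt_d9
  push_cast
  linarith

namespace Param
variable {P : Param}

lemma pc_le_p : P.pc ≤ P.p := by
  unfold pc
  split_ifs with h
  · exact h.le
  · exact le_rfl

lemma one_lt_logb_p (hP : P.Ok) : 1 < Real.logb 2 P.p := by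
  rw [Real.lt_logb_iff_rpow_lt (by norm_num) (by linarith [hP.two_lt_p]), Real.rpow_one]
  exact hP.two_lt_p

lemma L_le_logb (hP : P.Ok) : (P.L : ℝ) ≤ Real.logb 2 P.p + 1 := by
  have h1 := hP.lt_pc.trans_le pc_le_p
  have h2 : ((P.L - 1 : ℕ) : ℝ) ≤ Real.logb 2 P.p := by
    rw [Real.le_logb_iff_rpow_le (by norm_num) (by linarith [hP.two_lt_p]), Real.rpow_natCast]
    exact h1.le
  have := hP.one_le_L
  rw [Nat.cast_sub this] at h2
  push_cast at h2
  linarith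

lemma two_pow_lam_le (hP : P.Ok) : 2 ^ P.lam ≤ 4 * P.d := by
  have hd := hP.one_le_d
  rcases hP.two_le_lam.eq_or_lt with h | h
  · rw [← h]; omega
  · have h1 := hP.lam_min h
    have h2 : 2 ^ P.lam = 2 * 2 ^ (P.lam - 1) := by rw [← pow_succ']; congr 1; omega
    omega

/-- A bound 2n would bring in a factor 2 to be raised to the power L + 3, which is not a constant.
The square costs only a constant factor in the exponent and holds for n = 1 as well, where nu = 0.
-/
lemma two_pow_nu_le (hP : P.Ok) : 2 ^ P.nu ≤ P.n ^ 2 := by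
  have hn := hP.one_le_n
  rcases Nat.eq_zero_or_pos P.nu with h | h
  · rw [h]; exact Nat.one_le_pow _ _ hn
  · have h1 := hP.nu_min h
    have h2 : 2 ^ P.nu = 2 * 2 ^ (P.nu - 1) := by rw [← pow_succ']; congr 1; omega
    have h3 : 1 ≤ 2 ^ (P.nu - 1) := Nat.one_le_two_pow
    nlinarith

lemma one_le_logb_n (hP : P.Ok) : 1 ≤ Real.logb 2 (P.n + 1) := by
  have : (1 : ℝ) ≤ P.n := by exact_mod_cast hP.one_le_n
  rw [Real.le_logb_iff_rpow_le (by norm_num) (by linarith), Real.rpow_one]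
  linarith

lemma nu_le_logb (hP : P.Ok) : (P.nu : ℝ) + 1 ≤ 3 * Real.logb 2 (P.n + 1) := by
  have h1 := one_le_logb_n hP
  rcases Nat.eq_zero_or_pos P.nu with h | h
  · rw [h]; push_cast; linarith
  · have h2 : ((P.nu - 1 : ℕ) : ℝ) ≤ Real.logb 2 (P.n + 1) := by
      rw [Real.le_logb_iff_rpow_le (by norm_num) (by positivity), Real.rpow_natCast]
      have : ((2 ^ (P.nu - 1) : ℕ) : ℝ) ≤ P.n := Nat.cast_le.2 (hP.nu_min h).le
      push_cast at this
      linarith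
    rw [Nat.cast_sub h] at h2
    push_cast at h2
    linarith

/-- From 5³ = 125 ≤ 128 = 2^7 one gets 5^(L-1) ≤ (2^(L-1))^(7/3) ≤ p^(7/3), and 7/3 < 1 + ln 4. -/
lemma five_pow_L_le (hP : P.Ok) {ε : ℝ} (hε : 0 < ε) :
    (5 : ℝ) ^ P.L ≤ 5 * P.p ^ (1 + Real.log 4 + ε) := by
  have hp := hP.two_lt_p
  have h1 := (hP.lt_pc.trans_le pc_le_p).le
  have h5 : (5 : ℝ) ≤ 2 ^ (7 / 3 : ℝ) := by
    rw [show (7 / 3 : ℝ) = 7 * (1 / 3) by norm_num, Real.rpow_mul (by norm_num)]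
    have e : (5 : ℝ) = (5 ^ (3 : ℝ)) ^ (1 / 3 : ℝ) := by
      rw [← Real.rpow_mul (by norm_num)]; norm_num
    rw [e]
    exact Real.rpow_le_rpow (by positivity) (by norm_num) (by norm_num)
  have h2 : (5 : ℝ) ^ (P.L - 1) ≤ P.p ^ (7 / 3 : ℝ) := by
    calc (5 : ℝ) ^ (P.L - 1) ≤ (2 ^ (7 / 3 : ℝ)) ^ (P.L - 1) := pow_le_pow_left₀ (by norm_num) h5 _
      _ = (2 ^ (P.L - 1)) ^ (7 / 3 : ℝ) := by
        rw [← Real.rpow_natCast, ← Real.rpow_mul (by norm_num), mul_comm,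
          Real.rpow_mul (by norm_num), Real.rpow_natCast]
      _ ≤ _ := Real.rpow_le_rpow (by positivity) h1 (by norm_num)
  have h3 : P.p ^ (7 / 3 : ℝ) ≤ P.p ^ (1 + Real.log 4 + ε) :=
    Real.rpow_le_rpow_of_exponent_le (by linarith) (by linarith [four_thirds_lt_log_four])
  have h4 : (5 : ℝ) ^ P.L = 5 * 5 ^ (P.L - 1) := by
    rw [← pow_succ']; congr 1; have := hP.one_le_L; omega
  rw [h4]
  linarith

lemma radius_le (hP : P.Ok) {ε : ℝ} (hε : 0 < ε) : 4 * (8589934592 * 5 ^ P.L + 1) * P.r ≤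
    206158430208 * P.p ^ (1 + Real.log 4 + ε) * P.r := by
  have h1 := five_pow_L_le hP hε
  have h2 : (1 : ℝ) ≤ P.p ^ (1 + Real.log 4 + ε) :=
    Real.one_le_rpow (by linarith [hP.two_lt_p]) (by linarith [four_thirds_lt_log_four])
  refine mul_le_mul_of_nonneg_right ?_ hP.r_pos.le
  linarith

/-- The quantity that bounds the cost of the preprocessing. -/
def preSize (P : Param) (ε : ℝ) : ℝ := P.d * (P.n : ℝ) ^ (ε⁻¹ * Real.logb 2 P.p)

/-- The quantity that bounds the cost of a query. -/
def querySize (P : Param) (ε : ℝ) : ℝ := ε⁻¹ * P.d * Real.logb 2 (P.n + 1)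

variable {ε : ℝ}

/-- The exponent of n is 2(L + 3) ≤ 2 log_2 p + 8, which is at most 10 log_2 p since p > 2. -/
lemma two_pow_nu_mul_le (hP : P.Ok) (hε : 0 < ε) (hε1 : ε < 1) :
    (2 : ℝ) ^ (P.nu * (P.L + 3)) ≤ ((P.n : ℝ) ^ (ε⁻¹ * Real.logb 2 P.p)) ^ 10 := by
  have hn : (1 : ℝ) ≤ P.n := by exact_mod_cast hP.one_le_n
  have h1 : (2 : ℝ) ^ P.nu ≤ P.n ^ 2 := by exact_mod_cast two_pow_nu_le hP
  have h2 := one_lt_logb_p hP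
  have h3 := L_le_logb hP
  have h4 : Real.logb 2 P.p ≤ ε⁻¹ * Real.logb 2 P.p :=
    le_mul_of_one_le_left (by linarith) ((one_le_inv₀ hε).2 hε1.le)
  calc (2 : ℝ) ^ (P.nu * (P.L + 3)) = (2 ^ P.nu) ^ (P.L + 3) := pow_mul _ _ _
    _ ≤ ((P.n : ℝ) ^ 2) ^ (P.L + 3) := pow_le_pow_left₀ (by positivity) h1 _
    _ = (P.n : ℝ) ^ ((2 * (P.L + 3) : ℕ) : ℝ) := by rw [← pow_mul, Real.rpow_natCast]
    _ ≤ (P.n : ℝ) ^ (ε⁻¹ * Real.logb 2 P.p * 10) := by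
      refine Real.rpow_le_rpow_of_exponent_le hn ?_
      push_cast
      linarith
    _ = _ := by
      rw [Real.rpow_mul (by positivity)]
      exact_mod_cast rfl

lemma one_le_n_rpow (hP : P.Ok) (hε : 0 < ε) : 1 ≤ (P.n : ℝ) ^ (ε⁻¹ * Real.logb 2 P.p) := by
  have := one_lt_logb_p hP
  exact Real.one_le_rpow (by exact_mod_cast hP.one_le_n) (by positivity)

lemma one_le_preSize (hP : P.Ok) (hε : 0 < ε) : 1 ≤ P.preSize ε :=
  one_le_mul_of_one_le_of_one_le (by exact_mod_cast hP.one_le_d) (one_le_n_rpow hP hε)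

lemma one_le_inv_mul_d (hP : P.Ok) (hε : 0 < ε) (hε1 : ε < 1) : 1 ≤ ε⁻¹ * P.d :=
  one_le_mul_of_one_le_of_one_le ((one_le_inv₀ hε).2 hε1.le) (by exact_mod_cast hP.one_le_d)

lemma one_le_querySize (hP : P.Ok) (hε : 0 < ε) (hε1 : ε < 1) : 1 ≤ P.querySize ε :=
  one_le_mul_of_one_le_of_one_le (one_le_inv_mul_d hP hε hε1) (one_le_logb_n hP)

lemma exists_two_pow_t_le : ∃ c k : ℕ, ∀ P : Param, P.Ok → ∀ ε : ℝ, 0 < ε → ε < 1 →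
    (2 : ℝ) ^ P.t ≤ c * P.preSize ε ^ k := by
  -- 1600 is the coefficient of `lam`, and the constant term, in the sketch length t; it also
  -- exceeds the exponent 160 that the powers of n need.
  obtain ⟨k, hk⟩ : ∃ k : ℕ, k = 1600 := ⟨_, rfl⟩
  refine ⟨8 ^ k, k, fun P hP ε hε hε1 => ?_⟩
  set N := (P.n : ℝ) ^ (ε⁻¹ * Real.logb 2 P.p) with hN
  have hN1 : 1 ≤ N := one_le_n_rpow hP hε
  have h1 := two_pow_nu_mul_le hP hε hε1
  have h2 : (2 : ℝ) ^ P.lam ≤ 4 * P.d := by exact_mod_cast two_pow_lam_le hP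
  have e : P.t = P.nu * (P.L + 3) * 16 + P.lam * k + k := by rw [← t_ge, hk]; ring
  calc (2 : ℝ) ^ P.t = (2 ^ (P.nu * (P.L + 3))) ^ 16 * (2 ^ P.lam) ^ k * 2 ^ k := by
        rw [e, pow_add, pow_add, pow_mul _ _ 16, pow_mul _ _ k]
    _ ≤ (N ^ 10) ^ 16 * (4 * P.d) ^ k * 2 ^ k := by gcongr
    _ = N ^ 160 * (4 * P.d) ^ k * 2 ^ k := by rw [← pow_mul]
    _ ≤ N ^ k * (4 * P.d) ^ k * 2 ^ k := by
        gcongr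
        omega
    _ = ((8 ^ k : ℕ) : ℝ) * P.preSize ε ^ k := by
        rw [preSize, ← hN, ← mul_pow, ← mul_pow, Nat.cast_pow, ← mul_pow]
        congr 1
        push_cast
        ring

lemma exists_ZQ_le : ∃ c k : ℕ, ∀ P : Param, P.Ok → ∀ ε : ℝ, 0 < ε → ε < 1 →
    (P.ZQ : ℝ) ≤ c * P.querySize ε ^ k := by
  refine ⟨4 ^ 18 * 2 ^ 12 * 3, 18, fun P hP ε hε hε1 => ?_⟩
  have h1 := one_le_logb_n hP
  have h2 : (2 : ℝ) ^ P.lam ≤ 4 * P.d := by exact_mod_cast two_pow_lam_le hP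
  have h3 : (P.d : ℝ) ≤ ε⁻¹ * P.d :=
    le_mul_of_one_le_left (Nat.cast_nonneg _) ((one_le_inv₀ hε).2 hε1.le)
  have h4 := nu_le_logb hP
  calc (P.ZQ : ℝ) = (2 ^ P.lam) ^ 18 * 2 ^ 12 * (P.nu + 1) := by
        rw [ZQ, pow_add, pow_mul', Nat.cast_mul, Nat.cast_mul]
        push_cast
        ring
    _ ≤ (4 * (ε⁻¹ * P.d)) ^ 18 * 2 ^ 12 * (3 * Real.logb 2 (P.n + 1) ^ 18) := by
        gcongr
        · exact h2.trans (by linarith)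
        · exact h4.trans (mul_le_mul_of_nonneg_left (le_self_pow₀ h1 (by norm_num)) (by norm_num))
    _ = _ := by
        rw [querySize]
        push_cast
        ring

end Param

/-! ### The data structure -/

namespace Param
variable {P : Param}

lemma vec_congr_rows {X X' : ℕ → ℝ} (ph j : ℕ) {cen : ℕ → ℕ} (hcen : ∀ e, cen e < P.n + 1)
    (h : ∀ x < P.n + 1, ∀ i < P.D, X (x * P.D + i) = X' (x * P.D + i)) {x i : ℕ} (hx : x < P.n + 1)
    (hi : i < P.D) : P.vec X ph j cen x i = P.vec X' ph j cen x i :=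
  image_congr_rows _ (fun e _ => hcen e) h _ hx hi

/-- Probabilities are estimated for a matrix fixed in advance, while the matrix in the memory of a
run is known only on its n + 1 rows. -/
lemma GoodW.congr {W : ℕ → ℕ} {X X' : ℕ → ℝ} (hW : P.GoodW W X)
    (h : ∀ x < P.n + 1, ∀ i < P.D, X (x * P.D + i) = X' (x * P.D + i)) : P.GoodW W X' := by
  intro ph hph j hj cc hcc x hx
  have hcen : ∀ e, digit P.n cc e < P.n + 1 := fun e =>
    (Nat.mod_lt _ (Nat.zero_lt_of_lt hx)).trans (Nat.lt_succ_self _)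
  have hv : ∀ x < P.n + 1, ∀ i < P.D, P.vec X ph j (digit P.n cc) x i =
      P.vec X' ph j (digit P.n cc) x i := fun x hx i hi => vec_congr_rows ph j hcen h hx hi
  have hb : ∀ x < P.n + 1, P.bits W X ph j (digit P.n cc) x = P.bits W X' ph j (digit P.n cc) x :=
    fun x hx => funext fun b => sketch_congr _ _ _ D_pos (fun i hi => hv x hx i hi) b
  have hn := Nat.lt_succ_self P.n
  have hx' := hx.trans hn
  have e1 : ∑ i ∈ Finset.range P.D, |P.vec X ph j (digit P.n cc) P.n i| =
      ∑ i ∈ Finset.range P.D, |P.vec X' ph j (digit P.n cc) P.n i| :=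
    Finset.sum_congr rfl fun i hi => by rw [hv _ hn i (Finset.mem_range.1 hi)]
  have e2 : ∑ i ∈ Finset.range P.D, |P.vec X ph j (digit P.n cc) P.n i -
      P.vec X ph j (digit P.n cc) x i| = ∑ i ∈ Finset.range P.D,
        |P.vec X' ph j (digit P.n cc) P.n i - P.vec X' ph j (digit P.n cc) x i| :=
    Finset.sum_congr rfl fun i hi => by
      rw [hv _ hn i (Finset.mem_range.1 hi), hv _ hx' i (Finset.mem_range.1 hi)]
  have := hW ph hph j hj cc hcc x hx
  simp only [Faithful, e1, e2, hb _ hx', hb _ hn] at this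
  exact this

lemma GoodG.congr {G : ℕ → ℕ} {X X' : ℕ → ℝ} (hG : P.GoodG G X)
    (h : ∀ x < P.n + 1, ∀ i < P.D, X (x * P.D + i) = X' (x * P.D + i)) : P.GoodG G X' := by
  intro x hx hle i hi
  have hn := Nat.lt_succ_self P.n
  have hx' := hx.trans hn
  have hdot : ∀ x < P.n + 1, dot G X' P.D x = dot G X P.D x := fun x hx =>
    Finset.sum_congr rfl fun i hi => by rw [h x hx i (Finset.mem_range.1 hi)]
  rw [hdot _ hn, hdot _ hx'] at hle
  rw [← h _ hn i hi, ← h _ hx' i hi]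
  exact hG x hx hle i hi

/-- The data and the query, as a matrix with padded rows. -/
def matrix (P : Param) (V inp : ℕ → ℝ) (a : ℕ) : ℝ :=
  if a % P.D < P.d then
    if a / P.D < P.n then V (a / P.D * P.d + a % P.D) else inp (a % P.D)
  else 0

lemma matrix_row (V inp : ℕ → ℝ) {x : ℕ} (hx : x < P.n) {i : ℕ} (hi : i < P.D) :
    P.matrix V inp (x * P.D + i) = if i < P.d then V (x * P.d + i) else 0 := by
  rw [matrix, mul_comm x P.D, Nat.mul_add_mod, Nat.mod_eq_of_lt hi, Nat.mul_add_div D_pos,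
    Nat.div_eq_of_lt hi, add_zero, if_pos hx]

lemma matrix_last (V inp : ℕ → ℝ) {i : ℕ} (hi : i < P.D) :
    P.matrix V inp (P.n * P.D + i) = if i < P.d then inp i else 0 := by
  rw [matrix, mul_comm P.n P.D, Nat.mul_add_mod, Nat.mod_eq_of_lt hi, Nat.mul_add_div D_pos,
    Nat.div_eq_of_lt hi, add_zero, if_neg (lt_irrefl _)]

/-- For good random words, the result of a query is a near point. -/
lemma Result.nrm_matrix_le {inp V : ℕ → ℝ} {ω : ℕ → Bool} {m : Mem} {X : ℕ → ℝ} {ans : ℕ} (hP : P.Ok)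
    (hm : Ready P V ω m) (hR : P.Result inp m X ans) (hW : P.GoodW (wWords P ω) (P.matrix V inp))
    (hG : P.GoodG (gWords P ω) (P.matrix V inp)) {x : ℕ} (hx : x < P.n)
    (h : nrm P.D P.p (fun i => P.matrix V inp (P.n * P.D + i) - P.matrix V inp (x * P.D + i)) ≤ P.r) :
    ans < P.n ∧ nrm P.D P.p
      (fun i => P.matrix V inp (P.n * P.D + i) - P.matrix V inp (ans * P.D + i)) ≤
      4 * (8589934592 * 5 ^ P.L + 1) * P.r := by
  have hX : ∀ x < P.n + 1, ∀ i < P.D, P.matrix V inp (x * P.D + i) = X (x * P.D + i) := by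
    intro x hx i hi
    rcases Nat.lt_succ_iff_lt_or_eq.1 hx with hx | rfl
    · rw [matrix_row V inp hx hi, hR.old x hx i hi, hm.rows x hx i hi]
    · rw [matrix_last V inp hi, hR.new i hi]
  have hn := Nat.lt_succ_self P.n
  have e : ∀ x < P.n, nrm P.D P.p (fun i => P.matrix V inp (P.n * P.D + i) -
      P.matrix V inp (x * P.D + i)) = nrm P.D P.p (fun i => X (P.n * P.D + i) - X (x * P.D + i)) :=
    fun x hx => nrm_congr fun i hi => by rw [hX _ hn i hi, hX _ (hx.trans hn) i hi]
  rw [e x hx] at h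
  obtain ⟨h1, h2⟩ := Result.nrm_le hP hm hR (hW.congr hX) (hG.congr hX) hx h
  exact ⟨h1, by rwa [e ans h1]⟩

end Param

/-- The padding coordinates vanish for data and query alike and contribute nothing, because 0^p = 0.
-/
lemma dist_eq_nrm {P : Param} (hP : P.Ok) {V : Fin P.n → LpSpace P.p P.d} (q : LpSpace P.p P.d)
    (x : Fin P.n) : dist q (V x) = nrm P.D P.p (fun i =>
      P.matrix (ANNAlgorithm.dataInput V) (ANNAlgorithm.queryInput q) (P.n * P.D + i) -
      P.matrix (ANNAlgorithm.dataInput V) (ANNAlgorithm.queryInput q) (x * P.D + i)) := by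
  have hp := hP.two_lt_p
  have hp0 : 0 < P.p := by linarith
  have hpt : (ENNReal.ofReal P.p).toReal = P.p := ENNReal.toReal_ofReal hp0.le
  have hd : P.d ≤ P.D := hP.d_le
  rw [PiLp.dist_eq_sum (by rw [hpt]; exact hp0), hpt, nrm]
  congr 1
  rw [← Finset.sum_subset (Finset.range_subset_range.2 hd), Finset.sum_range]
  · refine Finset.sum_congr rfl fun i _ => ?_
    have hi : (i : ℕ) < P.D := i.2.trans_le hd
    have hdiv : ((x : ℕ) * P.d + i) / P.d = x := by
      rw [mul_comm, Nat.mul_add_div (Nat.zero_lt_of_lt i.2), Nat.div_eq_of_lt i.2, add_zero]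
    have hmod : ((x : ℕ) * P.d + i) % P.d = i := by
      rw [mul_comm, Nat.mul_add_mod, Nat.mod_eq_of_lt i.2]
    rw [Param.matrix_last _ _ hi, Param.matrix_row _ _ x.2 hi, if_pos i.2, if_pos i.2, Real.dist_eq,
      ANNAlgorithm.queryInput, dif_pos i.2, ANNAlgorithm.dataInput,
      dif_pos ⟨by rw [hdiv]; exact x.2, by rw [hmod]; exact i.2⟩]
    simp only [hdiv, hmod]
  · intro i hi hi'
    rw [Finset.mem_range] at hi hi'
    rw [Param.matrix_last _ _ hi, Param.matrix_row _ _ x.2 hi, if_neg hi', if_neg hi', sub_zero,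
      abs_zero, Real.zero_rpow hp0.ne']

/-- The memory that a machine configuration represents. -/
def memOf (s : State) : Mem where
  nat τ i := s.nat (NVar.addr τ i)
  real τ i := s.real (RVar.addr τ i)
  coins := s.coins

lemma memOf_rep (s : State) : (memOf s).Rep s := ⟨fun _ _ => rfl, fun _ _ => rfl, rfl⟩

/-- The algorithm. -/
def algorithm : ANNAlgorithm := ⟨[], preP.code, queryP.code⟩

/-- The degree of the space bound. -/
def spaceDeg : ℕ := sDeg preP.code + sDeg queryP.code + 2

section Runs
variable {P : Param} (ε : ℝ) (ω : ℕ → Bool)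

lemma exists_preprocess (hP : P.Ok) (V : ℕ → ℝ) :
    ∃ s, Exec [] ω V preP.code (ANNAlgorithm.initState P.p ε P.r P.d P.n) s ∧
      (∃ m, m.Rep s ∧ Ready P V ω m) ∧ (∀ a, s.nat a < 2 ^ P.t + 1) ∧
      s.time ≤ sCost (2 ^ P.t) preP.code ∧ s.space ≤ (2 ^ P.t + 1) ^ spaceDeg := by
  set s₀ := ANNAlgorithm.initState P.p ε P.r P.d P.n with hs₀
  have hF := Param.fitsPre hP
  have h4 : 2 ≤ 2 ^ P.t := hF.two_le
  -- The arrays `n`, `d` and `p`, `eps`, `r` are the first of their kinds, so their entries 0 are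
  -- the cells in which the machine receives the parameters.
  have hw : wp (2 ^ P.t) (2 ^ P.t + 1) ω V preP (Ready P V ω) (memOf s₀) :=
    wp_preP hF hP rfl rfl rfl rfl rfl fun _ h => h
  obtain ⟨s, h⟩ := exists_outcome [] (by omega) hw (memOf_rep s₀) fun a => by
    have h1 := hF.n_le
    have h2 := hF.d_le
    simp only [hs₀, ANNAlgorithm.initState]
    split_ifs <;> omega
  refine ⟨s, h.exec, h.post, h.words, h.time.trans_eq (zero_add _), h.space.trans (max_le ?_ ?_)⟩
  · refine le_trans ?_ (Nat.pow_le_pow_right (by omega) (show 2 ≤ spaceDeg by unfold spaceDeg; omega))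
    have h1 := hF.n_le
    have h2 := hF.d_le
    change P.n + P.d + 3 ≤ _
    nlinarith
  · exact Nat.pow_le_pow_right (by omega) (by unfold spaceDeg; omega)

lemma exists_query (hP : P.Ok) {V : ℕ → ℝ} {s : State} {m : Mem} (hm : m.Rep s) (hR : Ready P V ω m)
    (hs : ∀ a, s.nat a < 2 ^ P.t + 1) (hsp : s.space ≤ (2 ^ P.t + 1) ^ spaceDeg) (inp : ℕ → ℝ) :
    ∃ s', Exec [] ω inp queryP.code { s with time := 0 } s' ∧
      (∃ X, P.Result inp m X (s'.nat 0)) ∧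
      s'.time ≤ sCost P.ZQ queryP.code ∧ s'.space ≤ (2 ^ P.t + 1) ^ spaceDeg := by
  have hF := Param.fits_ZQ hP
  have h4 : 2 ≤ 2 ^ P.t := hF.two_le.trans Param.ZQ_le
  have hw : wp P.ZQ (2 ^ P.t + 1) ω inp queryP
      (fun m' => ∃ X, P.Result inp m X (m'.nat .n 0)) m :=
    wp_queryP hF hP hR fun _ X h => ⟨X, h⟩
  obtain ⟨s', h⟩ := exists_outcome [] (by omega) hw
    (s := { s with time := 0 }) ⟨hm.nat, hm.real, hm.coins⟩ hs
  obtain ⟨m', hm', X, hX⟩ := h.post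
  refine ⟨s', h.exec, ⟨X, ?_⟩, h.time.trans_eq (zero_add _), h.space.trans (max_le hsp ?_)⟩
  -- The entry 0 of the array `n`, to which the query finally copies its answer, is the first word
  -- of the machine.
  · rw [← hm'.nat .n 0] at hX
    exact hX
  · exact Nat.pow_le_pow_right (by omega) (by unfold spaceDeg; omega)

/-- The algorithm is correct. -/
lemma isCorrect {ε : ℝ} (hP : P.Ok) (hε : 0 < ε) (V : Fin P.n → LpSpace P.p P.d) :
    algorithm.IsCorrect ε (206158430208 * P.p ^ (1 + Real.log 4 + ε)) P.r V := by
  intro q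
  refine (Param.measure_good hP (P.matrix (ANNAlgorithm.dataInput V)
    (ANNAlgorithm.queryInput q))).trans (MeasureTheory.measure_mono ?_)
  rintro ω ⟨hW, hG⟩
  obtain ⟨s, hs, ⟨m, hm, hR⟩, hw, -, hsp⟩ := exists_preprocess ε ω hP (ANNAlgorithm.dataInput V)
  obtain ⟨s', hs', ⟨X, hX⟩, -, -⟩ :=
    exists_query ω hP hm hR hw hsp (ANNAlgorithm.queryInput q)
  refine ⟨s, s', hs, hs', ?_⟩
  rintro ⟨j, hj⟩
  rw [dist_eq_nrm hP] at hj
  obtain ⟨h1, h2⟩ := hX.nrm_matrix_le hP hR hW hG j.2 hj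
  refine ⟨h1, ?_⟩
  rw [dist_eq_nrm hP]
  exact h2.trans (Param.radius_le hP hε)

end Runs

lemma mul_pow_le_of_le {x y : ℝ} {A c k e C : ℕ} (hx : 1 ≤ x) (hy : 0 ≤ y) (h : y ≤ c * x ^ k)
    (hA : A * c ^ e ≤ C) (hk : k * e ≤ C) : A * y ^ e ≤ C * x ^ C := by
  calc A * y ^ e ≤ A * (c * x ^ k) ^ e := by gcongr
    _ = ((A * c ^ e : ℕ) : ℝ) * x ^ (k * e) := by
        rw [mul_pow, ← pow_mul]; push_cast; ring
    _ ≤ C * x ^ C := mul_pow_le_mul_pow hx hA hk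

lemma succ_pow_le {z : ℕ} (hz : 2 ≤ z) (e : ℕ) : (z + 1) ^ e ≤ z ^ (2 * e) := by
  rw [pow_mul]
  exact Nat.pow_le_pow_left (by nlinarith) _

/-- The algorithm is efficient. -/
lemma exists_runsWithin : ∃ C : ℕ, ∀ P : Param, P.Ok → ∀ ε : ℝ, 0 < ε → ε < 1 →
    ∀ V : Fin P.n → LpSpace P.p P.d, algorithm.RunsWithin ε P.r V (C * P.preSize ε ^ C)
      (C * P.preSize ε ^ C) (C * P.querySize ε ^ C) := by
  obtain ⟨A₁, h₁⟩ := exists_sCost_le preP.code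
  obtain ⟨A₂, h₂⟩ := exists_sCost_le queryP.code
  obtain ⟨c, k, hc⟩ := Param.exists_two_pow_t_le
  obtain ⟨c', k', hc'⟩ := Param.exists_ZQ_le
  -- The sum of all factors and exponents that occur in the three bounds, so that it dominates each
  -- of them.
  refine ⟨A₁ * c ^ A₁ + k * A₁ + 1 * c ^ (2 * spaceDeg) + k * (2 * spaceDeg) + A₂ * c' ^ A₂ +
    k' * A₂, fun P hP ε hε hε1 V ω => ?_⟩
  set C := A₁ * c ^ A₁ + k * A₁ + 1 * c ^ (2 * spaceDeg) + k * (2 * spaceDeg) + A₂ * c' ^ A₂ +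
    k' * A₂ with hC
  have hpre := Param.one_le_preSize hP hε
  have hqry := Param.one_le_querySize hP hε hε1
  have hZ1 : 1 ≤ 2 ^ P.t := Nat.one_le_two_pow
  have hZQ : 1 ≤ P.ZQ := one_le_two.trans (Param.fits_ZQ hP).two_le
  have hZ2 : 2 ≤ 2 ^ P.t := (Param.fitsPre hP).two_le
  have hspace : (((2 ^ P.t + 1) ^ spaceDeg : ℕ) : ℝ) ≤ C * P.preSize ε ^ C := by
    have e : (2 ^ P.t + 1) ^ spaceDeg ≤ (2 ^ P.t) ^ (2 * spaceDeg) := succ_pow_le hZ2 _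
    have e' : (((2 ^ P.t + 1) ^ spaceDeg : ℕ) : ℝ) ≤ (((2 ^ P.t) ^ (2 * spaceDeg) : ℕ) : ℝ) :=
      Nat.cast_le.2 e
    refine e'.trans ?_
    rw [Nat.cast_pow, Nat.cast_pow, Nat.cast_ofNat]
    have := mul_pow_le_of_le (A := 1) (e := 2 * spaceDeg) (C := C) hpre (by positivity)
      (hc P hP ε hε hε1) (by omega) (by omega)
    rwa [Nat.cast_one, one_mul] at this
  obtain ⟨s, hs, ⟨m, hm, hR⟩, hw, ht, hsp⟩ := exists_preprocess ε ω hP (ANNAlgorithm.dataInput V)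
  refine ⟨s, hs, ?_, (Nat.cast_le.2 hsp).trans hspace, fun q => ?_⟩
  · refine (Nat.cast_le.2 (ht.trans (h₁ _ hZ1))).trans ?_
    rw [Nat.cast_mul, Nat.cast_pow, Nat.cast_pow, Nat.cast_ofNat]
    exact mul_pow_le_of_le hpre (by positivity) (hc P hP ε hε hε1) (by omega) (by omega)
  · obtain ⟨s', hs', -, ht', hsp'⟩ := exists_query ω hP hm hR hw hsp (ANNAlgorithm.queryInput q)
    refine ⟨s', hs', ?_, (Nat.cast_le.2 hsp').trans hspace⟩
    refine (Nat.cast_le.2 (ht'.trans (h₂ _ hZQ))).trans ?_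
    rw [Nat.cast_mul, Nat.cast_pow]
    exact mul_pow_le_of_le hqry (Nat.cast_nonneg _) (hc' P hP ε hε hε1) (by omega) (by omega)

end LpANN

end

theorem mainTheorem5 :
    ∃ (A : ANNAlgorithm) (K : ℝ) (C : ℕ), 1 ≤ K ∧
      ∀ (p ε r : ℝ) (d n : ℕ), 2 < p → 0 < ε → ε < 1 → 0 < r → 1 ≤ d → 1 ≤ n →
        ∀ V : Fin n → LpSpace p d, Function.Injective V →
          A.IsCorrect ε (K * p ^ (1 + Real.log 4 + ε)) r V ∧
          A.RunsWithin ε r V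
            (C * (d * (n : ℝ) ^ (ε⁻¹ * Real.logb 2 p)) ^ C)
            (C * (d * (n : ℝ) ^ (ε⁻¹ * Real.logb 2 p)) ^ C)
            (C * (ε⁻¹ * d * Real.logb 2 (n + 1)) ^ C) := by
  obtain ⟨C, hC⟩ := LpANN.exists_runsWithin
  -- The constant is 24 · 2^33: the radius factor 4(2^33 · 5^L + 1) is at most (20 · 2^33 + 4) times
  -- the power of p.
  refine ⟨LpANN.algorithm, 206158430208, C, by norm_num, ?_⟩
  intro p ε r d n hp hε hε1 hr hd hn V _
  obtain ⟨P, hP, rfl, rfl, rfl, rfl⟩ := LpANN.Param.exists_ok hp hr hd hn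
  exact ⟨LpANN.isCorrect hP hε V, hC P hP ε hε hε1 V⟩
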